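/- Let $\mathcal R=(X,R_0,Y,R_0^\vee,F_0)$ be a based root datum, with $X,Y$ free abelian groups of finite rank in perfect duality and $R_0$ a finite, reduced, possibly empty root system that need not span $X\otimes\mathbb R$. Let $W_0$ be the Weyl group of $R_0$ and let $W=X\rtimes W_0$, with length function $$\ell(w)=\#\{a\in R^{\mathrm{aff}}_+ : wa\in R^{\mathrm{aff}}_-\},$$ where $R^{\mathrm{aff}}=R_0^\vee\times\mathbb Z$ is the set of affine roots. Let $S^{\mathrm{aff}}$ be the set of simple affine reflections. Let $q:W\to(0,\infty)$ be a positive parameter function, that is, $q(\omega)=1$ whenever $\ell(\omega)=0$, and $q(wv)=q(w)q(v)$ whenever $\ell(wv)=\ell(w)+\ell(v)$. Let $\mathcal H=\mathcal H(\mathcal R,q)$ be the affine Hecke algebra: the unital associative complex algebra generated by elements $T_w$ $(w\in W)$ with the relations $T_e=1$, $T_wT_v=T_{wv}$ if $\ell(wv)=\ell(w)+\ell(v)$, and $T_sT_s=(q(s)-1)T_s+q(s)T_e$ for $s\in S^{\mathrm{aff}}$. Let $\mathrm{Mod}(\mathcal H)$ be the category of all $\mathcal H$-modules. Endow $\mathcal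 H$ with the fine bornology and let $\mathrm{Mod}_{bor}(\mathcal H)$ be the category of bornological $\mathcal H$-modules: complex vector spaces with a convex vector bornology and an $\mathcal H$-module structure given by a bounded bilinear map, with the bounded $\mathcal H$-linear maps as morphisms. It is an exact category, in which the extensions are those that are split as extensions of bornological vector spaces; accordingly a resolution is a complex that admits a bounded $\mathbb C$-linear contraction. The cohomological dimension of either category is the least $d\in\{0,1,2,\ldots,\infty\}$ such that $\mathrm{Ext}^n(U,V)=0$ for all objects $U,V$ and all $n>d$. Then the cohomological dimensions of $\mathrm{Mod}(\mathcal H)$ and of $\mathrm{Mod}_{bor}(\mathcal H)$ are both equal to the rank of $X$. This holds for $\mathrm{Mod}_{bor}(\mathcal H)$ both when all bornological modules are allowed and when bornological vector spaces are required to be complete. -/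

import Mathlib

open CategoryTheory

universe u v w

noncomputable section

namespace AffineHecke

/-! ### Extended affine Weyl groups -/

section WeylGroups

variable {ι X Y : Type u} [AddCommGroup X] [AddCommGroup Y] {P : RootDatum ι X Y}

/-- The action of the finite Weyl group `W₀` on the (multiplicatively written) lattice `X`. -/
def weylAction (P : RootDatum ι X Y) : P.weylGroup →* MulAut (Multiplicative X) where
  toFun w := AddEquiv.toMultiplicative (DistribMulAction.toAddEquiv X w)
  map_one' := by
    ext x
    change Multiplicative.ofAdd ((1 : P.weylGroup) • x.toAdd) = x
    rw [one_smul]; rfl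
  map_mul' v w := by
    ext x
    change Multiplicative.ofAdd ((v * w) • x.toAdd) = Multiplicative.ofAdd (v • w • x.toAdd)
    rw [mul_smul]

/-- The group `W = X ⋊ W₀`. -/
abbrev AffineWeylGroup (P : RootDatum ι X Y) : Type u :=
  Multiplicative X ⋊[weylAction P] P.weylGroup

/-- The translation `t_x ∈ W`. -/
def translation (P : RootDatum ι X Y) (x : X) : AffineWeylGroup P :=
  SemidirectProduct.inl (Multiplicative.ofAdd x)

/-- The reflection `s_α ∈ W₀ ⊆ W` in the root with index `i`. -/
def reflection (P : RootDatum ι X Y) (i : ι) : AffineWeylGroup P :=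
  SemidirectProduct.inr (RootPairing.weylGroup.ofIdx P i)

/-- Affine roots: the pair `(i, k)` stands for the affine linear function
`y ↦ ⟨y, α_i^∨⟩ + k` on `X`. -/
abbrev AffineRoot (_P : RootDatum ι X Y) : Type u := ι × ℤ

/-- The action of `W` on affine roots: `(g • a)(y) = a(g⁻¹ y)`, where `g = t_x w` acts on `X` by
`y ↦ w y + x`. -/
def actAffineRoot (g : AffineWeylGroup P) (a : AffineRoot P) : AffineRoot P :=
  (P.weylGroupToPerm g.right a.1,
    a.2 - P.coroot' (P.weylGroupToPerm g.right a.1) g.left.toAdd)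

/-- The coroot with index `i` is positive with respect to the basis `b`. -/
def IsPosCoroot (b : P.Base) (i : ι) : Prop :=
  P.coroot i ∈ AddSubmonoid.closure (P.coroot '' (b.support : Set ι))

/-- Positive affine roots: `(α^∨, k)` with `k > 0`, or `k = 0` and `α^∨` positive. The other
affine roots are the negative ones. -/
def IsPosAffineRoot (b : P.Base) (a : AffineRoot P) : Prop :=
  0 < a.2 ∨ (a.2 = 0 ∧ IsPosCoroot b a.1)

/-- The length function on `W`: the number of positive affine roots made negative. -/
def length (b : P.Base) (g : AffineWeylGroup P) : ℕ :=
  {a : AffineRoot P | IsPosAffineRoot b a ∧ ¬ IsPosAffineRoot b (actAffineRoot g a)}.ncard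

/-- `α_i^∨` is maximal among the coroots for the dominance ordering. -/
def IsMaxCoroot (b : P.Base) (i : ι) : Prop :=
  ∀ j, P.coroot j - P.coroot i ∈ AddSubmonoid.closure (P.coroot '' (b.support : Set ι)) → j = i

/-- The set `S^aff` of simple affine reflections: `s_α` for `α` simple, and
the reflection `t_α s_α` in the hyperplane `⟨x, α^∨⟩ = 1` for `α^∨` maximal. -/
def simpleAffineReflections (b : P.Base) : Set (AffineWeylGroup P) :=
  {g | (∃ i ∈ b.support, g = reflection P i) ∨
    ∃ i, IsMaxCoroot b i ∧ g = translation P (P.root i) * reflection P i}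

/-! ### The affine Hecke algebra -/

/-- Positive parameter functions `q : W → (0, ∞)`. -/
structure ParameterFunction (b : P.Base) where
  toFun : AffineWeylGroup P → ℝ
  pos : ∀ g, 0 < toFun g
  eq_one_of_length_eq_zero : ∀ g, length b g = 0 → toFun g = 1
  mul_of_length_add : ∀ g h, length b (g * h) = length b g + length b h →
    toFun (g * h) = toFun g * toFun h

instance (b : P.Base) : CoeFun (ParameterFunction b) (fun _ => AffineWeylGroup P → ℝ) :=
  ⟨ParameterFunction.toFun⟩

/-- The defining relations of the affine Hecke algebra between the generators `T_g`, `g ∈ W`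
(here `T_g` is `FreeAlgebra.ι ℂ g`). -/
inductive HeckeRel (b : P.Base) (q : ParameterFunction b) :
    FreeAlgebra ℂ (AffineWeylGroup P) → FreeAlgebra ℂ (AffineWeylGroup P) → Prop
  | one : HeckeRel b q (FreeAlgebra.ι ℂ 1) 1
  | mul (g h : AffineWeylGroup P) (hgh : length b (g * h) = length b g + length b h) :
      HeckeRel b q (FreeAlgebra.ι ℂ g * FreeAlgebra.ι ℂ h) (FreeAlgebra.ι ℂ (g * h))
  | quadratic (s : AffineWeylGroup P) (hs : s ∈ simpleAffineReflections b) :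
      HeckeRel b q (FreeAlgebra.ι ℂ s * FreeAlgebra.ι ℂ s)
        (((q s : ℂ) - 1) • FreeAlgebra.ι ℂ s + (q s : ℂ) • 1)

/-- The affine Hecke algebra `ℋ(ℛ, q)`: the unital associative complex algebra generated by the
`T_g`, `g ∈ W`, subject to `T_e = 1`, `T_g T_h = T_{gh}` whenever `ℓ(gh) = ℓ(g) + ℓ(h)`, and
`T_s T_s = (q(s) - 1) T_s + q(s)` for `s ∈ S^aff`. -/
abbrev HeckeAlgebra (b : P.Base) (q : ParameterFunction b) : Type u :=
  RingQuot (HeckeRel b q)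

end WeylGroups

/-! ### Cohomological dimension of an abelian category -/

/-- The least `d ∈ {0, 1, 2, …, ∞}` such that `Ext^n(U, V) = 0` for all objects `U`, `V` and all
`n > d`. -/
def cohomologicalDimension (C : Type u) [Category.{v} C] [Abelian C] [HasExt.{w} C] : ℕ∞ :=
  sInf {d : ℕ∞ | ∀ n : ℕ, d < (n : ℕ∞) → ∀ U V : C, Subsingleton (Abelian.Ext U V n)}

/-! ### Bornological vector spaces -/

section Bornology

/-- Convex vector bornologies on a complex vector space. -/
class IsConvexBornology (V : Type v) [AddCommGroup V] [Module ℂ V] [Bornology V] : Prop where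
  isBounded_add : ∀ s t : Set V, Bornology.IsBounded s → Bornology.IsBounded t →
    Bornology.IsBounded {x | ∃ a ∈ s, ∃ b ∈ t, x = a + b}
  isBounded_smul : ∀ (c : ℂ) (s : Set V), Bornology.IsBounded s →
    Bornology.IsBounded ((fun x => c • x) '' s)
  isBounded_hull : ∀ s : Set V, Bornology.IsBounded s →
    ∃ t : Set V, s ⊆ t ∧ Bornology.IsBounded t ∧ Balanced ℂ t ∧ Convex ℝ t

/-- The fine bornology: a set is bounded if it is contained in a finite dimensional
subspace and bounded there in the usual sense. -/
@[reducible]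
def fineBornology (V : Type v) [AddCommGroup V] [Module ℂ V] : Bornology V :=
  Bornology.ofBounded
    {s | ∃ (n : ℕ) (f : (Fin n → ℂ) →ₗ[ℂ] V) (t : Set (Fin n → ℂ)),
      Bornology.IsBounded t ∧ s ⊆ f '' t}
    ⟨0, 0, ∅, Bornology.isBounded_empty, Set.empty_subset _⟩
    (fun _ ⟨n, f, t, ht, hs⟩ _ h => ⟨n, f, t, ht, h.trans hs⟩)
    (by
      rintro s₁ ⟨n₁, f₁, t₁, ht₁, hs₁⟩ s₂ ⟨n₂, f₂, t₂, ht₂, hs₂⟩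
      obtain ⟨C₁, hC₁⟩ := ht₁.exists_norm_le
      obtain ⟨C₂, hC₂⟩ := ht₂.exists_norm_le
      refine ⟨n₁ + n₂,
        f₁ ∘ₗ LinearMap.funLeft ℂ ℂ (Fin.castAdd n₂) + f₂ ∘ₗ LinearMap.funLeft ℂ ℂ (Fin.natAdd n₁),
        Metric.closedBall 0 (max 0 (max C₁ C₂)), Metric.isBounded_closedBall, ?_⟩
      rintro x (hx | hx)
      · obtain ⟨y, hy, rfl⟩ := hs₁ hx
        refine ⟨Fin.append y 0, ?_, ?_⟩
        · rw [mem_closedBall_zero_iff, pi_norm_le_iff_of_nonneg (le_max_left _ _)]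
          intro i
          refine Fin.addCases (fun j => ?_) (fun j => ?_) i
          · rw [Fin.append_left]
            exact (norm_le_pi_norm y j).trans ((hC₁ y hy).trans (by simp))
          · simp
        · have h1 : LinearMap.funLeft ℂ ℂ (Fin.castAdd n₂) (Fin.append y 0) = y := by
            ext j; simp [LinearMap.funLeft_apply]
          have h2 : LinearMap.funLeft ℂ ℂ (Fin.natAdd n₁) (Fin.append y (0 : Fin n₂ → ℂ)) = 0 := by
            ext j; simp [LinearMap.funLeft_apply]
          simp [h1, h2]
      · obtain ⟨y, hy, rfl⟩ := hs₂ hx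
        refine ⟨Fin.append 0 y, ?_, ?_⟩
        · rw [mem_closedBall_zero_iff, pi_norm_le_iff_of_nonneg (le_max_left _ _)]
          intro i
          refine Fin.addCases (fun j => ?_) (fun j => ?_) i
          · simp
          · rw [Fin.append_right]
            exact (norm_le_pi_norm y j).trans ((hC₂ y hy).trans (by simp))
        · have h1 : LinearMap.funLeft ℂ ℂ (Fin.castAdd n₂) (Fin.append (0 : Fin n₁ → ℂ) y) = 0 := by
            ext j; simp [LinearMap.funLeft_apply]
          have h2 : LinearMap.funLeft ℂ ℂ (Fin.natAdd n₁) (Fin.append 0 y) = y := by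
            ext j; simp [LinearMap.funLeft_apply]
          simp [h1, h2])
    (fun x => ⟨1, LinearMap.toSpanSingleton ℂ V x ∘ₗ LinearMap.proj 0, {1},
      Bornology.isBounded_singleton, by simp⟩)

/-- A completant bounded disc: the span of `D`, normed by the gauge of `D`, is a
Banach space. -/
def IsCompletantDisc {V : Type v} [AddCommGroup V] [Module ℂ V] (D : Set V) : Prop :=
  Balanced ℂ D ∧ Convex ℝ D ∧
  (∀ x : V, (∀ ε : ℝ, 0 < ε → ∃ y ∈ D, x = ε • y) → x = 0) ∧
  ∀ x : ℕ → V,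
    (∀ ε : ℝ, 0 < ε → ∃ N, ∀ m ≥ N, ∀ n ≥ N, ∃ y ∈ D, x m - x n = ε • y) →
    ∃ l : V, ∀ ε : ℝ, 0 < ε → ∃ N, ∀ n ≥ N, ∃ y ∈ D, x n - l = ε • y

/-- A linear map is bounded if it sends bounded sets to bounded sets. -/
def IsBoundedMap {V : Type v} {V' : Type w} [AddCommGroup V] [Module ℂ V] [Bornology V]
    [AddCommGroup V'] [Module ℂ V'] [Bornology V'] (f : V →ₗ[ℂ] V') : Prop :=
  ∀ s : Set V, Bornology.IsBounded s → Bornology.IsBounded (f '' s)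

/-! ### Bornological modules over an algebra with the fine bornology -/

variable (A : Type u) [Ring A] [Algebra ℂ A]

/-- Bornological `A`-modules, where `A` carries the fine bornology: the action `A × V → V` is a
bounded bilinear map. -/
structure BorMod where
  carrier : Type v
  [addCommGroup : AddCommGroup carrier]
  [complexModule : Module ℂ carrier]
  [module : Module A carrier]
  [isScalarTower : IsScalarTower ℂ A carrier]
  [bornology : Bornology carrier]
  [isConvexBornology : IsConvexBornology carrier]
  isBounded_smul : ∀ (S : Set A) (B : Set carrier), (fineBornology A).IsBounded S →
    Bornology.IsBounded B → Bornology.IsBounded {x | ∃ a ∈ S, ∃ v ∈ B, x = a • v}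

namespace BorMod

attribute [instance] addCommGroup complexModule module isScalarTower bornology isConvexBornology

instance : CoeSort (BorMod.{u, v} A) (Type v) := ⟨carrier⟩

variable {A}

/-- Completeness: every bounded set is contained in a bounded completant disc. -/
def IsComplete (V : BorMod.{u, v} A) : Prop :=
  ∀ B : Set V, Bornology.IsBounded B → ∃ D : Set V, B ⊆ D ∧ Bornology.IsBounded D ∧
    IsCompletantDisc D

/-- Bounded `A`-module homomorphisms. -/
def Hom (U V : BorMod.{u, v} A) : AddSubgroup (U →ₗ[A] V) where
  carrier := {f | IsBoundedMap (f.restrictScalars ℂ)}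
  zero_mem' := fun s _ =>
    (Bornology.isBounded_singleton (x := (0 : V))).subset (by rintro _ ⟨x, _, rfl⟩; simp)
  add_mem' := by
    intro f g hf hg s hs
    refine (IsConvexBornology.isBounded_add _ _ (hf s hs) (hg s hs)).subset ?_
    rintro _ ⟨x, hx, rfl⟩
    exact ⟨_, ⟨x, hx, rfl⟩, _, ⟨x, hx, rfl⟩, rfl⟩
  neg_mem' := by
    intro f hf s hs
    refine (IsConvexBornology.isBounded_smul (-1) _ (hf s hs)).subset ?_
    rintro _ ⟨x, hx, rfl⟩
    exact ⟨_, ⟨x, hx, rfl⟩, by simp⟩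

/-- Precomposition with a bounded homomorphism. -/
def precomp {U V : BorMod.{u, v} A} (f : Hom U V) (Z : BorMod.{u, v} A) : Hom V Z →+ Hom U Z where
  toFun g := ⟨g.1 ∘ₗ f.1, fun s hs => by
    have h := g.2 _ (f.2 s hs)
    rw [Set.image_image] at h
    exact h⟩
  map_zero' := by ext; rfl
  map_add' _ _ := by ext; rfl

/-! The following notions refer to a full subcategory of the category of bornological
`A`-modules, given by a predicate `C` on objects. The exact structure consists of the extensions
that are split in the category of bornological vector spaces. -/

variable (C : BorMod.{u, v} A → Prop)

/-- `Q` is projective: bounded homomorphisms from `Q` lift along all bounded homomorphisms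
`p : V → V'` that have a bounded `ℂ`-linear section. -/
def IsProjective (Q : BorMod.{u, v} A) : Prop :=
  ∀ V V' : BorMod.{u, v} A, C V → C V' → ∀ p : Hom V V',
    (∃ σ : V' →ₗ[ℂ] V, IsBoundedMap σ ∧ ∀ x, p.1 (σ x) = x) →
    ∀ f : Hom Q V', ∃ g : Hom Q V, ∀ x, p.1 (g.1 x) = f.1 x

/-- A projective resolution `0 ← U ← Q₀ ← Q₁ ← ⋯` of `U`: a complex with projective terms `Q_n`,
which is exact in the sense that it admits a bounded `ℂ`-linear contraction. -/
structure ProjRes (U : BorMod.{u, v} A) where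
  obj : ℕ → BorMod.{u, v} A
  mem : ∀ n, C (obj n)
  projective : ∀ n, IsProjective C (obj n)
  d : ∀ n, Hom (obj (n + 1)) (obj n)
  ε : Hom (obj 0) U
  d_comp_d : ∀ n x, (d n).1 ((d (n + 1)).1 x) = 0
  ε_comp_d : ∀ x, ε.1 ((d 0).1 x) = 0
  exact : ∃ (η : U →ₗ[ℂ] obj 0) (γ : ∀ n, obj n →ₗ[ℂ] obj (n + 1)),
    IsBoundedMap η ∧ (∀ n, IsBoundedMap (γ n)) ∧
    (∀ x, ε.1 (η x) = x) ∧
    (∀ x, η (ε.1 x) + (d 0).1 (γ 0 x) = x) ∧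
    ∀ n x, γ n ((d n).1 x) + (d (n + 1)).1 (γ (n + 1) x) = x

variable {C}

/-- The `n`-coboundaries of the cochain complex `Hom(Q_*, V)`. -/
def ProjRes.coboundaries {U : BorMod.{u, v} A} (Q : ProjRes C U) (V : BorMod.{u, v} A) :
    ∀ n, AddSubgroup (Hom (Q.obj n) V)
  | 0 => ⊥
  | n + 1 => (precomp (Q.d n) V).range

/-- The `n`-cocycles of the cochain complex `Hom(Q_*, V)`. -/
def ProjRes.cocycles {U : BorMod.{u, v} A} (Q : ProjRes C U) (V : BorMod.{u, v} A) (n : ℕ) :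
    AddSubgroup (Hom (Q.obj n) V) :=
  (precomp (Q.d n) V).ker

/-- The group `Ext^n(U, V)`, computed with the projective resolution `Q` of `U`: the `n`-th
cohomology group of the cochain complex `Hom(Q_*, V)`. -/
abbrev ProjRes.Ext {U : BorMod.{u, v} A} (Q : ProjRes C U) (V : BorMod.{u, v} A) (n : ℕ) :
    Type v :=
  Q.cocycles V n ⧸ (Q.coboundaries V n).addSubgroupOf (Q.cocycles V n)

variable (C)

/-- `Ext^n(U, V) = 0`: there is a projective resolution of `U`, and with it one finds
`Ext^n(U, V) = 0`. (The group does not depend on the resolution, up to isomorphism.) -/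
def ExtVanishes (U V : BorMod.{u, v} A) (n : ℕ) : Prop :=
  ∃ Q : ProjRes C U, Subsingleton (Q.Ext V n)

/-- The least `d ∈ {0, 1, 2, …, ∞}` such that `Ext^n(U, V) = 0` for all `U`, `V` and all
`n > d`. -/
def cohomologicalDimension : ℕ∞ :=
  sInf {d : ℕ∞ | ∀ n : ℕ, d < (n : ℕ∞) → ∀ U V : BorMod.{u, v} A, C U → C V → ExtVanishes C U V n}

end BorMod

end Bornology

end AffineHecke

end

/-! The upper bound comes from a statement on bimodules: over the enveloping algebra ℋ ⊗ ℋᵒᵖ (`Env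
(Hecke q)`) the module ℋ has projective dimension at most the rank of X (`pdLT_kerMul`). A
resolution of ℋ by free bimodules, tensored with a module U, then resolves U. The mechanism is a
choice of coordinates. The vectors T_g ⊗ T_g⁻¹h (`twist`) identify ℋ ⊗ ℋᵒᵖ with a sum of copies of ℋ
indexed by W. In these coordinates the left ideal generated by T_v ⊗ 1 - 1 ⊗ T_v, for v in a set Γ
of simple reflections and elements of length zero, is the kernel of summation over the cosets of
⟨Γ⟩, exactly as for q = 1 (`mem_relIdeal_iff`). For one simple affine reflection s the ideal
consists of the functions antisymmetric under g ↦ g s. The alternating sums over g W_J, with J the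
descents of g, form a basis adapted to all these ideals at once
(`mem_relIdeal_simpleRefl_iff_adapted`), so the ideals generate a distributive lattice and give
exact sequences of subquotients. If J contains no component of the affine diagram, then W_J is
finite and the quotient by the ideal of J is projective, thanks to a Casimir element that is
invertible because q > 0. An intersection over a whole component vanishes, because no element of W
has all nodes of a component as descents. Hence affine nodes, added first, cost no degree, and each
finite node costs at most one (`nodePdLT_ncard`). Translations orthogonal to all coroots are
central, and a basis of them costs one degree each. The group generated by these and the reflections
has finite index in W, and averaging over its cosets exhibits ℋ as a direct summand of the quotient
obtained. The free bimodule resolution has right ℋ-linear contractions. They survive tensoring with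
U and become bounded for every bornology on U, so a single resolution serves all the categories. For
the lower bound, the Bernstein elements θ_x - 1, for x in a basis of X, form a sequence that is
regular for right multiplication and annihilates the trivial representation. Iterated connecting
homomorphisms produce a nonzero class in degree rank X (`IsRegularSeq.extElement_ne_zero`).
Bornologically, the same modules with fine bornologies are used: vanishing of the bornological Ext,
computed with any resolution, would make the algebraic class zero (`BorMod.Tower.not_extVanishes`).
-/

noncomputable section
namespace AffineHecke

/-! ### The integral pairing between roots and coroots. -/

section Pairing

variable {ι X Y : Type u} [AddCommGroup X] [AddCommGroup Y] {P : RootDatum ι X Y}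

lemma coroot'_weyl_smul (w : P.weylGroup) (i : ι) (x : X) :
    P.coroot' (P.weylGroupToPerm w i) (w • x) = P.coroot' i x := by
  have h := RootPairing.Hom.weight_coweight_transpose_apply P P (P.coroot (P.weylGroupToPerm w i))
    w.1.toHom
  have h2 := RootPairing.Hom.coroot_coweightMap_apply P P (P.weylGroupToPerm w i) w.1.toHom
  rw [h2] at h
  have h3 := DFunLike.congr_fun h x
  have h4 : w.1.toHom.indexEquiv.symm (P.weylGroupToPerm w i) = i :=
    w.1.toHom.indexEquiv.symm_apply_apply i
  rw [h4] at h3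
  exact h3

lemma coroot'_weyl (w : P.weylGroup) (i : ι) (x : X) :
    P.coroot' (P.weylGroupToPerm w i) x = P.coroot' i (w⁻¹ • x) := by
  rw [← coroot'_weyl_smul w i (w⁻¹ • x), smul_inv_smul]

lemma ofIdx_smul (i : ι) (x : X) :
    RootPairing.weylGroup.ofIdx P i • x = x - P.coroot' i x • P.root i := by
  rw [RootPairing.weylGroup.ofIdx_smul]
  exact P.reflection_apply i x

lemma weylGroup_faithful {v w : P.weylGroup} (h : ∀ x : X, v • x = w • x) : v = w := by
  apply Subtype.ext
  apply RootPairing.Equiv.weightHom_injective P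
  ext x
  exact h x

lemma pairing_eq_zero_comm [Finite ι] {i j : ι} : P.pairing i j = 0 ↔ P.pairing j i = 0 := by
  have : Module.IsReflexive ℤ X := .of_isPerfPair P.toLinearMap
  have : Module.IsTorsionFree ℤ X := .trans_faithfulSMul ℤ ℤ X
  exact P.pairing_eq_zero_iff

lemma pairing_pos_comm [Finite ι] {i j : ι} : 0 < P.pairing i j ↔ 0 < P.pairing j i := by
  have := P.zero_lt_pairingIn_iff' ℤ (i := i) (j := j)
  rwa [← P.algebraMap_pairingIn ℤ i j, ← P.algebraMap_pairingIn ℤ j i]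

lemma pairing_nonneg_comm [Finite ι] {i j : ι} : 0 ≤ P.pairing i j ↔ 0 ≤ P.pairing j i := by
  rw [le_iff_lt_or_eq, le_iff_lt_or_eq, pairing_pos_comm, eq_comm, pairing_eq_zero_comm,
    eq_comm (a := (0 : ℤ))]

lemma neg_reflectionPerm_self (i : ι) : P.coroot (P.reflectionPerm i i) = - P.coroot i := by
  rw [P.coroot_reflectionPerm, P.coreflection_apply_coroot]
  simp [two_smul]

variable [Finite ι] (b : P.Base)

lemma coroot_sub_mem {i j : ι} (h : 0 < P.pairing i j) (hij : i ≠ j) :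
    ∃ k, P.coroot k = P.coroot i - P.coroot j := by
  refine P.flip.root_sub_root_mem_of_pairingIn_pos (i := i) (j := j) ?_ hij
  have h2 := pairing_pos_comm.1 h
  rw [← P.algebraMap_pairingIn ℤ j i] at h2
  exact h2

lemma coroot_add_mem {i j : ι} (h : P.pairing i j < 0) (hij : P.coroot i ≠ - P.coroot j) :
    ∃ k, P.coroot k = P.coroot i + P.coroot j := by
  refine P.flip.root_add_root_mem_of_pairingIn_neg (i := i) (j := j) ?_ hij
  have h2 : P.pairing j i < 0 := by
    rw [← not_le] at h ⊢
    rwa [pairing_nonneg_comm]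
  rw [← P.algebraMap_pairingIn ℤ j i] at h2
  exact h2

/-- The simple roots span all roots over ℤ, so every root kills `y`, and hence so does the coroot
form. That form is nondegenerate on the span of the coroots. -/
lemma corootSpan_separating {y : Y} (hy : y ∈ P.corootSpan ℤ)
    (h : ∀ i ∈ b.support, P.root' i y = 0) : y = 0 := by
  have := Fintype.ofFinite ι
  have h1 : ∀ i, P.root' i y = 0 := by
    intro i
    have hi : P.root i ∈ Submodule.span ℤ (P.root '' b.support) := b.root_mem_span_int i
    change P.toLinearMap (P.root i) y = 0
    generalize P.root i = x at hi
    induction hi using Submodule.span_induction with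
    | mem x hx => obtain ⟨j, hj, rfl⟩ := hx; exact h j hj
    | zero => simp
    | add x z _ _ hx hz => simp [hx, hz]
    | smul a x _ hx => simp [hx]
  have h2 := Submodule.disjoint_def.1 P.disjoint_corootSpan_ker_corootForm y hy
  apply h2
  rw [LinearMap.mem_ker]
  ext z
  simp [RootPairing.corootForm_apply_apply, h1]

/-- The Cartan matrix has nonzero determinant, so values on the simple coroots can be prescribed up
to a fixed factor. Fundamental weights need not lie in `X`, which is why `M` appears. -/
lemma exists_coroot'_eq : ∃ M : ℤ, 0 < M ∧ ∀ c : ι → ℤ, ∃ x : X, ∀ i ∈ b.support,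
    P.coroot' i x = M * c i := by
  classical
  let A : Matrix b.support b.support ℤ := fun i j => P.pairing i j
  have hA : A.det ≠ 0 := by
    intro h
    obtain ⟨v, hv, hv2⟩ := Matrix.exists_mulVec_eq_zero_iff.2 h
    apply hv
    have h0 : ∑ j, v j • P.coroot j = 0 := by
      refine corootSpan_separating b (Submodule.sum_mem _ fun j _ => Submodule.smul_mem _ _
        (Submodule.subset_span ⟨_, rfl⟩)) ?_
      intro i hi
      have := congrFun hv2 ⟨i, hi⟩
      simp only [Matrix.mulVec, dotProduct, A] at this
      simp only [map_sum, map_smul, smul_eq_mul]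
      rw [Pi.zero_apply] at this
      rw [← this]
      refine Finset.sum_congr rfl fun j _ => ?_
      rw [mul_comm, ← P.root'_coroot_eq_pairing]
    have := b.linearIndepOn_coroot
    have := Fintype.linearIndependent_iff.1 this v h0
    funext i
    exact this i
  -- The adjugate inverts `A` up to its determinant; squaring makes the factor positive.
  refine ⟨A.det ^ 2, by positivity, fun c => ?_⟩
  let d : b.support → ℤ := A.det • Matrix.vecMul (fun i : b.support => c i) A.adjugate
  refine ⟨∑ i, d i • P.root i, fun j hj => ?_⟩
  have : Matrix.vecMul d A = (A.det ^ 2) • fun i : b.support => c i := by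
    simp only [d]
    rw [Matrix.smul_vecMul, Matrix.vecMul_vecMul, Matrix.adjugate_mul, Matrix.vecMul_smul,
      Matrix.vecMul_one, smul_smul, sq]
  have := congrFun this ⟨j, hj⟩
  simp only [Matrix.vecMul, dotProduct, A, Pi.smul_apply, smul_eq_mul] at this
  rw [← this]
  simp only [map_sum, map_smul, smul_eq_mul]
  refine Finset.sum_congr rfl fun i _ => ?_
  rw [P.root_coroot'_eq_pairing]

end Pairing
end AffineHecke
end

noncomputable section
set_option linter.unusedSectionVars false
namespace AffineHecke

/-! ### Maximal coroots and the components of the Dynkin diagram. -/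

section MaxCoroots

variable {ι X Y : Type u} [AddCommGroup X] [AddCommGroup Y] {P : RootDatum ι X Y} (b : P.Base)

/-- The monoid of nonnegative combinations of simple coroots. -/
abbrev posCone : AddSubmonoid Y := AddSubmonoid.closure (P.coroot '' (b.support : Set ι))

variable {b}

lemma exists_sum_of_mem_posCone {y : Y} (hy : y ∈ posCone b) :
    ∃ n : ι → ℕ, y = ∑ i ∈ b.support, n i • P.coroot i := by
  classical
  induction hy using AddSubmonoid.closure_induction with
  | mem x hx =>
    obtain ⟨j, hj, rfl⟩ := hx
    refine ⟨fun i => if i = j then 1 else 0, ?_⟩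
    rw [Finset.sum_eq_single_of_mem j hj (by intro k _ hk; simp [hk])]
    simp
  | zero => exact ⟨0, by simp⟩
  | add x y _ _ hx hy =>
    obtain ⟨m, rfl⟩ := hx
    obtain ⟨n, rfl⟩ := hy
    exact ⟨m + n, by simp [add_smul, Finset.sum_add_distrib]⟩

lemma coroot_mem_posCone {i : ι} (hi : i ∈ b.support) : P.coroot i ∈ posCone b :=
  AddSubmonoid.subset_closure ⟨i, hi, rfl⟩

lemma isPosCoroot_of_mem_support {i : ι} (hi : i ∈ b.support) : IsPosCoroot b i :=
  coroot_mem_posCone hi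

variable [Finite ι]

/-- Links positivity in terms of a submonoid with positivity in the dual base, for which it is known
that a simple reflection permutes the other positive roots. -/
lemma isPosCoroot_iff (i : ι) : IsPosCoroot b i ↔ b.flip.IsPos i := by
  have key : ∀ i, IsPosCoroot b i → b.flip.IsPos i := by
    intro i hi
    obtain ⟨n, hn⟩ := exists_sum_of_mem_posCone hi
    rw [RootPairing.Base.isPos_iff']
    rw [RootPairing.Base.height_eq_sum (f := fun j => (n j : ℤ))]
    · positivity
    · change P.coroot i = ∑ j ∈ b.support, (n j : ℤ) • P.coroot j
      simpa using hn
  refine ⟨key i, fun h => ?_⟩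
  rcases b.coroot_mem_or_neg_mem i with h' | h'
  · exact h'
  · exfalso
    have h2 : IsPosCoroot b (P.reflectionPerm i i) := by
      rw [IsPosCoroot, neg_reflectionPerm_self]; exact h'
    have h3 := key _ h2
    have := (RootPairing.Base.IsPos.neg_iff_not b.flip i).1 h3
    exact this h

variable (b) in
/-- A regular dominant point in the fundamental alcove. -/
lemma exists_alcove_point : ∃ (x : X) (N : ℤ), 0 < N ∧ (∀ i ∈ b.support, 0 < P.coroot' i x) ∧
    ∀ i, P.coroot' i x < N := by
  have := Fintype.ofFinite ι
  obtain ⟨M, hM, h⟩ := exists_coroot'_eq b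
  obtain ⟨x, hx⟩ := h 1
  refine ⟨x, 1 + ∑ i, |P.coroot' i x|, by positivity, fun i hi => by simp [hx i hi, hM],
    fun i => ?_⟩
  have h1 := Finset.single_le_sum (f := fun i => |P.coroot' i x|) (fun i _ => abs_nonneg _)
    (Finset.mem_univ i)
  have h2 := le_abs_self (P.coroot' i x)
  linarith

omit [Finite ι] in
lemma posCone_nonneg {x : X} (hx : ∀ i ∈ b.support, 0 ≤ P.coroot' i x) {y : Y}
    (hy : y ∈ posCone b) : 0 ≤ P.toLinearMap x y := by
  induction hy using AddSubmonoid.closure_induction with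
  | mem z hz => obtain ⟨j, hj, rfl⟩ := hz; exact hx j hj
  | zero => simp
  | add y z _ _ h1 h2 => rw [map_add]; positivity

omit [Finite ι] in
lemma posCone_pos {x : X} (hx : ∀ i ∈ b.support, 0 < P.coroot' i x) {y : Y}
    (hy : y ∈ posCone b) : y = 0 ∨ 0 < P.toLinearMap x y := by
  induction hy using AddSubmonoid.closure_induction with
  | mem z hz => obtain ⟨j, hj, rfl⟩ := hz; exact Or.inr (hx j hj)
  | zero => simp
  | add y z _ _ h1 h2 =>
    rcases h1 with rfl | h1
    · simpa using h2
    · rcases h2 with rfl | h2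
      · simp [h1]
      · right; rw [map_add]; positivity

lemma eq_zero_of_mem_posCone_of_neg_mem {y : Y} (hy : y ∈ posCone b) (hy' : -y ∈ posCone b) :
    y = 0 := by
  obtain ⟨x, N, -, hx, -⟩ := exists_alcove_point b
  rcases posCone_pos hx hy with h | h
  · exact h
  · rcases posCone_pos hx hy' with h' | h'
    · simpa using h'
    · rw [map_neg] at h'; linarith

/-- Among the finitely many coroots above that of `j`, one with the largest value at a regular
dominant point is maximal, because a strictly larger coroot has a larger value there. -/
lemma exists_isMaxCoroot_ge (j : ι) : ∃ i, IsMaxCoroot b i ∧ P.coroot i - P.coroot j ∈ posCone b := by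
  obtain ⟨x, N, -, hx, -⟩ := exists_alcove_point b
  have hfin : ({i | P.coroot i - P.coroot j ∈ posCone b}).Finite := Set.toFinite _
  obtain ⟨i, hi, hmax⟩ := Set.exists_max_image _ (fun i => P.coroot' i x) hfin
    ⟨j, by simp [zero_mem]⟩
  refine ⟨i, fun k hk => ?_, hi⟩
  have hk2 : P.coroot k - P.coroot j ∈ posCone b := by
    have := add_mem hk hi
    rwa [sub_add_sub_cancel] at this
  have h1 := hmax k hk2
  rcases posCone_pos hx hk with h | h
  · exact P.coroot.injective (sub_eq_zero.1 h)
  · rw [map_sub] at h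
    simp only [RootPairing.coroot'] at h1
    exfalso
    change P.toLinearMap x (P.coroot k) ≤ P.toLinearMap x (P.coroot i) at h1
    linarith

variable {θ : ι} (hθ : IsMaxCoroot b θ)
include hθ

/-- Otherwise `-θ^∨ - θ^∨` would lie in the cone, so the coroot `-θ^∨` would dominate `θ^∨`. -/
lemma IsMaxCoroot.isPosCoroot : IsPosCoroot b θ := by
  rcases b.coroot_mem_or_neg_mem θ with h | h
  · exact h
  · exfalso
    have h1 := hθ (P.reflectionPerm θ θ) (by
      rw [neg_reflectionPerm_self, sub_eq_add_neg]; exact add_mem h h)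
    have h2 := neg_reflectionPerm_self (P := P) θ
    rw [h1] at h2
    have h3 : IsPosCoroot b θ := by rw [IsPosCoroot, h2]; exact h
    exact P.flip.ne_zero θ (eq_zero_of_mem_posCone_of_neg_mem h3 h)

/-- Adding a positive coroot to a maximal one never gives a coroot. -/
lemma IsMaxCoroot.add_ne {i k : ι} (hi : IsPosCoroot b i) : P.coroot k ≠ P.coroot θ + P.coroot i := by
  intro h
  have := hθ k (by rw [h, add_sub_cancel_left]; exact hi)
  rw [this] at h
  exact P.flip.ne_zero i (by simpa using h.symm)

/-- A negative pairing would make the sum of the two coroots a coroot above `θ^∨`. -/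
lemma IsMaxCoroot.pairing_nonneg {i : ι} (hi : IsPosCoroot b i) : 0 ≤ P.pairing θ i := by
  by_contra! h
  obtain ⟨k, hk⟩ := coroot_add_mem h (by
    intro h
    have h1 : -P.coroot i ∈ posCone b := by rw [← h]; exact hθ.isPosCoroot
    exact P.flip.ne_zero i (eq_zero_of_mem_posCone_of_neg_mem hi h1))
  exact hθ.add_ne hi hk

/-- If a coroot `β ≠ -θ` has negative product with `θ`, then `β + θ` is a positive coroot. -/
lemma IsMaxCoroot.add_isPos {i : ι} (h : P.pairing θ i < 0) (hi : P.coroot i ≠ - P.coroot θ) :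
    ∃ k, P.coroot k = P.coroot θ + P.coroot i ∧ IsPosCoroot b k := by
  obtain ⟨k, hk⟩ := coroot_add_mem h (by
    intro h'; apply hi; rw [h', neg_neg])
  refine ⟨k, hk, ?_⟩
  rcases b.coroot_mem_or_neg_mem k with h1 | h1
  · exact h1
  -- If `θ^∨ + β` were negative, then `-β = θ^∨ + (-(θ^∨ + β))` would be a coroot above `θ^∨`.
  · exfalso
    refine hθ.add_ne (i := P.reflectionPerm k k) (k := P.reflectionPerm i i) ?_ ?_
    · rw [IsPosCoroot, neg_reflectionPerm_self]; exact h1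
    · rw [neg_reflectionPerm_self, neg_reflectionPerm_self, hk]; abel

/-- If the pairing with `β` were at most -2, then `θ^∨ + β` would be a positive coroot, and
nonnegativity of its pairing forces the value -2. But then `s_θ β = β + 2θ^∨` is a coroot above
`θ^∨`. The bound means that reflection in the affine node lowers the level of an affine root by at
most one, unless its coroot is `-θ^∨`. -/
lemma IsMaxCoroot.pairing_ge {i : ι} (hi : P.coroot i ≠ - P.coroot θ) : -1 ≤ P.pairing θ i := by
  by_contra! h
  obtain ⟨k, hk, hk2⟩ := hθ.add_isPos (by linarith) hi
  have h1 : P.pairing θ k = 2 + P.pairing θ i := by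
    have : P.root' θ (P.coroot k) = P.root' θ (P.coroot θ) + P.root' θ (P.coroot i) := by
      rw [hk, map_add]
    simpa [P.root'_coroot_eq_pairing] using this
  have h2 := hθ.pairing_nonneg hk2
  have h3 : P.pairing θ i = -2 := by linarith
  obtain ⟨l, hl⟩ : ∃ l, P.coroot l = P.coroot i + (2 : ℤ) • P.coroot θ := by
    refine ⟨P.reflectionPerm θ i, ?_⟩
    rw [P.coroot_reflectionPerm, P.coreflection_apply_coroot, h3]
    simp
  refine hθ.add_ne hk2 (k := l) ?_
  rw [hl, hk, two_smul]; abel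

lemma IsMaxCoroot.pairing_simple_nonneg {i : ι} (hi : i ∈ b.support) : 0 ≤ P.pairing θ i :=
  hθ.pairing_nonneg (isPosCoroot_of_mem_support hi)

omit hθ in
variable (b) in
/-- The coefficients of a coroot with respect to the simple coroots, if it is positive. -/
def coeff (i : ι) : ι → ℕ :=
  open Classical in
  if h : IsPosCoroot b i then (exists_sum_of_mem_posCone h).choose else 0

omit hθ in
lemma coroot_eq_sum_coeff {i : ι} (h : IsPosCoroot b i) :
    P.coroot i = ∑ j ∈ b.support, coeff b i j • P.coroot j := by
  rw [coeff, dif_pos h]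
  exact (exists_sum_of_mem_posCone h).choose_spec

omit hθ in
lemma pairing_eq_sum_coeff {i : ι} (h : IsPosCoroot b i) (k : ι) :
    P.pairing k i = ∑ j ∈ b.support, coeff b i j * P.pairing k j := by
  have : P.root' k (P.coroot i) = P.root' k (∑ j ∈ b.support, coeff b i j • P.coroot j) := by
    rw [← coroot_eq_sum_coeff h]
  simpa [P.root'_coroot_eq_pairing] using this

omit hθ in
lemma coroot'_eq_sum_coeff {i : ι} (h : IsPosCoroot b i) (x : X) :
    P.coroot' i x = ∑ j ∈ b.support, coeff b i j * P.coroot' j x := by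
  have : P.toLinearMap x (P.coroot i) =
      P.toLinearMap x (∑ j ∈ b.support, coeff b i j • P.coroot j) := by
    rw [← coroot_eq_sum_coeff h]
  simpa using this

omit hθ in
lemma pairing_nonpos_of_ne {i j : ι} (hi : i ∈ b.support) (hj : j ∈ b.support) (h : i ≠ j) :
    P.pairing i j ≤ 0 := by
  have := b.pairingIn_le_zero_of_ne h hi hj
  rwa [← P.algebraMap_pairingIn ℤ i j]

/-- With positive pairing the difference would be a coroot, and its sign would make one of the two
dominate the other. -/
lemma IsMaxCoroot.pairing_nonpos {θ' : ι} (hθ' : IsMaxCoroot b θ') (h : θ ≠ θ') :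
    P.pairing θ θ' ≤ 0 := by
  by_contra! h'
  obtain ⟨k, hk⟩ := coroot_sub_mem h' h
  rcases b.coroot_mem_or_neg_mem k with h1 | h1
  · exact h (hθ' θ (by rw [← hk]; exact h1))
  · exact h (hθ θ' (by rw [hk, neg_sub] at h1; exact h1)).symm

/-- Simple coroots in the support of one maximal coroot are orthogonal to any other one. -/
lemma IsMaxCoroot.pairing_eq_zero {θ' : ι} (hθ' : IsMaxCoroot b θ') (h : θ ≠ θ') {i : ι}
    (hi : i ∈ b.support) (hn : coeff b θ i ≠ 0) : P.pairing i θ' = 0 := by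
  have h1 : P.pairing θ' θ ≤ 0 := hθ'.pairing_nonpos hθ h.symm
  rw [pairing_eq_sum_coeff hθ.isPosCoroot] at h1
  have h2 : ∀ j ∈ b.support, 0 ≤ (coeff b θ j : ℤ) * P.pairing θ' j := fun j hj =>
    mul_nonneg (by positivity) (hθ'.pairing_simple_nonneg hj)
  have h3 := (Finset.sum_eq_zero_iff_of_nonneg h2).1 (le_antisymm h1 (Finset.sum_nonneg h2)) i hi
  rw [pairing_eq_zero_comm]
  exact (mul_eq_zero.1 h3).resolve_left (by exact_mod_cast hn)

/-- For `α_k` outside the support of `θ^∨`, every term of `⟨α_k, θ^∨⟩` is nonpositive while the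
total is nonnegative, so every term vanishes. Thus the support of a maximal coroot is a union of
components of the Dynkin diagram. -/
lemma IsMaxCoroot.pairing_eq_zero_of_notMem {k i : ι} (hk : k ∈ b.support) (hi : i ∈ b.support)
    (hk0 : coeff b θ k = 0) (hi0 : coeff b θ i ≠ 0) :
    P.pairing k i = 0 := by
  have h1 : 0 ≤ P.pairing k θ := pairing_nonneg_comm.1 (hθ.pairing_simple_nonneg hk)
  rw [pairing_eq_sum_coeff hθ.isPosCoroot] at h1
  have h2 : ∀ j ∈ b.support, (coeff b θ j : ℤ) * P.pairing k j ≤ 0 := by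
    intro j hj
    by_cases hjk : k = j
    · subst hjk; simp [hk0]
    · exact mul_nonpos_of_nonneg_of_nonpos (by positivity) (pairing_nonpos_of_ne hk hj hjk)
  have h3 := (Finset.sum_eq_zero_iff_of_nonpos h2).1 (le_antisymm (Finset.sum_nonpos h2) h1) i hi
  exact (mul_eq_zero.1 h3).resolve_left (by exact_mod_cast hi0)

/-- Different maximal coroots have disjoint supports. -/
theorem IsMaxCoroot.disjoint_support {θ' : ι} (hθ' : IsMaxCoroot b θ') (h : θ ≠ θ') {i : ι}
    (hi : i ∈ b.support) (hn : coeff b θ i ≠ 0) : coeff b θ' i = 0 := by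
  classical
  by_contra hn'
  -- The part `y` of `θ^∨` carried by the common support is orthogonal to every simple root, hence
  -- zero, against linear independence. For `k` in both supports, `⟨α_k, y⟩ = ⟨α_k, θ^∨⟩`, which
  -- vanishes because `θ` and `θ'` are different maximal coroots.
  set J := b.support.filter fun j => coeff b θ j ≠ 0 ∧ coeff b θ' j ≠ 0 with hJ
  set y : Y := ∑ j ∈ J, (coeff b θ j : ℤ) • P.coroot j with hy
  have hy0 : y = 0 := by
    refine corootSpan_separating b (Submodule.sum_mem _ fun j _ => Submodule.smul_mem _ _
        (Submodule.subset_span ⟨_, rfl⟩)) fun k hk => ?_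
    have expand : P.root' k y = ∑ j ∈ J, (coeff b θ j : ℤ) * P.pairing k j := by
      simp [hy, P.root'_coroot_eq_pairing]
    rw [expand]
    by_cases hk1 : coeff b θ k = 0
    · refine Finset.sum_eq_zero fun j hj => ?_
      simp only [hJ, Finset.mem_filter] at hj
      rw [hθ.pairing_eq_zero_of_notMem hk hj.1 hk1 hj.2.1, mul_zero]
    by_cases hk2 : coeff b θ' k = 0
    · refine Finset.sum_eq_zero fun j hj => ?_
      simp only [hJ, Finset.mem_filter] at hj
      rw [hθ'.pairing_eq_zero_of_notMem hk hj.1 hk2 hj.2.2, mul_zero]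
    have h0 := hθ'.pairing_eq_zero hθ h.symm hk hk2
    rw [pairing_eq_sum_coeff hθ.isPosCoroot] at h0
    rw [← h0]
    refine Finset.sum_subset (Finset.filter_subset _ _) fun j hj hj' => ?_
    by_cases hj1 : coeff b θ j = 0
    · simp [hj1]
    · have hj2 : coeff b θ' j = 0 := by
        by_contra hj2
        exact hj' (by simp [hJ, hj, hj1, hj2])
      rw [pairing_eq_zero_comm.1 (hθ'.pairing_eq_zero_of_notMem hj hk hj2 hk2),
        mul_zero]
  have hli := linearIndepOn_iff'.1 b.linearIndepOn_coroot J (fun j => (coeff b θ j : ℤ))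
    (fun j hj => (Finset.mem_filter.1 hj).1) hy0 i (by simp [hJ, hi, hn, hn'])
  exact hn (by exact_mod_cast hli)

end MaxCoroots

end AffineHecke
end

noncomputable section
set_option linter.unusedSectionVars false
namespace AffineHecke

/-! ### Affine roots, affine reflections and positivity on the fundamental alcove. -/

section AffineRoots

variable {ι X Y : Type u} [AddCommGroup X] [AddCommGroup Y] {P : RootDatum ι X Y} {b : P.Base}

/-- `N` times the value of the affine root `a` at the point `x / N`. -/
def affEval (x : X) (N : ℤ) (a : AffineRoot P) : ℤ := P.coroot' a.1 x + N * a.2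

/-- The vector in `Y × ℤ` underlying an affine root. -/
def affVec (a : AffineRoot P) : Y × ℤ := (P.coroot a.1, a.2)

lemma affVec_injective : Function.Injective (affVec (P := P)) := by
  rintro ⟨i, k⟩ ⟨j, l⟩ h
  simp only [affVec, Prod.mk.injEq] at h
  rw [P.coroot.injective h.1, h.2]

/-- The linear form on `Y × ℤ` with values `affEval`. -/
def affForm (P : RootDatum ι X Y) (x : X) (N : ℤ) : Y × ℤ →+ ℤ :=
  AddMonoidHom.coprod (P.toLinearMap x).toAddMonoidHom (AddMonoidHom.mulLeft N)

lemma affForm_affVec (x : X) (N : ℤ) (a : AffineRoot P) : affForm P x N (affVec a) = affEval x N a :=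
  rfl

/-- The action of `W` on `X`, scaled by `N`. -/
def actPoint (g : AffineWeylGroup P) (x : X) (N : ℤ) : X := g.right • x + N • g.left.toAdd

lemma actPoint_mul (g h : AffineWeylGroup P) (x : X) (N : ℤ) :
    actPoint (g * h) x N = actPoint g (actPoint h x N) N := by
  simp only [actPoint, SemidirectProduct.mul_right, SemidirectProduct.mul_left, mul_smul, smul_add]
  rw [toAdd_mul, smul_add]
  have : (weylAction P g.right h.left).toAdd = g.right • h.left.toAdd := rfl
  rw [this, smul_comm N g.right h.left.toAdd]
  abel

@[simp] lemma actPoint_one (x : X) (N : ℤ) : actPoint (1 : AffineWeylGroup P) x N = x := by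
  simp [actPoint]

lemma affineWeyl_ext {g h : AffineWeylGroup P} (H : ∀ x, actPoint g x 1 = actPoint h x 1) :
    g = h := by
  have h0 := H 0
  simp only [actPoint, smul_zero, zero_add, one_smul] at h0
  have h0' : g.left = h.left := h0
  refine SemidirectProduct.ext h0' (weylGroup_faithful fun x => ?_)
  have := H x
  simp only [actPoint, one_smul, h0'] at this
  exact add_right_cancel this

lemma actAffineRoot_mul (g h : AffineWeylGroup P) (a : AffineRoot P) :
    actAffineRoot (g * h) a = actAffineRoot g (actAffineRoot h a) := by
  refine Prod.ext ?_ ?_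
  · simp [actAffineRoot]
  · simp only [actAffineRoot, SemidirectProduct.mul_right, SemidirectProduct.mul_left, map_mul,
      Equiv.Perm.mul_apply]
    rw [toAdd_mul, map_add]
    have : (weylAction P g.right h.left).toAdd = g.right • h.left.toAdd := rfl
    rw [this, coroot'_weyl_smul]
    ring

@[simp] lemma actAffineRoot_one (a : AffineRoot P) :
    actAffineRoot (1 : AffineWeylGroup P) a = a := by
  refine Prod.ext ?_ ?_ <;> simp [actAffineRoot]

@[simp] lemma actAffineRoot_inv_act (g : AffineWeylGroup P) (a : AffineRoot P) :
    actAffineRoot g⁻¹ (actAffineRoot g a) = a := by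
  rw [← actAffineRoot_mul, inv_mul_cancel, actAffineRoot_one]

@[simp] lemma actAffineRoot_act_inv (g : AffineWeylGroup P) (a : AffineRoot P) :
    actAffineRoot g (actAffineRoot g⁻¹ a) = a := by
  rw [← actAffineRoot_mul, mul_inv_cancel, actAffineRoot_one]

lemma actAffineRoot_injective (g : AffineWeylGroup P) : Function.Injective (actAffineRoot g) :=
  Function.LeftInverse.injective (actAffineRoot_inv_act g)

lemma affEval_act (g : AffineWeylGroup P) (x : X) (N : ℤ) (a : AffineRoot P) :
    affEval (actPoint g x N) N (actAffineRoot g a) = affEval x N a := by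
  simp only [affEval, actPoint, actAffineRoot, map_add, coroot'_weyl_smul, map_smul, smul_eq_mul]
  ring

lemma affEval_act' (g : AffineWeylGroup P) (x : X) (N : ℤ) (a : AffineRoot P) :
    affEval x N (actAffineRoot g a) = affEval (actPoint g⁻¹ x N) N a := by
  rw [← affEval_act g (actPoint g⁻¹ x N), ← actPoint_mul, mul_inv_cancel, actPoint_one]

/-- The affine root `-a`. -/
def affNeg (a : AffineRoot P) : AffineRoot P := (P.reflectionPerm a.1 a.1, -a.2)

lemma affVec_neg (a : AffineRoot P) : affVec (affNeg a) = - affVec a := by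
  simp [affVec, affNeg]

lemma affEval_neg (x : X) (N : ℤ) (a : AffineRoot P) : affEval x N (affNeg a) = - affEval x N a := by
  rw [← affForm_affVec, affVec_neg, map_neg, affForm_affVec]

lemma affNeg_neg (a : AffineRoot P) : affNeg (affNeg a) = a := by
  apply affVec_injective; rw [affVec_neg, affVec_neg, neg_neg]

lemma affVec_eq_of_affEval {a c : AffineRoot P} (h : ∀ x N, affEval x N a = affEval x N c) :
    a = c := by
  have h0 := h 0 1
  simp only [affEval, map_zero, zero_add, one_mul] at h0
  have h1 : P.coroot a.1 = P.coroot c.1 := by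
    have : P.flip.toLinearMap (P.coroot a.1) = P.flip.toLinearMap (P.coroot c.1) := by
      ext x
      have := h x 0
      simpa [affEval] using this
    exact P.flip.toPerfPair.injective this
  exact Prod.ext (P.coroot.injective h1) h0

lemma actAffineRoot_neg (g : AffineWeylGroup P) (a : AffineRoot P) :
    actAffineRoot g (affNeg a) = affNeg (actAffineRoot g a) := by
  apply affVec_eq_of_affEval
  intro x N
  rw [affEval_act', affEval_neg, affEval_neg, affEval_act']

/-- The reflection in the hyperplane where the affine root `a` vanishes. -/
def affReflection (a : AffineRoot P) : AffineWeylGroup P :=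
  translation P (-a.2 • P.root a.1) * reflection P a.1

lemma actPoint_affReflection (a : AffineRoot P) (x : X) (N : ℤ) :
    actPoint (affReflection a) x N = x - affEval x N a • P.root a.1 := by
  rw [affReflection, actPoint_mul]
  simp only [actPoint, reflection, translation, SemidirectProduct.right_inr,
    SemidirectProduct.left_inr, SemidirectProduct.right_inl, SemidirectProduct.left_inl, one_smul,
    toAdd_one, toAdd_ofAdd, smul_zero, add_zero, ofIdx_smul, affEval, add_smul, mul_smul, neg_smul,
    smul_neg]
  abel

lemma affReflection_mul_self (a : AffineRoot P) : affReflection a * affReflection a = 1 := by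
  apply affineWeyl_ext
  intro x
  rw [actPoint_mul, actPoint_affReflection, actPoint_affReflection, actPoint_one]
  have : affEval (x - affEval x 1 a • P.root a.1) 1 a = - affEval x 1 a := by
    simp only [affEval, map_sub, map_smul, P.root_coroot'_eq_pairing, P.pairing_same, smul_eq_mul]
    ring
  rw [this]
  simp

lemma affReflection_inv (a : AffineRoot P) : (affReflection a)⁻¹ = affReflection a :=
  inv_eq_of_mul_eq_one_left (affReflection_mul_self a)

lemma affEval_affReflection (a c : AffineRoot P) (x : X) (N : ℤ) :
    affEval x N (actAffineRoot (affReflection a) c) =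
      affEval x N c - P.pairing a.1 c.1 * affEval x N a := by
  rw [affEval_act', affReflection_inv, actPoint_affReflection]
  simp only [affEval, map_sub, map_smul, P.root_coroot'_eq_pairing, smul_eq_mul]
  ring

lemma affReflection_act (a c : AffineRoot P) :
    actAffineRoot (affReflection a) c =
      (P.reflectionPerm a.1 c.1, c.2 - P.pairing a.1 c.1 * a.2) := by
  apply affVec_eq_of_affEval
  intro x N
  rw [affEval_affReflection]
  have : P.coroot' (P.reflectionPerm a.1 c.1) x
      = P.coroot' c.1 x - P.pairing a.1 c.1 * P.coroot' a.1 x := by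
    change P.toLinearMap x (P.coroot _) = _
    rw [P.coroot_reflectionPerm, P.coreflection_apply_coroot, map_sub, map_smul]
    rfl
  simp only [affEval, this]
  ring

lemma affReflection_act_self (a : AffineRoot P) :
    actAffineRoot (affReflection a) a = affNeg a := by
  rw [affReflection_act, affNeg, P.pairing_same]
  simp only [Prod.mk.injEq, true_and]
  ring

lemma affReflection_conj (g : AffineWeylGroup P) (a : AffineRoot P) :
    affReflection (actAffineRoot g a) = g * affReflection a * g⁻¹ := by
  apply affineWeyl_ext
  intro x
  rw [actPoint_mul, actPoint_mul, actPoint_affReflection, actPoint_affReflection, affEval_act']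
  have : actPoint g (actPoint g⁻¹ x 1) 1 = x := by
    rw [← actPoint_mul, mul_inv_cancel, actPoint_one]
  generalize actPoint g⁻¹ x 1 = y at this ⊢
  rw [← this]
  simp only [actPoint, smul_sub, actAffineRoot]
  rw [← RootPairing.weylGroup_apply_root, smul_comm (affEval _ _ _) g.right]
  abel

lemma affReflection_neg (a : AffineRoot P) : affReflection (affNeg a) = affReflection a := by
  rw [← affReflection_act_self, affReflection_conj]
  simp

variable (b) in
/-- The simple affine roots. -/
def IsSimpleAffine (a : AffineRoot P) : Prop :=
  (a.1 ∈ b.support ∧ a.2 = 0) ∨ ∃ θ, IsMaxCoroot b θ ∧ a = affNeg (θ, -1)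

lemma simpleAffineReflections_eq :
    simpleAffineReflections b = affReflection '' {a | IsSimpleAffine b a} := by
  ext g
  simp only [simpleAffineReflections, Set.mem_ofPred_eq, Set.mem_image]
  have h0 : ∀ i : ι, affReflection ((i, 0) : AffineRoot P) = reflection P i := by
    intro i
    simp [affReflection, translation]
  have h1 : ∀ i : ι, affReflection (affNeg ((i, -1) : AffineRoot P)) =
      translation P (P.root i) * reflection P i := by
    intro i
    rw [affReflection_neg]
    simp [affReflection]
  constructor
  · rintro (⟨i, hi, rfl⟩ | ⟨i, hi, rfl⟩)
    · exact ⟨(i, 0), Or.inl ⟨hi, rfl⟩, h0 i⟩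
    · exact ⟨_, Or.inr ⟨i, hi, rfl⟩, h1 i⟩
  · rintro ⟨⟨i, k⟩, ⟨hi, rfl⟩ | ⟨θ, hθ, h⟩, rfl⟩
    · exact Or.inl ⟨i, hi, h0 i⟩
    · exact Or.inr ⟨θ, hθ, by rw [h, h1]⟩

lemma finite_isSimpleAffine [Finite ι] : {a | IsSimpleAffine b a}.Finite := by
  refine Set.Finite.subset (((Set.finite_univ (α := ι)).prod (Set.finite_Icc (0 : ℤ) 1))) ?_
  rintro ⟨i, k⟩ (⟨-, h⟩ | ⟨θ, -, h⟩)
  · simp only at h; simp [h]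
  · simp only [affNeg, Prod.mk.injEq] at h; simp [h]

/-- A functional form of positivity, by means of a point inside the fundamental alcove. -/
structure IsAlcovePoint (b : P.Base) (x : X) (N : ℤ) : Prop where
  pos : 0 < N
  simple_pos : ∀ i ∈ b.support, 0 < P.coroot' i x
  lt : ∀ i, P.coroot' i x < N

variable [Finite ι] {x₀ : X} {N₀ : ℤ}

lemma exists_isAlcovePoint (b : P.Base) : ∃ x N, IsAlcovePoint b x N := by
  obtain ⟨x, N, h1, h2, h3⟩ := exists_alcove_point b
  exact ⟨x, N, h1, h2, h3⟩

lemma IsAlcovePoint.isPosCoroot_iff (h : IsAlcovePoint b x₀ N₀) (i : ι) :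
    IsPosCoroot b i ↔ 0 < P.coroot' i x₀ := by
  constructor
  · intro hi
    exact (posCone_pos h.simple_pos hi).resolve_left (P.flip.ne_zero i)
  · intro hi
    refine (b.coroot_mem_or_neg_mem i).resolve_right fun h' => ?_
    rcases posCone_pos h.simple_pos h' with h' | h'
    · exact P.flip.ne_zero i (neg_eq_zero.1 h')
    · rw [map_neg] at h'
      change 0 < - P.coroot' i x₀ at h'
      linarith

lemma IsAlcovePoint.neg_lt (h : IsAlcovePoint b x₀ N₀) (i : ι) : -N₀ < P.coroot' i x₀ := by
  have := h.lt (P.reflectionPerm i i)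
  change P.toLinearMap x₀ (P.coroot _) < _ at this
  rw [neg_reflectionPerm_self, map_neg] at this
  change - P.coroot' i x₀ < _ at this
  linarith

lemma IsAlcovePoint.coroot_ne_zero (h : IsAlcovePoint b x₀ N₀) (i : ι) : P.coroot' i x₀ ≠ 0 := by
  intro h0
  rcases b.coroot_mem_or_neg_mem i with h' | h'
  · have := (h.isPosCoroot_iff i).1 h'
    omega
  · rcases posCone_pos h.simple_pos h' with h' | h'
    · exact P.flip.ne_zero i (neg_eq_zero.1 h')
    · rw [map_neg] at h'
      change 0 < - P.coroot' i x₀ at h'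
      omega

/-- The coroots take values strictly between `-N₀` and `N₀` at the point, so the level decides the
sign unless it is zero. Positivity becomes the sign of a single linear form, and the action of `W`
on roots can be transferred to the point. -/
lemma IsAlcovePoint.isPos_iff (h : IsAlcovePoint b x₀ N₀) (a : AffineRoot P) :
    IsPosAffineRoot b a ↔ 0 < affEval x₀ N₀ a := by
  have h1 := h.lt a.1
  have h2 := h.neg_lt a.1
  have h3 := h.pos
  simp only [IsPosAffineRoot, h.isPosCoroot_iff, affEval]
  rcases lt_trichotomy a.2 0 with hk | hk | hk
  · have : N₀ * a.2 ≤ - N₀ := by nlinarith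
    constructor
    · rintro (h | h) <;> omega
    · intro h; omega
  · simp [hk]
  · have : N₀ ≤ N₀ * a.2 := by nlinarith
    constructor
    · intro _; omega
    · intro h; exact Or.inl hk

lemma IsAlcovePoint.eval_ne_zero (h : IsAlcovePoint b x₀ N₀) (a : AffineRoot P) :
    affEval x₀ N₀ a ≠ 0 := by
  have h1 := h.lt a.1
  have h2 := h.neg_lt a.1
  have h3 := h.pos
  have h4 := h.coroot_ne_zero a.1
  simp only [affEval]
  rcases lt_trichotomy a.2 0 with hk | hk | hk
  · have : N₀ * a.2 ≤ - N₀ := by nlinarith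
    omega
  · simpa [hk] using h4
  · have : N₀ ≤ N₀ * a.2 := by nlinarith
    omega

lemma isPos_neg_iff (a : AffineRoot P) : IsPosAffineRoot b (affNeg a) ↔ ¬ IsPosAffineRoot b a := by
  obtain ⟨x, N, h⟩ := exists_isAlcovePoint b
  have := h.eval_ne_zero a
  rw [h.isPos_iff, h.isPos_iff, affEval_neg]
  omega

lemma IsSimpleAffine.isPos {a : AffineRoot P} (ha : IsSimpleAffine b a) : IsPosAffineRoot b a := by
  rcases ha with ⟨h1, h2⟩ | ⟨θ, hθ, rfl⟩
  · exact Or.inr ⟨h2, isPosCoroot_of_mem_support h1⟩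
  · left; simp [affNeg]

variable (b) in
/-- Nonnegative combinations of simple affine roots. -/
abbrev affCone : AddSubmonoid (Y × ℤ) := AddSubmonoid.closure (affVec '' {a | IsSimpleAffine b a})

lemma posCone_affCone {y : Y} (hy : y ∈ posCone b) : (y, (0 : ℤ)) ∈ affCone b := by
  induction hy using AddSubmonoid.closure_induction with
  | mem z hz =>
    obtain ⟨i, hi, rfl⟩ := hz
    exact AddSubmonoid.subset_closure ⟨(i, 0), Or.inl ⟨hi, rfl⟩, rfl⟩
  | zero => exact zero_mem _
  | add y z _ _ h1 h2 => simpa using add_mem h1 h2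

/-- For `k > 0` and a maximal `θ^∨` above `-α^∨`, write `α^∨ + k = (1 - θ^∨) + (θ^∨ + α^∨) + (k -
1)·1`, where `1 = (1 - θ^∨) + θ^∨` is also in the cone. -/
lemma isPos_mem_affCone {a : AffineRoot P} (ha : IsPosAffineRoot b a) : affVec a ∈ affCone b := by
  obtain ⟨i, k⟩ := a
  rcases ha with hk | ⟨hk, hi⟩
  · obtain ⟨θ, hθ, hle⟩ := exists_isMaxCoroot_ge (b := b) (P.reflectionPerm i i)
    rw [neg_reflectionPerm_self, sub_neg_eq_add] at hle
    have h1 : ((-P.coroot θ, 1) : Y × ℤ) ∈ affCone b :=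
      AddSubmonoid.subset_closure ⟨affNeg (θ, -1), Or.inr ⟨θ, hθ, rfl⟩, by
        rw [affVec_neg]; simp [affVec]⟩
    have h2 : ((0, 1) : Y × ℤ) ∈ affCone b := by
      have := add_mem h1 (posCone_affCone hθ.isPosCoroot)
      simpa using this
    obtain ⟨n, rfl⟩ : ∃ n : ℕ, k = n + 1 := ⟨(k - 1).toNat, by simp only at hk; omega⟩
    have := add_mem (add_mem h1 (posCone_affCone hle)) (nsmul_mem h2 n)
    have h3 : affVec (P := P) (i, (n : ℤ) + 1) =
        (-P.coroot θ, 1) + (P.coroot θ + P.coroot i, 0) + n • (0, 1) := by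
      simp [affVec, add_comm]
    rw [h3]; exact this
  · simp only at hk
    subst hk
    exact posCone_affCone hi

/-- If a linear form is nonnegative on simple affine roots and vanishes at a positive affine root,
then the latter is a combination of the simple affine roots where it vanishes. -/
lemma isPos_form_nonneg (φ : Y × ℤ →+ ℤ) (hφ : ∀ a : AffineRoot P, IsSimpleAffine b a → 0 ≤ φ (affVec a))
    {a : AffineRoot P} (ha : IsPosAffineRoot b a) : 0 ≤ φ (affVec a) ∧ (φ (affVec a) = 0 →
      affVec a ∈ AddSubmonoid.closure (affVec '' {a | IsSimpleAffine b a ∧ φ (affVec a) = 0})) := by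
  have := isPos_mem_affCone ha
  generalize affVec a = v at this ⊢
  induction this using AddSubmonoid.closure_induction with
  | mem z hz =>
    obtain ⟨c, hc, rfl⟩ := hz
    exact ⟨hφ c hc, fun h => AddSubmonoid.subset_closure ⟨c, ⟨hc, h⟩, rfl⟩⟩
  | zero => simp
  | add y z _ _ h1 h2 =>
    rw [map_add]
    refine ⟨add_nonneg h1.1 h2.1, fun h => add_mem (h1.2 ?_) (h2.2 ?_)⟩ <;> linarith [h1.1, h2.1]

/-- A simple affine reflection makes only one positive affine root negative. -/
theorem IsSimpleAffine.isPos_act [P.IsReduced] {a c : AffineRoot P} (ha : IsSimpleAffine b a)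
    (hc : IsPosAffineRoot b c) (hac : c ≠ a) :
    IsPosAffineRoot b (actAffineRoot (affReflection a) c) := by
  obtain ⟨i, k⟩ := c
  rcases ha with ⟨h1, h2⟩ | ⟨θ, hθ, rfl⟩
  · rw [affReflection_act, h2]
    rcases hc with hk | ⟨hk, hi⟩
    · left; simpa using hk
    · right
      simp only at hk
      refine ⟨by simp [hk], ?_⟩
      -- At level zero this is the statement for finite root systems, applied to the dual one.
      rw [isPosCoroot_iff] at hi ⊢
      have : Module.IsReflexive ℤ X := .of_isPerfPair P.toLinearMap
      have : Module.IsTorsionFree ℤ X := .trans_faithfulSMul ℤ ℤ X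
      have : Module.IsReflexive ℤ Y := .of_isPerfPair P.flip.toLinearMap
      have : Module.IsTorsionFree ℤ Y := .trans_faithfulSMul ℤ ℤ Y
      have : P.flip.IsReduced := inferInstance
      refine hi.reflectionPerm (b := b.flip) h1 ?_
      rintro rfl
      exact hac (Prod.ext rfl (by rw [h2, hk]))
  · rw [affReflection_neg, affReflection_act]
    simp only [IsPosAffineRoot]
    -- The level changes from `k` to `k + ⟨θ, α^∨⟩`. If `α^∨ = -θ^∨`, it drops by 2 and the coroot
    -- becomes `θ^∨`; here `k = 1` is the excluded root. Otherwise it drops by at most 1, and when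
    -- it drops from 1 to 0 the new coroot `θ^∨ + α^∨` is positive.
    by_cases hi : P.coroot i = - P.coroot θ
    · have hi2 : P.reflectionPerm θ i = θ := by
        apply P.coroot.injective
        rw [P.coroot_reflectionPerm, hi, map_neg, P.coreflection_apply_self, neg_neg]
      have hpair : P.pairing θ i = -2 := by
        rw [← P.root'_coroot_eq_pairing, hi, map_neg, P.root'_coroot_eq_pairing, P.pairing_same]
      have hk : 0 < k := by
        rcases hc with hk | ⟨hk, hi'⟩
        · exact hk
        · exfalso
          rw [IsPosCoroot, hi] at hi'
          exact P.flip.ne_zero θ (eq_zero_of_mem_posCone_of_neg_mem hθ.isPosCoroot hi')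
      have hk1 : k ≠ 1 := by
        rintro rfl
        apply hac
        apply affVec_injective
        rw [affVec_neg]; simp [affVec, hi]
      rw [hi2, hpair]
      rcases eq_or_ne k 2 with rfl | hk2
      · exact Or.inr ⟨by norm_num, hθ.isPosCoroot⟩
      · left; omega
    · have hge := hθ.pairing_ge hi
      rcases hc with hk | ⟨hk, hi'⟩
      · simp only at hk
        by_cases h0 : k = 1 ∧ P.pairing θ i = -1
        · right
          refine ⟨by rw [h0.1, h0.2]; norm_num, ?_⟩
          obtain ⟨l, hl, hl2⟩ := hθ.add_isPos (by rw [h0.2]; norm_num) hi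
          rw [IsPosCoroot, P.coroot_reflectionPerm, P.coreflection_apply_coroot, h0.2]
          rw [IsPosCoroot, hl] at hl2
          simpa [add_comm] using hl2
        · left; omega
      · simp only at hk hi'
        have h0 := hθ.pairing_nonneg hi'
        rcases h0.lt_or_eq with h0 | h0
        · left; omega
        · right
          refine ⟨by rw [← h0, hk]; norm_num, ?_⟩
          rw [IsPosCoroot, P.coroot_reflectionPerm, P.coreflection_apply_coroot, ← h0]
          simpa using! hi'

end AffineRoots

end AffineHecke
end

noncomputable section
set_option linter.unusedSectionVars false
namespace AffineHecke

/-! ### The length function and the exchange property. -/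

section Length

variable {ι X Y : Type u} [AddCommGroup X] [AddCommGroup Y] {P : RootDatum ι X Y} {b : P.Base}

variable (b) in
/-- The set of positive affine roots made negative by `g`. -/
def inversions (g : AffineWeylGroup P) : Set (AffineRoot P) :=
  {a | IsPosAffineRoot b a ∧ ¬ IsPosAffineRoot b (actAffineRoot g a)}

lemma length_eq (g : AffineWeylGroup P) : length b g = (inversions b g).ncard := rfl

@[simp] lemma length_one : length b 1 = 0 := by
  rw [length_eq]
  convert Set.ncard_empty (AffineRoot P)
  ext a
  simp [inversions]

variable [Finite ι]

lemma finite_inversions (g : AffineWeylGroup P) : (inversions b g).Finite := by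
  have := Fintype.ofFinite ι
  set C : ℤ := ∑ i, |P.coroot' i g.left.toAdd| with hC
  refine Set.Finite.subset (((Set.finite_univ (α := ι)).prod (Set.finite_Icc (0 : ℤ) C))) ?_
  rintro ⟨i, k⟩ ⟨h1, h2⟩
  simp only [Set.mem_prod, Set.mem_univ, true_and, Set.mem_Icc]
  constructor
  · rcases h1 with h | ⟨h, -⟩
    · exact le_of_lt h
    · exact h.ge
  · by_contra! h
    apply h2
    left
    have h3 := Finset.single_le_sum (f := fun i => |P.coroot' i g.left.toAdd|)
      (fun i _ => abs_nonneg _) (Finset.mem_univ (P.weylGroupToPerm g.right i))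
    have h4 := le_abs_self (P.coroot' (P.weylGroupToPerm g.right i) g.left.toAdd)
    simp only [actAffineRoot]
    linarith

/-- The map `a ↦ -g a` carries the inversions of `g` to those of `g⁻¹`. -/
lemma length_inv (g : AffineWeylGroup P) : length b g⁻¹ = length b g := by
  rw [length_eq, length_eq]
  symm
  refine Set.ncard_congr (fun a _ => affNeg (actAffineRoot g a)) ?_ ?_ ?_
  · rintro a ⟨h1, h2⟩
    refine ⟨(isPos_neg_iff _).2 h2, ?_⟩
    rw [actAffineRoot_neg, actAffineRoot_inv_act, isPos_neg_iff]
    exact not_not.2 h1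
  · intro a c _ _ h
    exact actAffineRoot_injective g (by rw [← affNeg_neg (actAffineRoot g a), h, affNeg_neg])
  · rintro a ⟨h1, h2⟩
    refine ⟨affNeg (actAffineRoot g⁻¹ a), ⟨(isPos_neg_iff _).2 h2, ?_⟩, ?_⟩
    · rw [actAffineRoot_neg, actAffineRoot_act_inv, isPos_neg_iff]
      exact not_not.2 h1
    · rw [actAffineRoot_neg, actAffineRoot_act_inv, affNeg_neg]

lemma length_mul_le (g h : AffineWeylGroup P) : length b (g * h) ≤ length b g + length b h := by
  have hfin := finite_inversions (b := b) g
  have h1 : inversions b (g * h) ⊆ actAffineRoot h⁻¹ '' (inversions b g) ∪ inversions b h := by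
    rintro a ⟨h1, h2⟩
    by_cases h3 : IsPosAffineRoot b (actAffineRoot h a)
    · left
      refine ⟨actAffineRoot h a, ⟨h3, by rwa [← actAffineRoot_mul]⟩, actAffineRoot_inv_act _ _⟩
    · exact Or.inr ⟨h1, h3⟩
  calc _ ≤ _ := Set.ncard_le_ncard h1 ((hfin.image _).union (finite_inversions h))
    _ ≤ _ := Set.ncard_union_le _ _
    _ = _ := by rw [Set.ncard_image_of_injective _ (actAffineRoot_injective _)]; rfl

/-- The inversions of `g h` always lie in the disjoint union of those of `h` and the
`h⁻¹`-translates of those of `g`; the hypothesis turns this into an equality. -/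
lemma length_mul_of_subset {g h : AffineWeylGroup P} (H : inversions b h ⊆ inversions b (g * h)) :
    length b (g * h) = length b g + length b h := by
  have hfin := finite_inversions (b := b) g
  have h1 : inversions b (g * h) = actAffineRoot h⁻¹ '' (inversions b g) ∪ inversions b h := by
    apply subset_antisymm
    · rintro a ⟨h1, h2⟩
      by_cases h3 : IsPosAffineRoot b (actAffineRoot h a)
      · left
        refine ⟨actAffineRoot h a, ⟨h3, by rwa [← actAffineRoot_mul]⟩, actAffineRoot_inv_act _ _⟩
      · exact Or.inr ⟨h1, h3⟩
    · refine Set.union_subset ?_ H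
      rintro _ ⟨a, ⟨h1, h2⟩, rfl⟩
      refine ⟨?_, by rwa [actAffineRoot_mul, actAffineRoot_act_inv]⟩
      -- If `h⁻¹ a` were negative, its opposite would be an inversion of `h`, hence of `g h`; but `g
      -- h` sends it to `-g a`, which is positive.
      by_contra h3
      have h4 : affNeg (actAffineRoot h⁻¹ a) ∈ inversions b h := by
        refine ⟨(isPos_neg_iff _).2 h3, ?_⟩
        rw [actAffineRoot_neg, actAffineRoot_act_inv, isPos_neg_iff]
        exact not_not.2 h1
      have h5 := (H h4).2
      rw [actAffineRoot_neg, actAffineRoot_mul, actAffineRoot_act_inv, isPos_neg_iff] at h5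
      exact h5 h2
  rw [length_eq, h1, Set.ncard_union_eq _ (hfin.image _) (finite_inversions h),
    Set.ncard_image_of_injective _ (actAffineRoot_injective _)]
  · rfl
  · rw [Set.disjoint_left]
    rintro _ ⟨a, ⟨h1, h2⟩, rfl⟩ ⟨h3, h4⟩
    rw [actAffineRoot_act_inv] at h4
    exact h4 h1

lemma isPos_act_of_length_eq_zero {g : AffineWeylGroup P} (hg : length b g = 0)
    {a : AffineRoot P} : IsPosAffineRoot b (actAffineRoot g a) ↔ IsPosAffineRoot b a := by
  have key : ∀ g : AffineWeylGroup P, length b g = 0 → ∀ a, IsPosAffineRoot b a →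
      IsPosAffineRoot b (actAffineRoot g a) := by
    intro g hg a ha
    by_contra h
    rw [length_eq, Set.ncard_eq_zero (finite_inversions g)] at hg
    exact (hg ▸ (⟨ha, h⟩ : a ∈ inversions b g) : a ∈ (∅ : Set (AffineRoot P)))
  refine ⟨fun h => ?_, key g hg a⟩
  have := key g⁻¹ (by rwa [length_inv]) _ h
  rwa [actAffineRoot_inv_act] at this

lemma length_mul_left_of_eq_zero {g : AffineWeylGroup P} (hg : length b g = 0)
    (h : AffineWeylGroup P) : length b (g * h) = length b h := by
  rw [length_mul_of_subset, hg, zero_add]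
  rintro a ⟨h1, h2⟩
  exact ⟨h1, by rwa [actAffineRoot_mul, isPos_act_of_length_eq_zero hg]⟩

lemma length_mul_right_of_eq_zero {h : AffineWeylGroup P} (hh : length b h = 0)
    (g : AffineWeylGroup P) : length b (g * h) = length b g := by
  rw [← length_inv, mul_inv_rev, length_mul_left_of_eq_zero (by rwa [length_inv]), length_inv]

variable (b) in
/-- The nodes of the affine Dynkin diagram, as simple affine roots. -/
abbrev Node : Type u := {a : AffineRoot P // IsSimpleAffine b a}

instance : Finite (Node b) := finite_isSimpleAffine.to_subtype

/-- The simple affine reflection attached to a node. -/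
def simpleRefl (a : Node b) : AffineWeylGroup P := affReflection a.1

lemma simpleAffineReflections_eq_range : simpleAffineReflections b = Set.range (simpleRefl (b := b)) := by
  rw [simpleAffineReflections_eq]
  ext g
  simp [simpleRefl]

@[simp] lemma simpleRefl_mul_self (a : Node b) : simpleRefl a * simpleRefl a = 1 :=
  affReflection_mul_self _

@[simp] lemma simpleRefl_inv (a : Node b) : (simpleRefl a)⁻¹ = simpleRefl a := affReflection_inv _

@[simp] lemma simpleRefl_mul_cancel_left (a : Node b) (g : AffineWeylGroup P) :
    simpleRefl a * (simpleRefl a * g) = g := by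
  rw [← mul_assoc, simpleRefl_mul_self, one_mul]

@[simp] lemma simpleRefl_mul_cancel_right (a : Node b) (g : AffineWeylGroup P) :
    g * simpleRefl a * simpleRefl a = g := by
  rw [mul_assoc, simpleRefl_mul_self, mul_one]

variable [P.IsReduced]

lemma inversions_simpleRefl (a : Node b) : inversions b (simpleRefl a) = {a.1} := by
  ext c
  simp only [inversions, Set.mem_ofPred_eq, Set.mem_singleton_iff]
  constructor
  · rintro ⟨h1, h2⟩
    by_contra h
    exact h2 (a.2.isPos_act h1 h)
  · rintro rfl
    refine ⟨a.2.isPos, ?_⟩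
    rw [simpleRefl, affReflection_act_self, isPos_neg_iff]
    exact not_not.2 a.2.isPos

lemma length_simpleRefl (a : Node b) : length b (simpleRefl a) = 1 := by
  rw [length_eq, inversions_simpleRefl, Set.ncard_singleton]

lemma length_mul_simpleRefl_of_pos {g : AffineWeylGroup P} {a : Node b}
    (h : IsPosAffineRoot b (actAffineRoot g a.1)) :
    length b (g * simpleRefl a) = length b g + 1 := by
  rw [length_mul_of_subset, length_simpleRefl]
  rw [inversions_simpleRefl]
  rintro _ rfl
  refine ⟨a.2.isPos, ?_⟩
  rw [actAffineRoot_mul, simpleRefl, affReflection_act_self, actAffineRoot_neg, isPos_neg_iff]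
  exact not_not.2 h

lemma length_mul_simpleRefl_of_not_pos {g : AffineWeylGroup P} {a : Node b}
    (h : ¬ IsPosAffineRoot b (actAffineRoot g a.1)) :
    length b (g * simpleRefl a) + 1 = length b g := by
  rw [← length_mul_simpleRefl_of_pos, simpleRefl_mul_cancel_right]
  rw [actAffineRoot_mul, simpleRefl, affReflection_act_self, actAffineRoot_neg, isPos_neg_iff]
  exact h

lemma isPos_act_iff {g : AffineWeylGroup P} {a : Node b} :
    IsPosAffineRoot b (actAffineRoot g a.1) ↔ length b g < length b (g * simpleRefl a) := by
  by_cases h : IsPosAffineRoot b (actAffineRoot g a.1)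
  · simp [h, length_mul_simpleRefl_of_pos h]
  · have := length_mul_simpleRefl_of_not_pos h
    simp only [h, false_iff]; omega

lemma length_mul_simpleRefl (g : AffineWeylGroup P) (a : Node b) :
    length b (g * simpleRefl a) = length b g + 1 ∨ length b (g * simpleRefl a) + 1 = length b g := by
  by_cases h : IsPosAffineRoot b (actAffineRoot g a.1)
  · exact Or.inl (length_mul_simpleRefl_of_pos h)
  · exact Or.inr (length_mul_simpleRefl_of_not_pos h)

lemma length_simpleRefl_mul_eq (g : AffineWeylGroup P) (a : Node b) :
    length b (simpleRefl a * g) = length b (g⁻¹ * simpleRefl a) := by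
  rw [← length_inv, mul_inv_rev, simpleRefl_inv]

lemma length_simpleRefl_mul (g : AffineWeylGroup P) (a : Node b) :
    length b (simpleRefl a * g) = length b g + 1 ∨ length b (simpleRefl a * g) + 1 = length b g := by
  rw [length_simpleRefl_mul_eq, ← length_inv (b := b) g]
  exact length_mul_simpleRefl _ _

/-- The exchange property. -/
theorem simpleRefl_exchange {g : AffineWeylGroup P} {a c : Node b}
    (h1 : length b g < length b (simpleRefl a * g))
    (h3 : length b (simpleRefl a * (g * simpleRefl c)) < length b (g * simpleRefl c)) :
    simpleRefl a * g = g * simpleRefl c := by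
  rw [length_simpleRefl_mul_eq, ← length_inv (b := b) g, ← isPos_act_iff] at h1
  have h4 : ¬ IsPosAffineRoot b (actAffineRoot (g * simpleRefl c)⁻¹ a.1) := by
    rw [isPos_act_iff, ← length_simpleRefl_mul_eq, length_inv]; omega
  rw [mul_inv_rev, simpleRefl_inv, actAffineRoot_mul] at h4
  -- The root `g⁻¹ a` is positive and `s_c` makes it negative, which happens to the root `c` only.
  have h5 : actAffineRoot g⁻¹ a.1 = c.1 := by
    by_contra h
    exact h4 (c.2.isPos_act h1 h)
  have h6 := affReflection_conj g⁻¹ a.1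
  rw [h5, inv_inv] at h6
  simp only [simpleRefl]
  rw [h6]; group

/-- If no simple reflection on the right shortens `g`, then `g` keeps the simple affine roots
positive, hence also all positive affine roots, which are nonnegative combinations of them. -/
lemma exists_length_mul_lt {g : AffineWeylGroup P} (hg : length b g ≠ 0) :
    ∃ a : Node b, length b (g * simpleRefl a) < length b g := by
  by_contra! h
  apply hg
  rw [length_eq, Set.ncard_eq_zero (finite_inversions g), Set.eq_empty_iff_forall_notMem]
  rintro c ⟨h1, h2⟩
  apply h2
  obtain ⟨x, N, hx⟩ := exists_isAlcovePoint b
  rw [hx.isPos_iff, affEval_act', ← affForm_affVec]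
  refine lt_of_le_of_ne (isPos_form_nonneg _ (fun a ha => ?_) h1).1 ?_
  · rw [affForm_affVec, ← affEval_act']
    refine le_of_lt ((hx.isPos_iff _).1 ?_)
    rw [isPos_act_iff (a := ⟨a, ha⟩)]
    have := h ⟨a, ha⟩
    have := length_mul_simpleRefl g ⟨a, ha⟩
    omega
  · rw [affForm_affVec, ← affEval_act']
    exact (hx.eval_ne_zero _).symm

lemma exists_length_simpleRefl_mul_lt {g : AffineWeylGroup P} (hg : length b g ≠ 0) :
    ∃ a : Node b, length b (simpleRefl a * g) < length b g := by
  obtain ⟨a, ha⟩ := exists_length_mul_lt (g := g⁻¹) (b := b) (by rwa [length_inv])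
  exact ⟨a, by rwa [length_simpleRefl_mul_eq, ← length_inv (b := b) g]⟩

end Length

end AffineHecke
end

noncomputable section
set_option linter.unusedSectionVars false
namespace AffineHecke

/-! ### Finite parabolic subgroups, descents and longest coset elements. -/

section Parabolic

variable {ι X Y : Type u} [AddCommGroup X] [AddCommGroup Y] {P : RootDatum ι X Y} {b : P.Base}

/-- `J` contains all nodes of some component of the affine Dynkin diagram. -/
def ContainsComponent (J : Set (Node b)) : Prop :=
  ∃ θ, IsMaxCoroot b θ ∧ affNeg (θ, -1) ∈ Subtype.val '' J ∧
    ∀ i ∈ b.support, coeff b θ i ≠ 0 → ((i, 0) : AffineRoot P) ∈ Subtype.val '' J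

variable (b) in
/-- The right descents of `g`. -/
def descents (g : AffineWeylGroup P) : Set (Node b) :=
  {a | length b (g * simpleRefl a) < length b g}

/-- The parabolic subgroup attached to a set of nodes. -/
def parabolic (J : Set (Node b)) : Subgroup (AffineWeylGroup P) :=
  Subgroup.closure (simpleRefl '' J)

lemma simpleRefl_mem_parabolic {J : Set (Node b)} {a : Node b} (ha : a ∈ J) :
    simpleRefl a ∈ parabolic J := Subgroup.subset_closure ⟨a, ha, rfl⟩

lemma parabolic_mono {J K : Set (Node b)} (h : J ⊆ K) : parabolic J ≤ parabolic K :=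
  Subgroup.closure_mono (Set.image_mono h)

lemma affEval_affNode (x : X) (N : ℤ) (θ : ι) :
    affEval x N (affNeg (P := P) (θ, -1)) = N - P.coroot' θ x := by
  rw [affEval_neg]; simp [affEval, sub_eq_add_neg]

variable [Finite ι]

omit [Finite ι] in
lemma weyl_smul_sub_mem (w : P.weylGroup) (x : X) : w • x - x ∈ P.rootSpan ℤ := by
  obtain ⟨w, hw⟩ := w
  revert x
  induction hw using RootPairing.weylGroup.induction with
  | mem i =>
    intro x
    have := ofIdx_smul (P := P) i x
    rw [show (⟨_, P.reflection_mem_weylGroup i⟩ : P.weylGroup) = RootPairing.weylGroup.ofIdx P i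
      from rfl, this, sub_sub_cancel_left]
    exact neg_mem (Submodule.smul_mem _ _ (Submodule.subset_span ⟨i, rfl⟩))
  | one =>
    intro x
    rw [show (⟨1, one_mem _⟩ : P.weylGroup) = 1 from rfl, one_smul, sub_self]
    exact zero_mem _
  | mul v w hv hw h1 h2 =>
    intro x
    have := add_mem (h1 ((⟨w, hw⟩ : P.weylGroup) • x)) (h2 x)
    rw [sub_add_sub_cancel, ← mul_smul] at this
    exact this

/-- If `w` fixes all coroots, then `w x - x` lies in the root span and is orthogonal to all coroots,
so it vanishes. -/
lemma weylGroupToPerm_injective (b : P.Base) : Function.Injective P.weylGroupToPerm := by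
  rw [injective_iff_map_eq_one]
  intro w hw
  refine weylGroup_faithful fun x => ?_
  rw [one_smul, ← sub_eq_zero]
  refine corootSpan_separating (P := P.flip) b.flip (weyl_smul_sub_mem w x) fun i _ => ?_
  change P.coroot' i (w • x - x) = 0
  have := coroot'_weyl_smul w i x
  rw [hw, Equiv.Perm.one_apply] at this
  rw [map_sub, this, sub_self]

lemma finite_weylGroup (b : P.Base) : Finite P.weylGroup := by
  have hf := weylGroupToPerm_injective b
  exact Finite.of_injective _ hf

/-- The point `x / N` lies on the face of the closed fundamental alcove determined by `J`. It exists
because in each component some node is outside `J`, and different components do not interact. -/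
lemma exists_special_point {J : Set (Node b)} (hJ : ¬ ContainsComponent J) :
    ∃ (x : X) (N : ℤ), 0 < N ∧ ∀ a : Node b, 0 ≤ affEval x N a.1 ∧ (affEval x N a.1 = 0 ↔ a ∈ J) := by
  classical
  have := Fintype.ofFinite ι
  set JF : ι → Prop := fun i => ((i, 0) : AffineRoot P) ∈ Subtype.val '' J with hJF
  set JA : ι → Prop := fun θ => affNeg (P := P) (θ, -1) ∈ Subtype.val '' J with hJA
  -- The simple coroots of `θ^∨` outside `J` get the value `N₁ / m' θ`, those in `J` the value 0, so
  -- `θ^∨` gets the value `m θ * (N₁ / m' θ)`. This reaches `N₁`, where the affine node vanishes,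
  -- exactly if `m' θ = m θ`, that is, if that node is in `J`.
  set m : ι → ℤ := fun θ => ∑ i ∈ b.support.filter (fun i => ¬ JF i), (coeff b θ i : ℤ) with hm
  set m' : ι → ℤ := fun θ => if JA θ then m θ else m θ + 1 with hm'
  have hm0 : ∀ θ, 0 ≤ m θ := fun θ => Finset.sum_nonneg fun i _ => by positivity
  have hmpos : ∀ θ, IsMaxCoroot b θ → 0 < m' θ := by
    intro θ hθ
    simp only [hm']
    split_ifs with h
    · refine lt_of_le_of_ne (hm0 θ) fun h0 => hJ ⟨θ, hθ, h, fun i hi hn => ?_⟩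
      by_contra hi'
      have := (Finset.sum_eq_zero_iff_of_nonneg (fun i _ => by positivity)).1 h0.symm i
        (Finset.mem_filter.2 ⟨hi, hi'⟩)
      exact hn (by exact_mod_cast this)
    · have := hm0 θ; omega
  set T := Finset.univ.filter (fun θ => IsMaxCoroot b θ) with hT
  set N₁ : ℤ := ∏ θ ∈ T, m' θ with hN₁
  have hN₁pos : 0 < N₁ := Finset.prod_pos fun θ hθ => hmpos θ (Finset.mem_filter.1 hθ).2
  have hdvd : ∀ θ, IsMaxCoroot b θ → m' θ * (N₁ / m' θ) = N₁ := fun θ hθ =>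
    Int.mul_ediv_cancel' (Finset.dvd_prod_of_mem _ (Finset.mem_filter.2 ⟨Finset.mem_univ _, hθ⟩))
  have hQ : ∀ θ, IsMaxCoroot b θ → 0 < N₁ / m' θ := by
    intro θ hθ
    have h1 := hdvd θ hθ
    by_contra! h
    have := mul_nonpos_of_nonneg_of_nonpos (hmpos θ hθ).le h
    omega
  -- Disjointness of the supports of maximal coroots makes the prescription consistent. A simple
  -- coroot in none of these supports could get any positive value.
  have hc : ∀ i, ∃ z : ℤ, i ∈ b.support → 0 ≤ z ∧ (z = 0 ↔ JF i) ∧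
      ∀ θ, IsMaxCoroot b θ → coeff b θ i ≠ 0 → ¬ JF i → z = N₁ / m' θ := by
    intro i
    by_cases hi : i ∈ b.support
    swap
    · exact ⟨0, fun h => absurd h hi⟩
    by_cases h : JF i
    · exact ⟨0, fun _ => ⟨le_rfl, by simp [h], fun _ _ _ h' => absurd h h'⟩⟩
    by_cases h2 : ∃ θ, IsMaxCoroot b θ ∧ coeff b θ i ≠ 0
    · obtain ⟨θ, hθ, hn⟩ := h2
      refine ⟨N₁ / m' θ, fun _ => ⟨(hQ θ hθ).le, by simp [h, (hQ θ hθ).ne'], ?_⟩⟩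
      intro θ' hθ' hn' _
      by_cases hne : θ = θ'
      · rw [hne]
      · exact absurd (hθ.disjoint_support hθ' hne hi hn) hn'
    · exact ⟨1, fun _ => ⟨by norm_num, by simp [h], fun θ hθ hn => absurd ⟨θ, hθ, hn⟩ h2⟩⟩
  choose c hc using hc
  obtain ⟨M, hM, hx⟩ := exists_coroot'_eq b
  obtain ⟨x, hx⟩ := hx c
  refine ⟨x, M * N₁, by positivity, ?_⟩
  rintro ⟨a, ha⟩
  rcases id ha with ⟨h1, h2⟩ | ⟨θ, hθ, rfl⟩
  · obtain ⟨i, k⟩ := a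
    simp only at h1 h2
    subst h2
    have h3 : affEval (P := P) x (M * N₁) (i, 0) = M * c i := by simp [affEval, hx i h1]
    obtain ⟨h4, h5, -⟩ := hc i h1
    rw [h3]
    refine ⟨by positivity, ?_⟩
    rw [mul_eq_zero, or_iff_right hM.ne', h5]
    simp only [hJF, Set.mem_image]
    constructor
    · rintro ⟨a, ha, h⟩
      exact (Subtype.ext h : a = ⟨(i, 0), _⟩) ▸ ha
    · intro h; exact ⟨_, h, rfl⟩
  · have h3 : P.coroot' θ x = M * (m θ * (N₁ / m' θ)) := by
      rw [coroot'_eq_sum_coeff hθ.isPosCoroot, hm, Finset.sum_mul, Finset.mul_sum,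
        Finset.sum_filter]
      refine Finset.sum_congr rfl fun i hi => ?_
      rw [hx i hi]
      obtain ⟨h4, h5, h6⟩ := hc i hi
      by_cases h : JF i
      · rw [if_neg (not_not.2 h), h5.2 h]; simp
      · rw [if_pos h]
        by_cases hn : coeff b θ i = 0
        · simp [hn]
        · rw [h6 θ hθ hn h]; ring
    rw [affEval_affNode, h3, ← mul_sub]
    have hmem : (⟨affNeg (P := P) (θ, -1), ha⟩ : Node b) ∈ J ↔ JA θ := by
      simp only [hJA, Set.mem_image]
      constructor
      · intro h; exact ⟨_, h, rfl⟩
      · rintro ⟨a, ha, h⟩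
        exact (Subtype.ext h : a = ⟨affNeg (P := P) (θ, -1), _⟩) ▸ ha
    rw [hmem]
    have h7 := hdvd θ hθ
    have h8 := hQ θ hθ
    by_cases hA : JA θ
    · have : m' θ = m θ := by simp [hm', hA]
      rw [this] at h7 ⊢
      simp [h7, hA]
    · have : m' θ = m θ + 1 := by simp [hm', hA]
      have h9 : N₁ - m θ * (N₁ / m' θ) = N₁ / m' θ := by
        rw [this] at h7 ⊢; linarith
      rw [h9]
      exact ⟨by positivity, by simp [hA, hM.ne', h8.ne']⟩

variable {x : X} {N : ℤ} {J : Set (Node b)}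

lemma actPoint_of_mem_parabolic (hx : ∀ a ∈ J, affEval x N a.1 = 0) {u : AffineWeylGroup P}
    (hu : u ∈ parabolic J) : actPoint u x N = x := by
  induction hu using Subgroup.closure_induction with
  | mem s hs =>
    obtain ⟨a, ha, rfl⟩ := hs
    rw [simpleRefl, actPoint_affReflection, hx a ha, zero_smul, sub_zero]
  | one => exact actPoint_one x N
  | mul u v _ _ h1 h2 => rw [actPoint_mul, h2, h1]
  | inv u _ h => conv_lhs => rw [← h, ← actPoint_mul, inv_mul_cancel, actPoint_one]

omit [Finite ι] in
lemma torsionFree_weights (P : RootDatum ι X Y) : Module.IsTorsionFree ℤ X := by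
  have : Module.IsReflexive ℤ X := .of_isPerfPair P.toLinearMap
  exact .trans_faithfulSMul ℤ ℤ X

/-- The parabolic subgroup fixes `x / N`, so the translation part of an element is determined by its
part in the finite Weyl group. -/
theorem finite_parabolic (hJ : ¬ ContainsComponent J) : Finite (parabolic J) := by
  obtain ⟨x, N, hN, hx⟩ := exists_special_point hJ
  have hx' : ∀ a ∈ J, affEval x N a.1 = 0 := fun a ha => (hx a).2.2 ha
  have := finite_weylGroup b
  have := torsionFree_weights P
  refine Finite.of_injective (fun u : parabolic J => u.1.right) ?_
  rintro ⟨u, hu⟩ ⟨v, hv⟩ h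
  simp only at h
  have h1 := actPoint_of_mem_parabolic hx' hu
  have h2 := actPoint_of_mem_parabolic hx' hv
  have h3 : u.right • x = v.right • x := by rw [h]
  have h4 : N • u.left.toAdd = N • v.left.toAdd := by
    rw [actPoint] at h1 h2
    rw [h3] at h1
    exact add_left_cancel (h1.trans h2.symm)
  have h5 : u.left.toAdd = v.left.toAdd := smul_right_injective X hN.ne' h4
  exact Subtype.ext (SemidirectProduct.ext h5 h)

variable [P.IsReduced]

/-- The identity `(1 - θ^∨) + Σ cᵢ αᵢ^∨ = 1` writes a positive constant as a nonnegative combination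
of the nodes of a component, so `g` cannot make all of them negative. -/
lemma not_containsComponent_descents (g : AffineWeylGroup P) : ¬ ContainsComponent (descents b g) := by
  rintro ⟨θ, hθ, h1, h2⟩
  obtain ⟨x₀, N, hx⟩ := exists_isAlcovePoint b
  have key : ∀ a : Node b, a ∈ descents b g → affEval (actPoint g⁻¹ x₀ N) N a.1 ≤ 0 := by
    intro a ha
    rw [← affEval_act']
    by_contra! h
    rw [← hx.isPos_iff, isPos_act_iff] at h
    simp only [descents, Set.mem_ofPred_eq] at ha
    omega
  set x := actPoint g⁻¹ x₀ N
  have h3 : N - P.coroot' θ x ≤ 0 := by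
    obtain ⟨a, ha, ha'⟩ := h1
    rw [← affEval_affNode, ← ha']
    exact key a ha
  have h4 : P.coroot' θ x ≤ 0 := by
    rw [coroot'_eq_sum_coeff hθ.isPosCoroot]
    refine Finset.sum_nonpos fun i hi => ?_
    by_cases hn : coeff b θ i = 0
    · simp [hn]
    · obtain ⟨a, ha, ha'⟩ := h2 i hi hn
      have := key a ha
      rw [ha'] at this
      simp only [affEval, mul_zero, add_zero] at this
      exact mul_nonpos_of_nonneg_of_nonpos (by positivity) this
  have := hx.pos
  omega

/-- The product of a word in the simple affine reflections. -/
def wordProd (l : List (Node b)) : AffineWeylGroup P := (l.map simpleRefl).prod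

lemma length_wordProd_le (l : List (Node b)) : length b (wordProd l) ≤ l.length := by
  induction l with
  | nil => simp [wordProd]
  | cons a l ih =>
    have : wordProd (a :: l) = simpleRefl a * wordProd l := by simp [wordProd]
    rw [this]
    have := length_simpleRefl_mul (wordProd l) a
    simp only [List.length_cons]
    omega

/-- If `s_a w s_c` is shorter than `s_a w` although `w s_c` is longer than `w`, the exchange
property gives `s_a w s_c = w`, and otherwise the recursion proceeds. Since no letter other than `c`
is added, an element of a parabolic subgroup has a reduced word in the letters of that subgroup. -/
lemma exists_reduced_mul (l : List (Node b)) (hl : l.length = length b (wordProd l)) (c : Node b) :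
    ∃ l' : List (Node b), wordProd l' = wordProd l * simpleRefl c ∧
      l'.length = length b (wordProd l * simpleRefl c) ∧ ∀ a ∈ l', a ∈ l ∨ a = c := by
  induction l with
  | nil => exact ⟨[c], by simp [wordProd], by simp [wordProd, length_simpleRefl], by simp⟩
  | cons a l ih =>
    have h0 : wordProd (a :: l) = simpleRefl a * wordProd l := by simp [wordProd]
    have h1 := length_wordProd_le l
    have h2 := length_simpleRefl_mul (wordProd l) a
    rw [h0] at hl ⊢
    simp only [List.length_cons] at hl
    have hl' : l.length = length b (wordProd l) := by omega
    rcases length_mul_simpleRefl (b := b) (simpleRefl a * wordProd l) c with h | h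
    · refine ⟨a :: l ++ [c], by simp [wordProd, mul_assoc], ?_, by simp [or_assoc]⟩
      rw [h, ← hl]
      simp
    · rcases length_mul_simpleRefl (b := b) (wordProd l) c with h3 | h3
      · have := simpleRefl_exchange (g := wordProd l) (a := a) (c := c) (by omega)
          (by rw [← mul_assoc]; omega)
        rw [this, simpleRefl_mul_cancel_right]
        exact ⟨l, rfl, hl', fun d hd => Or.inl (List.mem_cons_of_mem _ hd)⟩
      · obtain ⟨l', h4, h5, h6⟩ := ih hl'
        refine ⟨a :: l', by rw [mul_assoc, ← h4]; simp [wordProd], ?_, ?_⟩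
        · simp only [List.length_cons]
          omega
        · intro d hd
          rcases List.mem_cons.1 hd with rfl | hd
          · exact Or.inl List.mem_cons_self
          · exact (h6 d hd).imp_left (List.mem_cons_of_mem _)

lemma exists_reduced_word {g : AffineWeylGroup P} (hg : g ∈ parabolic J) :
    ∃ l : List (Node b), wordProd l = g ∧ l.length = length b g ∧ ∀ a ∈ l, a ∈ J := by
  rw [parabolic] at hg
  induction hg using Subgroup.closure_induction_right with
  | one => exact ⟨[], by simp [wordProd], by simp, by simp⟩
  | mul_right x hx y hy ih =>
    obtain ⟨a, ha, rfl⟩ := hy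
    obtain ⟨l, rfl, hl, hJ⟩ := ih
    obtain ⟨l', h1, h2, h3⟩ := exists_reduced_mul l hl a
    exact ⟨l', h1, h2, fun c hc => (h3 c hc).elim (hJ c) (fun h => h ▸ ha)⟩
  | mul_inv_cancel x hx y hy ih =>
    obtain ⟨a, ha, rfl⟩ := hy
    obtain ⟨l, rfl, hl, hJ⟩ := ih
    rw [simpleRefl_inv]
    obtain ⟨l', h1, h2, h3⟩ := exists_reduced_mul l hl a
    exact ⟨l', h1, h2, fun c hc => (h3 c hc).elim (hJ c) (fun h => h ▸ ha)⟩

lemma parabolic_induction {p : AffineWeylGroup P → Prop} (h1 : p 1)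
    (hs : ∀ a ∈ J, ∀ g ∈ parabolic J, length b g < length b (simpleRefl a * g) → p g →
      p (simpleRefl a * g)) {g : AffineWeylGroup P} (hg : g ∈ parabolic J) : p g := by
  obtain ⟨l, rfl, hl, hJ⟩ := exists_reduced_word hg
  clear hg
  induction l with
  | nil => simpa [wordProd] using h1
  | cons a l ih =>
    have h0 : wordProd (a :: l) = simpleRefl a * wordProd l := by simp [wordProd]
    have h2 := length_wordProd_le l
    have h3 := length_simpleRefl_mul (wordProd l) a
    rw [h0, List.length_cons] at hl
    rw [h0]
    have hlJ : ∀ c ∈ l, c ∈ J := fun c hc => hJ c (List.mem_cons_of_mem _ hc)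
    refine hs a (hJ a List.mem_cons_self) _ ?_ (by omega) (ih (by omega) hlJ)
    refine list_prod_mem fun y hy => ?_
    obtain ⟨c, hc, rfl⟩ := List.mem_map.1 hy
    exact simpleRefl_mem_parabolic (hlJ c hc)

lemma eq_one_of_mem_parabolic {g : AffineWeylGroup P} (hg : g ∈ parabolic (Set.univ : Set (Node b)))
    (h : length b g = 0) : g = 1 := by
  obtain ⟨l, rfl, hl, -⟩ := exists_reduced_word hg
  rw [h, List.length_eq_zero_iff] at hl
  simp [hl, wordProd]

/-- `g` is the unique element of maximal length in `g W_J` if `J` consists of descents of `g`. -/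
theorem length_mul_lt_of_mem_parabolic {g u : AffineWeylGroup P} (hJ : J ⊆ descents b g)
    (hu : u ∈ parabolic J) (hu1 : u ≠ 1) : length b (g * u) < length b g := by
  have hJ' : ¬ ContainsComponent J := by
    rintro ⟨θ, hθ, h1, h2⟩
    exact not_containsComponent_descents g
      ⟨θ, hθ, Set.image_mono hJ h1, fun i hi hn => Set.image_mono hJ (h2 i hi hn)⟩
  -- At a point where exactly the nodes of `J` vanish, the positive roots that vanish are
  -- combinations of nodes in `J`, so `g` makes them negative. They include all inversions of
  -- elements of `W_J`, because `W_J` preserves the values at the point.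
  obtain ⟨x, N, hN, hx⟩ := exists_special_point hJ'
  have hx' : ∀ a ∈ J, affEval x N a.1 = 0 := fun a ha => (hx a).2.2 ha
  have hnn : ∀ a : AffineRoot P, IsSimpleAffine b a → 0 ≤ affForm P x N (affVec a) :=
    fun a ha => (hx ⟨a, ha⟩).1
  obtain ⟨x₀, N₀, hx₀⟩ := exists_isAlcovePoint b
  have key : ∀ a : AffineRoot P, IsPosAffineRoot b a → affEval x N a = 0 →
      ¬ IsPosAffineRoot b (actAffineRoot g a) := by
    intro a ha h0
    have hmem := (isPos_form_nonneg _ hnn ha).2 h0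
    rw [hx₀.isPos_iff, affEval_act', not_lt, ← affForm_affVec]
    generalize affVec a = v at hmem
    induction hmem using AddSubmonoid.closure_induction with
    | mem z hz =>
      obtain ⟨c, ⟨hc1, hc2⟩, rfl⟩ := hz
      have hcJ := (hx ⟨c, hc1⟩).2.1 hc2
      rw [affForm_affVec, ← affEval_act', ← not_lt, ← hx₀.isPos_iff,
        isPos_act_iff (a := ⟨c, hc1⟩), not_lt]
      exact le_of_lt (hJ hcJ)
    | zero => simp
    | add y z _ _ h1 h2 => rw [map_add]; linarith
  have inv : ∀ v ∈ parabolic J, ∀ a, affEval x N (actAffineRoot v a) = affEval x N a := by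
    intro v hv a
    rw [affEval_act', actPoint_of_mem_parabolic hx' (inv_mem hv)]
  have hN0 : ∀ v ∈ parabolic J, ∀ a, IsPosAffineRoot b a → ¬ IsPosAffineRoot b (actAffineRoot v a) →
      affEval x N a = 0 := by
    intro v hv a h1 h2
    have h3 : 0 ≤ affEval x N a := (isPos_form_nonneg _ hnn h1).1
    have h4 : 0 ≤ affEval x N (affNeg (actAffineRoot v a)) :=
      (isPos_form_nonneg _ hnn ((isPos_neg_iff _).2 h2)).1
    rw [affEval_neg, inv v hv] at h4
    omega
  -- Strictness comes from an inversion of `u⁻¹`: it is an inversion of `g` but not the image under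
  -- `u` of a positive root.
  have hsub : actAffineRoot u '' inversions b (g * u) ⊂ inversions b g := by
    rw [Set.ssubset_iff_of_subset]
    · have hu2 : length b u⁻¹ ≠ 0 := by
        intro h
        rw [length_inv] at h
        exact hu1 (eq_one_of_mem_parabolic (parabolic_mono (Set.subset_univ _) hu) h)
      rw [length_eq, Ne, Set.ncard_eq_zero (finite_inversions _), ← Ne, ← Set.nonempty_iff_ne_empty]
        at hu2
      obtain ⟨a, h1, h2⟩ := hu2
      refine ⟨a, ⟨h1, key a h1 (hN0 _ (inv_mem hu) a h1 h2)⟩, ?_⟩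
      rintro ⟨c, ⟨h3, -⟩, rfl⟩
      rw [actAffineRoot_inv_act] at h2
      exact h2 h3
    · rintro _ ⟨a, ⟨h1, h2⟩, rfl⟩
      rw [actAffineRoot_mul] at h2
      refine ⟨?_, h2⟩
      by_contra h3
      have h4 := hN0 u hu a h1 h3
      refine key _ ((isPos_neg_iff _).2 h3) ?_ ?_
      · rw [affEval_neg, inv u hu, h4, neg_zero]
      · rw [actAffineRoot_neg, isPos_neg_iff]; exact h2
  rw [length_eq, length_eq, ← Set.ncard_image_of_injective _ (actAffineRoot_injective u)]
  exact Set.ncard_lt_ncard hsub (finite_inversions g)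

end Parabolic

end AffineHecke
end

noncomputable section
set_option linter.unusedSectionVars false
namespace AffineHecke

/-! ### The basis T_g of the affine Hecke algebra, via the regular representation. -/

section HeckeBasis

variable {ι X Y : Type u} [AddCommGroup X] [AddCommGroup Y] {P : RootDatum ι X Y} {b : P.Base}
  (q : ParameterFunction b)

/-- The affine Hecke algebra, as a type of its own. -/
def Hecke : Type u := HeckeAlgebra b q

instance : Ring (Hecke q) := inferInstanceAs (Ring (HeckeAlgebra b q))

instance : Algebra ℂ (Hecke q) := inferInstanceAs (Algebra ℂ (HeckeAlgebra b q))

/-- The projection of the free algebra on the affine Hecke algebra. -/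
def mkHecke : FreeAlgebra ℂ (AffineWeylGroup P) →ₐ[ℂ] Hecke q :=
  RingQuot.mkAlgHom ℂ (HeckeRel b q)

lemma mkHecke_rel {x y : FreeAlgebra ℂ (AffineWeylGroup P)} (h : HeckeRel b q x y) :
    mkHecke q x = mkHecke q y := RingQuot.mkAlgHom_rel ℂ h

lemma mkHecke_surjective : Function.Surjective (mkHecke q) :=
  RingQuot.mkAlgHom_surjective ℂ (HeckeRel b q)

/-- The universal property of the affine Hecke algebra. -/
def liftHecke {B : Type*} [Ring B] [Algebra ℂ B] (f : AffineWeylGroup P → B)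
    (hf : ∀ x y, HeckeRel b q x y → FreeAlgebra.lift ℂ f x = FreeAlgebra.lift ℂ f y) :
    Hecke q →ₐ[ℂ] B :=
  (RingQuot.liftAlgHom ℂ ⟨FreeAlgebra.lift ℂ f, fun {x y} h => hf x y h⟩ :
    HeckeAlgebra b q →ₐ[ℂ] B)

lemma liftHecke_mkHecke {B : Type*} [Ring B] [Algebra ℂ B] (f : AffineWeylGroup P → B)
    (hf : ∀ x y, HeckeRel b q x y → FreeAlgebra.lift ℂ f x = FreeAlgebra.lift ℂ f y)
    (x : FreeAlgebra ℂ (AffineWeylGroup P)) :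
    liftHecke q f hf (mkHecke q x) = FreeAlgebra.lift ℂ f x :=
  RingQuot.liftAlgHom_mkAlgHom_apply ℂ (FreeAlgebra.lift ℂ f) (fun {x y} h => hf x y h) x

/-- The generator `T_g` of the affine Hecke algebra. -/
def T (g : AffineWeylGroup P) : Hecke q := mkHecke q (FreeAlgebra.ι ℂ g)

lemma T_one : T q 1 = 1 := by
  rw [T, mkHecke_rel q HeckeRel.one, map_one]

lemma T_mul {g h : AffineWeylGroup P} (hgh : length b (g * h) = length b g + length b h) :
    T q g * T q h = T q (g * h) := by
  rw [T, T, T, ← map_mul, mkHecke_rel q (HeckeRel.mul g h hgh)]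

lemma T_sq [Finite ι] (a : Node b) : T q (simpleRefl a) * T q (simpleRefl a) =
    ((q (simpleRefl a) : ℂ) - 1) • T q (simpleRefl a) + (q (simpleRefl a) : ℂ) • 1 := by
  have hs : simpleRefl a ∈ simpleAffineReflections b := by
    rw [simpleAffineReflections_eq_range]; exact ⟨a, rfl⟩
  rw [T, ← map_mul, mkHecke_rel q (HeckeRel.quadratic _ hs), map_add, map_smul, map_smul,
    map_one]

lemma q_ne_zero (g : AffineWeylGroup P) : (q g : ℂ) ≠ 0 := by
  exact_mod_cast (q.pos g).ne'

lemma q_one : q 1 = 1 := q.eq_one_of_length_eq_zero 1 length_one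

variable [Finite ι] [P.IsReduced]

lemma T_simpleRefl_mul (a : Node b) (g : AffineWeylGroup P) : T q (simpleRefl a) * T q g =
    if length b g < length b (simpleRefl a * g) then T q (simpleRefl a * g)
    else ((q (simpleRefl a) : ℂ) - 1) • T q g + (q (simpleRefl a) : ℂ) • T q (simpleRefl a * g) := by
  have h := length_simpleRefl_mul g a
  split_ifs with hlt
  · rw [T_mul]
    rw [length_simpleRefl]; omega
  · have h1 : T q (simpleRefl a) * T q (simpleRefl a * g) = T q g := by
      rw [T_mul, simpleRefl_mul_cancel_left]
      rw [simpleRefl_mul_cancel_left, length_simpleRefl]; omega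
    conv_lhs => rw [← h1, ← mul_assoc, T_sq, add_mul, smul_mul_assoc, smul_mul_assoc, one_mul, h1]

lemma T_mul_simpleRefl (a : Node b) (g : AffineWeylGroup P) : T q g * T q (simpleRefl a) =
    if length b g < length b (g * simpleRefl a) then T q (g * simpleRefl a)
    else ((q (simpleRefl a) : ℂ) - 1) • T q g + (q (simpleRefl a) : ℂ) • T q (g * simpleRefl a) := by
  have h := length_mul_simpleRefl g a
  split_ifs with hlt
  · rw [T_mul]
    rw [length_simpleRefl]; omega
  · have h1 : T q (g * simpleRefl a) * T q (simpleRefl a) = T q g := by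
      rw [T_mul, simpleRefl_mul_cancel_right]
      rw [simpleRefl_mul_cancel_right, length_simpleRefl]; omega
    conv_lhs => rw [← h1, mul_assoc, T_sq, mul_add, mul_smul_comm, mul_smul_comm, mul_one, h1]

lemma T_mul_of_length_eq_zero_left {g : AffineWeylGroup P} (hg : length b g = 0)
    (h : AffineWeylGroup P) : T q g * T q h = T q (g * h) := by
  rw [T_mul]
  rw [length_mul_left_of_eq_zero hg, hg, zero_add]

lemma T_mul_of_length_eq_zero_right {h : AffineWeylGroup P} (hh : length b h = 0)
    (g : AffineWeylGroup P) : T q g * T q h = T q (g * h) := by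
  rw [T_mul]
  rw [length_mul_right_of_eq_zero hh, hh, add_zero]

omit [P.IsReduced] in
/-- Induction over `W` by left multiplication with simple reflections that raise the length. -/
lemma length_induction_left {p : AffineWeylGroup P → Prop} (h0 : ∀ g, length b g = 0 → p g)
    (h1 : ∀ (a : Node b) g, length b g < length b (simpleRefl a * g) → p g → p (simpleRefl a * g))
    [P.IsReduced] (g : AffineWeylGroup P) : p g := by
  induction hn : length b g using Nat.strong_induction_on generalizing g with
  | _ n ih =>
    subst hn
    by_cases hg : length b g = 0
    · exact h0 g hg
    · obtain ⟨a, ha⟩ := exists_length_simpleRefl_mul_lt hg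
      have := h1 a (simpleRefl a * g) (by rwa [simpleRefl_mul_cancel_left]) (ih _ ha _ rfl)
      rwa [simpleRefl_mul_cancel_left] at this

omit [P.IsReduced] in
lemma length_induction_right {p : AffineWeylGroup P → Prop} (h0 : ∀ g, length b g = 0 → p g)
    (h1 : ∀ (a : Node b) g, length b g < length b (g * simpleRefl a) → p g → p (g * simpleRefl a))
    [P.IsReduced] (g : AffineWeylGroup P) : p g := by
  induction hn : length b g using Nat.strong_induction_on generalizing g with
  | _ n ih =>
    subst hn
    by_cases hg : length b g = 0
    · exact h0 g hg
    · obtain ⟨a, ha⟩ := exists_length_mul_lt hg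
      have := h1 a (g * simpleRefl a) (by rwa [simpleRefl_mul_cancel_right]) (ih _ ha _ rfl)
      rwa [simpleRefl_mul_cancel_right] at this

/-! The regular representation. -/

/-- Left multiplication by `T_s` on the span of `W`. -/
def regLeft (a : Node b) : (AffineWeylGroup P →₀ ℂ) →ₗ[ℂ] (AffineWeylGroup P →₀ ℂ) :=
  Finsupp.linearCombination ℂ fun g =>
    if length b g < length b (simpleRefl a * g) then Finsupp.single (simpleRefl a * g) 1
    else ((q (simpleRefl a) : ℂ) - 1) • Finsupp.single g 1 +
      (q (simpleRefl a) : ℂ) • Finsupp.single (simpleRefl a * g) 1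

/-- Right multiplication by `T_s` on the span of `W`. -/
def regRight (a : Node b) : (AffineWeylGroup P →₀ ℂ) →ₗ[ℂ] (AffineWeylGroup P →₀ ℂ) :=
  Finsupp.linearCombination ℂ fun g =>
    if length b g < length b (g * simpleRefl a) then Finsupp.single (g * simpleRefl a) 1
    else ((q (simpleRefl a) : ℂ) - 1) • Finsupp.single g 1 +
      (q (simpleRefl a) : ℂ) • Finsupp.single (g * simpleRefl a) 1

lemma regLeft_single (a : Node b) (g : AffineWeylGroup P) :
    regLeft q a (Finsupp.single g 1) =
    if length b g < length b (simpleRefl a * g) then Finsupp.single (simpleRefl a * g) 1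
    else ((q (simpleRefl a) : ℂ) - 1) • Finsupp.single g 1 +
      (q (simpleRefl a) : ℂ) • Finsupp.single (simpleRefl a * g) 1 := by
  rw [regLeft, Finsupp.linearCombination_single, one_smul]

lemma regRight_single (a : Node b) (g : AffineWeylGroup P) :
    regRight q a (Finsupp.single g 1) =
    if length b g < length b (g * simpleRefl a) then Finsupp.single (g * simpleRefl a) 1
    else ((q (simpleRefl a) : ℂ) - 1) • Finsupp.single g 1 +
      (q (simpleRefl a) : ℂ) • Finsupp.single (g * simpleRefl a) 1 := by
  rw [regRight, Finsupp.linearCombination_single, one_smul]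

lemma q_eq_of_conj {a c : Node b} {g : AffineWeylGroup P} (h : simpleRefl a * g = g * simpleRefl c)
    (hlt : length b g < length b (simpleRefl a * g)) : q (simpleRefl a) = q (simpleRefl c) := by
  have h1 := length_simpleRefl_mul g a
  have e1 : q (simpleRefl a * g) = q (simpleRefl a) * q g :=
    q.mul_of_length_add _ _ (by rw [length_simpleRefl]; omega)
  have e2 : q (g * simpleRefl c) = q g * q (simpleRefl c) :=
    q.mul_of_length_add _ _ (by rw [length_simpleRefl, ← h]; omega)
  rw [h, e2, mul_comm] at e1
  exact (mul_right_cancel₀ (q.pos g).ne' e1).symm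

/-- If `s g` and `g s'` are both longer than `g`, or both shorter, while `s g s'` has the length of
`g`, then the exchange property gives `s g = g s'`; this implies `q(s) = q(s')`, and both sides
agree. In the other cases the two rules do not interfere. -/
lemma regLeft_regRight (a c : Node b) (v : AffineWeylGroup P →₀ ℂ) :
    regLeft q a (regRight q c v) = regRight q c (regLeft q a v) := by
  suffices h : regLeft q a ∘ₗ regRight q c = regRight q c ∘ₗ regLeft q a from
    LinearMap.congr_fun h v
  refine Finsupp.lhom_ext' fun g => LinearMap.ext_ring ?_
  simp only [LinearMap.comp_apply, Finsupp.lsingle_apply]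
  have hA := length_simpleRefl_mul g a
  have hB := length_mul_simpleRefl g c
  have hC := length_simpleRefl_mul (g * simpleRefl c) a
  have hD := length_mul_simpleRefl (simpleRefl a * g) c
  have hass : simpleRefl a * (g * simpleRefl c) = simpleRefl a * g * simpleRefl c :=
    (mul_assoc _ _ _).symm
  rw [hass] at hC
  by_cases h1 : length b g < length b (simpleRefl a * g)
  · by_cases h2 : length b g < length b (g * simpleRefl c)
    · by_cases h3 : length b (g * simpleRefl c) < length b (simpleRefl a * g * simpleRefl c)
      · have h4 : length b (simpleRefl a * g) < length b (simpleRefl a * g * simpleRefl c) := by omega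
        simp only [regLeft_single, regRight_single, h1, h2, h3, h4, hass, if_true]
      · have h4 : ¬ length b (simpleRefl a * g) < length b (simpleRefl a * g * simpleRefl c) := by
          omega
        have hx := simpleRefl_exchange h1 (by rw [hass]; omega)
        have hq := q_eq_of_conj q hx h1
        simp only [regLeft_single, regRight_single, h1, h2, h3, h4, hass, if_true, if_false, hq]
        rw [hx]
    · have h3 : length b (g * simpleRefl c) < length b (simpleRefl a * g * simpleRefl c) := by omega
      have h4 : ¬ length b (simpleRefl a * g) < length b (simpleRefl a * g * simpleRefl c) := by omega
      simp only [regLeft_single, regRight_single, h1, h2, h3, h4, hass, if_true, if_false, map_add,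
          map_smul]
  · by_cases h2 : length b g < length b (g * simpleRefl c)
    · have h3 : ¬ length b (g * simpleRefl c) < length b (simpleRefl a * g * simpleRefl c) := by omega
      have h4 : length b (simpleRefl a * g) < length b (simpleRefl a * g * simpleRefl c) := by omega
      simp only [regLeft_single, regRight_single, h1, h2, h3, h4, hass, if_true, if_false, map_add,
          map_smul]
    · by_cases h3 : length b (g * simpleRefl c) < length b (simpleRefl a * g * simpleRefl c)
      · have h4 : length b (simpleRefl a * g) < length b (simpleRefl a * g * simpleRefl c) := by
          omega
        have hx := simpleRefl_exchange (g := g * simpleRefl c) (a := a) (c := c)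
          (by rw [hass]; exact h3)
          (by rw [simpleRefl_mul_cancel_right]; omega)
        rw [simpleRefl_mul_cancel_right, hass] at hx
        have hx2 : simpleRefl a * g = g * simpleRefl c := by
          rw [← simpleRefl_mul_cancel_right c (simpleRefl a * g), hx]
        have hq : q (simpleRefl a) = q (simpleRefl c) := by
          refine q_eq_of_conj q (g := g * simpleRefl c) ?_ (by rw [hass]; exact h3)
          rw [hass, hx, simpleRefl_mul_cancel_right]
        simp only [regLeft_single, regRight_single, h1, h2, h3, h4, hass, if_true, if_false, hq,
          map_add, map_smul]
        rw [hx2]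
      · have h4 : ¬ length b (simpleRefl a * g) < length b (simpleRefl a * g * simpleRefl c) := by
          omega
        simp only [regLeft_single, regRight_single, h1, h2, h3, h4, hass, if_false,
          map_add, map_smul]
        module

omit [Finite ι] [P.IsReduced] in
lemma lmapDomain_single_one (f : AffineWeylGroup P → AffineWeylGroup P) (g : AffineWeylGroup P) :
    Finsupp.lmapDomain ℂ ℂ f (Finsupp.single g 1) = Finsupp.single (f g) 1 := by
  rw [Finsupp.lmapDomain_apply, Finsupp.mapDomain_single]

/-- An operator that behaves like left multiplication by an element of the Hecke algebra. -/
structure IsLeftOp (f : (AffineWeylGroup P →₀ ℂ) →ₗ[ℂ] (AffineWeylGroup P →₀ ℂ)) : Prop where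
  comm_right : ∀ (c : Node b) v, f (regRight q c v) = regRight q c (f v)
  comm_zero : ∀ (h : AffineWeylGroup P) (_ : length b h = 0) v,
    f (Finsupp.lmapDomain ℂ ℂ (· * h) v) = Finsupp.lmapDomain ℂ ℂ (· * h) (f v)

variable {q} in
-- The right operators generate every basis vector from the one of 1, so an operator that commutes
-- with them is known from one value. The defining relations of the Hecke algebra then need checking
-- on that vector only.
lemma IsLeftOp.ext {f f' : (AffineWeylGroup P →₀ ℂ) →ₗ[ℂ] (AffineWeylGroup P →₀ ℂ)}
    (hf : IsLeftOp q f) (hf' : IsLeftOp q f')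
    (h : f (Finsupp.single 1 1) = f' (Finsupp.single 1 1)) : f = f' := by
  refine Finsupp.lhom_ext' fun g => LinearMap.ext_ring ?_
  simp only [LinearMap.comp_apply, Finsupp.lsingle_apply]
  refine length_induction_right (b := b)
    (p := fun g => f (Finsupp.single g 1) = f' (Finsupp.single g 1))
    (fun g hg => ?_) (fun a g hg ih => ?_) g
  · have : Finsupp.single g (1 : ℂ) = Finsupp.lmapDomain ℂ ℂ (· * g) (Finsupp.single 1 1) := by
      simp
    rw [this, hf.comm_zero g hg, hf'.comm_zero g hg, h]
  · have : Finsupp.single (g * simpleRefl a) (1 : ℂ) = regRight q a (Finsupp.single g 1) := by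
      rw [regRight_single, if_pos hg]
    rw [this, hf.comm_right, hf'.comm_right, ih]

variable {q} in
lemma IsLeftOp.comp {f f' : (AffineWeylGroup P →₀ ℂ) →ₗ[ℂ] (AffineWeylGroup P →₀ ℂ)}
    (hf : IsLeftOp q f) (hf' : IsLeftOp q f') : IsLeftOp q (f ∘ₗ f') where
  comm_right c v := by simp only [LinearMap.comp_apply, hf'.comm_right, hf.comm_right]
  comm_zero h hh v := by simp only [LinearMap.comp_apply, hf'.comm_zero h hh, hf.comm_zero h hh]

lemma isLeftOp_id : IsLeftOp q LinearMap.id := ⟨fun _ _ => rfl, fun _ _ _ => rfl⟩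

lemma isLeftOp_combination {f f' : (AffineWeylGroup P →₀ ℂ) →ₗ[ℂ] (AffineWeylGroup P →₀ ℂ)}
    (hf : IsLeftOp q f) (hf' : IsLeftOp q f') (x y : ℂ) : IsLeftOp q (x • f + y • f') where
  comm_right c v := by
    simp only [LinearMap.add_apply, LinearMap.smul_apply, hf'.comm_right, hf.comm_right, map_add,
      map_smul]
  comm_zero h hh v := by
    simp only [LinearMap.add_apply, LinearMap.smul_apply, hf'.comm_zero h hh, hf.comm_zero h hh,
      map_add, map_smul]

lemma isLeftOp_regLeft (a : Node b) : IsLeftOp q (regLeft q a) where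
  comm_right c v := regLeft_regRight q a c v
  comm_zero h hh v := by
    suffices H : regLeft q a ∘ₗ Finsupp.lmapDomain ℂ ℂ (· * h) =
      Finsupp.lmapDomain ℂ ℂ (· * h) ∘ₗ regLeft q a from LinearMap.congr_fun H v
    refine Finsupp.lhom_ext' fun g => LinearMap.ext_ring ?_
    simp only [LinearMap.comp_apply, Finsupp.lsingle_apply, lmapDomain_single_one,
      regLeft_single, length_mul_right_of_eq_zero hh, ← mul_assoc]
    split_ifs <;> simp only [map_add, map_smul, lmapDomain_single_one, mul_assoc]

lemma isLeftOp_lmapDomain {g : AffineWeylGroup P} (hg : length b g = 0) :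
    IsLeftOp q (Finsupp.lmapDomain ℂ ℂ (g * ·)) where
  comm_right c v := by
    suffices H : Finsupp.lmapDomain ℂ ℂ (g * ·) ∘ₗ regRight q c =
      regRight q c ∘ₗ Finsupp.lmapDomain ℂ ℂ (g * ·) from LinearMap.congr_fun H v
    refine Finsupp.lhom_ext' fun h => LinearMap.ext_ring ?_
    simp only [LinearMap.comp_apply, Finsupp.lsingle_apply, lmapDomain_single_one,
      regRight_single, mul_assoc, length_mul_left_of_eq_zero hg]
    split_ifs <;> simp only [map_add, map_smul, lmapDomain_single_one]
  comm_zero h _ v := by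
    simp only [Finsupp.lmapDomain_apply, ← Finsupp.mapDomain_comp]
    congr 1
    funext x
    simp [mul_assoc]

/-- The operator is a product of elementary ones along a reduced expression. Independence of the
expression is a consequence of `IsLeftOp.ext` and plays no role in the construction. -/
lemma exists_leftOp (g : AffineWeylGroup P) : ∃ f, IsLeftOp q f ∧
    ∀ h, length b (g * h) = length b g + length b h →
      f (Finsupp.single h 1) = Finsupp.single (g * h) 1 := by
  refine length_induction_left (b := b) (p := fun g => ∃ f, IsLeftOp q f ∧
    ∀ h, length b (g * h) = length b g + length b h →
      f (Finsupp.single h 1) = Finsupp.single (g * h) 1) (fun g hg => ?_) (fun a g hg ih => ?_) g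
  · exact ⟨_, isLeftOp_lmapDomain q hg, fun h _ => by simp⟩
  · obtain ⟨f, hf, hf2⟩ := ih
    refine ⟨_, (isLeftOp_regLeft q a).comp hf, fun h hh => ?_⟩
    have h1 := length_simpleRefl_mul (g * h) a
    have h2 := length_mul_le (b := b) g h
    have h3 := length_simpleRefl_mul g a
    rw [mul_assoc] at hh
    rw [LinearMap.comp_apply, hf2 h (by omega), regLeft_single, if_pos (by omega), mul_assoc]

/-- Left multiplication by `T_g` on the span of `W`. -/
def leftOp (g : AffineWeylGroup P) : Module.End ℂ (AffineWeylGroup P →₀ ℂ) :=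
  (exists_leftOp q g).choose

lemma isLeftOp_leftOp (g : AffineWeylGroup P) : IsLeftOp q (leftOp q g) :=
  (exists_leftOp q g).choose_spec.1

lemma leftOp_single {g h : AffineWeylGroup P} (hgh : length b (g * h) = length b g + length b h) :
    leftOp q g (Finsupp.single h 1) = Finsupp.single (g * h) 1 :=
  (exists_leftOp q g).choose_spec.2 h hgh

lemma leftOp_single_one (g : AffineWeylGroup P) :
    leftOp q g (Finsupp.single 1 1) = Finsupp.single g 1 := by
  rw [leftOp_single] <;> simp

/-- The regular representation of the affine Hecke algebra on the span of `W`. -/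
def regularRep : Hecke q →ₐ[ℂ] Module.End ℂ (AffineWeylGroup P →₀ ℂ) :=
  liftHecke q (leftOp q) (by
    intro x y hxy
    induction hxy with
    | one =>
      rw [FreeAlgebra.lift_ι_apply, map_one]
      exact (isLeftOp_leftOp q 1).ext (isLeftOp_id q) (leftOp_single_one q 1)
    | mul g h hgh =>
      rw [map_mul, FreeAlgebra.lift_ι_apply, FreeAlgebra.lift_ι_apply, FreeAlgebra.lift_ι_apply]
      refine ((isLeftOp_leftOp q g).comp (isLeftOp_leftOp q h)).ext (isLeftOp_leftOp q _) ?_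
      rw [LinearMap.comp_apply, leftOp_single_one, leftOp_single_one, leftOp_single q hgh]
    | quadratic s hs =>
      rw [simpleAffineReflections_eq_range] at hs
      obtain ⟨a, rfl⟩ := hs
      simp only [map_mul, map_add, map_smul, FreeAlgebra.lift_ι_apply, map_one]
      refine ((isLeftOp_leftOp q _).comp (isLeftOp_leftOp q _)).ext
        (isLeftOp_combination q (isLeftOp_leftOp q _) (isLeftOp_id q) _ _) ?_
      have h1 : leftOp q (simpleRefl a) = regLeft q a := by
        refine (isLeftOp_leftOp q _).ext (isLeftOp_regLeft q a) ?_
        rw [leftOp_single_one, regLeft_single, if_pos]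
        · simp
        · simp [length_simpleRefl]
      rw [h1, LinearMap.comp_apply, LinearMap.add_apply, LinearMap.smul_apply, ← h1,
        leftOp_single_one, h1, regLeft_single, if_neg]
      · simp
      · simp)

lemma regularRep_T (g : AffineWeylGroup P) : regularRep q (T q g) = leftOp q g := by
  rw [regularRep, T, liftHecke_mkHecke, FreeAlgebra.lift_ι_apply]

lemma span_T : Submodule.span ℂ (Set.range (T q)) = ⊤ := by
  set M := Submodule.span ℂ (Set.range (T q)) with hM
  have hT : ∀ g, T q g ∈ M := fun g => Submodule.subset_span ⟨g, rfl⟩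
  have hs : ∀ (a : Node b), ∀ x ∈ M, T q (simpleRefl a) * x ∈ M := by
    intro a x hx
    induction hx using Submodule.span_induction with
    | mem x hx =>
      obtain ⟨h, rfl⟩ := hx
      rw [T_simpleRefl_mul]
      split_ifs
      · exact hT _
      · exact add_mem (M.smul_mem _ (hT _)) (M.smul_mem _ (hT _))
    | zero => simp
    | add x y _ _ h1 h2 => rw [mul_add]; exact add_mem h1 h2
    | smul c x _ h1 => rw [mul_smul_comm]; exact Submodule.smul_mem _ _ h1
  have key : ∀ g, ∀ x ∈ M, T q g * x ∈ M := by
    intro g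
    refine length_induction_left (b := b) (p := fun g => ∀ x ∈ M, T q g * x ∈ M)
      (fun g hg x hx => ?_) (fun a g hg ih x hx => ?_) g
    · induction hx using Submodule.span_induction with
      | mem x hx =>
        obtain ⟨h, rfl⟩ := hx
        rw [T_mul_of_length_eq_zero_left q hg]
        exact hT _
      | zero => simp
      | add x y _ _ h1 h2 => rw [mul_add]; exact add_mem h1 h2
      | smul c x _ h1 => rw [mul_smul_comm]; exact Submodule.smul_mem _ _ h1
    · have h1 := T_simpleRefl_mul q a g
      rw [if_pos hg] at h1
      rw [← h1, mul_assoc]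
      exact hs a _ (ih x hx)
  have key2 : ∀ y : FreeAlgebra ℂ (AffineWeylGroup P), ∀ x ∈ M,
      mkHecke q y * x ∈ M := by
    intro y
    induction y using FreeAlgebra.induction with
    | grade0 c =>
      intro x hx
      rw [AlgHom.commutes, ← Algebra.smul_def]
      exact M.smul_mem _ hx
    | grade1 g => exact key g
    | mul y z hy hz =>
      intro x hx
      rw [map_mul, mul_assoc]
      exact hy _ (hz _ hx)
    | add y z hy hz =>
      intro x hx
      rw [map_add, add_mul]
      exact add_mem (hy _ hx) (hz _ hx)
  rw [eq_top_iff]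
  rintro x -
  obtain ⟨y, rfl⟩ := mkHecke_surjective q x
  have := key2 y 1 (by rw [← T_one q]; exact hT 1)
  rwa [mul_one] at this

/-- In the regular representation `T_g` sends the basis vector of 1 to that of `g`. -/
lemma linearIndependent_T : LinearIndependent ℂ (T q) := by
  have h : LinearIndependent ℂ fun g : AffineWeylGroup P => Finsupp.single g (1 : ℂ) :=
    (Finsupp.basisSingleOne (R := ℂ) (ι := AffineWeylGroup P)).linearIndependent
  refine LinearIndependent.of_comp
    (LinearMap.applyₗ (Finsupp.single 1 1) ∘ₗ (regularRep q).toLinearMap) ?_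
  convert h using 2 with g
  simp [regularRep_T, leftOp_single_one]

/-- The basis of the affine Hecke algebra consisting of the `T_g`. -/
def heckeBasis : Module.Basis (AffineWeylGroup P) ℂ (Hecke q) :=
  Module.Basis.mk (linearIndependent_T q) (span_T q).ge

@[simp]
lemma heckeBasis_apply (g : AffineWeylGroup P) : heckeBasis q g = T q g := by
  rw [heckeBasis, Module.Basis.mk_apply]

lemma isUnit_T (g : AffineWeylGroup P) : IsUnit (T q g) := by
  refine length_induction_left (b := b) (p := fun g => IsUnit (T q g))
    (fun g hg => ?_) (fun a g hg ih => ?_) g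
  · refine ⟨⟨T q g, T q g⁻¹, ?_, ?_⟩, rfl⟩
    · rw [T_mul_of_length_eq_zero_left q hg, mul_inv_cancel, T_one]
    · rw [T_mul_of_length_eq_zero_right q hg, inv_mul_cancel, T_one]
  · have h1 := T_simpleRefl_mul q a g
    rw [if_pos hg] at h1
    rw [← h1]
    refine IsUnit.mul ?_ ih
    have h2 := T_sq q a
    have h3 := q_ne_zero q (simpleRefl a)
    set t := T q (simpleRefl a)
    set c := (q (simpleRefl a) : ℂ)
    -- This is the quadratic relation solved for the inverse of `T_s`.
    refine ⟨⟨t, c⁻¹ • (t - (c - 1) • 1), ?_, ?_⟩, rfl⟩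
    · rw [mul_smul_comm, mul_sub, h2, mul_smul_comm, mul_one, add_sub_cancel_left,
        inv_smul_smul₀ h3]
    · rw [smul_mul_assoc, sub_mul, h2, smul_mul_assoc, one_mul, add_sub_cancel_left,
        inv_smul_smul₀ h3]

end HeckeBasis

end AffineHecke
end

noncomputable section
set_option linter.unusedSectionVars false
namespace AffineHecke

open scoped TensorProduct
open MulOpposite

/-! ### The enveloping algebra and its coordinates indexed by W. -/

section Env

variable (A : Type u) [Ring A] [Algebra ℂ A]

/-- The enveloping algebra `A ⊗ Aᵒᵖ`, whose left modules are the `A`-bimodules. -/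
def Env : Type u := A ⊗[ℂ] Aᵐᵒᵖ

instance : Ring (Env A) := inferInstanceAs (Ring (A ⊗[ℂ] Aᵐᵒᵖ))

instance : Algebra ℂ (Env A) := inferInstanceAs (Algebra ℂ (A ⊗[ℂ] Aᵐᵒᵖ))

variable {A}

/-- The pure tensor `a ⊗ b` in the enveloping algebra. -/
def Env.tmul (a b : A) : Env A := (a ⊗ₜ[ℂ] op b : A ⊗[ℂ] Aᵐᵒᵖ)

lemma Env.tmul_mul_tmul (a b c d : A) :
    Env.tmul a b * Env.tmul c d = Env.tmul (a * c) (d * b) :=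
  Algebra.TensorProduct.tmul_mul_tmul a c (op b) (op d)

lemma Env.tmul_one_one : (Env.tmul 1 1 : Env A) = 1 := rfl

/-- The pure tensor as a bilinear map. -/
def Env.tmulBilin : A →ₗ[ℂ] A →ₗ[ℂ] Env A :=
  LinearMap.mk₂ ℂ Env.tmul (fun a a' b => TensorProduct.add_tmul a a' (op b))
    (fun c a b => TensorProduct.smul_tmul' c a (op b))
    (fun a b b' => TensorProduct.tmul_add a (op b) (op b'))
    (fun c a b => TensorProduct.tmul_smul c a (op b))

lemma Env.tmulBilin_apply (a b : A) : Env.tmulBilin a b = Env.tmul a b := rfl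

lemma Env.add_tmul (a a' b : A) : Env.tmul (a + a') b = Env.tmul a b + Env.tmul a' b :=
  LinearMap.map_add₂ Env.tmulBilin a a' b

lemma Env.tmul_add (a b b' : A) : Env.tmul a (b + b') = Env.tmul a b + Env.tmul a b' :=
  map_add (Env.tmulBilin a) b b'

lemma Env.smul_tmul (c : ℂ) (a b : A) : Env.tmul (c • a) b = c • Env.tmul a b :=
  LinearMap.map_smul₂ Env.tmulBilin c a b

lemma Env.tmul_smul (c : ℂ) (a b : A) : Env.tmul a (c • b) = c • Env.tmul a b :=
  map_smul (Env.tmulBilin a) c b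

/-- The universal property of the enveloping algebra as a vector space. -/
def Env.lift {M : Type*} [AddCommGroup M] [Module ℂ M] (f : A →ₗ[ℂ] A →ₗ[ℂ] M) : Env A →ₗ[ℂ] M :=
  (TensorProduct.lift (f.compl₂ (MulOpposite.opLinearEquiv ℂ).symm.toLinearMap) :
    A ⊗[ℂ] Aᵐᵒᵖ →ₗ[ℂ] M)

lemma Env.lift_tmul {M : Type*} [AddCommGroup M] [Module ℂ M] (f : A →ₗ[ℂ] A →ₗ[ℂ] M) (a b : A) :
    Env.lift f (Env.tmul a b) = f a b := rfl

lemma Env.induction {p : Env A → Prop} (h0 : p 0) (h1 : ∀ x y, p x → p y → p (x + y))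
    (h2 : ∀ a b, p (Env.tmul a b)) (x : Env A) : p x :=
  TensorProduct.induction_on (motive := p) x h0 (fun a b => h2 a b.unop) h1

/-- The element `a ⊗ 1 - 1 ⊗ a` of the enveloping algebra. -/
def Env.diff (a : A) : Env A := Env.tmul a 1 - Env.tmul 1 a

lemma Env.tmul_mul_diff (a b c : A) :
    Env.tmul a b * Env.diff c = Env.tmul (a * c) b - Env.tmul a (c * b) := by
  simp [Env.diff, mul_sub, Env.tmul_mul_tmul]

end Env

section Bimodule

variable {ι X Y : Type u} [AddCommGroup X] [AddCommGroup Y] {P : RootDatum ι X Y} {b : P.Base}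
  (q : ParameterFunction b) [Finite ι] [P.IsReduced]

/-- The inverse of `T_g`. -/
def Tinv (g : AffineWeylGroup P) : Hecke q := Ring.inverse (T q g)

lemma T_mul_Tinv (g : AffineWeylGroup P) : T q g * Tinv q g = 1 :=
  Ring.mul_inverse_cancel _ (isUnit_T q g)

lemma Tinv_mul_T (g : AffineWeylGroup P) : Tinv q g * T q g = 1 :=
  Ring.inverse_mul_cancel _ (isUnit_T q g)

lemma T_mul_Tinv_mul (g : AffineWeylGroup P) (h : Hecke q) :
    T q g * (Tinv q g * h) = h := by rw [← mul_assoc, T_mul_Tinv, one_mul]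

lemma Tinv_mul_T_mul (g : AffineWeylGroup P) (h : Hecke q) :
    Tinv q g * (T q g * h) = h := by rw [← mul_assoc, Tinv_mul_T, one_mul]

/-- The element `T_g ⊗ T_g⁻¹ h` of the enveloping algebra. -/
def twist (g : AffineWeylGroup P) : Hecke q →ₗ[ℂ] Env (Hecke q) :=
  Env.tmulBilin (T q g) ∘ₗ LinearMap.mulLeft ℂ (Tinv q g)

lemma twist_apply (g : AffineWeylGroup P) (h : Hecke q) :
    twist q g h = Env.tmul (T q g) (Tinv q g * h) := rfl

lemma tmul_eq_twist (g : AffineWeylGroup P) (h : Hecke q) :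
    Env.tmul (T q g) h = twist q g (T q g * h) := by
  rw [twist_apply, Tinv_mul_T_mul]

variable {q} in
lemma env_induction {p : Env (Hecke q) → Prop} (h0 : p 0)
    (h1 : ∀ x y, p x → p y → p (x + y)) (h2 : ∀ g h, p (twist q g h))
    (x : Env (Hecke q)) : p x := by
  refine Env.induction h0 h1 (fun a c => ?_) x
  rw [← (heckeBasis q).linearCombination_repr a, Finsupp.linearCombination_apply, Finsupp.sum,
    ← Env.tmulBilin_apply, map_sum, LinearMap.sum_apply]
  refine Finset.sum_induction _ p h1 h0 fun g _ => ?_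
  rw [map_smul, LinearMap.smul_apply, Env.tmulBilin_apply, heckeBasis_apply, tmul_eq_twist,
    ← map_smul]
  exact h2 _ _

/-- Coordinates on the enveloping algebra. -/
def envCoord : Env (Hecke q) →ₗ[ℂ] (AffineWeylGroup P →₀ Hecke q) :=
  Env.lift ((heckeBasis q).constr ℂ fun g => Finsupp.lsingle g ∘ₗ LinearMap.mulLeft ℂ (T q g))

lemma envCoord_twist (g : AffineWeylGroup P) (h : Hecke q) :
    envCoord q (twist q g h) = Finsupp.single g h := by
  rw [envCoord, twist_apply, Env.lift_tmul, ← heckeBasis_apply, Module.Basis.constr_basis]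
  simp [T_mul_Tinv_mul]

/-- Coordinates on the enveloping algebra. -/
def envEquiv : (AffineWeylGroup P →₀ Hecke q) ≃ₗ[ℂ] Env (Hecke q) :=
  LinearEquiv.ofLinearMap (Finsupp.lsum ℂ (twist q)) (envCoord q)
    (by
      refine LinearMap.ext fun x => ?_
      induction x using env_induction with
      | h0 => simp
      | h1 x y hx hy => rw [map_add, map_add, hx, hy]
      | h2 g h => simp [envCoord_twist])
    (by
      refine Finsupp.lhom_ext' fun g => LinearMap.ext fun h => ?_
      simp [envCoord_twist])

@[simp]
lemma envEquiv_single (g : AffineWeylGroup P) (h : Hecke q) :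
    envEquiv q (Finsupp.single g h) = twist q g h := by
  simp [envEquiv]

@[simp]
lemma envEquiv_symm_twist (g : AffineWeylGroup P) (h : Hecke q) :
    (envEquiv q).symm (twist q g h) = Finsupp.single g h := by
  rw [LinearEquiv.symm_apply_eq, envEquiv_single]

/-- Elements `g` for which right multiplication by `T_g ⊗ 1 - 1 ⊗ T_g` is easily expressed
in coordinates. -/
def IsElementary (b : P.Base) (g : AffineWeylGroup P) : Prop :=
  length b g = 0 ∨ ∃ a : Node b, g = simpleRefl a

lemma twist_mul_diff {g v : AffineWeylGroup P} (h : T q g * T q v = T q (g * v))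
    (x : Hecke q) : Env.tmul (T q g) x * Env.diff (T q v) =
      twist q (g * v) (T q (g * v) * x) - twist q g (T q (g * v) * x) := by
  rw [Env.tmul_mul_diff, h, tmul_eq_twist, tmul_eq_twist, ← mul_assoc, h]

/-- In the twisted coordinates the terms with `q(s) - 1` cancel and only the nonzero factor `q(s)`
remains. Hence `T_s ⊗ 1 - 1 ⊗ T_s` generates the same differences as `s` does in the group algebra
of `W`. -/
lemma twist_mul_diff_of_lt {g : AffineWeylGroup P} {a : Node b}
    (h : length b (g * simpleRefl a) < length b g)
    (x : Hecke q) : Env.tmul (T q g) x * Env.diff (T q (simpleRefl a)) =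
      (q (simpleRefl a) : ℂ) • (twist q (g * simpleRefl a) (T q (g * simpleRefl a) * x) -
        twist q g (T q (g * simpleRefl a) * x)) := by
  have e1 := T_mul_simpleRefl q a g
  rw [if_neg (by omega)] at e1
  have e2 := T_mul_simpleRefl q a (g * simpleRefl a)
  rw [simpleRefl_mul_cancel_right, if_pos h] at e2
  rw [Env.tmul_mul_diff, e1, Env.add_tmul, Env.smul_tmul, tmul_eq_twist,
    Env.smul_tmul, tmul_eq_twist, tmul_eq_twist, ← mul_assoc, e1, add_mul,
    smul_mul_assoc, smul_mul_assoc, map_add, map_smul, map_smul]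
  module

/-- The left ideal of the enveloping algebra generated by the `T_g ⊗ 1 - 1 ⊗ T_g`, `g ∈ Γ`. -/
def relIdeal (Γ : Set (AffineWeylGroup P)) :
    Submodule (Env (Hecke q)) (Env (Hecke q)) :=
  Submodule.span _ ((fun g => Env.diff (T q g)) '' Γ)

variable {q} in
lemma complex_smul_mem {M : Type*} [AddCommGroup M] [Module (Env (Hecke q)) M] [Module ℂ M]
    [IsScalarTower ℂ (Env (Hecke q)) M] (N : Submodule (Env (Hecke q)) M) (c : ℂ)
    {x : M} (hx : x ∈ N) : c • x ∈ N := by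
  rw [← one_smul (Env (Hecke q)) x, ← smul_assoc]
  exact N.smul_mem _ hx

variable {q} in
lemma twist_sub_mem {Γ : Set (AffineWeylGroup P)} {v : AffineWeylGroup P}
    (hv : v ∈ Γ) (hv2 : IsElementary b v) (g : AffineWeylGroup P) (x : Hecke q) :
    twist q (g * v) x - twist q g x ∈ relIdeal q Γ := by
  have hd : Env.diff (T q v) ∈ relIdeal q Γ := Submodule.subset_span ⟨v, hv, rfl⟩
  have main : T q g * T q v = T q (g * v) → twist q (g * v) x - twist q g x ∈ relIdeal q Γ := by
    intro h
    have := twist_mul_diff q h (Tinv q (g * v) * x)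
    rw [T_mul_Tinv_mul] at this
    rw [← this]
    exact (relIdeal q Γ).smul_mem _ hd
  rcases hv2 with hv2 | ⟨a, rfl⟩
  · exact main (T_mul_of_length_eq_zero_right q hv2 g)
  · rcases length_mul_simpleRefl (b := b) g a with h | h
    · refine main ?_
      rw [T_mul_simpleRefl, if_pos (by omega)]
    · have := twist_mul_diff_of_lt q (g := g) (a := a) (by omega) (Tinv q (g * simpleRefl a) * x)
      rw [T_mul_Tinv_mul] at this
      have h2 := complex_smul_mem _ ((q (simpleRefl a) : ℂ)⁻¹) ((relIdeal q Γ).smul_mem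
        (Env.tmul (T q g) (Tinv q (g * simpleRefl a) * x)) hd)
      rw [smul_eq_mul, this, inv_smul_smul₀ (q_ne_zero q _)] at h2
      exact h2

lemma map_mul_diff_eq_zero {M : Type*} [AddCommGroup M] [Module ℂ M]
    (φ : Env (Hecke q) →ₗ[ℂ] M) {v : AffineWeylGroup P} (hv : IsElementary b v)
    (h : ∀ g x, φ (twist q (g * v) x) = φ (twist q g x)) (x : Env (Hecke q)) :
    φ (x * Env.diff (T q v)) = 0 := by
  induction x using env_induction with
  | h0 => simp
  | h1 x y hx hy => rw [add_mul, map_add, hx, hy, add_zero]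
  | h2 g x =>
    rw [twist_apply]
    rcases hv with hv | ⟨a, rfl⟩
    · rw [twist_mul_diff q (T_mul_of_length_eq_zero_right q hv g), map_sub, h, sub_self]
    · rcases length_mul_simpleRefl (b := b) g a with h1 | h1
      · rw [twist_mul_diff q (by rw [T_mul_simpleRefl, if_pos (by omega)]), map_sub, h, sub_self]
      · rw [twist_mul_diff_of_lt q (by omega), map_smul, map_sub, h, sub_self, smul_zero]

variable {q} in
lemma map_relIdeal_eq_zero {M : Type*} [AddCommGroup M] [Module ℂ M]
    (φ : Env (Hecke q) →ₗ[ℂ] M) {Γ : Set (AffineWeylGroup P)}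
    (hΓ : ∀ v ∈ Γ, IsElementary b v)
    (h : ∀ v ∈ Γ, ∀ g x, φ (twist q (g * v) x) = φ (twist q g x))
    {x : Env (Hecke q)} (hx : x ∈ relIdeal q Γ) : φ x = 0 := by
  induction hx using Submodule.span_induction with
  | mem x hx =>
    obtain ⟨v, hv, rfl⟩ := hx
    simpa using map_mul_diff_eq_zero q φ (hΓ v hv) (h v hv) 1
  | zero => simp
  | add x y _ _ hx hy => rw [map_add, hx, hy, add_zero]
  | smul e x hx' ih =>
    clear ih
    induction hx' using Submodule.span_induction generalizing e with
    | mem x hx =>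
      obtain ⟨v, hv, rfl⟩ := hx
      exact map_mul_diff_eq_zero q φ (hΓ v hv) (h v hv) e
    | zero => simp
    | add x y _ _ hx hy => rw [smul_add, map_add, hx, hy, add_zero]
    | smul e' x _ ih => rw [← mul_smul]; exact ih _

/-- The projection of the enveloping algebra on the span of the cosets of `G`. -/
def cosetMap (G : Subgroup (AffineWeylGroup P)) :
    Env (Hecke q) →ₗ[ℂ] (AffineWeylGroup P ⧸ G →₀ Hecke q) :=
  Finsupp.lmapDomain _ ℂ (QuotientGroup.mk : AffineWeylGroup P → AffineWeylGroup P ⧸ G) ∘ₗ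
    (envEquiv q).symm.toLinearMap

@[simp]
lemma cosetMap_twist (G : Subgroup (AffineWeylGroup P)) (g : AffineWeylGroup P)
    (h : Hecke q) : cosetMap q G (twist q g h) = Finsupp.single (g : AffineWeylGroup P ⧸ G) h := by
  simp [cosetMap]

variable {q} in
lemma twist_sub_mem_of_mem_closure {Γ : Set (AffineWeylGroup P)} (hΓ : ∀ v ∈ Γ, IsElementary b v)
    {v : AffineWeylGroup P} (hv : v ∈ Subgroup.closure Γ) (g : AffineWeylGroup P)
    (x : Hecke q) : twist q (g * v) x - twist q g x ∈ relIdeal q Γ := by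
  induction hv using Subgroup.closure_induction generalizing g with
  | mem v hv => exact twist_sub_mem hv (hΓ v hv) g x
  | one => simp
  | mul v w _ _ hv hw =>
    have := add_mem (hw (g * v)) (hv g)
    rwa [sub_add_sub_cancel, mul_assoc] at this
  | inv v _ hv =>
    have := neg_mem (hv (g * v⁻¹))
    rwa [inv_mul_cancel_right, neg_sub] at this

variable {q} in
-- Modulo the ideal, `twist q g h` depends only on `h` and the coset of `g`. So the quotient is a
-- sum of copies of the Hecke algebra indexed by the cosets of `⟨Γ⟩`.
theorem mem_relIdeal_iff {Γ : Set (AffineWeylGroup P)} (hΓ : ∀ v ∈ Γ, IsElementary b v)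
    {x : Env (Hecke q)} :
    x ∈ relIdeal q Γ ↔ cosetMap q (Subgroup.closure Γ) x = 0 := by
  constructor
  · intro hx
    refine map_relIdeal_eq_zero (cosetMap q (Subgroup.closure Γ)) hΓ (fun v hv g y => ?_) hx
    rw [cosetMap_twist, cosetMap_twist, (QuotientGroup.mk_mul_of_mem g (Subgroup.subset_closure hv))]
  · have key : ∀ x : Env (Hecke q),
        (relIdeal q Γ).mkQ x = (cosetMap q (Subgroup.closure Γ) x).sum
          fun c h => (relIdeal q Γ).mkQ (twist q c.out h) := by
      intro x
      have hadd : ∀ (x y : AffineWeylGroup P ⧸ Subgroup.closure Γ →₀ Hecke q),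
          ((x + y).sum fun c h => (relIdeal q Γ).mkQ (twist q c.out h)) =
          (x.sum fun c h => (relIdeal q Γ).mkQ (twist q c.out h)) +
          (y.sum fun c h => (relIdeal q Γ).mkQ (twist q c.out h)) := fun x y =>
        Finsupp.sum_add_index' (by simp) (by simp)
      induction x using env_induction with
      | h0 => simp
      | h1 x y hx hy => rw [map_add, map_add, hadd, hx, hy]
      | h2 g h =>
        rw [cosetMap_twist, Finsupp.sum_single_index (by simp), ← sub_eq_zero, ← map_sub,
          Submodule.mkQ_apply, Submodule.Quotient.mk_eq_zero]
        obtain ⟨v, hv⟩ := QuotientGroup.mk_out_eq_mul (Subgroup.closure Γ) g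
        rw [hv, ← neg_mem_iff, neg_sub]
        exact twist_sub_mem_of_mem_closure hΓ v.2 g h
    intro hx
    rw [← Submodule.Quotient.mk_eq_zero, ← Submodule.mkQ_apply, key, hx, Finsupp.sum_zero_index]

lemma isElementary_simpleRefl (a : Node b) : IsElementary b (simpleRefl a) := Or.inr ⟨a, rfl⟩

/-- The ideal is spanned by the differences over pairs `{g, g s}`, and these span the antisymmetric
functions. -/
lemma mem_relIdeal_simpleRefl_iff (a : Node b) {x : Env (Hecke q)} :
    x ∈ relIdeal q {simpleRefl a} ↔
      ∀ g, (envEquiv q).symm x (g * simpleRefl a) = - (envEquiv q).symm x g := by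
  constructor
  · intro hx g
    have := map_relIdeal_eq_zero
      ((Finsupp.lapply (g * simpleRefl a) + Finsupp.lapply g) ∘ₗ (envEquiv q).symm.toLinearMap)
      (Γ := {simpleRefl a})
      (by rintro _ rfl; exact isElementary_simpleRefl a) (by
        rintro _ rfl v h
        classical
        have e1 : v * simpleRefl a = g ↔ v = g * simpleRefl a :=
          ⟨fun h => by rw [← h, simpleRefl_mul_cancel_right], fun h => by
            rw [h, simpleRefl_mul_cancel_right]⟩
        simp [Finsupp.single_apply, e1]
        rw [add_comm]) hx
    exact eq_neg_of_add_eq_zero_left this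
  · intro hx
    have key : ∀ m : AffineWeylGroup P →₀ Hecke q,
        envEquiv q (m - Finsupp.mapDomain (· * simpleRefl a) m) ∈ relIdeal q {simpleRefl a} := by
      intro m
      induction m using Finsupp.induction_linear with
      | zero => simp
      | add f g hf hg =>
        rw [Finsupp.mapDomain_add, add_sub_add_comm, map_add]
        exact add_mem hf hg
      | single g h =>
        rw [Finsupp.mapDomain_single, map_sub, envEquiv_single, envEquiv_single, ← neg_mem_iff,
          neg_sub]
        exact twist_sub_mem (Set.mem_singleton _) (isElementary_simpleRefl a) g h
    have h1 : Finsupp.mapDomain (· * simpleRefl a) ((envEquiv q).symm x) = - (envEquiv q).symm x := by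
      ext g
      have : g = (fun g => g * simpleRefl a) (g * simpleRefl a) := by
        simp [simpleRefl_mul_cancel_right]
      conv_lhs => rw [this]
      rw [Finsupp.mapDomain_apply (mul_left_injective _), hx, Finsupp.neg_apply]
    -- An antisymmetric function is half of the difference between itself and its right translate.
    have h2 := complex_smul_mem _ (2⁻¹ : ℂ) (key ((envEquiv q).symm x))
    rw [h1, sub_neg_eq_add, ← two_smul ℂ, map_smul, inv_smul_smul₀ two_ne_zero,
      LinearEquiv.apply_symm_apply] at h2
    exact h2

end Bimodule

end AffineHecke
end

noncomputable section
set_option linter.unusedSectionVars false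
namespace AffineHecke

/-! ### Projective dimension in short exact sequences of subquotients. -/

section ProjectiveDimension

variable (R : Type u) [Ring R]

/-- The projective dimension of the module `M` is less than `n`. -/
def PdLT (M : Type u) [AddCommGroup M] [Module R M] (n : ℕ) : Prop :=
  HasProjectiveDimensionLT (ModuleCat.of R M) n

variable {R} {M M' M'' : Type u} [AddCommGroup M] [Module R M] [AddCommGroup M'] [Module R M']
  [AddCommGroup M''] [Module R M'']

lemma PdLT.mono {m n : ℕ} (h : PdLT R M m) (hmn : m ≤ n) : PdLT R M n :=
  have : HasProjectiveDimensionLT (ModuleCat.of R M) m := h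
  hasProjectiveDimensionLT_of_ge _ m n hmn

lemma PdLT.retract {n : ℕ} (h : PdLT R M n) (i : M' →ₗ[R] M) (r : M →ₗ[R] M')
    (hri : ∀ x, r (i x) = x) : PdLT R M' n :=
  have : HasProjectiveDimensionLT (ModuleCat.of R M) n := h
  Retract.hasProjectiveDimensionLT (X := ModuleCat.of R M') (Y := ModuleCat.of R M)
    { i := ModuleCat.ofHom i, r := ModuleCat.ofHom r, retract := by ext x; exact hri x } n

lemma PdLT.equiv {n : ℕ} (h : PdLT R M n) (e : M ≃ₗ[R] M') : PdLT R M' n :=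
  h.retract e.symm.toLinearMap e.toLinearMap (by simp)

lemma pdLT_zero_of_subsingleton [Subsingleton M] (n : ℕ) : PdLT R M n :=
  PdLT.mono (m := 0) (ModuleCat.isZero_of_subsingleton (ModuleCat.of R M)).hasProjectiveDimensionLT_zero
    (Nat.zero_le _)

lemma pdLT_one_iff : PdLT R M 1 ↔ Module.Projective R M := by
  rw [PdLT, ← projective_iff_hasProjectiveDimensionLT_one]
  exact (IsProjective.iff_projective M).symm

lemma shortExact_of {f : M →ₗ[R] M'} {g : M' →ₗ[R] M''} (hf : Function.Injective f)
    (hfg : Function.Exact f g) (hg : Function.Surjective g) :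
    (ShortComplex.mk (ModuleCat.ofHom f) (ModuleCat.ofHom g) (by
      ext x; exact hfg.apply_apply_eq_zero x)).ShortExact where
  exact := by
    rw [ShortComplex.ShortExact.moduleCat_exact_iff_function_exact]
    exact hfg
  mono_f := (ModuleCat.mono_iff_injective _).2 hf
  epi_g := (ModuleCat.epi_iff_surjective _).2 hg

lemma pdLT_right_of_exact {n : ℕ} {f : M →ₗ[R] M'} {g : M' →ₗ[R] M''} (hf : Function.Injective f)
    (hfg : Function.Exact f g) (hg : Function.Surjective g) (h₁ : PdLT R M n)
    (h₂ : PdLT R M' (n + 1)) : PdLT R M'' (n + 1) :=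
  (shortExact_of hf hfg hg).hasProjectiveDimensionLT_X₃ n h₁ h₂

lemma pdLT_left_of_exact {n : ℕ} {f : M →ₗ[R] M'} {g : M' →ₗ[R] M''} (hf : Function.Injective f)
    (hfg : Function.Exact f g) (hg : Function.Surjective g) (h₂ : PdLT R M' n)
    (h₃ : PdLT R M'' (n + 1)) : PdLT R M n :=
  (shortExact_of hf hfg hg).hasProjectiveDimensionLT_X₁ n h₂ h₃

variable {E : Type u} [AddCommGroup E] [Module R E]

lemma submoduleOf_le_comap_inclusion (N J S : Submodule R E) :
    J.submoduleOf (N ⊓ S) ≤ Submodule.comap (Submodule.inclusion inf_le_left) (J.submoduleOf N) :=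
  fun _ hx => hx

lemma submoduleOf_le_comap_id (N J S : Submodule R E) :
    J.submoduleOf N ≤ Submodule.comap LinearMap.id ((J ⊔ S).submoduleOf N) :=
  fun _ hx => (le_sup_left : J ≤ J ⊔ S) hx

/-- The inclusion of subquotients `(N ⊓ S) / J → N / J`. -/
def subquotInl (N J S : Submodule R E) :
    ↥(N ⊓ S) ⧸ J.submoduleOf (N ⊓ S) →ₗ[R] N ⧸ J.submoduleOf N :=
  Submodule.mapQ _ _ (Submodule.inclusion inf_le_left) (submoduleOf_le_comap_inclusion N J S)

/-- The projection of subquotients `N / J → N / (J ⊔ S)`. -/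
def subquotProj (N J S : Submodule R E) :
    N ⧸ J.submoduleOf N →ₗ[R] N ⧸ (J ⊔ S).submoduleOf N :=
  Submodule.mapQ _ _ LinearMap.id (submoduleOf_le_comap_id N J S)

lemma subquotInl_injective (N J S : Submodule R E) : Function.Injective (subquotInl N J S) := by
  rw [injective_iff_map_eq_zero]
  intro x hx
  obtain ⟨x, rfl⟩ := Submodule.Quotient.mk_surjective _ x
  rw [subquotInl, Submodule.mapQ_apply, Submodule.Quotient.mk_eq_zero] at hx
  rw [Submodule.Quotient.mk_eq_zero]
  exact hx

lemma subquotProj_surjective (N J S : Submodule R E) : Function.Surjective (subquotProj N J S) := by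
  intro x
  obtain ⟨x, rfl⟩ := Submodule.Quotient.mk_surjective _ x
  exact ⟨Submodule.Quotient.mk x, rfl⟩

/-- Exactness in the middle rests on distributivity for the three submodules, which the modular law
does not supply. -/
lemma subquot_exact {N J S : Submodule R E} (h : N ⊓ (J ⊔ S) ≤ (N ⊓ J) ⊔ (N ⊓ S)) :
    Function.Exact (subquotInl N J S) (subquotProj N J S) := by
  intro x
  constructor
  · intro hx
    obtain ⟨x, rfl⟩ := Submodule.Quotient.mk_surjective _ x
    rw [subquotProj, Submodule.mapQ_apply, Submodule.Quotient.mk_eq_zero] at hx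
    obtain ⟨y, hy, z, hz, hyz⟩ := Submodule.mem_sup.1 (h ⟨x.2, hx⟩)
    refine ⟨Submodule.Quotient.mk ⟨z, hz⟩, ?_⟩
    rw [subquotInl, Submodule.mapQ_apply, Submodule.Quotient.eq]
    change z - (x : E) ∈ J
    rw [← hyz, sub_add_cancel_right]
    exact neg_mem hy.2
  · rintro ⟨x, rfl⟩
    obtain ⟨x, rfl⟩ := Submodule.Quotient.mk_surjective _ x
    rw [subquotInl, Submodule.mapQ_apply, subquotProj, Submodule.mapQ_apply,
      Submodule.Quotient.mk_eq_zero]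
    exact (le_sup_right : S ≤ J ⊔ S) x.2.2

end ProjectiveDimension

/-! ### A basis adapted to all simple reflections, and the resulting distributive lattice. -/

section Adapted

variable {ι X Y : Type u} [AddCommGroup X] [AddCommGroup Y] {P : RootDatum ι X Y} {b : P.Base}
  [Finite ι] [P.IsReduced]

variable (b) in
/-- The elements of the parabolic subgroup generated by the descents of `g`. -/
def descentFinset (g : AffineWeylGroup P) : Finset (AffineWeylGroup P) :=
  (show (parabolic (descents b g) : Set (AffineWeylGroup P)).Finite from
    Set.finite_coe_iff.1 (finite_parabolic (not_containsComponent_descents g))).toFinset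

lemma mem_descentFinset {g u : AffineWeylGroup P} :
    u ∈ descentFinset b g ↔ u ∈ parabolic (descents b g) := by
  simp [descentFinset]

variable (b) (H : Type u) [AddCommGroup H] [Module ℂ H]

/-- The alternating sum over the coset of `g` with respect to the parabolic subgroup generated by
the descents of `g`. -/
def alternating (g : AffineWeylGroup P) : H →ₗ[ℂ] (AffineWeylGroup P →₀ H) :=
  ∑ u ∈ descentFinset b g, (-1 : ℂ) ^ length b u • Finsupp.lsingle (g * u)

lemma alternating_apply (g v : AffineWeylGroup P) (h : H) [Decidable (g⁻¹ * v ∈ parabolic (descents b g))] :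
    alternating b H g h v =
      if g⁻¹ * v ∈ parabolic (descents b g) then (-1 : ℂ) ^ length b (g⁻¹ * v) • h else 0 := by
  classical
  have : ∀ u, (g * u = v) ↔ u = g⁻¹ * v := fun u => by rw [eq_inv_mul_iff_mul_eq]
  simp only [alternating, LinearMap.sum_apply, LinearMap.smul_apply, Finsupp.lsingle_apply,
    Finsupp.finsetSum_apply, Finsupp.smul_apply, Finsupp.single_apply, this, smul_ite, smul_zero]
  rw [Finset.sum_ite_eq']
  simp only [mem_descentFinset]

lemma alternating_apply_self (g : AffineWeylGroup P) (h : H) : alternating b H g h g = h := by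
  classical
  rw [alternating_apply, inv_mul_cancel, if_pos (one_mem _), length_one, pow_zero, one_smul]

/-- As `g` is the unique longest element of its coset, the alternating sums are triangular with
respect to length. This makes them a system of coordinates. -/
lemma alternating_apply_of_le {g v : AffineWeylGroup P} (hv : length b g ≤ length b v) (hgv : v ≠ g)
    (h : H) : alternating b H g h v = 0 := by
  classical
  rw [alternating_apply, if_neg]
  intro hmem
  have := length_mul_lt_of_mem_parabolic (b := b) le_rfl hmem (by
    rwa [Ne, inv_mul_eq_one, eq_comm])
  rw [mul_inv_cancel_left] at this
  omega

lemma alternating_apply_mul_simpleRefl {g : AffineWeylGroup P} {a : Node b} (ha : a ∈ descents b g)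
    (v : AffineWeylGroup P) (h : H) :
    alternating b H g h (v * simpleRefl a) = - alternating b H g h v := by
  classical
  have hs := simpleRefl_mem_parabolic ha
  rw [alternating_apply, alternating_apply, ← mul_assoc]
  have h1 := length_mul_simpleRefl (b := b) (g⁻¹ * v) a
  by_cases hm : g⁻¹ * v ∈ parabolic (descents b g)
  · rw [if_pos hm, if_pos (mul_mem hm hs)]
    rcases h1 with h1 | h1
    · rw [h1, pow_succ, mul_neg_one, neg_smul]
    · rw [← h1, pow_succ, mul_neg_one, neg_smul, neg_neg]
  · rw [if_neg hm, if_neg, neg_zero]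
    intro h2
    have := mul_mem h2 hs
    rw [simpleRefl_mul_cancel_right] at this
    exact hm this

/-- The change of coordinates given by alternating sums. -/
def altMap : (AffineWeylGroup P →₀ H) →ₗ[ℂ] (AffineWeylGroup P →₀ H) :=
  Finsupp.lsum ℂ (alternating b H)

lemma altMap_single (g : AffineWeylGroup P) (h : H) :
    altMap b H (Finsupp.single g h) = alternating b H g h := by
  rw [altMap, Finsupp.lsum_single]

lemma altMap_apply (m : AffineWeylGroup P →₀ H) (v : AffineWeylGroup P) :
    altMap b H m v = ∑ g ∈ m.support, alternating b H g (m g) v := by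
  rw [altMap, Finsupp.lsum_apply, Finsupp.sum, Finsupp.finsetSum_apply]

lemma altMap_apply_of_le {m : AffineWeylGroup P →₀ H} {v : AffineWeylGroup P}
    (hv : ∀ g ∈ m.support, length b g ≤ length b v) : altMap b H m v = m v := by
  rw [altMap_apply, Finset.sum_eq_single v]
  · exact alternating_apply_self b H v _
  · intro g hg hgv
    exact alternating_apply_of_le b H (hv g hg) hgv.symm _
  · intro hv
    rw [Finsupp.notMem_support_iff.1 hv, map_zero, Finsupp.zero_apply]

lemma altMap_injective : Function.Injective (altMap b H) := by
  rw [injective_iff_map_eq_zero]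
  intro m hm
  by_contra hne
  obtain ⟨v, hv, hmax⟩ := Finset.exists_max_image m.support (length b)
    (Finsupp.support_nonempty_iff.2 hne)
  have := altMap_apply_of_le b H hmax
  rw [hm] at this
  exact Finsupp.mem_support_iff.1 hv this.symm

lemma altMap_surjective : Function.Surjective (altMap b H) := by
  rw [← LinearMap.range_eq_top, eq_top_iff]
  have key : ∀ (n : ℕ) (g : AffineWeylGroup P), length b g = n → ∀ h,
      Finsupp.single g h ∈ LinearMap.range (altMap b H) := by
    intro n
    induction n using Nat.strong_induction_on with
    | _ n ih =>
      intro g hg h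
      have h1 : Finsupp.single g h = alternating b H g h -
          (alternating b H g h - Finsupp.single g h) := by abel
      rw [h1]
      refine sub_mem ⟨Finsupp.single g h, altMap_single b H g h⟩ ?_
      rw [← Finsupp.sum_single (alternating b H g h - Finsupp.single g h)]
      refine sum_mem fun v hv => ?_
      rw [Finsupp.mem_support_iff, Finsupp.sub_apply] at hv
      have hvg : v ≠ g := by
        rintro rfl
        rw [alternating_apply_self, Finsupp.single_eq_same, sub_self] at hv
        exact hv rfl
      rw [Finsupp.single_eq_of_ne hvg, sub_zero] at hv
      refine ih (length b v) ?_ v rfl _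
      by_contra hle
      exact hv (alternating_apply_of_le b H (by omega) hvg h)
  rintro m -
  rw [← Finsupp.sum_single m]
  exact sum_mem fun g _ => key _ g rfl _

/-- The change of coordinates given by alternating sums, as an equivalence. -/
def altEquiv : (AffineWeylGroup P →₀ H) ≃ₗ[ℂ] (AffineWeylGroup P →₀ H) :=
  LinearEquiv.ofBijective (altMap b H) ⟨altMap_injective b H, altMap_surjective b H⟩

lemma altEquiv_apply (m : AffineWeylGroup P →₀ H) : altEquiv b H m = altMap b H m := rfl

variable {b} (q : ParameterFunction b)

/-- The coordinates on the enveloping algebra that are adapted to all ideals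
`relIdeal q {simpleRefl a}`. -/
def adapted : Env (Hecke q) ≃ₗ[ℂ] (AffineWeylGroup P →₀ Hecke q) :=
  (envEquiv q).symm.trans (altEquiv b (Hecke q)).symm

lemma adapted_symm_single_mem {g : AffineWeylGroup P} {a : Node b} (ha : a ∈ descents b g)
    (h : Hecke q) : (adapted q).symm (Finsupp.single g h) ∈ relIdeal q {simpleRefl a} := by
  rw [mem_relIdeal_simpleRefl_iff]
  intro v
  have : (envEquiv q).symm ((adapted q).symm (Finsupp.single g h)) = alternating b _ g h := by
    simp [adapted, altEquiv_apply, altMap_single]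
  rw [this]
  exact alternating_apply_mul_simpleRefl b _ ha v h

lemma mem_of_adapted {N : Submodule (Env (Hecke q)) (Env (Hecke q))} {x : Env (Hecke q)}
    (h : ∀ g, adapted q x g ≠ 0 → ∀ y, (adapted q).symm (Finsupp.single g y) ∈ N) : x ∈ N := by
  rw [← (adapted q).symm_apply_apply x, ← Finsupp.sum_single (adapted q x), Finsupp.sum, map_sum]
  exact sum_mem fun g hg => h g (Finsupp.mem_support_iff.1 hg) _

/-- Components at elements with `a` as a descent lie in the ideal. Once they are removed from an
element of the ideal, the rest is still antisymmetric; at a longest `v` in its support, `v s_a` is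
longer and has coefficient zero, hence so has `v`, a contradiction. -/
theorem mem_relIdeal_simpleRefl_iff_adapted (a : Node b) {x : Env (Hecke q)} :
    x ∈ relIdeal q {simpleRefl a} ↔ ∀ g, adapted q x g ≠ 0 → a ∈ descents b g := by
  classical
  constructor
  · intro hx
    by_contra! hcon
    obtain ⟨g₀, hg₀, hag₀⟩ := hcon
    set m := adapted q x with hm
    set m₁ := m.filter (fun g => a ∈ descents b g) with hm1
    set m₂ := m.filter (fun g => ¬ a ∈ descents b g) with hm2
    have hsum : m₁ + m₂ = m := Finsupp.filter_add_filter_not m _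
    have h1 : (adapted q).symm m₁ ∈ relIdeal q {simpleRefl a} := by
      refine mem_of_adapted q fun g hg y => ?_
      rw [LinearEquiv.apply_symm_apply] at hg
      refine adapted_symm_single_mem q ?_ y
      by_contra hn
      exact hg (Finsupp.filter_apply_neg _ m hn)
    have h2 : (adapted q).symm m₂ ∈ relIdeal q {simpleRefl a} := by
      have h3 : x = (adapted q).symm m₁ + (adapted q).symm m₂ := by
        rw [← map_add, hsum, hm, LinearEquiv.symm_apply_apply]
      have h4 := sub_mem hx h1
      rwa [h3, add_sub_cancel_left] at h4
    rw [mem_relIdeal_simpleRefl_iff] at h2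
    have h5 : (envEquiv q).symm ((adapted q).symm m₂) = altMap b _ m₂ := by
      simp [adapted, altEquiv_apply]
    rw [h5] at h2
    have hne : m₂.support.Nonempty :=
      ⟨g₀, Finsupp.mem_support_iff.2
        ((Finsupp.filter_apply_pos (fun g => a ∉ descents b g) m hag₀).trans_ne hg₀)⟩
    obtain ⟨v, hv, hmax⟩ := Finset.exists_max_image m₂.support (length b) hne
    have hva : a ∉ descents b v := by
      by_contra hn
      exact Finsupp.mem_support_iff.1 hv (Finsupp.filter_apply_neg _ m (not_not.2 hn))
    have hlt : length b v < length b (v * simpleRefl a) := by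
      have := length_mul_simpleRefl (b := b) v a
      simp only [descents, Set.mem_ofPred_eq, not_lt] at hva
      omega
    have h6 := h2 v
    rw [altMap_apply_of_le b _ hmax,
      altMap_apply_of_le b _ (fun g hg => (hmax g hg).trans hlt.le)] at h6
    have h7 : m₂ (v * simpleRefl a) = 0 := by
      by_contra hn
      have := hmax _ (Finsupp.mem_support_iff.2 hn)
      omega
    rw [h7, eq_comm, neg_eq_zero] at h6
    exact Finsupp.mem_support_iff.1 hv h6
  · intro h
    exact mem_of_adapted q fun g hg y => adapted_symm_single_mem q (h g hg) y

/-- The left ideal attached to a set of nodes. -/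
def nodeSup (J : Set (Node b)) : Submodule (Env (Hecke q)) (Env (Hecke q)) :=
  relIdeal q (simpleRefl '' J)

/-- The intersection of the left ideals attached to the elements of a set of nodes. -/
def nodeInf (F : Set (Node b)) : Submodule (Env (Hecke q)) (Env (Hecke q)) :=
  ⨅ a ∈ F, relIdeal q {simpleRefl a}

lemma mem_nodeInf_iff {F : Set (Node b)} {x : Env (Hecke q)} :
    x ∈ nodeInf q F ↔ ∀ g, adapted q x g ≠ 0 → F ⊆ descents b g := by
  simp only [nodeInf, Submodule.mem_iInf, mem_relIdeal_simpleRefl_iff_adapted]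
  exact ⟨fun h g hg a ha => h a ha g hg, fun h a ha g hg => h g hg ha⟩

lemma mem_nodeSup_iff {J : Set (Node b)} {x : Env (Hecke q)} :
    x ∈ nodeSup q J ↔ ∀ g, adapted q x g ≠ 0 → ∃ a ∈ J, a ∈ descents b g := by
  constructor
  · intro hx g hg
    by_contra! hcon
    refine hg (map_relIdeal_eq_zero (Finsupp.lapply g ∘ₗ (adapted q).toLinearMap)
      (Γ := simpleRefl '' J) ?_ ?_ hx)
    · rintro _ ⟨a, _, rfl⟩
      exact isElementary_simpleRefl a
    · rintro _ ⟨a, ha, rfl⟩ v y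
      have h1 := twist_sub_mem (q := q) (Set.mem_singleton _) (isElementary_simpleRefl a) v y
      rw [mem_relIdeal_simpleRefl_iff_adapted] at h1
      rw [← sub_eq_zero, ← map_sub]
      by_contra hn
      exact hcon a ha (h1 g hn)
  · intro h
    refine mem_of_adapted q fun g hg y => ?_
    obtain ⟨a, ha, hag⟩ := h g hg
    exact Submodule.span_mono (Set.image_mono (Set.singleton_subset_iff.2 (Set.mem_image_of_mem _ ha)))
      (adapted_symm_single_mem q hag y)

lemma nodeInf_insert (F : Set (Node b)) (a : Node b) :
    nodeInf q (insert a F) = nodeInf q F ⊓ relIdeal q {simpleRefl a} := by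
  ext x
  rw [Submodule.mem_inf, mem_nodeInf_iff, mem_nodeInf_iff, mem_relIdeal_simpleRefl_iff_adapted]
  simp only [Set.insert_subset_iff]
  exact ⟨fun h => ⟨fun g hg => (h g hg).2, fun g hg => (h g hg).1⟩,
    fun h g hg => ⟨h.2 g hg, h.1 g hg⟩⟩

lemma nodeSup_insert (J : Set (Node b)) (a : Node b) :
    nodeSup q (insert a J) = nodeSup q J ⊔ relIdeal q {simpleRefl a} := by
  rw [nodeSup, nodeSup, relIdeal, relIdeal, relIdeal, ← Submodule.span_union, ← Set.image_union,
    Set.image_insert_eq, Set.union_comm, Set.singleton_union]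

/-- In adapted coordinates all these ideals are coordinate subspaces, so that intersections and sums
become intersections and unions of index sets. -/
lemma node_distrib (F J : Set (Node b)) (a : Node b) :
    nodeInf q F ⊓ (nodeSup q J ⊔ relIdeal q {simpleRefl a}) ≤
      (nodeInf q F ⊓ nodeSup q J) ⊔ (nodeInf q F ⊓ relIdeal q {simpleRefl a}) := by
  rintro x ⟨h1, h2⟩
  rw [← nodeSup_insert] at h2
  rw [SetLike.mem_coe, mem_nodeInf_iff] at h1
  rw [SetLike.mem_coe, mem_nodeSup_iff] at h2
  have hsingle : ∀ g y g', adapted q ((adapted q).symm (Finsupp.single g y)) g' ≠ 0 → g' = g := by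
    intro g y g' h
    rw [LinearEquiv.apply_symm_apply] at h
    by_contra hn
    exact h (Finsupp.single_eq_of_ne hn)
  refine mem_of_adapted q fun g hg y => ?_
  have h3 : (adapted q).symm (Finsupp.single g y) ∈ nodeInf q F := by
    rw [mem_nodeInf_iff]
    intro g' hg'
    rw [hsingle g y g' hg']
    exact h1 g hg
  obtain ⟨c, hc, hcg⟩ := h2 g hg
  rcases Set.mem_insert_iff.1 hc with rfl | hc
  · exact Submodule.mem_sup_right ⟨h3, adapted_symm_single_mem q hcg y⟩
  · refine Submodule.mem_sup_left ⟨h3, ?_⟩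
    rw [SetLike.mem_coe, mem_nodeSup_iff]
    intro g' hg'
    rw [hsingle g y g' hg']
    exact ⟨c, hc, hcg⟩

/-- The projective dimension of the subquotient attached to `J` and `F` is less than `n`. -/
def NodePdLT (F J : Set (Node b)) (n : ℕ) : Prop :=
  PdLT (Env (Hecke q)) (nodeInf q F ⧸ (nodeSup q J).submoduleOf (nodeInf q F)) n

variable {q}

/-- The subquotients of `(F ∪ {a}, J)`, `(F, J)` and `(F, J ∪ {a})` form a short exact sequence.
Here it is read at its right end, in `NodePdLT.insert_left` at its left end. -/
lemma NodePdLT.of_insert {F J : Set (Node b)} {a : Node b} {n : ℕ}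
    (h₁ : NodePdLT q (insert a F) J n) (h₂ : NodePdLT q F J (n + 1)) :
    NodePdLT q F (insert a J) (n + 1) := by
  rw [NodePdLT, nodeInf_insert] at h₁
  rw [NodePdLT, nodeSup_insert]
  exact pdLT_right_of_exact (subquotInl_injective _ _ _) (subquot_exact (node_distrib q F J a))
    (subquotProj_surjective _ _ _) h₁ h₂

lemma NodePdLT.insert_left {F J : Set (Node b)} {a : Node b} {n : ℕ}
    (h₂ : NodePdLT q F J n) (h₃ : NodePdLT q F (insert a J) (n + 1)) :
    NodePdLT q (insert a F) J n := by
  rw [NodePdLT, nodeInf_insert]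
  rw [NodePdLT, nodeSup_insert] at h₃
  exact pdLT_left_of_exact (subquotInl_injective _ _ _) (subquot_exact (node_distrib q F J a))
    (subquotProj_surjective _ _ _) h₂ h₃

/-- No element of `W` has all nodes of a component as descents, so no adapted coordinate can be
nonzero on the intersection. -/
lemma nodeInf_eq_bot {F : Set (Node b)} (hF : ContainsComponent F) : nodeInf q F = ⊥ := by
  rw [eq_bot_iff]
  intro x hx
  rw [mem_nodeInf_iff] at hx
  rw [Submodule.mem_bot, ← (adapted q).map_eq_zero_iff]
  ext g
  by_contra hg
  obtain ⟨θ, h1, h2, h3⟩ := hF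
  exact not_containsComponent_descents g ⟨θ, h1, Set.image_mono (hx g hg) h2,
    fun i hi hn => Set.image_mono (hx g hg) (h3 i hi hn)⟩

lemma nodePdLT_of_containsComponent {F : Set (Node b)} (hF : ContainsComponent F) (J : Set (Node b))
    (n : ℕ) : NodePdLT q F J n := by
  rw [NodePdLT, nodeInf_eq_bot hF]
  exact pdLT_zero_of_subsingleton n

end Adapted

end AffineHecke
end

noncomputable section
set_option linter.unusedSectionVars false
namespace AffineHecke

section Env

variable {A : Type u} [Ring A] [Algebra ℂ A]

variable (A) in
/-- The multiplication map of an algebra. -/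
def Env.mulMap : Env A →ₗ[ℂ] A := Env.lift (LinearMap.mul ℂ A)

lemma Env.mulMap_tmul (a b : A) : Env.mulMap A (Env.tmul a b) = a * b := by
  rw [mulMap, lift_tmul, LinearMap.mul_apply']

lemma Env.mulMap_tmul_mul (a b : A) (x : Env A) :
    Env.mulMap A (Env.tmul a b * x) = a * Env.mulMap A x * b := by
  induction x using Env.induction with
  | h0 => simp
  | h1 x y hx hy => rw [mul_add, map_add, map_add, hx, hy, mul_add, add_mul]
  | h2 c d => simp [tmul_mul_tmul, mulMap_tmul, mul_assoc]

lemma Env.mulMap_diff_mul (a : A) (x : Env A) :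
    Env.mulMap A (Env.diff a * x) = a * Env.mulMap A x - Env.mulMap A x * a := by
  rw [Env.diff, sub_mul, map_sub, mulMap_tmul_mul, mulMap_tmul_mul, mul_one, one_mul]

lemma Env.diff_mul_tmul (a b c : A) :
    Env.diff c * Env.tmul a b = Env.tmul (c * a) b - Env.tmul a (b * c) := by
  rw [Env.diff, sub_mul, Env.tmul_mul_tmul, Env.tmul_mul_tmul, mul_one, one_mul]

end Env

/-! ### Casimir elements, projectivity for finite parabolics, and the count of nodes. -/

section Casimir

variable {ι X Y : Type u} [AddCommGroup X] [AddCommGroup Y] {P : RootDatum ι X Y} {b : P.Base}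
  (q : ParameterFunction b) [Finite ι] [P.IsReduced]

open ComplexConjugate

lemma q_mul_of_lt {a : Node b} {g : AffineWeylGroup P}
    (h : length b g < length b (simpleRefl a * g)) :
    q (simpleRefl a * g) = q (simpleRefl a) * q g := by
  refine q.mul_of_length_add _ _ ?_
  have := length_simpleRefl_mul g a
  rw [length_simpleRefl]; omega

lemma simpleRefl_mul_ne (a : Node b) (g : AffineWeylGroup P) : simpleRefl a * g ≠ g := by
  intro h
  have := length_simpleRefl_mul g a
  rw [h] at this
  omega

/-- The coefficients of `T_s y` in terms of those of `y`. -/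
lemma repr_T_simpleRefl_mul (a : Node b) (y : Hecke q) (v : AffineWeylGroup P) :
    (heckeBasis q).repr (T q (simpleRefl a) * y) v =
      if length b v < length b (simpleRefl a * v) then
        (q (simpleRefl a) : ℂ) * (heckeBasis q).repr y (simpleRefl a * v)
      else ((q (simpleRefl a) : ℂ) - 1) * (heckeBasis q).repr y v +
        (heckeBasis q).repr y (simpleRefl a * v) := by
  classical
  have hr : ∀ g w, (heckeBasis q).repr (T q g) w = if g = w then 1 else 0 := fun g w => by
    rw [← heckeBasis_apply, Module.Basis.repr_self, Finsupp.single_apply]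
  have hss : ∀ g w, (simpleRefl a * g = w) = (g = simpleRefl a * w) := fun g w => by
    apply propext
    constructor
    · rintro rfl; rw [simpleRefl_mul_cancel_left]
    · rintro rfl; rw [simpleRefl_mul_cancel_left]
  have hl := length_simpleRefl_mul v a
  have hne := simpleRefl_mul_ne a v
  split_ifs with hv
  · suffices H : Finsupp.lapply v ∘ₗ (heckeBasis q).repr.toLinearMap ∘ₗ
        LinearMap.mulLeft ℂ (T q (simpleRefl a)) = (q (simpleRefl a) : ℂ) •
        (Finsupp.lapply (simpleRefl a * v) ∘ₗ (heckeBasis q).repr.toLinearMap) from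
      LinearMap.congr_fun H y
    refine (heckeBasis q).ext fun g => ?_
    simp only [LinearMap.comp_apply, LinearMap.mulLeft_apply, heckeBasis_apply,
      LinearEquiv.coe_coe, Finsupp.lapply_apply, LinearMap.smul_apply, hr, smul_eq_mul]
    rw [T_simpleRefl_mul]
    by_cases h1 : g = simpleRefl a * v
    · subst h1
      rw [simpleRefl_mul_cancel_left, if_neg (by omega), map_add, map_smul, map_smul,
        Finsupp.add_apply, Finsupp.smul_apply, Finsupp.smul_apply, hr, hr]
      simp [hne]
    · by_cases h2 : g = v
      · subst h2
        rw [if_pos hv, hr]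
        simp [hne, hne.symm]
      · split_ifs <;> simp only [map_add, map_smul, Finsupp.add_apply, Finsupp.smul_apply, hr, h1,
          h2, hss, if_false, smul_zero, mul_zero, add_zero]
  · suffices H : Finsupp.lapply v ∘ₗ (heckeBasis q).repr.toLinearMap ∘ₗ
        LinearMap.mulLeft ℂ (T q (simpleRefl a)) = ((q (simpleRefl a) : ℂ) - 1) •
        (Finsupp.lapply v ∘ₗ (heckeBasis q).repr.toLinearMap) +
        (Finsupp.lapply (simpleRefl a * v) ∘ₗ (heckeBasis q).repr.toLinearMap) from
      LinearMap.congr_fun H y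
    refine (heckeBasis q).ext fun g => ?_
    simp only [LinearMap.comp_apply, LinearMap.mulLeft_apply, heckeBasis_apply,
      LinearEquiv.coe_coe, Finsupp.lapply_apply, LinearMap.smul_apply, LinearMap.add_apply, hr,
      smul_eq_mul]
    rw [T_simpleRefl_mul]
    by_cases h1 : g = simpleRefl a * v
    · subst h1
      rw [simpleRefl_mul_cancel_left, if_pos (by omega), hr]
      simp [hne]
    · by_cases h2 : g = v
      · subst h2
        rw [if_neg hv, map_add, map_smul, map_smul,
          Finsupp.add_apply, Finsupp.smul_apply, Finsupp.smul_apply, hr, hr]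
        simp [hne, hne.symm]
      · split_ifs <;> simp only [map_add, map_smul, Finsupp.add_apply, Finsupp.smul_apply, hr, h1,
          h2, hss, if_false, smul_zero, mul_zero, add_zero]

/-- The inner product with `y`, for which the `T_g` are orthogonal with norms `q(g)`. -/
def heckeForm (y : Hecke q) : Hecke q →ₗ[ℂ] ℂ :=
  (heckeBasis q).constr ℂ fun g => conj ((heckeBasis q).repr y g) * (q g : ℂ)

lemma heckeForm_T (y : Hecke q) (g : AffineWeylGroup P) :
    heckeForm q y (T q g) = conj ((heckeBasis q).repr y g) * (q g : ℂ) := by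
  rw [heckeForm, ← heckeBasis_apply, Module.Basis.constr_basis]

/-- `T_s` is self-adjoint: the rule `q(s g) = q(s) q(g)` for growing length balances the two unequal
off-diagonal entries of its matrix on `{g, s g}`. -/
lemma heckeForm_T_simpleRefl_mul (a : Node b) (x y : Hecke q) :
    heckeForm q y (T q (simpleRefl a) * x) = heckeForm q (T q (simpleRefl a) * y) x := by
  suffices H : heckeForm q y ∘ₗ LinearMap.mulLeft ℂ (T q (simpleRefl a)) =
    heckeForm q (T q (simpleRefl a) * y) from LinearMap.congr_fun H x
  refine (heckeBasis q).ext fun v => ?_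
  rw [LinearMap.comp_apply, LinearMap.mulLeft_apply, heckeBasis_apply, heckeForm_T,
    repr_T_simpleRefl_mul, T_simpleRefl_mul]
  split_ifs with hv
  · rw [heckeForm_T, q_mul_of_lt q hv, map_mul (starRingEnd ℂ), Complex.conj_ofReal]
    push_cast
    ring
  · have h1 : length b (simpleRefl a * v) < length b (simpleRefl a * (simpleRefl a * v)) := by
      have := length_simpleRefl_mul v a
      rw [simpleRefl_mul_cancel_left]; omega
    have h2 := q_mul_of_lt q h1
    rw [simpleRefl_mul_cancel_left] at h2
    rw [map_add, map_smul, map_smul, heckeForm_T, heckeForm_T, map_add (starRingEnd ℂ),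
      map_mul (starRingEnd ℂ), map_sub (starRingEnd ℂ), Complex.conj_ofReal, map_one, h2]
    push_cast
    simp only [smul_eq_mul]
    ring

lemma heckeForm_self (x : Hecke q) : heckeForm q x x =
    ((∑ g ∈ ((heckeBasis q).repr x).support, ‖(heckeBasis q).repr x g‖ ^ 2 * q g : ℝ) : ℂ) := by
  rw [heckeForm, Module.Basis.constr_apply, Finsupp.sum]
  push_cast
  refine Finset.sum_congr rfl fun g _ => ?_
  rw [smul_eq_mul, ← mul_assoc, Complex.mul_conj']

lemma heckeForm_self_nonneg (x : Hecke q) : 0 ≤ (heckeForm q x x).re := by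
  rw [heckeForm_self, Complex.ofReal_re]
  exact Finset.sum_nonneg fun g _ => mul_nonneg (sq_nonneg _) (q.pos g).le

lemma heckeForm_self_pos {x : Hecke q} (hx : x ≠ 0) : 0 < (heckeForm q x x).re := by
  rw [heckeForm_self, Complex.ofReal_re]
  refine Finset.sum_pos (fun g hg => mul_pos (pow_pos (norm_pos_iff.2 ?_) 2) (q.pos g)) ?_
  · exact Finsupp.mem_support_iff.1 hg
  · rwa [Finsupp.support_nonempty_iff, Ne, LinearEquiv.map_eq_zero_iff]

variable (J : Set (Node b))

lemma T_inv_mul_simpleRefl {a : Node b} {g : AffineWeylGroup P}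
    (h : length b g < length b (simpleRefl a * g)) :
    T q g⁻¹ * T q (simpleRefl a) = T q (simpleRefl a * g)⁻¹ := by
  rw [T_mul, mul_inv_rev, simpleRefl_inv]
  have h1 := length_simpleRefl_mul g a
  rw [← length_inv, mul_inv_rev, inv_inv, simpleRefl_inv, length_inv g, length_simpleRefl]
  omega

lemma heckeForm_T_mul {g : AffineWeylGroup P} (hg : g ∈ parabolic J) (x y : Hecke q) :
    heckeForm q y (T q g * x) = heckeForm q (T q g⁻¹ * y) x := by
  revert x y
  refine parabolic_induction (J := J) (p := fun g => ∀ x y, heckeForm q y (T q g * x) =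
    heckeForm q (T q g⁻¹ * y) x) ?_ ?_ hg
  · intro x y
    rw [inv_one, T_one, one_mul, one_mul]
  · intro a _ g _ hlt ih x y
    have h1 := T_simpleRefl_mul q a g
    rw [if_pos hlt] at h1
    rw [← h1, mul_assoc, heckeForm_T_simpleRefl_mul, ih, ← mul_assoc, T_inv_mul_simpleRefl q hlt]

/-- The span of the `T_g` with `g` in a parabolic subgroup. -/
def parabolicSpan : Submodule ℂ (Hecke q) :=
  Submodule.span ℂ (T q '' (parabolic J : Set (AffineWeylGroup P)))

variable {J} in
lemma T_mem_parabolicSpan {g : AffineWeylGroup P} (hg : g ∈ parabolic J) :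
    T q g ∈ parabolicSpan q J := Submodule.subset_span ⟨g, hg, rfl⟩

variable {J} in
lemma T_mul_mem_parabolicSpan {g : AffineWeylGroup P} (hg : g ∈ parabolic J) {x : Hecke q}
    (hx : x ∈ parabolicSpan q J) : T q g * x ∈ parabolicSpan q J := by
  revert x
  refine parabolic_induction (J := J) (p := fun g => ∀ {x}, x ∈ parabolicSpan q J →
    T q g * x ∈ parabolicSpan q J) ?_ ?_ hg
  · intro x hx
    rwa [T_one, one_mul]
  · intro a ha g _ hlt ih x hx
    have h1 := T_simpleRefl_mul q a g
    rw [if_pos hlt] at h1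
    rw [← h1, mul_assoc]
    have h2 := ih hx
    generalize T q g * x = z at h2
    induction h2 using Submodule.span_induction with
    | mem y hy =>
      obtain ⟨v, hv, rfl⟩ := hy
      have h3 := T_mem_parabolicSpan q (mul_mem (simpleRefl_mem_parabolic ha) hv)
      rw [T_simpleRefl_mul]
      split_ifs
      · exact h3
      · exact add_mem (Submodule.smul_mem _ _ (T_mem_parabolicSpan q hv)) (Submodule.smul_mem _ _ h3)
    | zero => simp
    | add x y _ _ h1 h2 => rw [mul_add]; exact add_mem h1 h2
    | smul c x _ h1 => rw [mul_smul_comm]; exact Submodule.smul_mem _ _ h1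

variable {J} (hJ : ¬ ContainsComponent J)

/-- The elements of a finite parabolic subgroup. -/
def parabolicFinset : Finset (AffineWeylGroup P) :=
  (show (parabolic J : Set (AffineWeylGroup P)).Finite from
    Set.finite_coe_iff.1 (finite_parabolic hJ)).toFinset

lemma mem_parabolicFinset {g : AffineWeylGroup P} : g ∈ parabolicFinset hJ ↔ g ∈ parabolic J := by
  simp [parabolicFinset]

/-- The Casimir element of a finite parabolic subalgebra. -/
def casimir : Env (Hecke q) :=
  ∑ g ∈ parabolicFinset hJ, (q g : ℂ)⁻¹ • Env.tmul (T q g) (T q g⁻¹)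

/-- The terms of `g` and `s g` cancel in pairs. -/
lemma diff_mul_casimir {a : Node b} (ha : a ∈ J) :
    Env.diff (T q (simpleRefl a)) * casimir q hJ = 0 := by
  rw [casimir, Finset.mul_sum]
  have key : ∀ g : AffineWeylGroup P, length b g < length b (simpleRefl a * g) →
      Env.diff (T q (simpleRefl a)) * ((q g : ℂ)⁻¹ • Env.tmul (T q g) (T q g⁻¹)) +
      Env.diff (T q (simpleRefl a)) * ((q (simpleRefl a * g) : ℂ)⁻¹ •
        Env.tmul (T q (simpleRefl a * g)) (T q (simpleRefl a * g)⁻¹)) = 0 := by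
    intro g hg
    have e1 := T_simpleRefl_mul q a g
    rw [if_pos hg] at e1
    have e2 := T_simpleRefl_mul q a (simpleRefl a * g)
    rw [simpleRefl_mul_cancel_left, if_neg (by omega)] at e2
    have e3 := T_inv_mul_simpleRefl q hg
    have e4 : T q (simpleRefl a * g)⁻¹ * T q (simpleRefl a) =
        ((q (simpleRefl a) : ℂ) - 1) • T q (simpleRefl a * g)⁻¹ + (q (simpleRefl a) : ℂ) • T q g⁻¹ := by
      rw [← e3, mul_assoc, T_sq, mul_add, mul_smul_comm, mul_smul_comm, mul_one]
    rw [mul_smul_comm, mul_smul_comm, Env.diff_mul_tmul, Env.diff_mul_tmul, e1, e2, e3, e4,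
      Env.add_tmul, Env.tmul_add, Env.smul_tmul, Env.smul_tmul, Env.tmul_smul, Env.tmul_smul,
      q_mul_of_lt q hg]
    have h1 := q_ne_zero q g
    have h2 := q_ne_zero q (simpleRefl a)
    push_cast
    have h3 : ((q (simpleRefl a) : ℂ) * (q g : ℂ))⁻¹ * (q (simpleRefl a) : ℂ) = (q g : ℂ)⁻¹ := by
      field_simp
    rw [add_sub_add_left_eq_sub, ← smul_sub, smul_smul, h3, ← smul_add, sub_add_sub_cancel, sub_self,
      smul_zero]
  refine Finset.sum_involution (fun g _ => simpleRefl a * g) ?_ ?_ ?_ ?_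
  · intro g _
    rcases length_simpleRefl_mul (b := b) g a with h | h
    · exact key g (by omega)
    · have := key (simpleRefl a * g) (by rw [simpleRefl_mul_cancel_left]; omega)
      rw [simpleRefl_mul_cancel_left] at this
      rw [add_comm]
      exact this
  · intro g _ _
    exact simpleRefl_mul_ne a g
  · intro g hg
    rw [mem_parabolicFinset] at hg ⊢
    exact mul_mem (simpleRefl_mem_parabolic ha) hg
  · intro g _
    exact simpleRefl_mul_cancel_left a g

/-- The image of the Casimir element under multiplication. -/
def casimirMul : Hecke q := Env.mulMap _ (casimir q hJ)

lemma casimirMul_eq : casimirMul q hJ =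
    ∑ g ∈ parabolicFinset hJ, (q g : ℂ)⁻¹ • (T q g * T q g⁻¹) := by
  simp only [casimirMul, casimir, map_sum, map_smul, Env.mulMap_tmul]

/-- With `c` the Casimir product, `⟨x, c x⟩` is the sum of the `q(g)⁻¹ ‖T_{g⁻¹} x‖²`, hence
positive. This is where positivity of the parameters enters. -/
lemma casimirMul_mul_ne_zero {x : Hecke q} (hx : x ≠ 0) : casimirMul q hJ * x ≠ 0 := by
  intro h
  have h1 : heckeForm q x (casimirMul q hJ * x) =
      ∑ g ∈ parabolicFinset hJ, (q g : ℂ)⁻¹ * heckeForm q (T q g⁻¹ * x) (T q g⁻¹ * x) := by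
    rw [casimirMul_eq, Finset.sum_mul, map_sum]
    refine Finset.sum_congr rfl fun g hg => ?_
    rw [smul_mul_assoc, map_smul, mul_assoc, smul_eq_mul,
      heckeForm_T_mul q J ((mem_parabolicFinset hJ).1 hg)]
  have h2 : 0 < (∑ g ∈ parabolicFinset hJ,
      (q g : ℂ)⁻¹ * heckeForm q (T q g⁻¹ * x) (T q g⁻¹ * x)).re := by
    have h3 : ∀ g, ((q g : ℂ)⁻¹ * heckeForm q (T q g⁻¹ * x) (T q g⁻¹ * x)).re =
        (q g)⁻¹ * (heckeForm q (T q g⁻¹ * x) (T q g⁻¹ * x)).re := fun g => by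
      rw [← Complex.ofReal_inv, Complex.re_ofReal_mul]
    rw [Complex.re_sum]
    simp only [h3]
    refine Finset.sum_pos' (fun g _ => mul_nonneg (inv_nonneg.2 (q.pos g).le)
      (heckeForm_self_nonneg q _)) ⟨1, (mem_parabolicFinset hJ).2 (one_mem _), ?_⟩
    rw [inv_one, T_one, one_mul]
    exact mul_pos (inv_pos.2 (q.pos 1)) (heckeForm_self_pos q hx)
  rw [← h1, h, map_zero] at h2
  exact lt_irrefl _ h2

lemma T_mul_casimirMul {a : Node b} (ha : a ∈ J) :
    T q (simpleRefl a) * casimirMul q hJ = casimirMul q hJ * T q (simpleRefl a) := by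
  have := Env.mulMap_diff_mul (T q (simpleRefl a)) (casimir q hJ)
  rw [diff_mul_casimir q hJ ha, map_zero, eq_comm, sub_eq_zero] at this
  exact this

lemma commute_casimirMul {x : Hecke q} (hx : x ∈ parabolicSpan q J) :
    Commute x (casimirMul q hJ) := by
  induction hx using Submodule.span_induction with
  | mem y hy =>
    obtain ⟨g, hg, rfl⟩ := hy
    refine parabolic_induction (J := J) (p := fun g => Commute (T q g) (casimirMul q hJ)) ?_ ?_ hg
    · rw [T_one]; exact Commute.one_left _
    · intro a ha g _ hlt ih
      have h1 := T_simpleRefl_mul q a g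
      rw [if_pos hlt] at h1
      rw [← h1]
      exact Commute.mul_left (T_mul_casimirMul q hJ ha) ih
  | zero => exact Commute.zero_left _
  | add x y _ _ h1 h2 => exact h1.add_left h2
  | smul c x _ h1 => exact h1.smul_left c

/-- Multiplication by the Casimir product `c` is injective on the finite dimensional span of the
`T_g`, `g ∈ W_J`, hence surjective. A preimage of 1 is a two-sided inverse because `c` commutes with
that span. -/
lemma exists_casimirMul_inv : ∃ d : Hecke q, d * casimirMul q hJ = 1 ∧ casimirMul q hJ * d = 1 := by
  have hfin : Module.Finite ℂ (parabolicSpan q J) := by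
    refine Module.Finite.span_of_finite ℂ (Set.Finite.image _ ?_)
    exact Set.finite_coe_iff.1 (finite_parabolic hJ)
  have hmap : ∀ x ∈ parabolicSpan q J, LinearMap.mulLeft ℂ (casimirMul q hJ) x ∈ parabolicSpan q J := by
    intro x hx
    rw [LinearMap.mulLeft_apply, casimirMul_eq, Finset.sum_mul]
    refine sum_mem fun g hg => ?_
    have hg' := (mem_parabolicFinset hJ).1 hg
    rw [smul_mul_assoc, mul_assoc]
    exact Submodule.smul_mem _ _ (T_mul_mem_parabolicSpan q hg' (T_mul_mem_parabolicSpan q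
      (inv_mem hg') hx))
  have hinj : Function.Injective ((LinearMap.mulLeft ℂ (casimirMul q hJ)).restrict hmap) := by
    rw [injective_iff_map_eq_zero]
    intro x hx
    by_contra hne
    refine casimirMul_mul_ne_zero q hJ (x := x) (fun h => hne (Subtype.ext h)) ?_
    exact congrArg Subtype.val hx
  obtain ⟨d, hd⟩ := LinearMap.injective_iff_surjective.1 hinj
    ⟨1, by rw [← T_one q]; exact T_mem_parabolicSpan q (one_mem _)⟩
  have hd' : casimirMul q hJ * d = 1 := congrArg Subtype.val hd
  exact ⟨d, (commute_casimirMul q hJ d.2).eq.trans hd', hd'⟩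

lemma isElementary_of_mem_image {J : Set (Node b)} :
    ∀ v ∈ simpleRefl '' J, IsElementary b v := by
  rintro _ ⟨a, _, rfl⟩
  exact isElementary_simpleRefl a

lemma casimir_sub_mem : casimir q hJ - Env.tmul 1 (casimirMul q hJ) ∈ nodeSup q J := by
  have : casimir q hJ - Env.tmul 1 (casimirMul q hJ) = ∑ g ∈ parabolicFinset hJ,
      (q g : ℂ)⁻¹ • (twist q (1 * g) (T q g * T q g⁻¹) - twist q 1 (T q g * T q g⁻¹)) := by
    rw [casimirMul_eq, ← Env.tmulBilin_apply, map_sum, casimir, ← Finset.sum_sub_distrib]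
    refine Finset.sum_congr rfl fun g _ => ?_
    rw [map_smul, ← smul_sub, one_mul, tmul_eq_twist, Env.tmulBilin_apply, ← T_one q, tmul_eq_twist,
      T_one, one_mul]
  rw [this]
  refine sum_mem fun g hg => complex_smul_mem _ _ ?_
  exact twist_sub_mem_of_mem_closure isElementary_of_mem_image ((mem_parabolicFinset hJ).1 hg) 1 _

include hJ in
-- Right multiplication by `e = (1 ⊗ c⁻¹) · casimir` annihilates the ideal and is the identity
-- modulo it, so the quotient is a direct summand of a free module. This amounts to separability of
-- the subalgebra attached to `W_J`.
theorem projective_quotient_nodeSup : PdLT (Env (Hecke q)) (Env (Hecke q) ⧸ nodeSup q J) 1 := by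
  obtain ⟨d, hd1, hd2⟩ := exists_casimirMul_inv q hJ
  set e := Env.tmul 1 d * casimir q hJ with he
  have h1 : ∀ x ∈ nodeSup q J, x * e = 0 := by
    intro x hx
    induction hx using Submodule.span_induction with
    | mem x hx =>
      obtain ⟨_, ⟨a, ha, rfl⟩, rfl⟩ := hx
      have h2 : T q (simpleRefl a) * d = d * T q (simpleRefl a) := by
        have h3 := T_mul_casimirMul q hJ ha
        calc _ = (d * casimirMul q hJ) * T q (simpleRefl a) * d := by rw [hd1, one_mul]
          _ = d * (T q (simpleRefl a) * casimirMul q hJ) * d := by rw [h3, mul_assoc d]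
          _ = d * T q (simpleRefl a) * (casimirMul q hJ * d) := by simp only [mul_assoc]
          _ = _ := by rw [hd2, mul_one]
      change Env.diff (T q (simpleRefl a)) * e = 0
      rw [he, ← mul_assoc, Env.diff_mul_tmul, mul_one, ← h2]
      have h4 := Env.tmul_mul_diff 1 d (T q (simpleRefl a))
      rw [one_mul] at h4
      rw [← h4, mul_assoc, diff_mul_casimir q hJ ha, mul_zero]
    | zero => exact zero_mul _
    | add x y _ _ h1 h2 => rw [add_mul, h1, h2, add_zero]
    | smul c x _ h1 => rw [smul_eq_mul, mul_assoc, h1, mul_zero]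
  have h2 : e - 1 ∈ nodeSup q J := by
    have := (nodeSup q J).smul_mem (Env.tmul 1 d) (casimir_sub_mem q hJ)
    rwa [smul_eq_mul, mul_sub, Env.tmul_mul_tmul, one_mul, hd2, Env.tmul_one_one] at this
  have hE : PdLT (Env (Hecke q)) (Env (Hecke q)) 1 := pdLT_one_iff.2 inferInstance
  refine hE.retract ((nodeSup q J).liftQ (LinearMap.toSpanSingleton _ _ e) ?_) (nodeSup q J).mkQ ?_
  · intro x hx
    rw [LinearMap.mem_ker, LinearMap.toSpanSingleton_apply]
    exact h1 x hx
  · intro x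
    obtain ⟨x, rfl⟩ := Submodule.Quotient.mk_surjective _ x
    rw [Submodule.liftQ_apply, Submodule.mkQ_apply, Submodule.Quotient.eq,
      LinearMap.toSpanSingleton_apply]
    have := (nodeSup q J).smul_mem x h2
    rwa [smul_eq_mul, mul_sub, mul_one] at this

/-- The quotient of the whole space by `N`, as a subquotient. -/
def topSubquotEquiv {R E : Type u} [Ring R] [AddCommGroup E] [Module R E] (N : Submodule R E) :
    (E ⧸ N) ≃ₗ[R] ((⊤ : Submodule R E) ⧸ N.submoduleOf ⊤) :=
  Submodule.Quotient.equiv _ _ Submodule.topEquiv.symm (by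
    ext x
    simp only [Submodule.mem_map_equiv]
    exact Iff.rfl)

lemma nodeInf_empty : nodeInf q ∅ = ⊤ := by simp [nodeInf]

lemma nodePdLT_empty_iff (J : Set (Node b)) (n : ℕ) :
    NodePdLT q ∅ J n ↔ PdLT (Env (Hecke q)) (Env (Hecke q) ⧸ nodeSup q J) n := by
  rw [NodePdLT, nodeInf_empty]
  exact ⟨fun h => h.equiv (topSubquotEquiv _).symm, fun h => h.equiv (topSubquotEquiv _)⟩

/-- Induction on `F`: the subquotient for `F ∪ {a}` is the kernel of a surjection between projective
modules. -/
lemma nodePdLT_of_not_containsComponent (F : Set (Node b)) (J : Set (Node b))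
    (h : ¬ ContainsComponent (J ∪ F)) : NodePdLT q F J 1 := by
  induction F, Set.toFinite F using Set.Finite.induction_on generalizing J with
  | empty =>
    rw [Set.union_empty] at h
    exact (nodePdLT_empty_iff q J 1).2 (projective_quotient_nodeSup q h)
  | @insert a F _ _ ih =>
    refine NodePdLT.insert_left (ih J ?_) ((ih (insert a J) ?_).mono (by omega))
    · rintro ⟨θ, h1, h2, h3⟩
      have : J ∪ F ⊆ J ∪ insert a F := Set.union_subset_union_right _ (Set.subset_insert _ _)
      exact h ⟨θ, h1, Set.image_mono this h2, fun i hi hn => Set.image_mono this (h3 i hi hn)⟩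
    · rwa [Set.insert_union, ← Set.union_insert]

variable (b) in
/-- The nodes that belong to the finite Weyl group. -/
def finiteNodes : Set (Node b) := {a | a.1.2 = 0}

/-- Affine nodes cost nothing. If `J ∪ F` contains a component, its finite nodes lie in `F`;
together with the affine node `a` they make the intersection over `F ∪ {a}` vanish, so the left term
of the exact sequence is zero. -/
lemma nodePdLT_of_no_finite (J F : Set (Node b)) (hJ : J ∩ finiteNodes b = ∅) :
    NodePdLT q F J 1 := by
  induction hn : J.ncard using Nat.strong_induction_on generalizing J F with
  | _ n ih =>
  by_cases h : ContainsComponent (J ∪ F)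
  · obtain ⟨θ, h1, ⟨a, ha, haθ⟩, h3⟩ := h
    have hF : ∀ i ∈ b.support, coeff b θ i ≠ 0 → ((i, 0) : AffineRoot P) ∈ Subtype.val '' F := by
      intro i hi hin
      obtain ⟨c, hc | hc, hci⟩ := h3 i hi hin
      · have : c ∈ J ∩ finiteNodes b := ⟨hc, by simp [finiteNodes, hci]⟩
        rw [hJ] at this
        exact this.elim
      · exact ⟨c, hc, hci⟩
    have hins : ContainsComponent (insert a F) := by
      refine ⟨θ, h1, ⟨a, Set.mem_insert _ _, haθ⟩, fun i hi hin => ?_⟩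
      exact Set.image_mono (Set.subset_insert _ _) (hF i hi hin)
    rcases ha with ha | ha
    · have hJa : insert a (J \ {a}) = J := Set.insert_sdiff_self_of_mem ha
      rw [← hJa]
      -- With a zero module on the left, `n = 0` is allowed and the bound stays at 1.
      refine NodePdLT.of_insert (nodePdLT_of_containsComponent hins _ 0) ?_
      refine ih _ ?_ _ F ?_ rfl
      · rw [← hn]
        exact Set.ncard_sdiff_singleton_lt_of_mem ha (Set.toFinite J)
      · rw [Set.eq_empty_iff_forall_notMem] at hJ ⊢
        exact fun c hc => hJ c ⟨hc.1.1, hc.2⟩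
    · rw [Set.insert_eq_of_mem ha] at hins
      exact nodePdLT_of_containsComponent hins _ _
  · exact nodePdLT_of_not_containsComponent q F J h

/-- Each finite node costs at most one degree, starting from the affine nodes alone. A bound by all
nodes would be too large by one for every maximal coroot. -/
theorem nodePdLT_ncard (J F : Set (Node b)) : NodePdLT q F J ((J ∩ finiteNodes b).ncard + 1) := by
  induction hn : (J ∩ finiteNodes b).ncard generalizing J F with
  | zero =>
    exact nodePdLT_of_no_finite q J F ((Set.ncard_eq_zero (Set.toFinite _)).1 hn)
  | succ n ih =>
    obtain ⟨a, ha⟩ : (J ∩ finiteNodes b).Nonempty := by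
      rw [Set.nonempty_iff_ne_empty]
      intro h
      rw [h, Set.ncard_empty] at hn
      omega
    have hJa : insert a (J \ {a}) = J := Set.insert_sdiff_self_of_mem ha.1
    have hcard : ((J \ {a}) ∩ finiteNodes b).ncard = n := by
      rw [← Set.inter_sdiff_right_comm, Set.ncard_sdiff_singleton_of_mem ha, hn]
      rfl
    have h1 := ih (J \ {a}) F hcard
    have h2 := ih (J \ {a}) (insert a F) hcard
    have := NodePdLT.of_insert h2 (h1.mono (Nat.le_succ _))
    rwa [hJa] at this

end Casimir

end AffineHecke
end

noncomputable section
set_option linter.unusedSectionVars false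
namespace AffineHecke

/-! ### Central translations and the rank of the radical. -/

section Translations

variable {ι X Y : Type u} [AddCommGroup X] [AddCommGroup Y] {P : RootDatum ι X Y} {b : P.Base}

variable (P) in
/-- The elements of `X` that are orthogonal to all coroots. -/
def radical : Submodule ℤ X := ⨅ i, LinearMap.ker (P.coroot' i)

lemma mem_radical {x : X} : x ∈ radical P ↔ ∀ i, P.coroot' i x = 0 := by
  simp [radical, Submodule.mem_iInf]

lemma weyl_smul_of_mem_radical {x : X} (hx : x ∈ radical P) (w : P.weylGroup) : w • x = x := by
  obtain ⟨w, hw⟩ := w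
  induction hw using RootPairing.weylGroup.induction with
  | mem i =>
    have := ofIdx_smul (P := P) i x
    rw [show (⟨_, P.reflection_mem_weylGroup i⟩ : P.weylGroup) = RootPairing.weylGroup.ofIdx P i
      from rfl, this, mem_radical.1 hx i, zero_smul, sub_zero]
  | one => rw [show (⟨1, one_mem _⟩ : P.weylGroup) = 1 from rfl, one_smul]
  | mul v w hv hw h1 h2 =>
    have h3 : (⟨v, hv⟩ * ⟨w, hw⟩ : P.weylGroup) • x = x := by rw [mul_smul, h2, h1]
    exact h3

@[simp] lemma translation_left (x : X) : (translation P x).left.toAdd = x := rfl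

@[simp] lemma translation_right (x : X) : (translation P x).right = 1 := rfl

lemma translation_add (x y : X) : translation P (x + y) = translation P x * translation P y := by
  rw [translation, translation, translation, ofAdd_add, map_mul]

lemma eq_translation {g : AffineWeylGroup P} (hg : g.right = 1) : g = translation P g.left.toAdd :=
  SemidirectProduct.ext rfl hg

lemma translation_mul_comm {x : X} (hx : x ∈ radical P) (g : AffineWeylGroup P) :
    translation P x * g = g * translation P x := by
  refine SemidirectProduct.ext ?_ ?_
  · rw [SemidirectProduct.mul_left, SemidirectProduct.mul_left, translation_right, map_one,
      MulAut.one_apply]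
    have h1 : (weylAction P g.right (translation P x).left).toAdd = g.right • x := rfl
    have h2 : weylAction P g.right (translation P x).left = (translation P x).left := by
      apply Multiplicative.toAdd.injective
      rw [h1, weyl_smul_of_mem_radical hx, translation_left]
    rw [h2, mul_comm]
  · rw [SemidirectProduct.mul_right, SemidirectProduct.mul_right, translation_right, one_mul,
      mul_one]

lemma act_translation (x : X) (a : AffineRoot P) :
    actAffineRoot (translation P x) a = (a.1, a.2 - P.coroot' a.1 x) := by
  simp [actAffineRoot]

variable [Finite ι]

lemma length_translation_of_mem_radical {x : X} (hx : x ∈ radical P) :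
    length b (translation P x) = 0 := by
  rw [length_eq, Set.ncard_eq_zero (finite_inversions _), Set.eq_empty_iff_forall_notMem]
  rintro a ⟨h1, h2⟩
  rw [act_translation, mem_radical.1 hx, sub_zero] at h2
  exact h2 h1

variable [P.IsReduced]

lemma mem_radical_of_length_translation {x : X} (hx : length b (translation P x) = 0) :
    x ∈ radical P := by
  have key : ∀ i, P.coroot' i x ≤ 0 := by
    intro i
    have h1 : IsPosAffineRoot (P := P) b (i, 1) := Or.inl one_pos
    -- Two applications are needed: `1 - ⟨x, α^∨⟩ ≥ 0` still allows the value 1, while `1 - 2⟨x,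
    -- α^∨⟩ ≥ 0` does not.
    have h2 := (isPos_act_of_length_eq_zero hx).2 h1
    have h3 := (isPos_act_of_length_eq_zero hx).2 h2
    rw [act_translation, act_translation] at h3
    have h4 : 0 ≤ 1 - P.coroot' i x - P.coroot' i x := by
      rcases h3 with h3 | h3
      · exact h3.le
      · exact h3.1.ge
    omega
  rw [mem_radical]
  intro i
  refine le_antisymm (key i) ?_
  have h1 := key (P.reflectionPerm i i)
  have h2 : P.coroot' (P.reflectionPerm i i) x = - P.coroot' i x := by
    simp only [RootPairing.coroot']
    rw [neg_reflectionPerm_self, map_neg]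
    rfl
  omega

variable (b) in
/-- The sum over the finite Weyl group of the translates of the translation part. -/
def weylSum (g : AffineWeylGroup P) : X :=
  letI := finite_weylGroup b
  letI := Fintype.ofFinite P.weylGroup
  ∑ u : P.weylGroup, u • g.left.toAdd

/-- Summation over `W₀` absorbs the Weyl part of `g`, whence a homomorphism from `W` to `X`. It
kills the reflections and multiplies a translation from the radical by `|W₀|`, so it separates these
two kinds of generators. -/
lemma weylSum_mul (g h : AffineWeylGroup P) : weylSum b (g * h) = weylSum b g + weylSum b h := by
  let := finite_weylGroup b
  let := Fintype.ofFinite P.weylGroup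
  have h1 : (g * h).left.toAdd = g.left.toAdd + g.right • h.left.toAdd := rfl
  simp only [weylSum, h1, smul_add, Finset.sum_add_distrib, ← mul_smul]
  congr 1
  exact Fintype.sum_equiv (Equiv.mulRight g.right) _ _ (fun _ => rfl)

lemma weylSum_one : weylSum b (1 : AffineWeylGroup P) = 0 := by
  have := weylSum_mul (b := b) (1 : AffineWeylGroup P) 1
  rwa [one_mul, left_eq_add] at this

lemma weylSum_translation {x : X} (hx : x ∈ radical P) :
    weylSum b (translation P x) = Nat.card P.weylGroup • x := by
  let := finite_weylGroup b
  let := Fintype.ofFinite P.weylGroup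
  simp [weylSum, weyl_smul_of_mem_radical hx]

variable [Module.Finite ℤ X]

lemma weylSum_simpleRefl (a : Node b) : weylSum b (simpleRefl a) = 0 := by
  have := torsionFree_weights P
  have h1 := weylSum_mul (b := b) (simpleRefl a) (simpleRefl a)
  rw [simpleRefl_mul_self, weylSum_one, ← two_zsmul] at h1
  rwa [eq_comm, smul_eq_zero_iff_right two_ne_zero] at h1

/-- The radical is the kernel of the pairing with the simple coroots, and the image of this pairing
contains a positive multiple of the full lattice. -/
lemma card_support_add_finrank_radical (b : P.Base) :
    b.support.card + Module.finrank ℤ (radical P) ≤ Module.finrank ℤ X := by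
  have := torsionFree_weights P
  let f : X →ₗ[ℤ] (b.support → ℤ) := LinearMap.pi fun i => P.coroot' i
  have hker : LinearMap.ker f = radical P := by
    ext x
    rw [mem_radical, LinearMap.mem_ker]
    constructor
    · intro h i
      have h1 : ∀ j ∈ b.support, P.coroot' j x = 0 := fun j hj => congrFun h ⟨j, hj⟩
      have key : ∀ i, IsPosCoroot b i → P.coroot' i x = 0 := fun i hi => by
        rw [coroot'_eq_sum_coeff hi]
        exact Finset.sum_eq_zero fun j hj => by rw [h1 j hj, mul_zero]
      by_cases hi : IsPosCoroot b i
      · exact key i hi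
      · have h2 := (isPos_neg_iff (b := b) ((i, 0) : AffineRoot P)).2 (by
          simpa [IsPosAffineRoot] using hi)
        have h3 : IsPosCoroot b (P.reflectionPerm i i) := by
          simpa [IsPosAffineRoot, affNeg] using h2
        have h4 := key _ h3
        simp only [RootPairing.coroot'] at h4 ⊢
        rw [neg_reflectionPerm_self, map_neg, LinearMap.neg_apply, neg_eq_zero] at h4
        exact h4
    · intro h
      funext i
      exact h i
  have h1 := Submodule.finrank_quotient_add_finrank (LinearMap.ker f)
  rw [f.quotKerEquivRange.finrank_eq, hker] at h1
  rw [← h1]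
  refine Nat.add_le_add_right ?_ _
  obtain ⟨M, hM, hc⟩ := exists_coroot'_eq b
  have h2 : ∀ c : b.support → ℤ, M • c ∈ LinearMap.range f := by
    classical
    intro c
    obtain ⟨x, hx⟩ := hc fun i => if h : i ∈ b.support then c ⟨i, h⟩ else 0
    refine ⟨x, funext fun i => ?_⟩
    have := hx i i.2
    simpa [f, i.2] using this
  have h3 := LinearMap.finrank_le_finrank_of_injective
    (f := (LinearMap.lsmul ℤ (b.support → ℤ) M).codRestrict (LinearMap.range f) h2) (by
      intro c d hcd
      have h4 : M • c = M • d := congrArg Subtype.val hcd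
      exact smul_right_injective _ hM.ne' h4)
  rwa [Module.finrank_fintype_fun_eq_card, Fintype.card_coe] at h3

lemma ncard_finiteNodes_le : (finiteNodes b).ncard ≤ b.support.card := by
  rw [← Set.ncard_coe_finset]
  refine Set.ncard_le_ncard_of_injOn (fun a : Node b => a.1.1) ?_ ?_ (Finset.finite_toSet _)
  · intro a ha
    have ha' : a.1.2 = 0 := ha
    rcases a.2 with ⟨h, -⟩ | ⟨θ, hθ, h⟩
    · exact h
    · rw [h] at ha'
      simp [affNeg] at ha'
  · intro a ha c hc h
    have ha' : a.1.2 = 0 := ha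
    have hc' : c.1.2 = 0 := hc
    exact Subtype.ext (Prod.ext h (ha'.trans hc'.symm))

end Translations

/-! ### Quotients by central regular elements. -/

section Generic

/-- A central element that is regular modulo `N` gives `0 → R/N → R/N → R/(N + R D) → 0`, which
costs one degree. -/
lemma relQuotient_pdLT_sup {R : Type u} [Ring R] (N : Submodule R R) (D : R) (hD : ∀ x, x * D = D * x)
    (hinj : ∀ x, x * D ∈ N → x ∈ N) {n : ℕ} (h : PdLT R (R ⧸ N) n) :
    PdLT R (R ⧸ N ⊔ Submodule.span R {D}) (n + 1) := by
  have hle : N ≤ Submodule.comap (LinearMap.toSpanSingleton R R D) N := by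
    intro x hx
    rw [Submodule.mem_comap, LinearMap.toSpanSingleton_apply, smul_eq_mul, hD]
    exact N.smul_mem D hx
  refine pdLT_right_of_exact (f := N.mapQ N (LinearMap.toSpanSingleton R R D) hle)
    (g := Submodule.factor le_sup_left) ?_ ?_ ?_ h (h.mono (Nat.le_succ n))
  · rw [injective_iff_map_eq_zero]
    intro x hx
    obtain ⟨x, rfl⟩ := Submodule.Quotient.mk_surjective _ x
    rw [Submodule.mapQ_apply, Submodule.Quotient.mk_eq_zero] at hx
    rw [Submodule.Quotient.mk_eq_zero]
    exact hinj x hx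
  · intro x
    obtain ⟨x, rfl⟩ := Submodule.Quotient.mk_surjective _ x
    change Submodule.Quotient.mk x = 0 ↔ _
    rw [Submodule.Quotient.mk_eq_zero]
    constructor
    · intro hx
      obtain ⟨y, hy, z, hz, rfl⟩ := Submodule.mem_sup.1 hx
      obtain ⟨c, rfl⟩ := Submodule.mem_span_singleton.1 hz
      refine ⟨Submodule.Quotient.mk c, ?_⟩
      rw [Submodule.mapQ_apply, Submodule.Quotient.eq, LinearMap.toSpanSingleton_apply,
        sub_add_cancel_right]
      exact neg_mem hy
    · rintro ⟨y, hy⟩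
      obtain ⟨y, rfl⟩ := Submodule.Quotient.mk_surjective _ y
      rw [Submodule.mapQ_apply, Submodule.Quotient.eq, LinearMap.toSpanSingleton_apply] at hy
      have h2 := sub_mem (Submodule.mem_sup_right
        (Submodule.smul_mem _ y (Submodule.mem_span_singleton_self D))) (Submodule.mem_sup_left hy)
      rwa [sub_sub_cancel] at h2
  · exact Submodule.factor_surjective _

/-- A finite support would be stable under `σ`, whose orbits are all infinite. This makes `σ - 1`
injective on finitely supported functions, the source of regularity in both bounds. -/
lemma eq_zero_of_mapDomain_eq {α M : Type*} [AddCommMonoid M] {σ : α → α}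
    (hσ : ∀ (c : α) (m n : ℕ), σ^[m] c = σ^[n] c → m = n) {f : α →₀ M}
    (hf : Finsupp.mapDomain σ f = f) : f = 0 := by
  by_contra hne
  obtain ⟨c, hc⟩ := Finsupp.support_nonempty_iff.2 hne
  classical
  have himg : f.support = f.support.image σ := by
    refine Finset.eq_of_subset_of_card_le ?_ Finset.card_image_le
    conv_lhs => rw [← hf]
    exact Finsupp.mapDomain_support
  have hmem : ∀ n, σ^[n] c ∈ f.support := by
    intro n
    induction n with
    | zero => exact hc
    | succ n ih =>
      rw [himg, Function.iterate_succ_apply']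
      exact Finset.mem_image_of_mem _ ih
  exact Set.infinite_of_injective_forall_mem (s := (f.support : Set α))
    (f := fun n : ℕ => σ^[n] c) (fun m n h => hσ c m n h) hmem (Finset.finite_toSet _)

variable (A : Type u) [Ring A] [Algebra ℂ A]

/-- The kernel of the multiplication map. -/
def Env.kerMul : Submodule (Env A) (Env A) where
  carrier := {x | Env.mulMap A x = 0}
  zero_mem' := map_zero _
  add_mem' {x y} hx hy := by
    change Env.mulMap A (x + y) = 0
    rw [map_add, hx, hy, add_zero]
  smul_mem' := by
    intro e x hx
    change Env.mulMap A (e * x) = 0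
    induction e using Env.induction with
    | h0 => rw [zero_mul, map_zero]
    | h1 e f he hf => rw [add_mul, map_add, he, hf, add_zero]
    | h2 a c => rw [Env.mulMap_tmul_mul, hx, mul_zero, zero_mul]

lemma Env.mem_kerMul {x : Env A} : x ∈ Env.kerMul A ↔ Env.mulMap A x = 0 := Iff.rfl

end Generic

/-! ### The projective dimension of the Hecke algebra as a bimodule. -/

section UpperBound

variable {ι X Y : Type u} [AddCommGroup X] [AddCommGroup Y] {P : RootDatum ι X Y} {b : P.Base}
  (q : ParameterFunction b) [Finite ι] [P.IsReduced]

lemma Tinv_mul_Tinv {g h : AffineWeylGroup P} (hgh : T q h * T q g = T q (h * g)) :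
    Tinv q g * Tinv q h = Tinv q (h * g) := by
  have h1 : Tinv q g * Tinv q h * T q (h * g) = 1 := by
    rw [← hgh, mul_assoc, Tinv_mul_T_mul, Tinv_mul_T]
  calc _ = Tinv q g * Tinv q h * (T q (h * g) * Tinv q (h * g)) := by rw [T_mul_Tinv, mul_one]
    _ = _ := by rw [← mul_assoc, h1, one_mul]

lemma twist_mul_twist_one {v : AffineWeylGroup P} (hv : length b v = 0) (g : AffineWeylGroup P)
    (x : Hecke q) : twist q g x * twist q v 1 = twist q (g * v) x := by
  have h1 := T_mul_of_length_eq_zero_right q hv g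
  rw [twist_apply, twist_apply, Env.tmul_mul_tmul, mul_one, h1, ← mul_assoc, Tinv_mul_Tinv q h1,
    twist_apply]

lemma mulMap_twist (g : AffineWeylGroup P) (x : Hecke q) : Env.mulMap _ (twist q g x) = x := by
  rw [twist_apply, Env.mulMap_tmul, T_mul_Tinv_mul]

lemma T_comm_of_mem_radical {z : X} (hz : z ∈ radical P) (x : Hecke q) :
    T q (translation P z) * x = x * T q (translation P z) := by
  suffices H : LinearMap.mulLeft ℂ (T q (translation P z)) =
      LinearMap.mulRight ℂ (T q (translation P z)) from LinearMap.congr_fun H x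
  refine (heckeBasis q).ext fun g => ?_
  have h0 := length_translation_of_mem_radical (b := b) hz
  rw [LinearMap.mulLeft_apply, LinearMap.mulRight_apply, heckeBasis_apply,
    T_mul_of_length_eq_zero_left q h0, T_mul_of_length_eq_zero_right q h0, translation_mul_comm hz]

/-- The central element `T_z ⊗ T_z⁻¹ - 1` of the enveloping algebra. -/
def centralDiff (z : X) : Env (Hecke q) := twist q (translation P z) 1 - 1

lemma centralDiff_comm {z : X} (hz : z ∈ radical P) (x : Env (Hecke q)) :
    x * centralDiff q z = centralDiff q z * x := by
  have hT : ∀ y, T q (translation P z) * y = y * T q (translation P z) := T_comm_of_mem_radical q hz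
  have hT' : ∀ y, Tinv q (translation P z) * y = y * Tinv q (translation P z) := by
    intro y
    calc _ = Tinv q (translation P z) * (y * T q (translation P z)) * Tinv q (translation P z) := by
          rw [mul_assoc, mul_assoc, T_mul_Tinv, mul_one]
      _ = _ := by rw [← hT, Tinv_mul_T_mul]
  rw [centralDiff, mul_sub, sub_mul, mul_one, one_mul]
  congr 1
  induction x using Env.induction with
  | h0 => simp
  | h1 x y hx hy => rw [mul_add, add_mul, hx, hy]
  | h2 a c => rw [twist_apply, mul_one, Env.tmul_mul_tmul, Env.tmul_mul_tmul, hT, hT']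

/-- The generator of the translation and `centralDiff q z` differ by the invertible factor `1 ⊗
T_z`; only the latter is central. -/
lemma relIdeal_insert_translation (z : X) (Γ : Set (AffineWeylGroup P)) :
    relIdeal q (insert (translation P z) Γ) =
      relIdeal q Γ ⊔ Submodule.span _ {centralDiff q z} := by
  have h1 : centralDiff q z =
      Env.tmul 1 (Tinv q (translation P z)) * Env.diff (T q (translation P z)) := by
    rw [Env.tmul_mul_diff, T_mul_Tinv, one_mul, centralDiff, twist_apply, mul_one,
      Env.tmul_one_one]
  have h2 : Env.diff (T q (translation P z)) =
      Env.tmul 1 (T q (translation P z)) * centralDiff q z := by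
    rw [h1, ← mul_assoc, Env.tmul_mul_tmul, one_mul, Tinv_mul_T, Env.tmul_one_one, one_mul]
  rw [relIdeal, Set.image_insert_eq, Submodule.span_insert, sup_comm]
  congr 1
  refine le_antisymm ?_ ?_ <;> rw [Submodule.span_singleton_le_iff_mem]
  · rw [h2]
    exact Submodule.smul_mem _ _ (Submodule.mem_span_singleton_self _)
  · rw [h1]
    exact Submodule.smul_mem _ _ (Submodule.mem_span_singleton_self _)

lemma cosetMap_mul_centralDiff (G : Subgroup (AffineWeylGroup P)) {z : X} (hz : z ∈ radical P)
    (x : Env (Hecke q)) : cosetMap q G (x * centralDiff q z) =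
      Finsupp.mapDomain (translation P z • ·) (cosetMap q G x) - cosetMap q G x := by
  induction x using env_induction with
  | h0 => simp
  | h1 x y hx hy => rw [add_mul, map_add, hx, hy, map_add, Finsupp.mapDomain_add]; abel
  | h2 g h =>
    rw [centralDiff, mul_sub, mul_one, map_sub,
      twist_mul_twist_one q (length_translation_of_mem_radical hz), cosetMap_twist, cosetMap_twist,
      Finsupp.mapDomain_single, ← translation_mul_comm hz]
    rfl

variable [Module.Finite ℤ X]

/-- The generators of a subgroup of finite index, built in steps. -/
def generators {k : ℕ} (z : Fin k → X) (j : ℕ) : Set (AffineWeylGroup P) :=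
  Set.range (simpleRefl (b := b)) ∪ (fun i => translation P (z i)) '' {i : Fin k | (i : ℕ) < j}

lemma isElementary_generators {k : ℕ} {z : Fin k → X} (hz : ∀ i, z i ∈ radical P) (j : ℕ) :
    ∀ v ∈ generators (b := b) z j, IsElementary b v := by
  rintro _ (⟨a, rfl⟩ | ⟨i, _, rfl⟩)
  · exact isElementary_simpleRefl a
  · exact Or.inl (length_translation_of_mem_radical (hz i))

lemma weylSum_mem_span {k : ℕ} {z : Fin k → X} (hz : ∀ i, z i ∈ radical P) (j : ℕ)
    {g : AffineWeylGroup P} (hg : g ∈ Subgroup.closure (generators (b := b) z j)) :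
    weylSum b g ∈ Submodule.span ℤ (z '' {i : Fin k | (i : ℕ) < j}) := by
  induction hg using Subgroup.closure_induction with
  | mem g hg =>
    rcases hg with ⟨a, rfl⟩ | ⟨i, hi, rfl⟩
    · rw [weylSum_simpleRefl]; exact zero_mem _
    · rw [weylSum_translation (hz i)]
      exact nsmul_mem (Submodule.subset_span (Set.mem_image_of_mem z hi)) _
  | one => rw [weylSum_one]; exact zero_mem _
  | mul g h _ _ h1 h2 => rw [weylSum_mul]; exact add_mem h1 h2
  | inv g _ h1 =>
    have := weylSum_mul (b := b) g g⁻¹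
    rw [mul_inv_cancel, weylSum_one, eq_comm, add_comm, add_eq_zero_iff_eq_neg] at this
    rw [this]
    exact neg_mem h1

/-- If the translation by `d z_j`, `d > 0`, were in the group generated so far, then `weylSum` would
put `|W₀| d z_j` in the span of the earlier vectors, against linear independence. So `z j` moves all
cosets in infinite orbits. -/
lemma eq_of_translation_nsmul_smul {k : ℕ} {z : Fin k → X} (hz : ∀ i, z i ∈ radical P)
    (hli : LinearIndependent ℤ z) (j : Fin k) (g : AffineWeylGroup P) {m n : ℕ} (hmn : m ≤ n)
    (h : (g * translation P (n • z j))⁻¹ * (g * translation P (m • z j)) ∈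
      Subgroup.closure (generators (b := b) z j)) : m = n := by
  have := finite_weylGroup b
  have hzn : ∀ n : ℕ, n • z j ∈ radical P := fun n => nsmul_mem (hz j) n
  obtain ⟨d, rfl⟩ := Nat.exists_eq_add_of_le hmn
  have h1 : (g * translation P ((m + d) • z j))⁻¹ * (g * translation P (m • z j)) =
      (translation P (d • z j))⁻¹ := by
    rw [add_smul, translation_add]
    group
  rw [h1, inv_mem_iff] at h
  have h2 := weylSum_mem_span hz j h
  rw [weylSum_translation (hzn d), smul_smul] at h2
  by_contra hd
  have hcard : Nat.card P.weylGroup * d ≠ 0 := mul_ne_zero Nat.card_pos.ne' (by omega)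
  have hdisj := hli.disjoint_span_image (s := {i : Fin k | (i : ℕ) < j}) (t := {j}) (by simp)
  rw [Submodule.disjoint_def] at hdisj
  have h5 := hdisj _ h2 (nsmul_mem (Submodule.subset_span (Set.mem_image_of_mem z (Set.mem_singleton j))) _)
  have := torsionFree_weights P
  rw [← natCast_zsmul, smul_eq_zero_iff_right (by exact_mod_cast hcard)] at h5
  exact hli.ne_zero j h5

lemma iterate_translation_smul (G : Subgroup (AffineWeylGroup P)) {z : X} (hz : z ∈ radical P)
    (n : ℕ) (g : AffineWeylGroup P) :
    (translation P z • ·)^[n] (g : AffineWeylGroup P ⧸ G) = ((g * translation P (n • z) : AffineWeylGroup P) : AffineWeylGroup P ⧸ G) := by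
  induction n with
  | zero =>
    have : translation P (0 : X) = 1 := rfl
    simp [this]
  | succ n ih =>
    rw [Function.iterate_succ_apply', ih, succ_nsmul', translation_add, ← mul_assoc,
      ← translation_mul_comm hz, mul_assoc]
    rfl

/-- The simple reflections account for the number of simple roots, and each further translation
contributes one degree, since `T_z ⊗ T_z⁻¹ - 1` is central and regular modulo the previous ideal. -/
theorem pdLT_generators {k : ℕ} {z : Fin k → X} (hz : ∀ i, z i ∈ radical P)
    (hli : LinearIndependent ℤ z) (j : ℕ) (hj : j ≤ k) :
    PdLT (Env (Hecke q)) (Env (Hecke q) ⧸ relIdeal q (generators (b := b) z j))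
      (b.support.card + j + 1) := by
  induction j with
  | zero =>
    have h1 := (nodePdLT_empty_iff q _ _).1 (nodePdLT_ncard q Set.univ ∅)
    have h2 : generators (b := b) z 0 = simpleRefl '' (Set.univ : Set (Node b)) := by simp [generators]
    rw [h2]
    refine PdLT.mono h1 ?_
    rw [Set.univ_inter]
    have := ncard_finiteNodes_le (b := b)
    omega
  | succ j ih =>
    have h1 : generators (b := b) z (j + 1) =
        insert (translation P (z ⟨j, hj⟩)) (generators (b := b) z j) := by
      have : {i : Fin k | (i : ℕ) < j + 1} = insert ⟨j, hj⟩ {i : Fin k | (i : ℕ) < j} := by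
        ext i
        simp only [Set.mem_ofPred_eq, Set.mem_insert_iff, Fin.ext_iff]
        omega
      rw [generators, this, Set.image_insert_eq, Set.union_insert, generators]
    rw [h1, relIdeal_insert_translation q]
    refine relQuotient_pdLT_sup _ _ (centralDiff_comm q (hz _)) ?_ (ih (by omega))
    intro x hx
    rw [mem_relIdeal_iff (isElementary_generators hz j)] at hx ⊢
    rw [cosetMap_mul_centralDiff q _ (hz _), sub_eq_zero] at hx
    refine eq_zero_of_mapDomain_eq ?_ hx
    intro c m n h
    obtain ⟨g, rfl⟩ := QuotientGroup.mk_surjective c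
    rw [iterate_translation_smul _ (hz _), iterate_translation_smul _ (hz _)] at h
    rcases le_total m n with hmn | hmn
    · exact eq_of_translation_nsmul_smul hz hli ⟨j, hj⟩ g hmn (QuotientGroup.eq.1 h.symm)
    · exact (eq_of_translation_nsmul_smul hz hli ⟨j, hj⟩ g hmn (QuotientGroup.eq.1 h)).symm

omit [Module.Finite ℤ X] in
lemma exists_length_zero_mul (g : AffineWeylGroup P) : ∃ v : AffineWeylGroup P, length b v = 0 ∧
    v⁻¹ * g ∈ parabolic (Set.univ : Set (Node b)) := by
  refine length_induction_right (b := b) (p := fun g => ∃ v : AffineWeylGroup P, length b v = 0 ∧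
    v⁻¹ * g ∈ parabolic (Set.univ : Set (Node b))) (fun g hg => ⟨g, hg, ?_⟩) ?_ g
  · rw [inv_mul_cancel]; exact one_mem _
  · rintro a g - ⟨v, h1, h2⟩
    refine ⟨v, h1, ?_⟩
    rw [← mul_assoc]
    exact mul_mem h2 (simpleRefl_mem_parabolic (Set.mem_univ a))

/-- The reflections and the translations from the radical generate a subgroup of finite index, with
coset representatives of length zero. Averaging over these splits the projection onto the quotient
by `kerMul`, which is the algebra itself as a bimodule. -/
theorem pdLT_kerMul :
    PdLT (Env (Hecke q)) (Env (Hecke q) ⧸ Env.kerMul (Hecke q)) (Module.finrank ℤ X + 1) := by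
  have := torsionFree_weights P
  have := finite_weylGroup b
  set k := Module.finrank ℤ (radical P) with hk
  let B : Module.Basis (Fin k) ℤ (radical P) := Module.finBasis ℤ (radical P)
  let z : Fin k → X := fun i => B i
  have hz : ∀ i, z i ∈ radical P := fun i => (B i).2
  have hli : LinearIndependent ℤ z :=
    B.linearIndependent.map' (radical P).subtype (Submodule.ker_subtype _)
  set G := Subgroup.closure (generators (b := b) z k) with hG
  have hpar : parabolic (Set.univ : Set (Node b)) ≤ G := by
    refine Subgroup.closure_mono ?_
    rw [Set.image_univ]
    exact Set.subset_union_left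
  have htr : ∀ x ∈ radical P, translation P x ∈ G := by
    intro x hx
    have h1 : (⟨x, hx⟩ : radical P) ∈ Submodule.span ℤ (Set.range B) := by
      rw [B.span_eq]; trivial
    rw [← Submodule.mem_toAddSubgroup, Submodule.span_int_eq_addSubgroupClosure] at h1
    have key : ∀ y : radical P, y ∈ AddSubgroup.closure (Set.range B) → translation P (y : X) ∈ G := by
      intro y hy
      induction hy using AddSubgroup.closure_induction with
      | mem y hy =>
        obtain ⟨i, rfl⟩ := hy
        exact Subgroup.subset_closure (Or.inr ⟨i, i.2, rfl⟩)
      | zero => exact one_mem G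
      | add y y' _ _ h1 h2 =>
        rw [Submodule.coe_add, translation_add]
        exact mul_mem h1 h2
      | neg y _ h1 =>
        have h2 : translation P ((-y : radical P) : X) * translation P (y : X) = 1 := by
          rw [← translation_add, Submodule.coe_neg, neg_add_cancel]; rfl
        rw [eq_inv_of_mul_eq_one_left h2]
        exact inv_mem h1
    exact key _ h1
  have hrep : ∀ c : AffineWeylGroup P ⧸ G, ∃ v : AffineWeylGroup P, length b v = 0 ∧
      (v : AffineWeylGroup P ⧸ G) = c := by
    intro c
    obtain ⟨g, rfl⟩ := QuotientGroup.mk_surjective c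
    obtain ⟨v, h1, h2⟩ := exists_length_zero_mul (b := b) g
    exact ⟨v, h1, QuotientGroup.eq.2 (hpar h2)⟩
  choose v hv1 hv2 using hrep
  -- Representatives with the same Weyl part differ by a translation of length zero; it lies in the
  -- radical, hence in `G`.
  have hfin : Finite (AffineWeylGroup P ⧸ G) := by
    refine Finite.of_injective (fun c => (v c).right) fun c d hcd => ?_
    rw [← hv2 c, ← hv2 d, QuotientGroup.eq]
    have h1 : ((v c)⁻¹ * v d).right = 1 := by
      have h0 : (v c).right = (v d).right := hcd
      rw [SemidirectProduct.mul_right, SemidirectProduct.inv_right, h0, inv_mul_cancel]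
    rw [eq_translation h1]
    refine htr _ (mem_radical_of_length_translation (b := b) ?_)
    rw [← eq_translation h1, length_mul_right_of_eq_zero (hv1 d), length_inv, hv1 c]
  have := Fintype.ofFinite (AffineWeylGroup P ⧸ G)
  set N := relIdeal q (generators (b := b) z k) with hN
  -- Right multiplication by `e` spreads an element evenly over all cosets, so modulo `N` the result
  -- depends only on the image under multiplication.
  set e : Env (Hecke q) := (Fintype.card (AffineWeylGroup P ⧸ G) : ℂ)⁻¹ •
    ∑ c : AffineWeylGroup P ⧸ G, twist q (v c) 1 with he
  have hcard : (Fintype.card (AffineWeylGroup P ⧸ G) : ℂ) ≠ 0 := by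
    exact_mod_cast Fintype.card_ne_zero
  have hmul : ∀ g x, twist q g x * e = (Fintype.card (AffineWeylGroup P ⧸ G) : ℂ)⁻¹ •
      ∑ c : AffineWeylGroup P ⧸ G, twist q (g * v c) x := by
    intro g x
    rw [he, mul_smul_comm, Finset.mul_sum]
    simp only [twist_mul_twist_one q (hv1 _)]
  have h1 : ∀ x, cosetMap q G (x * e) = (Fintype.card (AffineWeylGroup P ⧸ G) : ℂ)⁻¹ •
      ∑ c : AffineWeylGroup P ⧸ G, Finsupp.single c (Env.mulMap _ x) := by
    intro x
    induction x using env_induction with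
    | h0 => simp
    | h1 x y hx hy =>
      rw [add_mul, map_add, hx, hy, map_add, ← smul_add, ← Finset.sum_add_distrib]
      simp only [Finsupp.single_add]
    | h2 g x =>
      rw [hmul, map_smul, map_sum, mulMap_twist]
      congr 1
      refine Fintype.sum_equiv (MulAction.toPerm g) _ _ fun c => ?_
      rw [cosetMap_twist, MulAction.toPerm_apply]
      conv_rhs => rw [← hv2 c]
      rfl
  have h2 : ∀ x, Env.mulMap _ (x * e) = Env.mulMap _ x := by
    intro x
    induction x using env_induction with
    | h0 => simp
    | h1 x y hx hy => rw [add_mul, map_add, hx, hy, map_add]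
    | h2 g x =>
      rw [hmul, map_smul, map_sum]
      simp only [mulMap_twist, Finset.sum_const, Finset.card_univ]
      rw [← Nat.cast_smul_eq_nsmul ℂ, inv_smul_smul₀ hcard]
  have hpd := pdLT_generators q hz hli k le_rfl
  have hcount := card_support_add_finrank_radical b
  have hNle : N ≤ Env.kerMul (Hecke q) := by
    intro x hx
    exact map_relIdeal_eq_zero (Env.mulMap (Hecke q)) (isElementary_generators hz k)
      (fun v _ g y => by rw [mulMap_twist, mulMap_twist]) hx
  refine (PdLT.mono hpd (by omega)).retract
    ((Env.kerMul (Hecke q)).liftQ (N.mkQ ∘ₗ LinearMap.toSpanSingleton _ _ e) ?_)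
    (Submodule.factor hNle) ?_
  · intro x hx
    rw [LinearMap.mem_ker, LinearMap.comp_apply, LinearMap.toSpanSingleton_apply,
      Submodule.mkQ_apply, Submodule.Quotient.mk_eq_zero, hN,
      mem_relIdeal_iff (isElementary_generators hz k), smul_eq_mul, h1,
      (Env.mem_kerMul _).1 hx]
    simp
  · intro x
    obtain ⟨x, rfl⟩ := Submodule.Quotient.mk_surjective _ x
    change Submodule.Quotient.mk (x * e) = Submodule.Quotient.mk x
    rw [Submodule.Quotient.eq, Env.mem_kerMul, map_sub, h2, sub_self]

end UpperBound

end AffineHecke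
end

noncomputable section
set_option linter.unusedSectionVars false
namespace AffineHecke

/-! ### A free bimodule resolution with right linear contractions. -/

section RightSplit

variable (A : Type u) [Ring A] [Algebra ℂ A]

/-- Right multiplication by `c` on bimodules. -/
abbrev Env.right {A : Type u} [Ring A] [Algebra ℂ A] (c : A) : Env A := Env.tmul 1 c

/-- An index for a basis of `A`. -/
abbrev BasisIndex : Type u := Module.Basis.ofVectorSpaceIndex ℂ A

/-- A basis of `A`. -/
abbrev vecBasis : Module.Basis (BasisIndex A) ℂ A := Module.Basis.ofVectorSpace ℂ A

variable {A}

lemma Env.induction_basis {p : Env A → Prop} (h0 : p 0) (h1 : ∀ x y, p x → p y → p (x + y))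
    (h2 : ∀ i b, p (Env.tmul (vecBasis A i) b)) (x : Env A) : p x := by
  refine Env.induction h0 h1 (fun a c => ?_) x
  rw [← (vecBasis A).linearCombination_repr a, Finsupp.linearCombination_apply, Finsupp.sum,
    ← Env.tmulBilin_apply, map_sum, LinearMap.sum_apply]
  refine Finset.sum_induction _ p h1 h0 fun i _ => ?_
  rw [map_smul, LinearMap.smul_apply, ← map_smul]
  exact h2 _ _

lemma Env.right_mul_tmul (a b c : A) : Env.right c * Env.tmul a b = Env.tmul a (b * c) := by
  rw [Env.right, Env.tmul_mul_tmul, one_mul]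

variable (A)

/-- The map from the free module on the elements of a module to this module. -/
abbrev freeCover (Z : Type u) [AddCommGroup Z] [Module (Env A) Z] : (Z →₀ Env A) →ₗ[Env A] Z :=
  Finsupp.linearCombination (Env A) id

/-- A bimodule together with a right linear section of its cover by a free bimodule. -/
structure RightSplit where
  Z : Type u
  [addCommGroup : AddCommGroup Z]
  [module : Module (Env A) Z]
  sec : Z →+ (Z →₀ Env A)
  sec_right : ∀ (c : A) (z : Z), sec (Env.right c • z) = Env.right c • sec z
  cover_sec : ∀ z, freeCover A Z (sec z) = z

attribute [instance] RightSplit.addCommGroup RightSplit.module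

namespace RightSplit

variable {A} (S : RightSplit A)

/-- The free bimodule covering a given one. -/
abbrev Free : Type u := S.Z →₀ Env A

/-- The cover by a free bimodule. -/
abbrev cover : S.Free →ₗ[Env A] S.Z := freeCover A S.Z

/-- The kernel of the cover. -/
def Syz : Type u := LinearMap.ker S.cover

instance : AddCommGroup S.Syz := inferInstanceAs (AddCommGroup (LinearMap.ker S.cover))

instance : Module (Env A) S.Syz := inferInstanceAs (Module (Env A) (LinearMap.ker S.cover))

/-- The inclusion of the kernel of the cover. -/
def incl : S.Syz →ₗ[Env A] S.Free := (LinearMap.ker S.cover).subtype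

lemma incl_injective : Function.Injective S.incl := Subtype.val_injective

lemma cover_incl (x : S.Syz) : S.cover (S.incl x) = 0 := x.2

/-- The right linear projection on the kernel of the cover. -/
def proj : S.Free →+ S.Syz :=
  AddMonoidHom.mk' (fun x => ⟨x - S.sec (S.cover x), by
    rw [LinearMap.mem_ker, map_sub, S.cover_sec, sub_self]⟩) fun x y => S.incl_injective (by
      change x + y - S.sec (S.cover (x + y)) = x - S.sec (S.cover x) + (y - S.sec (S.cover y))
      simp only [map_add]
      abel)

lemma incl_proj (x : S.Free) : S.incl (S.proj x) = x - S.sec (S.cover x) := rfl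

lemma proj_right (c : A) (x : S.Free) : S.proj (Env.right c • x) = Env.right c • S.proj x := by
  apply S.incl_injective
  rw [incl_proj, map_smul S.incl, incl_proj, map_smul, sec_right, smul_sub]

lemma proj_incl (x : S.Syz) : S.proj (S.incl x) = x := by
  apply S.incl_injective
  rw [incl_proj, cover_incl, map_zero, sub_zero]

/-- A right linear lift of the projection on the kernel to the free cover of the kernel. -/
def lift : S.Free →ₗ[ℂ] (S.Syz →₀ Env A) :=
  Finsupp.lsum ℂ fun z => Env.lift ((vecBasis A).constr ℂ fun i =>
    Finsupp.lsingle (S.proj (Finsupp.single z (Env.tmul (vecBasis A i) 1))) ∘ₗ Env.tmulBilin 1)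

lemma lift_single (z : S.Z) (i : BasisIndex A) (c : A) :
    S.lift (Finsupp.single z (Env.tmul (vecBasis A i) c)) =
      Finsupp.single (S.proj (Finsupp.single z (Env.tmul (vecBasis A i) 1))) (Env.right c) := by
  rw [lift, Finsupp.lsum_single, Env.lift_tmul, Module.Basis.constr_basis]
  rfl

lemma free_induction {ι : Type u} {p : (ι →₀ Env A) → Prop} (h0 : p 0)
    (h1 : ∀ x y, p x → p y → p (x + y))
    (h2 : ∀ z i b, p (Finsupp.single z (Env.tmul (vecBasis A i) b))) (x : ι →₀ Env A) : p x := by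
  induction x using Finsupp.induction_linear with
  | zero => exact h0
  | add x y hx hy => exact h1 x y hx hy
  | single z x =>
    induction x using Env.induction_basis with
    | h0 => rw [Finsupp.single_zero]; exact h0
    | h1 x y hx hy => rw [Finsupp.single_add]; exact h1 _ _ hx hy
    | h2 i b => exact h2 z i b

lemma lift_right (c : A) (x : S.Free) : S.lift (Env.right c • x) = Env.right c • S.lift x := by
  induction x using free_induction with
  | h0 => simp
  | h1 x y hx hy => rw [smul_add, map_add, map_add, smul_add, hx, hy]
  | h2 z i b =>
    rw [Finsupp.smul_single, smul_eq_mul, Env.right_mul_tmul, lift_single, lift_single,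
      Finsupp.smul_single, smul_eq_mul, Env.right_mul_tmul]

lemma cover_lift (x : S.Free) : freeCover A S.Syz (S.lift x) = S.proj x := by
  induction x using free_induction with
  | h0 => simp
  | h1 x y hx hy => rw [map_add, map_add, map_add, hx, hy]
  | h2 z i b =>
    rw [lift_single, freeCover, Finsupp.linearCombination_single, id, ← proj_right,
      Finsupp.smul_single, smul_eq_mul, Env.right_mul_tmul, one_mul]

/-- The first syzygy of a right split bimodule. -/
def next : RightSplit A where
  Z := S.Syz
  sec := AddMonoidHom.mk' (fun z => S.lift (S.incl z)) fun x y => by rw [map_add, map_add]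
  sec_right c z := by
    change S.lift (S.incl (Env.right c • z)) = Env.right c • S.lift (S.incl z)
    rw [map_smul, lift_right]
  cover_sec z := (S.cover_lift _).trans (S.proj_incl z)

/-- The differential of the free resolution. -/
def diff : S.next.Free →ₗ[Env A] S.Free :=
  S.incl ∘ₗ S.next.cover

lemma cover_diff (x : S.next.Free) : S.cover (S.diff x) = 0 := S.cover_incl _

lemma diff_diff (x : S.next.next.Free) : S.diff (S.next.diff x) = 0 := by
  change S.incl (S.next.cover (S.next.diff x)) = 0
  rw [cover_diff]
  exact map_zero S.incl

/-- The right linear contraction of the free resolution. -/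
def contr : S.Free →ₗ[ℂ] S.next.Free := S.lift

lemma contr_right (c : A) (x : S.Free) : S.contr (Env.right c • x) = Env.right c • S.contr x :=
  S.lift_right c x

lemma diff_contr (x : S.Free) : S.diff (S.contr x) = x - S.sec (S.cover x) :=
  congrArg S.incl (S.cover_lift x)

lemma contr_diff (x : S.next.Free) : S.contr (S.diff x) = S.next.sec (S.next.cover x) := rfl

lemma contr_diff_add (x : S.next.Free) :
    S.contr (S.diff x) + S.next.diff (S.next.contr x) = x := by
  rw [contr_diff, diff_contr, add_sub_cancel]

lemma cover_surjective : Function.Surjective S.cover := fun z => ⟨S.sec z, S.cover_sec z⟩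

lemma pdLT_free {ι : Type u} : PdLT (Env A) (ι →₀ Env A) 1 := pdLT_one_iff.2 inferInstance

lemma pdLT_next {n : ℕ} (h : PdLT (Env A) S.Z (n + 2)) : PdLT (Env A) S.next.Z (n + 1) :=
  pdLT_left_of_exact (f := S.incl) (g := S.cover)
    S.incl_injective (LinearMap.exact_subtype_ker_map S.cover) S.cover_surjective
    (pdLT_free.mono (by omega)) h

lemma pdLT_next_one (h : PdLT (Env A) S.Z 1) : PdLT (Env A) S.next.Z 1 :=
  S.pdLT_next (h.mono (by omega))

/-- If the bimodule is projective, the free resolution has a bilinear contraction. -/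
lemma exists_homotopy (h : PdLT (Env A) S.Z 1) :
    ∃ (k : S.Free →ₗ[Env A] S.next.Free) (k' : S.next.Free →ₗ[Env A] S.next.next.Free),
      (∀ x, k (S.diff x) + S.next.diff (k' x) = x) ∧ (∀ x, S.diff (k (S.diff x)) = S.diff x) := by
  have lifting : ∀ S : RightSplit A, PdLT (Env A) S.Z 1 →
      ∃ t : S.Z →ₗ[Env A] S.Free, ∀ z, S.cover (t z) = z := by
    intro S h
    have := pdLT_one_iff.1 h
    obtain ⟨t, ht⟩ := Module.projective_lifting_property S.cover LinearMap.id S.cover_surjective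
    exact ⟨t, fun z => LinearMap.congr_fun ht z⟩
  -- The map `k` is the section `t'` of the next cover, applied after the projection `1 - t ∘ cover`
  -- on the syzygy. This determines both `d k` and `k d`.
  have hom : ∀ S : RightSplit A, PdLT (Env A) S.Z 1 → ∀ t' : S.next.Z →ₗ[Env A] S.next.Free,
      (∀ z, S.next.cover (t' z) = z) → ∃ (k : S.Free →ₗ[Env A] S.next.Free)
        (t : S.Z →ₗ[Env A] S.Free), (∀ x, S.diff (k x) = x - t (S.cover x)) ∧
        ∀ x, k (S.diff x) = t' (S.next.cover x) := by
    intro S h t' ht'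
    obtain ⟨t, ht⟩ := lifting S h
    let ρ : S.Free →ₗ[Env A] S.Syz := (LinearMap.id - t ∘ₗ S.cover).codRestrict (LinearMap.ker S.cover) (by
      intro x
      rw [LinearMap.mem_ker]
      simp only [LinearMap.sub_apply, LinearMap.id_apply, LinearMap.comp_apply, map_sub]
      rw [ht, sub_self])
    have hρ : ∀ x : S.Syz, ρ (S.incl x) = x := by
      intro x
      apply S.incl_injective
      change S.incl x - t (S.cover (S.incl x)) = S.incl x
      rw [cover_incl, map_zero, sub_zero]
    refine ⟨t' ∘ₗ ρ, t, fun x => ?_, fun x => ?_⟩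
    · exact congrArg S.incl (ht' (ρ x))
    · exact congrArg t' (hρ (S.next.cover x))
  obtain ⟨t'', ht''⟩ := lifting _ (S.next.pdLT_next_one (S.pdLT_next_one h))
  obtain ⟨k', t', h1, h2⟩ := hom _ (S.pdLT_next_one h) t'' ht''
  have ht' : ∀ z, S.next.cover (t' z) = z := by
    intro z
    obtain ⟨x, rfl⟩ := S.next.cover_surjective z
    have h3 := congrArg S.next.cover (h1 x)
    rw [cover_diff, map_sub, eq_comm, sub_eq_zero] at h3
    exact h3.symm
  obtain ⟨k, t, h3, h4⟩ := hom S h t' ht'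
  refine ⟨k, k', fun x => ?_, fun x => ?_⟩
  · rw [h4, h1, add_sub_cancel]
  · rw [h3, cover_diff, map_zero, sub_zero]

end RightSplit

/-- The multiplication map on the quotient by its kernel. -/
def Env.mulQuot : Env A ⧸ Env.kerMul A →+ A :=
  QuotientAddGroup.lift (Env.kerMul A).toAddSubgroup (Env.mulMap A).toAddMonoidHom
    (fun _ hx => AddMonoidHom.mem_ker.2 ((Env.mem_kerMul _).1 hx))

/-- The algebra itself, as a right split bimodule. -/
def RightSplit.base : RightSplit A where
  Z := Env A ⧸ Env.kerMul A
  sec := AddMonoidHom.mk' (fun z => Finsupp.single (Submodule.Quotient.mk 1)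
    (Env.right (Env.mulQuot A z))) fun x y => by
      rw [map_add, Env.right, Env.tmul_add, Finsupp.single_add]
  sec_right c z := by
    obtain ⟨z, rfl⟩ := Submodule.Quotient.mk_surjective _ z
    change Finsupp.single _ (Env.right (Env.mulMap A (Env.right c * z))) =
      Env.right c • Finsupp.single _ (Env.right (Env.mulMap A z))
    rw [Env.right, Env.mulMap_tmul_mul, one_mul, Finsupp.smul_single, smul_eq_mul,
      Env.right_mul_tmul]
  cover_sec z := by
    obtain ⟨z, rfl⟩ := Submodule.Quotient.mk_surjective _ z
    change freeCover A _ (Finsupp.single _ (Env.right (Env.mulMap A z))) = _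
    rw [freeCover, Finsupp.linearCombination_single, id, ← Submodule.Quotient.mk_smul,
      Submodule.Quotient.eq, Env.mem_kerMul, map_sub, smul_eq_mul, mul_one, Env.mulMap_tmul,
      one_mul, sub_self]

variable {A}

/-- The bimodules in the standard free resolution. -/
def RightSplit.seq : ℕ → RightSplit A
  | 0 => RightSplit.base A
  | n + 1 => (RightSplit.seq n).next

/-- Each passage to a syzygy lowers the projective dimension by one, so from step `r` on the
syzygies are projective. -/
lemma RightSplit.pdLT_seq {r : ℕ} (h : PdLT (Env A) (Env A ⧸ Env.kerMul A) (r + 1)) (n : ℕ)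
    (hn : r ≤ n) : PdLT (Env A) (RightSplit.seq (A := A) n).Z 1 := by
  have key : ∀ m k, m + k = r → PdLT (Env A) (RightSplit.seq (A := A) m).Z (k + 1) := by
    intro m
    induction m with
    | zero => rintro k hk; rw [zero_add] at hk; subst hk; exact h
    | succ m ih =>
      intro k hk
      exact (RightSplit.seq m).pdLT_next (ih (k + 1) (by omega))
  induction n, hn using Nat.le_induction with
  | base => exact key r 0 rfl
  | succ n _ ih => exact (RightSplit.seq n).pdLT_next_one ih

end RightSplit

end AffineHecke
end

noncomputable section
set_option linter.unusedSectionVars false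
namespace AffineHecke

open Bornology

/-! ### Bounded maps and bornologies described by coordinates. -/

section BoundedMaps

variable {V : Type*} {V' : Type*} {V'' : Type*} [AddCommGroup V] [Module ℂ V] [Bornology V]
  [AddCommGroup V'] [Module ℂ V'] [Bornology V'] [AddCommGroup V''] [Module ℂ V''] [Bornology V'']

lemma IsBoundedMap.comp {g : V' →ₗ[ℂ] V''} {f : V →ₗ[ℂ] V'} (hg : IsBoundedMap g)
    (hf : IsBoundedMap f) : IsBoundedMap (g ∘ₗ f) := fun s hs => by
  have h := hg _ (hf s hs)
  rw [Set.image_image] at h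
  exact h

lemma IsBoundedMap.id : IsBoundedMap (LinearMap.id : V →ₗ[ℂ] V) := fun s hs => by
  simpa using hs

lemma IsBoundedMap.zero : IsBoundedMap (0 : V →ₗ[ℂ] V') := fun s _ =>
  (isBounded_singleton (x := (0 : V'))).subset (by rintro _ ⟨x, _, rfl⟩; simp)

variable [IsConvexBornology V] [IsConvexBornology V']

lemma IsBoundedMap.add {f g : V →ₗ[ℂ] V'} (hf : IsBoundedMap f) (hg : IsBoundedMap g) :
    IsBoundedMap (f + g) := fun s hs => by
  refine (IsConvexBornology.isBounded_add _ _ (hf s hs) (hg s hs)).subset ?_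
  rintro _ ⟨x, hx, rfl⟩
  exact ⟨_, ⟨x, hx, rfl⟩, _, ⟨x, hx, rfl⟩, rfl⟩

lemma IsBoundedMap.smul (c : ℂ) {f : V →ₗ[ℂ] V'} (hf : IsBoundedMap f) :
    IsBoundedMap (c • f) := fun s hs => by
  refine (IsConvexBornology.isBounded_smul c _ (hf s hs)).subset ?_
  rintro _ ⟨x, hx, rfl⟩
  exact ⟨_, ⟨x, hx, rfl⟩, rfl⟩

lemma isBounded_sum {β : Type*} (J : Finset β) (S : β → Set V) (h : ∀ i ∈ J, IsBounded (S i)) :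
    IsBounded {x : V | ∃ f : β → V, (∀ i ∈ J, f i ∈ S i) ∧ x = ∑ i ∈ J, f i} := by
  classical
  induction J using Finset.induction_on with
  | empty =>
    refine (isBounded_singleton (x := (0 : V))).subset ?_
    rintro x ⟨f, _, rfl⟩
    simp
  | insert i J hi ih =>
    refine (IsConvexBornology.isBounded_add _ _ (h i (Finset.mem_insert_self i J))
      (ih fun j hj => h j (Finset.mem_insert_of_mem hj))).subset ?_
    rintro x ⟨f, hf, rfl⟩
    exact ⟨_, hf i (Finset.mem_insert_self i J), _,
      ⟨f, fun j hj => hf j (Finset.mem_insert_of_mem hj), rfl⟩, Finset.sum_insert hi⟩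

lemma isBounded_ball_smul (R : ℝ) {S : Set V} (hS : IsBounded S) :
    IsBounded {x : V | ∃ c : ℂ, ‖c‖ ≤ R ∧ ∃ y ∈ S, x = c • y} := by
  obtain ⟨t, hSt, ht, hbal, _⟩ := IsConvexBornology.isBounded_hull S hS
  -- The factor `max R 1` can be inverted even if `R ≤ 0`; the remaining scalar has norm at most 1
  -- and is absorbed by the balanced hull.
  refine (IsConvexBornology.isBounded_smul ((max R 1 : ℝ) : ℂ) t ht).subset ?_
  rintro x ⟨c, hc, y, hy, rfl⟩
  have h0 : (0 : ℝ) < max R 1 := lt_max_of_lt_right one_pos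
  have h1 : ((max R 1 : ℝ) : ℂ) ≠ 0 := by exact_mod_cast h0.ne'
  refine ⟨(((max R 1 : ℝ) : ℂ)⁻¹ * c) • y, hbal.smul_mem ?_ (hSt hy), ?_⟩
  · rw [norm_mul, norm_inv, Complex.norm_real, Real.norm_of_nonneg h0.le, inv_mul_le_one₀ h0]
    exact hc.trans (le_max_left _ _)
  · change ((max R 1 : ℝ) : ℂ) • _ = _
    rw [smul_smul, mul_inv_cancel_left₀ h1]

/-- If each element of `A` acts by a bounded map, then the action is bounded for the fine
bornology on `A`. -/
lemma isBounded_fine_smul {A : Type*} [Ring A] [Algebra ℂ A] [Module A V] [IsScalarTower ℂ A V]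
    (h : ∀ a : A, IsBoundedMap (Algebra.lsmul ℂ ℂ V a)) (S : Set A) (B : Set V)
    (hS : (fineBornology A).IsBounded S) (hB : IsBounded B) :
    IsBounded {x | ∃ a ∈ S, ∃ v ∈ B, x = a • v} := by
  obtain ⟨n, f, t, ht, hS⟩ := (Bornology.isBounded_ofBounded_iff _).1 hS
  obtain ⟨R, hR⟩ := ht.exists_norm_le
  refine (isBounded_sum Finset.univ _ fun (i : Fin n) _ =>
    isBounded_ball_smul R (h (f (Pi.single i 1)) B hB)).subset ?_
  rintro _ ⟨a, ha, v, hv, rfl⟩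
  obtain ⟨y, hy, rfl⟩ := hS ha
  refine ⟨fun i => y i • f (Pi.single i 1) • v, fun i _ =>
    ⟨y i, (norm_le_pi_norm y i).trans (hR y hy), _, ⟨v, hv, rfl⟩, rfl⟩, ?_⟩
  conv_lhs => rw [pi_eq_sum_univ' y, map_sum, Finset.sum_smul]
  refine Finset.sum_congr rfl fun i _ => ?_
  rw [map_smul, smul_assoc]

/-- Every bounded set is contained in a completant bounded disc. -/
def IsCompleteBornology (V : Type v) [AddCommGroup V] [Module ℂ V] [Bornology V] : Prop :=
  ∀ B : Set V, IsBounded B → ∃ D : Set V, B ⊆ D ∧ IsBounded D ∧ IsCompletantDisc D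

end BoundedMaps

section CoordinateBornology

variable {M : Type v} {U : Type w} {β : Type*} [AddCommGroup M] [Module ℂ M]
  [AddCommGroup U] [Module ℂ U] [Bornology U] (e : M ≃ₗ[ℂ] (β →₀ U))

/-- Boundedness with respect to coordinates: only finitely many coordinates occur, and the
coordinates stay in a bounded set. -/
def CoordBounded (S : Set M) : Prop :=
  ∃ (J : Finset β) (B : Set U), IsBounded B ∧ ∀ x ∈ S, (∀ i ∉ J, e x i = 0) ∧ ∀ i, e x i ∈ B

/-- The bornology given by coordinates. -/
@[reducible]
def coordBornology : Bornology M :=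
  Bornology.ofBounded {S | CoordBounded e S} ⟨∅, ∅, isBounded_empty, by simp⟩
    (fun _ ⟨J, B, hB, h⟩ _ hS => ⟨J, B, hB, fun x hx => h x (hS hx)⟩)
    (by
      classical
      rintro S ⟨J, B, hB, h⟩ S' ⟨J', B', hB', h'⟩
      refine ⟨J ∪ J', B ∪ B', hB.union hB', ?_⟩
      rintro x (hx | hx)
      · exact ⟨fun i hi => (h x hx).1 i fun hJ => hi (Finset.mem_union_left _ hJ),
          fun i => Or.inl ((h x hx).2 i)⟩
      · exact ⟨fun i hi => (h' x hx).1 i fun hJ => hi (Finset.mem_union_right _ hJ),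
          fun i => Or.inr ((h' x hx).2 i)⟩)
    (by
      intro x
      refine ⟨(e x).support, Set.range (e x), (Finsupp.finite_range (e x)).isBounded, ?_⟩
      rintro y rfl
      exact ⟨fun i hi => Finsupp.notMem_support_iff.1 hi, fun i => Set.mem_range_self i⟩)

lemma isBounded_coordBornology (S : Set M) :
    (coordBornology e).IsBounded S ↔ CoordBounded e S :=
  Bornology.isBounded_ofBounded_iff _

variable {e} [Bornology M] (hM : ∀ S : Set M, IsBounded S ↔ CoordBounded e S)

include hM

lemma isConvexBornology_of_coord [IsConvexBornology U] : IsConvexBornology M where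
  isBounded_add s t hs ht := by
    classical
    rw [hM] at hs ht ⊢
    obtain ⟨J, B, hB, h⟩ := hs
    obtain ⟨J', B', hB', h'⟩ := ht
    refine ⟨J ∪ J', _, IsConvexBornology.isBounded_add B B' hB hB', ?_⟩
    rintro _ ⟨x, hx, y, hy, rfl⟩
    simp only [map_add, Finsupp.add_apply]
    refine ⟨fun i hi => ?_, fun i => ⟨_, (h x hx).2 i, _, (h' y hy).2 i, rfl⟩⟩
    rw [Finset.mem_union, not_or] at hi
    rw [(h x hx).1 i hi.1, (h' y hy).1 i hi.2, add_zero]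
  isBounded_smul c s hs := by
    rw [hM] at hs ⊢
    obtain ⟨J, B, hB, h⟩ := hs
    refine ⟨J, _, IsConvexBornology.isBounded_smul c B hB, ?_⟩
    rintro _ ⟨x, hx, rfl⟩
    simp only [map_smul, Finsupp.smul_apply]
    exact ⟨fun i hi => by rw [(h x hx).1 i hi, smul_zero], fun i => ⟨_, (h x hx).2 i, rfl⟩⟩
  isBounded_hull s hs := by
    rw [hM] at hs
    obtain ⟨J, B, hB, h⟩ := hs
    obtain ⟨t, hBt, ht, hbal, hconv⟩ := IsConvexBornology.isBounded_hull B hB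
    refine ⟨{x | (∀ i ∉ J, e x i = 0) ∧ ∀ i, e x i ∈ t}, ?_, ?_, ?_, ?_⟩
    · exact fun x hx => ⟨(h x hx).1, fun i => hBt ((h x hx).2 i)⟩
    · rw [hM]
      exact ⟨J, t, ht, fun x hx => hx⟩
    · rintro c hc _ ⟨x, hx, rfl⟩
      simp only [Set.mem_ofPred_eq, map_smul, Finsupp.smul_apply]
      exact ⟨fun i hi => by rw [hx.1 i hi, smul_zero], fun i => hbal.smul_mem hc (hx.2 i)⟩
    · intro x hx y hy a c ha hc hac
      have he : ∀ i, e (a • x + c • y) i = a • e x i + c • e y i := fun i => by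
        rw [map_add, Finsupp.add_apply, ← Complex.coe_smul, map_smul, Finsupp.smul_apply,
          ← Complex.coe_smul c, map_smul, Finsupp.smul_apply, Complex.coe_smul, Complex.coe_smul]
      refine ⟨fun i hi => ?_, fun i => ?_⟩
      · rw [he, hx.1 i hi, hy.1 i hi, smul_zero, smul_zero, add_zero]
      · rw [he]
        exact hconv (hx.2 i) (hy.2 i) ha hc hac

/-- Only finitely many coordinates occur on a bounded set, so there the map is a finite sum of
bounded ones. -/
lemma isBoundedMap_of_coord {V : Type*} [AddCommGroup V] [Module ℂ V] [Bornology V]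
    [IsConvexBornology V] {φ : M →ₗ[ℂ] V}
    (h : ∀ i, IsBoundedMap (φ ∘ₗ e.symm.toLinearMap ∘ₗ Finsupp.lsingle i)) : IsBoundedMap φ := by
  intro S hS
  rw [hM] at hS
  obtain ⟨J, B, hB, hS⟩ := hS
  refine (isBounded_sum J _ fun i _ => h i B hB).subset ?_
  rintro _ ⟨x, hx, rfl⟩
  refine ⟨fun i => φ (e.symm (Finsupp.single i (e x i))), fun i _ =>
    ⟨e x i, (hS x hx).2 i, rfl⟩, ?_⟩
  rw [← map_sum, ← map_sum]
  congr 1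
  rw [LinearEquiv.eq_symm_apply]
  refine ((Finsupp.sum_single (e x)).symm).trans (Finsupp.sum_of_support_subset _ ?_ _ ?_)
  · intro i hi
    by_contra hJ
    exact Finsupp.mem_support_iff.1 hi ((hS x hx).1 i hJ)
  · exact fun i _ => Finsupp.single_zero i

lemma isBoundedMap_into_coord {V : Type*} [AddCommGroup V] [Module ℂ V] [Bornology V]
    {ψ : V →ₗ[ℂ] M} (J : Finset β) (h0 : ∀ i ∉ J, ∀ x, e (ψ x) i = 0)
    (h : ∀ i, IsBoundedMap (Finsupp.lapply i ∘ₗ e.toLinearMap ∘ₗ ψ)) : IsBoundedMap ψ := by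
  intro S hS
  rw [hM]
  refine ⟨J, insert 0 (⋃ i ∈ J, (Finsupp.lapply i ∘ₗ e.toLinearMap ∘ₗ ψ) '' S), ?_, ?_⟩
  · refine IsBounded.insert ?_ 0
    rw [isBounded_biUnion_finset]
    exact fun i _ => h i S hS
  · rintro _ ⟨x, hx, rfl⟩
    refine ⟨fun i hi => h0 i hi x, fun i => ?_⟩
    by_cases hi : i ∈ J
    · exact Or.inr (Set.mem_biUnion hi ⟨x, hx, rfl⟩)
    · exact Or.inl (h0 i hi x)

lemma isCompleteBornology_of_coord (hU : IsCompleteBornology U) : IsCompleteBornology M := by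
  classical
  intro S hS
  rw [hM] at hS
  obtain ⟨J, B, hB, h⟩ := hS
  obtain ⟨D, hBD, hD, hbal, hconv, hsep, hcomp⟩ := hU B hB
  have smul_apply : ∀ (a : ℝ) (x : M) i, e (a • x) i = a • e x i := fun a x i => by
    rw [← Complex.coe_smul, map_smul, Finsupp.smul_apply, Complex.coe_smul]
  refine ⟨{x | (∀ i ∉ J, e x i = 0) ∧ ∀ i, e x i ∈ D}, ?_, ?_, ?_, ?_, ?_, ?_⟩
  · exact fun x hx => ⟨(h x hx).1, fun i => hBD ((h x hx).2 i)⟩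
  · rw [hM]
    exact ⟨J, D, hD, fun x hx => hx⟩
  · rintro c hc _ ⟨x, hx, rfl⟩
    simp only [Set.mem_ofPred_eq, map_smul, Finsupp.smul_apply]
    exact ⟨fun i hi => by rw [hx.1 i hi, smul_zero], fun i => hbal.smul_mem hc (hx.2 i)⟩
  · intro x hx y hy a c ha hc hac
    have he : ∀ i, e (a • x + c • y) i = a • e x i + c • e y i := fun i => by
      rw [map_add, Finsupp.add_apply, smul_apply, smul_apply]
    refine ⟨fun i hi => ?_, fun i => ?_⟩
    · rw [he, hx.1 i hi, hy.1 i hi, smul_zero, smul_zero, add_zero]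
    · rw [he]
      exact hconv (hx.2 i) (hy.2 i) ha hc hac
  · intro x hx
    refine e.injective (Finsupp.ext fun i => ?_)
    rw [map_zero, Finsupp.zero_apply]
    refine hsep _ fun ε hε => ?_
    obtain ⟨y, hy, rfl⟩ := hx ε hε
    exact ⟨_, hy.2 i, smul_apply _ _ _⟩
  · intro x hx
    have hx' : ∀ i, ∃ l : U, ∀ ε : ℝ, 0 < ε → ∃ N, ∀ n ≥ N, ∃ y ∈ D, e (x n) i - l = ε • y := by
      refine fun i => hcomp (fun n => e (x n) i) fun ε hε => ?_
      obtain ⟨N, hN⟩ := hx ε hε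
      refine ⟨N, fun m hm n hn => ?_⟩
      obtain ⟨y, hy, hxy⟩ := hN m hm n hn
      refine ⟨_, hy.2 i, ?_⟩
      rw [← smul_apply, ← hxy, map_sub, Finsupp.sub_apply]
    choose l hl using hx'
    obtain ⟨N₀, hN₀⟩ := hx 1 one_pos
    have hoff : ∀ n ≥ N₀, ∀ i ∉ J, e (x n) i = e (x N₀) i := by
      intro n hn i hi
      obtain ⟨y, hy, hxy⟩ := hN₀ n hn N₀ le_rfl
      rw [← sub_eq_zero, ← Finsupp.sub_apply, ← map_sub, hxy, one_smul, hy.1 i hi]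
    -- Outside `J` the coordinates are constant from `N₀` on and the limit keeps those of `x N₀`;
    -- inside `J` it has the coordinatewise limits.
    let z : M := e.symm (e (x N₀) + ∑ i ∈ J, Finsupp.single i (l i - e (x N₀) i))
    have hz : ∀ i, e z i = if i ∈ J then l i else e (x N₀) i := by
      intro i
      simp only [z, LinearEquiv.apply_symm_apply, Finsupp.add_apply, Finsupp.finsetSum_apply,
        Finsupp.single_apply]
      rw [Finset.sum_ite_eq']
      split_ifs
      · rw [add_sub_cancel]
      · rw [add_zero]
    refine ⟨z, fun ε hε => ?_⟩
    choose N hN using fun i => hl i ε hε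
    refine ⟨max N₀ (J.sup N), fun n hn => ?_⟩
    refine ⟨(ε⁻¹ : ℝ) • (x n - z), ?_, by rw [smul_inv_smul₀ hε.ne']⟩
    have key : ∀ i, (i ∉ J → e ((ε⁻¹ : ℝ) • (x n - z)) i = 0) ∧ (i ∈ J →
        e ((ε⁻¹ : ℝ) • (x n - z)) i ∈ D) := by
      intro i
      rw [smul_apply, map_sub, Finsupp.sub_apply, hz]
      constructor
      · intro hi
        rw [if_neg hi, hoff n ((le_max_left _ _).trans hn) i hi, sub_self, smul_zero]
      · intro hi
        obtain ⟨y, hy, hxy⟩ := hN i n ((Finset.le_sup hi).trans ((le_max_right _ _).trans hn))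
        rw [if_pos hi, hxy, inv_smul_smul₀ hε.ne']
        exact hy
    refine ⟨fun i hi => (key i).1 hi, fun i => ?_⟩
    by_cases hi : i ∈ J
    · exact (key i).2 hi
    · rw [(key i).1 hi]
      obtain ⟨y, hy, -⟩ := hN i _ le_rfl
      exact hbal.zero_mem ⟨y, hy⟩

end CoordinateBornology

end AffineHecke
end

noncomputable section
set_option linter.unusedSectionVars false
namespace AffineHecke

open scoped TensorProduct
open Bornology

/-! ### Induced modules A^(κ) ⊗ U, algebraically and bornologically. -/

section Induced

variable {A : Type u} [Ring A] [Algebra ℂ A]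

/-- The free `A`-module on the index set `κ`, tensored with a vector space. -/
def Tens (A : Type u) [Ring A] [Algebra ℂ A] (κ : Type u) (U : Type u) [AddCommGroup U]
    [Module ℂ U] : Type u := (κ →₀ A) ⊗[ℂ] U

variable {κ κ' κ'' : Type u} {U : Type u} [AddCommGroup U] [Module ℂ U]

instance : AddCommGroup (Tens A κ U) := inferInstanceAs (AddCommGroup ((κ →₀ A) ⊗[ℂ] U))

instance : Module ℂ (Tens A κ U) := inferInstanceAs (Module ℂ ((κ →₀ A) ⊗[ℂ] U))

instance : Module A (Tens A κ U) := inferInstanceAs (Module A ((κ →₀ A) ⊗[ℂ] U))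

instance : IsScalarTower ℂ A (Tens A κ U) :=
  inferInstanceAs (IsScalarTower ℂ A ((κ →₀ A) ⊗[ℂ] U))

/-- Pure tensors. -/
def Tens.mk : (κ →₀ A) →ₗ[ℂ] U →ₗ[ℂ] Tens A κ U := TensorProduct.mk ℂ (κ →₀ A) U

lemma Tens.smul_mk (a : A) (l : κ →₀ A) (u : U) : a • Tens.mk l u = Tens.mk (a • l) u :=
  TensorProduct.smul_tmul' a l u

lemma Tens.induction {p : Tens A κ U → Prop} (h0 : p 0) (h1 : ∀ x y, p x → p y → p (x + y))
    (h2 : ∀ l u, p (Tens.mk l u)) (x : Tens A κ U) : p x :=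
  TensorProduct.induction_on (motive := p) x h0 h2 h1

lemma Tens.induction_single {p : Tens A κ U → Prop} (h0 : p 0)
    (h1 : ∀ x y, p x → p y → p (x + y)) (h2 : ∀ i a u, p (Tens.mk (Finsupp.single i a) u))
    (x : Tens A κ U) : p x := by
  refine Tens.induction h0 h1 (fun l u => ?_) x
  induction l using Finsupp.induction_linear with
  | zero => rw [map_zero]; exact h0
  | add l l' h h' => rw [map_add]; exact h1 _ _ h h'
  | single i a => exact h2 i a u

/-- The universal property of the tensor product. -/
def Tens.lift {M : Type*} [AddCommGroup M] [Module ℂ M] (f : (κ →₀ A) →ₗ[ℂ] U →ₗ[ℂ] M) :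
    Tens A κ U →ₗ[ℂ] M :=
  (TensorProduct.lift f : (κ →₀ A) ⊗[ℂ] U →ₗ[ℂ] M)

lemma Tens.lift_mk {M : Type*} [AddCommGroup M] [Module ℂ M] (f : (κ →₀ A) →ₗ[ℂ] U →ₗ[ℂ] M)
    (l : κ →₀ A) (u : U) : Tens.lift f (Tens.mk l u) = f l u := rfl

/-- A linear map compatible with the action of `A`, as an `A`-linear map. -/
def linearOf {M N : Type*} [AddCommGroup M] [Module ℂ M] [Module A M] [AddCommGroup N] [Module ℂ N]
    [Module A N] (f : M →ₗ[ℂ] N) (h : ∀ (a : A) x, f (a • x) = a • f x) : M →ₗ[A] N where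
  toFun := f
  map_add' := map_add f
  map_smul' := h

section Extend

variable {V : Type u} [AddCommGroup V] [Module ℂ V] [Module A V] [IsScalarTower ℂ A V]

/-- The extension of a family of linear maps to an `A`-linear map. -/
def Tens.extend (φ : κ → U →ₗ[ℂ] V) : Tens A κ U →ₗ[A] V :=
  linearOf (Tens.lift (Finsupp.lsum ℂ fun i =>
    (LinearMap.llcomp ℂ U V V).flip (φ i) ∘ₗ (Algebra.lsmul ℂ ℂ V).toLinearMap)) (by
    intro a x
    induction x using Tens.induction_single with
    | h0 => simp
    | h1 x y hx hy => rw [smul_add, map_add, map_add, smul_add, hx, hy]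
    | h2 i c u =>
      rw [Tens.smul_mk, Finsupp.smul_single, Tens.lift_mk, Tens.lift_mk, Finsupp.lsum_single,
        Finsupp.lsum_single]
      exact mul_smul a c (φ i u))

lemma Tens.extend_mk_single (φ : κ → U →ₗ[ℂ] V) (i : κ) (a : A) (u : U) :
    Tens.extend φ (Tens.mk (Finsupp.single i a) u) = a • φ i u := by
  change Tens.lift _ _ = _
  rw [Tens.lift_mk, Finsupp.lsum_single]
  rfl

lemma Tens.hom_ext {f g : Tens A κ U →ₗ[A] V}
    (h : ∀ i u, f (Tens.mk (Finsupp.single i 1) u) = g (Tens.mk (Finsupp.single i 1) u)) :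
    f = g := by
  ext x
  induction x using Tens.induction_single with
  | h0 => simp
  | h1 x y hx hy => rw [map_add, map_add, hx, hy]
  | h2 i a u =>
    have : Tens.mk (Finsupp.single i a) u = a • Tens.mk (Finsupp.single i 1) u := by
      rw [Tens.smul_mk, Finsupp.smul_single, smul_eq_mul, mul_one]
    rw [this, map_smul, map_smul, h]

end Extend

/-- A ℂ-linear section of the surjection, restricted to the vectors `e_i ⊗ u`, extends to an
`A`-linear one. -/
lemma Tens.projective : Module.Projective A (Tens A κ U) := by
  refine Module.Projective.of_lifting_property'' fun f hf => ?_
  obtain ⟨σ, hσ⟩ := (f.restrictScalars ℂ).exists_rightInverse_of_surjective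
    (LinearMap.range_eq_top.2 hf)
  refine ⟨Tens.extend fun i => σ ∘ₗ Tens.mk (Finsupp.single i 1), ?_⟩
  apply Tens.hom_ext
  intro i u
  rw [LinearMap.comp_apply, Tens.extend_mk_single, one_smul]
  exact LinearMap.congr_fun hσ _

section Bornology

open scoped Classical

/-- The coordinates with respect to a basis of the free module. -/
def Tens.coord : Tens A κ U ≃ₗ[ℂ] (Module.Basis.ofVectorSpaceIndex ℂ (κ →₀ A) →₀ U) :=
  TensorProduct.equivFinsuppOfBasisLeft (Module.Basis.ofVectorSpace ℂ (κ →₀ A))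

lemma Tens.coord_mk (l : κ →₀ A) (u : U) (i : Module.Basis.ofVectorSpaceIndex ℂ (κ →₀ A)) :
    Tens.coord (Tens.mk l u) i = (Module.Basis.ofVectorSpace ℂ (κ →₀ A)).repr l i • u :=
  TensorProduct.equivFinsuppOfBasisLeft_apply_tmul_apply _ l u i

lemma Tens.coord_symm_single (i : Module.Basis.ofVectorSpaceIndex ℂ (κ →₀ A)) (u : U) :
    Tens.coord.symm (Finsupp.single i u) =
      Tens.mk (A := A) (Module.Basis.ofVectorSpace ℂ (κ →₀ A) i) u := by
  refine (TensorProduct.equivFinsuppOfBasisLeft_symm_apply _ _).trans ?_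
  exact Finsupp.sum_single_index (TensorProduct.tmul_zero _ _)

variable [Bornology U]

instance : Bornology (Tens A κ U) := coordBornology Tens.coord

lemma Tens.isBounded_iff (S : Set (Tens A κ U)) : IsBounded S ↔ CoordBounded Tens.coord S :=
  isBounded_coordBornology _ S

variable [IsConvexBornology U]

instance : IsConvexBornology (Tens A κ U) := isConvexBornology_of_coord Tens.isBounded_iff

variable {V : Type*} [AddCommGroup V] [Module ℂ V] [Bornology V] [IsConvexBornology V]

lemma Tens.isBoundedMap {φ : Tens A κ U →ₗ[ℂ] V} (h : ∀ l, IsBoundedMap (φ ∘ₗ Tens.mk l)) :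
    IsBoundedMap φ := by
  refine isBoundedMap_of_coord Tens.isBounded_iff fun i => ?_
  convert h (Module.Basis.ofVectorSpace ℂ (κ →₀ A) i) using 1
  ext u
  exact congrArg φ (Tens.coord_symm_single i u)

lemma Tens.isBoundedMap_mk (l : κ →₀ A) : IsBoundedMap (Tens.mk (U := U) l) := by
  refine isBoundedMap_into_coord Tens.isBounded_iff
    ((Module.Basis.ofVectorSpace ℂ (κ →₀ A)).repr l).support (fun i hi x => ?_) (fun i => ?_)
  · rw [Tens.coord_mk, Finsupp.notMem_support_iff.1 hi, zero_smul]
  · convert (IsBoundedMap.id (V := U)).smul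
      ((Module.Basis.ofVectorSpace ℂ (κ →₀ A)).repr l i) using 1
    ext u
    exact Tens.coord_mk l u i

lemma Tens.isBoundedMap_of_single {φ : Tens A κ U →ₗ[ℂ] V}
    (h : ∀ i a, IsBoundedMap (φ ∘ₗ Tens.mk (Finsupp.single i a))) : IsBoundedMap φ := by
  refine Tens.isBoundedMap fun l => ?_
  induction l using Finsupp.induction_linear with
  | zero => rw [map_zero, LinearMap.comp_zero]; exact IsBoundedMap.zero
  | add l l' hl hl' => rw [map_add, LinearMap.comp_add]; exact hl.add hl'
  | single i a => exact h i a

end Bornology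

section Act

variable [Module A U] [IsScalarTower ℂ A U]

/-- The right multiplication, absorbed in the module. -/
def Tens.act : (κ →₀ Env A) →ₗ[ℂ] U →ₗ[ℂ] Tens A κ U :=
  Finsupp.lsum ℂ fun i => Env.lift ((LinearMap.llcomp ℂ U U (Tens A κ U)).compl₁₂
    (Tens.mk ∘ₗ Finsupp.lsingle i) (Algebra.lsmul ℂ ℂ U).toLinearMap)

lemma Tens.act_single (i : κ) (a c : A) (u : U) :
    Tens.act (Finsupp.single i (Env.tmul a c)) u = Tens.mk (Finsupp.single i a) (c • u) := by
  rw [Tens.act, Finsupp.lsum_single, Env.lift_tmul]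
  rfl

lemma Env.finsupp_induction {p : (κ →₀ Env A) → Prop} (h0 : p 0)
    (h1 : ∀ x y, p x → p y → p (x + y)) (h2 : ∀ i a b, p (Finsupp.single i (Env.tmul a b)))
    (x : κ →₀ Env A) : p x := by
  induction x using Finsupp.induction_linear with
  | zero => exact h0
  | add x y hx hy => exact h1 x y hx hy
  | single z x =>
    induction x using Env.induction with
    | h0 => rw [Finsupp.single_zero]; exact h0
    | h1 x y hx hy => rw [Finsupp.single_add]; exact h1 _ _ hx hy
    | h2 a b => exact h2 z a b

lemma Tens.act_right (c : A) (x : κ →₀ Env A) (u : U) :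
    Tens.act (Env.right c • x) u = Tens.act x (c • u) := by
  induction x using Env.finsupp_induction with
  | h0 => simp
  | h1 x y hx hy => simp only [smul_add, map_add, LinearMap.add_apply, hx, hy]
  | h2 i a b =>
    rw [Finsupp.smul_single, smul_eq_mul, Env.right_mul_tmul, Tens.act_single, Tens.act_single,
      mul_smul]

lemma Tens.act_left (c : A) (x : κ →₀ Env A) (u : U) :
    Tens.act (Env.tmul c 1 • x) u = c • Tens.act x u := by
  induction x using Env.finsupp_induction with
  | h0 => simp
  | h1 x y hx hy => simp only [smul_add, map_add, LinearMap.add_apply, hx, hy]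
  | h2 i a b =>
    rw [Finsupp.smul_single, smul_eq_mul, Env.tmul_mul_tmul, mul_one, Tens.act_single,
      Tens.act_single, Tens.smul_mk, Finsupp.smul_single, smul_eq_mul]

/-- The embedding of the free module in the free bimodule. -/
def freeLeft : (κ →₀ A) →ₗ[ℂ] (κ →₀ Env A) :=
  Finsupp.mapRange.linearMap (Env.tmulBilin.flip 1)

lemma freeLeft_single (i : κ) (a : A) :
    freeLeft (Finsupp.single i a) = Finsupp.single i (Env.tmul a 1) := by
  rw [freeLeft, Finsupp.mapRange.linearMap_apply, Finsupp.mapRange_single]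
  rfl

lemma freeLeft_smul (a : A) (l : κ →₀ A) : freeLeft (a • l) = Env.tmul a 1 • freeLeft l := by
  induction l using Finsupp.induction_linear with
  | zero => simp
  | add l l' hl hl' => rw [smul_add, map_add, map_add, hl, hl', smul_add]
  | single i c =>
    rw [Finsupp.smul_single, smul_eq_mul, freeLeft_single, freeLeft_single, Finsupp.smul_single,
      smul_eq_mul, Env.tmul_mul_tmul, mul_one]

lemma Tens.act_freeLeft (l : κ →₀ A) (u : U) : Tens.act (freeLeft l) u = Tens.mk l u := by
  induction l using Finsupp.induction_linear with
  | zero => simp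
  | add l l' hl hl' => simp only [map_add, LinearMap.add_apply, hl, hl']
  | single i c => rw [freeLeft_single, Tens.act_single, one_smul]

/-- The map induced by a map of free bimodules. -/
def Tens.map (U : Type u) [AddCommGroup U] [Module ℂ U] [Module A U] [IsScalarTower ℂ A U]
    (f : (κ →₀ Env A) →ₗ[ℂ] (κ' →₀ Env A)) : Tens A κ U →ₗ[ℂ] Tens A κ' U :=
  Tens.lift (Tens.act ∘ₗ f ∘ₗ freeLeft)

lemma Tens.map_mk (f : (κ →₀ Env A) →ₗ[ℂ] (κ' →₀ Env A)) (l : κ →₀ A) (u : U) :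
    Tens.map U f (Tens.mk l u) = Tens.act (f (freeLeft l)) u := rfl

/-- Right linear maps of bimodules. -/
def IsRightLinear (f : (κ →₀ Env A) →ₗ[ℂ] (κ' →₀ Env A)) : Prop :=
  ∀ (c : A) x, f (Env.right c • x) = Env.right c • f x

/-- `Tens A κ U` is a model for the free bimodule tensored over `A` with `U`, with `Tens.act` as
canonical map; balanced maps factor through it. This yields functoriality for maps that are only
right linear. -/
lemma Tens.lift_act {M : Type*} [AddCommGroup M] [Module ℂ M] {f : (κ →₀ Env A) →ₗ[ℂ] U →ₗ[ℂ] M}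
    (hf : ∀ (c : A) x u, f (Env.right c • x) u = f x (c • u)) (x : κ →₀ Env A) (u : U) :
    Tens.lift (f ∘ₗ freeLeft) (Tens.act x u) = f x u := by
  induction x using Env.finsupp_induction with
  | h0 => simp
  | h1 x y hx hy => simp only [map_add, LinearMap.add_apply, hx, hy]
  | h2 i a b =>
    rw [Tens.act_single, Tens.lift_mk, LinearMap.comp_apply, freeLeft_single, ← hf,
      Finsupp.smul_single, smul_eq_mul, Env.right_mul_tmul, one_mul]

lemma Tens.map_act {f : (κ →₀ Env A) →ₗ[ℂ] (κ' →₀ Env A)} (hf : IsRightLinear f)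
    (x : κ →₀ Env A) (u : U) : Tens.map U f (Tens.act x u) = Tens.act (f x) u :=
  Tens.lift_act (f := Tens.act ∘ₗ f)
    (fun c x u => by rw [LinearMap.comp_apply, hf, Tens.act_right, LinearMap.comp_apply]) x u

lemma Tens.map_comp {g : (κ' →₀ Env A) →ₗ[ℂ] (κ'' →₀ Env A)}
    {f : (κ →₀ Env A) →ₗ[ℂ] (κ' →₀ Env A)} (hg : IsRightLinear g) (t : Tens A κ U) :
    Tens.map U g (Tens.map U f t) = Tens.map U (g ∘ₗ f) t := by
  induction t using Tens.induction with
  | h0 => simp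
  | h1 x y hx hy => simp only [map_add, hx, hy]
  | h2 l u => rw [Tens.map_mk, Tens.map_act hg, Tens.map_mk, LinearMap.comp_apply]

lemma Tens.map_add_left (f g : (κ →₀ Env A) →ₗ[ℂ] (κ' →₀ Env A)) (t : Tens A κ U) :
    Tens.map U (f + g) t = Tens.map U f t + Tens.map U g t := by
  induction t using Tens.induction with
  | h0 => simp
  | h1 x y hx hy => simp only [map_add, hx, hy]; exact add_add_add_comm _ _ _ _
  | h2 l u => simp only [Tens.map_mk, LinearMap.add_apply, map_add]

lemma Tens.map_id (t : Tens A κ U) : Tens.map U LinearMap.id t = t := by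
  induction t using Tens.induction with
  | h0 => simp
  | h1 x y hx hy => simp only [map_add, hx, hy]
  | h2 l u => rw [Tens.map_mk, LinearMap.id_apply, Tens.act_freeLeft]

lemma Tens.map_zero_left (t : Tens A κ U) :
    Tens.map U (0 : (κ →₀ Env A) →ₗ[ℂ] (κ' →₀ Env A)) t = 0 := by
  induction t using Tens.induction with
  | h0 => rw [map_zero]
  | h1 x y hx hy => rw [map_add, hx, hy, add_zero]
  | h2 l u => rw [Tens.map_mk, LinearMap.zero_apply, map_zero, LinearMap.zero_apply]

/-- The `A`-linear map induced by a bilinear map of free bimodules. -/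
def Tens.mapLinear (U : Type u) [AddCommGroup U] [Module ℂ U] [Module A U] [IsScalarTower ℂ A U]
    (f : (κ →₀ Env A) →ₗ[Env A] (κ' →₀ Env A)) : Tens A κ U →ₗ[A] Tens A κ' U :=
  linearOf (Tens.map U (f.restrictScalars ℂ)) (by
    intro a x
    induction x using Tens.induction with
    | h0 => simp
    | h1 x y hx hy => rw [smul_add, map_add, map_add, smul_add, hx, hy]
    | h2 l u =>
      rw [Tens.smul_mk, Tens.map_mk, Tens.map_mk, freeLeft_smul, LinearMap.restrictScalars_apply,
        map_smul, Tens.act_left, LinearMap.restrictScalars_apply])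

variable [Bornology U] [IsConvexBornology U]

lemma Tens.isBoundedMap_act (hU : ∀ a : A, IsBoundedMap (Algebra.lsmul ℂ ℂ U a))
    (x : κ →₀ Env A) : IsBoundedMap (Tens.act (U := U) x) := by
  induction x using Env.finsupp_induction with
  | h0 => rw [map_zero]; exact IsBoundedMap.zero
  | h1 x y hx hy => rw [map_add]; exact hx.add hy
  | h2 i a b =>
    have : Tens.act (Finsupp.single i (Env.tmul a b)) =
        Tens.mk (Finsupp.single i a) ∘ₗ Algebra.lsmul ℂ ℂ U b :=
      LinearMap.ext fun u => Tens.act_single i a b u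
    rw [this]
    exact (Tens.isBoundedMap_mk _).comp (hU b)

/-- No continuity of `f` is required: for each fixed vector of the free module only finitely many
elements of `A` act on `U`, each by a bounded map. In particular the contractions of the resolution
are bounded. -/
lemma Tens.isBoundedMap_map (hU : ∀ a : A, IsBoundedMap (Algebra.lsmul ℂ ℂ U a))
    (f : (κ →₀ Env A) →ₗ[ℂ] (κ' →₀ Env A)) : IsBoundedMap (Tens.map U f) :=
  Tens.isBoundedMap fun l => Tens.isBoundedMap_act hU (f (freeLeft l))

lemma Tens.isBoundedMap_lsmul (a : A) :
    IsBoundedMap (Algebra.lsmul ℂ ℂ (Tens A κ U) a) := by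
  refine Tens.isBoundedMap fun l => ?_
  convert Tens.isBoundedMap_mk (U := U) (a • l) using 1
  ext u
  exact Tens.smul_mk a l u

end Act

end Induced

end AffineHecke
end

noncomputable section
set_option linter.unusedSectionVars false
namespace AffineHecke

open Bornology

/-! ### The standard resolution of a module. -/

section Augmentation

variable (A : Type u) [Ring A] [Algebra ℂ A]

lemma Env.mulQuot_tmul_smul {A : Type u} [Ring A] [Algebra ℂ A] (a c : A)
    (z : Env A ⧸ Env.kerMul A) :
    Env.mulQuot A (Env.tmul a c • z) = a * Env.mulQuot A z * c := by
  obtain ⟨z, rfl⟩ := Submodule.Quotient.mk_surjective _ z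
  exact Env.mulMap_tmul_mul a c z

/-- The composition of the free cover with the multiplication. -/
def mulCover : ((RightSplit.base A).Z →₀ Env A) →ₗ[ℂ] A where
  toFun x := Env.mulQuot A ((RightSplit.base A).cover x)
  map_add' x y := by rw [map_add]; exact map_add (Env.mulQuot A) _ _
  map_smul' c x := by
    have h : c • x = Env.tmul (algebraMap ℂ A c) 1 • x := by
      rw [Algebra.algebraMap_eq_smul_one, Env.smul_tmul, Env.tmul_one_one, smul_assoc, one_smul]
    rw [h, map_smul]
    refine (Env.mulQuot_tmul_smul _ _ _).trans ?_
    rw [mul_one, RingHom.id_apply, Algebra.smul_def]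

lemma mulCover_apply (x : (RightSplit.base A).Free) :
    mulCover A x = Env.mulQuot A ((RightSplit.base A).cover x) := rfl

lemma mulCover_tmul_smul (a c : A) (x : (RightSplit.base A).Free) :
    mulCover A (Env.tmul a c • x) = a * mulCover A x * c := by
  rw [mulCover_apply, map_smul]
  exact Env.mulQuot_tmul_smul _ _ _

/-- The element over the unit. -/
def unitIndex : (RightSplit.base A).Z := Submodule.Quotient.mk (1 : Env A)

lemma sec_cover_base (x : (RightSplit.base A).Free) :
    (RightSplit.base A).sec ((RightSplit.base A).cover x) =
      Finsupp.single (unitIndex A) (Env.right (mulCover A x)) := rfl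

lemma mulCover_single_unit : mulCover A (Finsupp.single (unitIndex A) 1) = 1 := by
  have h : mulCover A (Finsupp.single (unitIndex A) 1) =
      Env.mulMap A ((1 : Env A) * 1) := by
    rw [mulCover_apply, RightSplit.cover, freeCover, Finsupp.linearCombination_single]
    rfl
  rw [h, mul_one, ← Env.tmul_one_one, Env.mulMap_tmul, one_mul]

variable (U : Type u) [AddCommGroup U] [Module ℂ U] [Module A U] [IsScalarTower ℂ A U]

lemma lift_mulCover_act (x : (RightSplit.base A).Free) (u : U) :
    Tens.lift (((Algebra.lsmul ℂ ℂ U).toLinearMap ∘ₗ mulCover A) ∘ₗ freeLeft) (Tens.act x u) =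
      mulCover A x • u := by
  refine (Tens.lift_act (f := (Algebra.lsmul ℂ ℂ U).toLinearMap ∘ₗ mulCover A) ?_ x u)
  intro c x u
  change mulCover A (Env.right c • x) • u = mulCover A x • c • u
  rw [Env.right, mulCover_tmul_smul, one_mul, mul_smul]

/-- The augmentation of the standard resolution. -/
def augment : Tens A (RightSplit.base A).Z U →ₗ[A] U :=
  linearOf (Tens.lift (((Algebra.lsmul ℂ ℂ U).toLinearMap ∘ₗ mulCover A) ∘ₗ freeLeft)) (by
    intro a x
    induction x using Tens.induction with
    | h0 => simp
    | h1 x y hx hy => rw [smul_add, map_add, map_add, smul_add, hx, hy]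
    | h2 l u =>
      rw [Tens.smul_mk]
      change mulCover A (freeLeft (a • l)) • u = a • mulCover A (freeLeft l) • u
      rw [freeLeft_smul, mulCover_tmul_smul, mul_one, mul_smul])

lemma augment_act (x : (RightSplit.base A).Free) (u : U) :
    augment A U (Tens.act x u) = mulCover A x • u := lift_mulCover_act A U x u

lemma augment_mk (l : (RightSplit.base A).Z →₀ A) (u : U) :
    augment A U (Tens.mk l u) = mulCover A (freeLeft l) • u := rfl

/-- The section of the augmentation. -/
def augmentSec : U →ₗ[ℂ] Tens A (RightSplit.base A).Z U :=
  Tens.mk (Finsupp.single (unitIndex A) 1)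

lemma act_single_unit (a : A) (u : U) :
    Tens.act (Finsupp.single (unitIndex A) (Env.right a)) u = augmentSec A U (a • u) :=
  Tens.act_single _ _ _ _

lemma augment_augmentSec (u : U) : augment A U (augmentSec A U u) = u := by
  rw [← one_smul A u, ← act_single_unit, augment_act, one_smul, Env.right, Env.tmul_one_one,
    mulCover_single_unit, one_smul]

variable {A} (S : RightSplit A)

lemma Tens.map_diff_map_diff (t : Tens A S.next.next.Z U) :
    Tens.mapLinear U S.diff (Tens.mapLinear U S.next.diff t) = 0 := by
  have h : (S.diff.restrictScalars ℂ) ∘ₗ (S.next.diff.restrictScalars ℂ) = 0 :=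
    LinearMap.ext fun x => S.diff_diff x
  refine (Tens.map_comp (fun c x => map_smul S.diff _ _) t).trans ?_
  rw [h, Tens.map_zero_left]

lemma Tens.map_contr_diff_add (t : Tens A S.next.Z U) :
    Tens.map U S.contr (Tens.mapLinear U S.diff t) +
      Tens.mapLinear U S.next.diff (Tens.map U S.next.contr t) = t := by
  have h : S.contr ∘ₗ (S.diff.restrictScalars ℂ) +
      (S.next.diff.restrictScalars ℂ) ∘ₗ S.next.contr = LinearMap.id :=
    LinearMap.ext fun x => S.contr_diff_add x
  have h1 := Tens.map_comp (U := U) (g := S.contr) (f := S.diff.restrictScalars ℂ)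
    (fun c x => S.contr_right c x) t
  have h2 := Tens.map_comp (U := U) (g := S.next.diff.restrictScalars ℂ) (f := S.next.contr)
    (fun c x => map_smul S.next.diff _ _) t
  refine (congrArg₂ (· + ·) h1 h2).trans ?_
  rw [← Tens.map_add_left, h, Tens.map_id]

lemma Tens.map_homotopy {k : S.Free →ₗ[Env A] S.next.Free}
    {k' : S.next.Free →ₗ[Env A] S.next.next.Free}
    (hk : ∀ x, k (S.diff x) + S.next.diff (k' x) = x) (t : Tens A S.next.Z U) :
    Tens.mapLinear U k (Tens.mapLinear U S.diff t) +
      Tens.mapLinear U S.next.diff (Tens.mapLinear U k' t) = t := by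
  have h1 := Tens.map_comp (U := U) (g := k.restrictScalars ℂ)
    (f := S.diff.restrictScalars ℂ) (fun c x => map_smul k _ _) t
  have h2 := Tens.map_comp (U := U) (g := S.next.diff.restrictScalars ℂ)
    (f := k'.restrictScalars ℂ) (fun c x => map_smul S.next.diff _ _) t
  have h3 : (k.restrictScalars ℂ) ∘ₗ (S.diff.restrictScalars ℂ) +
      (S.next.diff.restrictScalars ℂ) ∘ₗ (k'.restrictScalars ℂ) =
      LinearMap.id := LinearMap.ext hk
  refine (congrArg₂ (· + ·) h1 h2).trans ?_
  rw [← Tens.map_add_left, h3, Tens.map_id]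

lemma augment_map_diff (t : Tens A (RightSplit.base A).next.Z U) :
    augment A U (Tens.mapLinear U (RightSplit.base A).diff t) = 0 := by
  induction t using Tens.induction with
  | h0 => simp
  | h1 x y hx hy => rw [map_add, map_add, hx, hy, add_zero]
  | h2 l u =>
    refine (augment_act A U _ u).trans ?_
    rw [mulCover_apply]
    change Env.mulQuot A ((RightSplit.base A).cover ((RightSplit.base A).diff _)) • u = 0
    rw [RightSplit.cover_diff]
    change (Env.mulQuot A 0) • u = 0
    rw [map_zero, zero_smul]

lemma augmentSec_augment_add (t : Tens A (RightSplit.base A).Z U) :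
    augmentSec A U (augment A U t) + Tens.mapLinear U (RightSplit.base A).diff
      (Tens.map U (RightSplit.base A).contr t) = t := by
  induction t using Tens.induction with
  | h0 => simp
  | h1 x y hx hy =>
    simp only [map_add]
    rw [add_add_add_comm, hx, hy]
  | h2 l u =>
    have h1 := Tens.map_comp (U := U) (g := (RightSplit.base A).diff.restrictScalars ℂ)
      (f := (RightSplit.base A).contr) (fun c x => map_smul (RightSplit.base A).diff _ _)
      (Tens.mk l u)
    refine (congrArg₂ (· + ·) rfl h1).trans ?_
    rw [augment_mk, ← act_single_unit, ← sec_cover_base, Tens.map_mk, LinearMap.comp_apply,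
      LinearMap.restrictScalars_apply, RightSplit.diff_contr, map_sub, LinearMap.sub_apply,
      add_sub_cancel, Tens.act_freeLeft]

end Augmentation

/-! ### The upper bound for bornological modules. -/

section BornologicalResolution

variable {A : Type u} [Ring A] [Algebra ℂ A]

lemma BorMod.isBoundedMap_lsmul (U : BorMod.{u, v} A) (a : A) :
    IsBoundedMap (Algebra.lsmul ℂ ℂ U a) := fun s hs => by
  refine (U.isBounded_smul {a} s ((fineBornology A).isBounded_singleton) hs).subset ?_
  rintro _ ⟨x, hx, rfl⟩
  exact ⟨a, rfl, x, hx, rfl⟩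

/-- The bornological module `A^(κ) ⊗ U`. -/
def BorMod.tens (κ : Type u) (U : BorMod.{u, u} A) : BorMod.{u, u} A where
  carrier := Tens A κ U
  isBounded_smul := isBounded_fine_smul Tens.isBoundedMap_lsmul

lemma BorMod.isComplete_tens (κ : Type u) {U : BorMod.{u, u} A} (hU : U.IsComplete) :
    (BorMod.tens κ U).IsComplete :=
  isCompleteBornology_of_coord (e := Tens.coord) Tens.isBounded_iff hU

/-- A homomorphism out of this module is determined by its bounded ℂ-linear restrictions to the
copies `e_i ⊗ U`, which lift along the bounded section `σ`. -/
lemma BorMod.isProjective_tens (C : BorMod.{u, u} A → Prop) (κ : Type u) (U : BorMod.{u, u} A) :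
    IsProjective C (BorMod.tens κ U) := by
  rintro V V' - - p ⟨σ, hσ, hpσ⟩ f
  let φ : κ → U →ₗ[ℂ] V := fun i => σ ∘ₗ f.1.restrictScalars ℂ ∘ₗ
    (Tens.mk (A := A) (U := U) (Finsupp.single i 1) : U →ₗ[ℂ] Tens A κ U)
  have hφ : ∀ i, IsBoundedMap (φ i) := fun i =>
    hσ.comp (IsBoundedMap.comp f.2 (Tens.isBoundedMap_mk (A := A) (Finsupp.single i 1)))
  refine ⟨⟨Tens.extend φ, Tens.isBoundedMap_of_single fun i a => ?_⟩, ?_⟩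
  · have : (Tens.extend φ).restrictScalars ℂ ∘ₗ Tens.mk (Finsupp.single i a) =
        Algebra.lsmul ℂ ℂ V a ∘ₗ φ i := LinearMap.ext fun u => Tens.extend_mk_single φ i a u
    have h := (V.isBoundedMap_lsmul a).comp (hφ i)
    rw [← this] at h
    exact h
  · have : p.1 ∘ₗ Tens.extend φ = f.1 := by
      apply Tens.hom_ext
      intro i u
      rw [LinearMap.comp_apply, Tens.extend_mk_single, one_smul]
      exact hpσ _
    exact fun x => LinearMap.congr_fun this x

/-- The standard resolution. -/
def BorMod.standardRes {C : BorMod.{u, u} A → Prop} (hC : ∀ κ V, C V → C (BorMod.tens κ V))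
    {U : BorMod.{u, u} A} (hU : C U) : ProjRes C U where
  obj n := BorMod.tens (RightSplit.seq n).Z U
  mem _ := hC _ _ hU
  projective _ := BorMod.isProjective_tens C _ U
  d n := ⟨Tens.mapLinear U (RightSplit.seq n).diff,
    Tens.isBoundedMap_map U.isBoundedMap_lsmul ((RightSplit.seq n).diff.restrictScalars ℂ)⟩
  ε := ⟨augment A U, Tens.isBoundedMap fun l => U.isBoundedMap_lsmul (mulCover A (freeLeft l))⟩
  d_comp_d n := Tens.map_diff_map_diff U (RightSplit.seq n)
  ε_comp_d := augment_map_diff U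
  exact := ⟨augmentSec A U, fun n => Tens.map U (RightSplit.seq n).contr,
    Tens.isBoundedMap_mk _, fun _ => Tens.isBoundedMap_map U.isBoundedMap_lsmul _,
    augment_augmentSec A U, augmentSec_augment_add U,
    fun n => Tens.map_contr_diff_add U (RightSplit.seq n)⟩

/-- Where the syzygies are projective bimodules there is a bilinear homotopy with `k d + d k' = 1`.
For a cocycle `f` it gives `f = f k d`, and `f k` is bounded. -/
lemma BorMod.extVanishes_of_pdLT {C : BorMod.{u, u} A → Prop}
    (hC : ∀ κ V, C V → C (BorMod.tens κ V)) {r : ℕ}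
    (h : PdLT (Env A) (Env A ⧸ Env.kerMul A) (r + 1)) (U V : BorMod.{u, u} A) (hU : C U) {n : ℕ}
    (hn : r < n) : ExtVanishes C U V n := by
  obtain ⟨m, rfl⟩ : ∃ m, n = m + 1 := ⟨n - 1, by omega⟩
  obtain ⟨k, k', hk, -⟩ := (RightSplit.seq m).exists_homotopy
    (RightSplit.pdLT_seq h m (by omega))
  refine ⟨BorMod.standardRes hC hU, ⟨fun x y => ?_⟩⟩
  suffices H : ∀ z : (BorMod.standardRes hC hU).Ext V (m + 1), z = 0 by rw [H x, H y]
  intro z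
  obtain ⟨f, rfl⟩ := QuotientAddGroup.mk_surjective z
  rw [QuotientAddGroup.eq_zero_iff, AddSubgroup.mem_addSubgroupOf]
  have hf : ∀ x, f.1.1 (Tens.mapLinear U (RightSplit.seq m).next.diff x) = 0 := fun x =>
    congrArg (fun g : Hom _ V => g.1 x) (AddMonoidHom.mem_ker.1 f.2)
  refine ⟨⟨f.1.1 ∘ₗ Tens.mapLinear U k, IsBoundedMap.comp f.1.2
    (Tens.isBoundedMap_map U.isBoundedMap_lsmul (k.restrictScalars ℂ))⟩, ?_⟩
  ext t
  have h1 := Tens.map_homotopy U (RightSplit.seq m) hk t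
  exact (add_zero _).symm.trans ((congrArg₂ (· + ·) rfl (hf (Tens.mapLinear U k' t)).symm).trans
    ((map_add f.1.1 _ _).symm.trans (congrArg f.1.1 h1)))

lemma BorMod.cohomologicalDimension_le {C : BorMod.{u, u} A → Prop}
    (hC : ∀ κ V, C V → C (BorMod.tens κ V)) {r : ℕ}
    (h : PdLT (Env A) (Env A ⧸ Env.kerMul A) (r + 1)) :
    BorMod.cohomologicalDimension C ≤ r :=
  sInf_le fun n hn U V hU _ => BorMod.extVanishes_of_pdLT hC h U V hU (by exact_mod_cast hn)

end BornologicalResolution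

/-! ### The upper bound for modules without bornology. -/

section ModuleResolution

variable {A : Type u} [Ring A]

/-- By `d k d = d` the map `1 - d k` factors through the cokernel of `d r` and splits the projection
onto it, so this cokernel is projective. Dimension shifting does the rest. -/
lemma pdLT_of_resolution {r : ℕ} {U : Type u} [AddCommGroup U] [Module A U] (Q : ℕ → Type u)
    [∀ n, AddCommGroup (Q n)] [∀ n, Module A (Q n)] [∀ n, Module.Projective A (Q n)]
    (d : ∀ n, Q (n + 1) →ₗ[A] Q n) (ε : Q 0 →ₗ[A] U) (hε : Function.Surjective ε)
    (h0 : LinearMap.ker ε = LinearMap.range (d 0))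
    (hd : ∀ n, LinearMap.ker (d n) = LinearMap.range (d (n + 1)))
    (k : Q r →ₗ[A] Q (r + 1)) (hk : ∀ x, d r (k (d r x)) = d r x) : PdLT A U (r + 1) := by
  have proj : ∀ n, PdLT A (Q n) 1 := fun n => pdLT_one_iff.2 inferInstance
  have key : ∀ m n, m + n = r → PdLT A (Q n ⧸ LinearMap.range (d n)) (m + 1) := by
    intro m
    induction m with
    | zero =>
      rintro n hn
      obtain rfl : n = r := by omega
      refine (proj n).retract ((LinearMap.range (d n)).liftQ (LinearMap.id - d n ∘ₗ k) ?_)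
        (LinearMap.range (d n)).mkQ ?_
      · rintro _ ⟨x, rfl⟩
        rw [LinearMap.mem_ker, LinearMap.sub_apply, LinearMap.comp_apply, hk, LinearMap.id_apply,
          sub_self]
      · intro x
        obtain ⟨x, rfl⟩ := Submodule.Quotient.mk_surjective _ x
        rw [Submodule.liftQ_apply, Submodule.mkQ_apply, Submodule.Quotient.eq]
        refine ⟨-k x, ?_⟩
        simp
    | succ m ih =>
      intro n hn
      refine pdLT_right_of_exact (f := (LinearMap.range (d (n + 1))).liftQ (d n) (hd n).ge)
        (g := (LinearMap.range (d n)).mkQ) ?_ ?_ (Submodule.mkQ_surjective _)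
        (ih (n + 1) (by omega)) ((proj n).mono (by omega))
      · rw [← LinearMap.ker_eq_bot, Submodule.ker_liftQ_eq_bot _ _ _ (hd n).le]
      · rw [LinearMap.exact_iff, Submodule.ker_mkQ, Submodule.range_liftQ]
  refine (key r 0 (by omega)).equiv ?_
  rw [← h0]
  exact ε.quotKerEquivOfSurjective hε

variable [Algebra ℂ A]

lemma pdLT_of_pdLT_kerMul {r : ℕ} (h : PdLT (Env A) (Env A ⧸ Env.kerMul A) (r + 1)) (U : Type u)
    [AddCommGroup U] [Module ℂ U] [Module A U] [IsScalarTower ℂ A U] : PdLT A U (r + 1) := by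
  obtain ⟨k, -, -, hk⟩ := (RightSplit.seq r).exists_homotopy (RightSplit.pdLT_seq h r le_rfl)
  have hproj : ∀ n, Module.Projective A (Tens A (RightSplit.seq (A := A) n).Z U) :=
    fun n => Tens.projective
  refine pdLT_of_resolution (fun n => Tens A (RightSplit.seq n).Z U)
    (fun n => Tens.mapLinear U (RightSplit.seq n).diff) (augment A U)
    (fun u => ⟨_, augment_augmentSec A U u⟩) ?_ (fun n => ?_) (Tens.mapLinear U k) ?_
  · refine le_antisymm (fun x hx => ?_) ?_
    · have h1 := augmentSec_augment_add U x
      rw [show augment A U x = 0 from hx, map_zero, zero_add] at h1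
      exact ⟨_, h1⟩
    · rintro _ ⟨x, rfl⟩
      exact augment_map_diff U x
  · refine le_antisymm (fun x hx => ?_) ?_
    · have h1 := Tens.map_contr_diff_add U (RightSplit.seq n) x
      rw [show Tens.mapLinear U (RightSplit.seq n).diff x = 0 from hx, map_zero, zero_add] at h1
      exact ⟨_, h1⟩
    · rintro _ ⟨x, rfl⟩
      exact Tens.map_diff_map_diff U _ x
  · intro t
    have h1 := Tens.map_comp (U := U) (g := k.restrictScalars ℂ)
      (f := (RightSplit.seq r).diff.restrictScalars ℂ) (fun c x => map_smul k _ _) t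
    have h2 := Tens.map_comp (U := U) (g := (RightSplit.seq r).diff.restrictScalars ℂ)
      (f := (k.restrictScalars ℂ) ∘ₗ (RightSplit.seq r).diff.restrictScalars ℂ)
      (fun c x => map_smul (RightSplit.seq r).diff _ _) t
    have h3 : (RightSplit.seq r).diff.restrictScalars ℂ ∘ₗ (k.restrictScalars ℂ) ∘ₗ
      (RightSplit.seq r).diff.restrictScalars ℂ = (RightSplit.seq r).diff.restrictScalars ℂ :=
      LinearMap.ext hk
    exact ((congrArg (Tens.map U ((RightSplit.seq r).diff.restrictScalars ℂ)) h1).trans h2).trans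
      (by rw [h3]; rfl)

lemma cohomologicalDimension_moduleCat_le {r : ℕ}
    (h : PdLT (Env A) (Env A ⧸ Env.kerMul A) (r + 1)) :
    cohomologicalDimension (ModuleCat.{u} A) ≤ r := by
  refine sInf_le fun n hn U V => ?_
  let _ : Module ℂ U := Module.compHom U (algebraMap ℂ A)
  have _ : IsScalarTower ℂ A U := IsScalarTower.of_algebraMap_smul fun _ _ => rfl
  have hU : HasProjectiveDimensionLT U (r + 1) := pdLT_of_pdLT_kerMul h U
  exact HasProjectiveDimensionLT.subsingleton U (r + 1) n (by
    have : r < n := by exact_mod_cast hn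
    omega) V

end ModuleResolution

end AffineHecke
end

noncomputable section
set_option linter.unusedSectionVars false
namespace AffineHecke

open Abelian Bornology

/-! ### Regular sequences and a nonzero class in the top Ext group. -/

section RegularSequence

variable {A : Type u} [Ring A] (x : ℕ → A)

/-- The left ideal generated by the first `m` elements of a sequence. -/
def seqIdeal (m : ℕ) : Submodule A A := Submodule.span A (x '' Set.Iio m)

/-- The quotient by the left ideal generated by the first `m` elements of a sequence. -/
abbrev SeqQuot (m : ℕ) : Type u := A ⧸ seqIdeal x m

lemma seqIdeal_mono {m n : ℕ} (h : m ≤ n) : seqIdeal x m ≤ seqIdeal x n :=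
  Submodule.span_mono (Set.image_mono (Set.Iio_subset_Iio h))

lemma mem_seqIdeal {i m : ℕ} (h : i < m) : x i ∈ seqIdeal x m :=
  Submodule.subset_span ⟨i, h, rfl⟩

lemma seqIdeal_succ (m : ℕ) : seqIdeal x (m + 1) = Submodule.span A {x m} ⊔ seqIdeal x m := by
  have h : Set.Iio (m + 1) = insert m (Set.Iio m) := by
    ext i
    simp only [Set.mem_Iio, Set.mem_insert_iff]
    omega
  rw [seqIdeal, h, Set.image_insert_eq, Submodule.span_insert]
  rfl

/-- The projection between two successive quotients. -/
def seqProj (m : ℕ) : SeqQuot x m →ₗ[A] SeqQuot x (m + 1) :=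
  Submodule.factor (seqIdeal_mono x (Nat.le_succ m))

lemma seqProj_surjective (m : ℕ) : Function.Surjective (seqProj x m) :=
  Submodule.factor_surjective (seqIdeal_mono x (Nat.le_succ m))

variable {x}

lemma seqIdeal_le_comap (hx : ∀ i j, Commute (x i) (x j)) (m j : ℕ) :
    seqIdeal x m ≤ (seqIdeal x m).comap (LinearMap.toSpanSingleton A A (x j)) := by
  refine Submodule.span_le.2 ?_
  rintro _ ⟨i, hi, rfl⟩
  change x i * x j ∈ seqIdeal x m
  rw [(hx i j).eq]
  exact (seqIdeal x m).smul_mem _ (mem_seqIdeal x hi)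

/-- Right multiplication by an element of a sequence of commuting elements. -/
def seqMul (hx : ∀ i j, Commute (x i) (x j)) (m j : ℕ) : SeqQuot x m →ₗ[A] SeqQuot x m :=
  Submodule.mapQ _ _ (LinearMap.toSpanSingleton A A (x j)) (seqIdeal_le_comap hx m j)

lemma seqMul_mk (hx : ∀ i j, Commute (x i) (x j)) (m j : ℕ) (a : A) :
    seqMul hx m j (Submodule.Quotient.mk a) = Submodule.Quotient.mk (a * x j) := rfl

lemma seqProj_mk (m : ℕ) (a : A) :
    seqProj x m (Submodule.Quotient.mk a) = Submodule.Quotient.mk a := rfl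

lemma seqProj_seqMul (hx : ∀ i j, Commute (x i) (x j)) (m j : ℕ) (u : SeqQuot x m) :
    seqProj x m (seqMul hx m j u) = seqMul hx (m + 1) j (seqProj x m u) := by
  obtain ⟨a, rfl⟩ := Submodule.Quotient.mk_surjective _ u
  rfl

lemma seqMul_comm (hx : ∀ i j, Commute (x i) (x j)) (m i j : ℕ) (u : SeqQuot x m) :
    seqMul hx m i (seqMul hx m j u) = seqMul hx m j (seqMul hx m i u) := by
  obtain ⟨a, rfl⟩ := Submodule.Quotient.mk_surjective _ u
  rw [seqMul_mk, seqMul_mk, seqMul_mk, seqMul_mk, mul_assoc, mul_assoc, (hx i j).eq]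

lemma seq_exact (hx : ∀ i j, Commute (x i) (x j)) (m : ℕ) :
    Function.Exact (seqMul hx m m) (seqProj x m) := by
  intro u
  obtain ⟨a, rfl⟩ := Submodule.Quotient.mk_surjective _ u
  rw [seqProj_mk, Submodule.Quotient.mk_eq_zero, seqIdeal_succ, Submodule.mem_sup]
  constructor
  · rintro ⟨y, hy, z, hz, rfl⟩
    obtain ⟨c, rfl⟩ := Submodule.mem_span_singleton.1 hy
    refine ⟨Submodule.Quotient.mk c, ?_⟩
    rw [seqMul_mk, Submodule.Quotient.eq, smul_eq_mul, sub_add_cancel_left]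
    exact neg_mem hz
  · rintro ⟨c, hc⟩
    obtain ⟨c, rfl⟩ := Submodule.Quotient.mk_surjective _ c
    rw [seqMul_mk, Submodule.Quotient.eq] at hc
    exact ⟨c * x m, Submodule.mem_span_singleton.2 ⟨c, rfl⟩, a - c * x m, by
      rw [← neg_sub]; exact neg_mem hc, by abel⟩

variable (x) in
/-- A sequence of commuting elements such that each of the first `r` elements acts injectively on
the quotient by the previous ones. -/
structure IsRegularSeq (r : ℕ) : Prop where
  comm : ∀ i j, Commute (x i) (x j)
  regular : ∀ m < r, ∀ a, a * x m ∈ seqIdeal x m → a ∈ seqIdeal x m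

variable {r : ℕ} (hx : IsRegularSeq x r)

include hx in
lemma IsRegularSeq.seqMul_injective {m : ℕ} (hm : m < r) :
    Function.Injective (seqMul hx.comm m m) := by
  rw [← LinearMap.ker_eq_bot, LinearMap.ker_eq_bot']
  intro u hu
  obtain ⟨a, rfl⟩ := Submodule.Quotient.mk_surjective _ u
  rw [seqMul_mk, Submodule.Quotient.mk_eq_zero] at hu
  rw [Submodule.Quotient.mk_eq_zero]
  exact hx.regular m hm a hu

/-- The short complex given by right multiplication. -/
abbrev IsRegularSeq.shortComplex (hx : IsRegularSeq x r) (m : ℕ) : ShortComplex (ModuleCat.{u} A) :=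
  ShortComplex.mk (ModuleCat.ofHom (seqMul hx.comm m m)) (ModuleCat.ofHom (seqProj x m)) 
    (ModuleCat.hom_ext (LinearMap.ext (seq_exact hx.comm m).apply_apply_eq_zero))

lemma IsRegularSeq.shortExact {m : ℕ} (hm : m < r) : (hx.shortComplex m).ShortExact :=
  shortExact_of (hx.seqMul_injective hm) (seq_exact hx.comm m) (seqProj_surjective x m)

lemma seqIdeal_zero : seqIdeal x 0 = ⊥ := by
  rw [seqIdeal, show Set.Iio 0 = ∅ by ext; simp, Set.image_empty, Submodule.span_empty]

include hx in
lemma IsRegularSeq.pdLT {m : ℕ} (hm : m ≤ r) : PdLT A (SeqQuot x m) (m + 1) := by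
  induction m with
  | zero =>
    have h : PdLT A A 1 := pdLT_one_iff.2 inferInstance
    exact h.equiv ((Submodule.quotEquivOfEqBot _ seqIdeal_zero).symm)
  | succ m ih =>
    exact pdLT_right_of_exact (hx.seqMul_injective hm) (seq_exact hx.comm m)
      (seqProj_surjective x m) (ih (by omega)) ((ih (by omega)).mono (by omega))

variable {V : Type u} [AddCommGroup V] [Module A V]

/-- The homomorphism from the algebra given by a vector. -/
def orbitMap (x : ℕ → A) (v : V) : SeqQuot x 0 →ₗ[A] V :=
  (seqIdeal x 0).liftQ (LinearMap.toSpanSingleton A V v) (by rw [seqIdeal_zero]; exact bot_le)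

lemma orbitMap_mk (v : V) (a : A) : orbitMap x v (Submodule.Quotient.mk a) = a • v := rfl

/-- The image of a homomorphism under the iterated connecting homomorphisms. -/
def IsRegularSeq.extElement (hx : IsRegularSeq x r) (v : V) :
    ∀ m, m ≤ r → Ext (ModuleCat.of A (SeqQuot x m)) (ModuleCat.of A V) m
  | 0, _ => Ext.mk₀ (ModuleCat.ofHom (orbitMap x v))
  | m + 1, hm => (hx.shortExact hm).extClass.comp (IsRegularSeq.extElement hx v m (by omega))
      (by omega)

/-- As the elements need not be central, it is right multiplication on the quotient that acts on
Ext. In degree 0 it acts by zero because `x j` annihilates `V`. Since `Ext^{m+1}(A/I_m, V) = 0`,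
every class of degree `m + 1` for `A/I_{m+1}` is the image of one of degree `m` under the connecting
map, which commutes with right multiplications. -/
lemma IsRegularSeq.mk₀_seqMul_comp (hV : ∀ j (w : V), x j • w = 0) {m : ℕ} (hm : m ≤ r) (j : ℕ)
    (y : Ext (ModuleCat.of A (SeqQuot x m)) (ModuleCat.of A V) m) :
    (Ext.mk₀ (ModuleCat.ofHom (seqMul hx.comm m j))).comp y (zero_add m) = 0 := by
  induction m with
  | zero =>
    obtain ⟨f, rfl⟩ := (Ext.mk₀_bijective _ _).2 y
    rw [Ext.mk₀_comp_mk₀]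
    have : ModuleCat.ofHom (seqMul hx.comm 0 j) ≫ f = 0 := by
      refine ModuleCat.hom_ext (LinearMap.ext fun u => ?_)
      obtain ⟨a, rfl⟩ := Submodule.Quotient.mk_surjective _ u
      change f.hom (seqMul hx.comm 0 j (Submodule.Quotient.mk a)) = 0
      have h1 : (Submodule.Quotient.mk (a * x j) : SeqQuot x 0) =
          (a * x j) • Submodule.Quotient.mk 1 := by
        rw [← Submodule.Quotient.mk_smul, smul_eq_mul, mul_one]
      rw [seqMul_mk, h1, map_smul, mul_smul]
      exact (congrArg (a • ·) (hV j _)).trans (smul_zero a)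
    rw [this, Ext.mk₀_zero]
  | succ m ih =>
    have hS := hx.shortExact (show m < r from hm)
    have hpd : HasProjectiveDimensionLT (ModuleCat.of A (SeqQuot x m)) (m + 1) :=
      hx.pdLT (by omega)
    have hsub := HasProjectiveDimensionLT.subsingleton (ModuleCat.of A (SeqQuot x m)) (m + 1)
      (m + 1) le_rfl (ModuleCat.of A V)
    obtain ⟨z, rfl⟩ := Ext.contravariant_sequence_exact₃ hS (ModuleCat.of A V) y
      (Subsingleton.elim _ _) (add_comm 1 m)
    let φ : hx.shortComplex m ⟶ hx.shortComplex m :=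
      { τ₁ := ModuleCat.ofHom (seqMul hx.comm m j)
        τ₂ := ModuleCat.ofHom (seqMul hx.comm m j)
        τ₃ := ModuleCat.ofHom (seqMul hx.comm (m + 1) j)
        comm₁₂ := ModuleCat.hom_ext (LinearMap.ext fun u => seqMul_comm hx.comm m m j u)
        comm₂₃ := ModuleCat.hom_ext (LinearMap.ext fun u => seqProj_seqMul hx.comm m j u) }
    have h1 := ShortComplex.ShortExact.extClass_naturality hS hS φ
    rw [← Ext.comp_assoc _ _ _ (zero_add 1) (add_comm 1 m) (by omega)]
    refine (congrArg (fun t => Ext.comp t z (add_comm 1 m)) h1.symm).trans ?_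
    rw [Ext.comp_assoc_of_second_deg_zero]
    refine (congrArg (fun t => Ext.comp hS.extClass t (add_comm 1 m)) (ih (by omega) z)).trans ?_
    rw [Ext.comp_zero]

/-- A class killed by the connecting map is the pullback of another class along multiplication by `x
m`, and such pullbacks vanish. -/
lemma IsRegularSeq.extElement_ne_zero (hV : ∀ j (w : V), x j • w = 0) {v : V} (hv : v ≠ 0)
    {m : ℕ} (hm : m ≤ r) : hx.extElement v m hm ≠ 0 := by
  induction m with
  | zero =>
    intro h
    rw [IsRegularSeq.extElement, ← Ext.mk₀_zero] at h
    have h1 := (Ext.mk₀_bijective _ _).1 h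
    refine hv ?_
    rw [← one_smul A v, ← orbitMap_mk (x := x)]
    exact congrArg (fun f => f.hom (Submodule.Quotient.mk 1)) h1
  | succ m ih =>
    intro h
    rw [IsRegularSeq.extElement] at h
    obtain ⟨y, hy⟩ := Ext.contravariant_sequence_exact₁ (hx.shortExact hm) (ModuleCat.of A V) _ _ h
    refine ih (by omega) (hy.symm.trans ?_)
    exact hx.mk₀_seqMul_comp hV (by omega) m y

include hx in
theorem IsRegularSeq.le_cohomologicalDimension (hV : ∀ j (w : V), x j • w = 0) {v : V}
    (hv : v ≠ 0) : (r : ℕ∞) ≤ cohomologicalDimension (ModuleCat.{u} A) := by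
  refine le_sInf fun d hd => ?_
  by_contra hlt
  have := hd r (not_le.1 hlt) (ModuleCat.of A (SeqQuot x r)) (ModuleCat.of A V)
  exact hx.extElement_ne_zero hV hv le_rfl (Subsingleton.elim _ _)

end RegularSequence

end AffineHecke
end

noncomputable section
set_option linter.unusedSectionVars false
namespace AffineHecke

open Abelian Bornology

/-! ### Fine modules, kernels and completeness. -/

section Complex

instance : IsConvexBornology ℂ where
  isBounded_add s t hs ht := by
    refine (hs.add ht).subset ?_
    rintro _ ⟨a, ha, c, hc, rfl⟩
    exact ⟨a, ha, c, hc, rfl⟩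
  isBounded_smul c s hs := by
    obtain ⟨R, hR⟩ := hs.exists_norm_le
    refine isBounded_iff_forall_norm_le.2 ⟨‖c‖ * R, ?_⟩
    rintro _ ⟨x, hx, rfl⟩
    rw [norm_smul]
    exact mul_le_mul_of_nonneg_left (hR x hx) (norm_nonneg c)
  isBounded_hull s hs := by
    obtain ⟨R, hR⟩ := hs.exists_norm_le
    exact ⟨Metric.closedBall 0 R, fun x hx => mem_closedBall_zero_iff.2 (hR x hx),
      Metric.isBounded_closedBall, balanced_closedBall_zero, convex_closedBall 0 R⟩

lemma isCompleteBornology_complex : IsCompleteBornology ℂ := by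
  intro s hs
  obtain ⟨R, hR⟩ := hs.exists_norm_le
  have hR' : 0 < max R 1 := lt_max_of_lt_right one_pos
  have hmem : ∀ (ε : ℝ), 0 < ε → ∀ x : ℂ,
      (∃ y ∈ Metric.closedBall (0 : ℂ) (max R 1), x = ε • y) ↔ ‖x‖ ≤ ε * max R 1 := by
    intro ε hε x
    constructor
    · rintro ⟨y, hy, rfl⟩
      rw [norm_smul, Real.norm_of_nonneg hε.le]
      exact mul_le_mul_of_nonneg_left (mem_closedBall_zero_iff.1 hy) hε.le
    · intro h
      refine ⟨ε⁻¹ • x, mem_closedBall_zero_iff.2 ?_, (smul_inv_smul₀ hε.ne' x).symm⟩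
      rw [norm_smul, norm_inv, Real.norm_of_nonneg hε.le, inv_mul_le_iff₀ hε]
      exact h
  have hdiv : ∀ δ : ℝ, 0 < δ → δ / max R 1 * max R 1 = δ := fun δ _ =>
    div_mul_cancel₀ δ hR'.ne'
  refine ⟨Metric.closedBall 0 (max R 1),
    fun x hx => mem_closedBall_zero_iff.2 ((hR x hx).trans (le_max_left _ _)),
    Metric.isBounded_closedBall, balanced_closedBall_zero, convex_closedBall 0 _, ?_, ?_⟩
  · intro x hx
    by_contra h0
    have h1 : 0 < ‖x‖ / 2 := half_pos (norm_pos_iff.2 h0)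
    have h2 := (hmem _ (div_pos h1 hR') x).1 (hx _ (div_pos h1 hR'))
    rw [hdiv _ h1] at h2
    linarith
  · intro x hx
    have hc : CauchySeq x := by
      rw [Metric.cauchySeq_iff]
      intro δ hδ
      obtain ⟨N, hN⟩ := hx _ (div_pos (half_pos hδ) hR')
      refine ⟨N, fun m hm n hn => ?_⟩
      have h2 := (hmem _ (div_pos (half_pos hδ) hR') _).1 (hN m hm n hn)
      rw [hdiv _ (half_pos hδ)] at h2
      rw [dist_eq_norm]
      linarith
    obtain ⟨l, hl⟩ := cauchySeq_tendsto_of_complete hc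
    refine ⟨l, fun ε hε => ?_⟩
    obtain ⟨N, hN⟩ := Metric.tendsto_atTop.1 hl (ε * max R 1) (mul_pos hε hR')
    refine ⟨N, fun n hn => (hmem ε hε _).2 ?_⟩
    rw [← dist_eq_norm]
    exact (hN n hn).le

lemma isBoundedMap_complex {V : Type*} [AddCommGroup V] [Module ℂ V] [Bornology V]
    [IsConvexBornology V] (f : ℂ →ₗ[ℂ] V) : IsBoundedMap f := by
  intro s hs
  obtain ⟨R, hR⟩ := hs.exists_norm_le
  refine (isBounded_ball_smul R (isBounded_singleton (x := f 1))).subset ?_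
  rintro _ ⟨c, hc, rfl⟩
  exact ⟨c, hR c hc, _, rfl, by rw [← map_smul, smul_eq_mul, mul_one]⟩

end Complex

section Fine

variable {A : Type u} [Ring A] [Algebra ℂ A] (M : Type u) [AddCommGroup M] [Module ℂ M]

/-- The finest convex bornology, described with a basis. -/
@[reducible]
def basisBornology : Bornology M := coordBornology (Module.Basis.ofVectorSpace ℂ M).repr

lemma isConvexBornology_basisBornology : @IsConvexBornology M _ _ (basisBornology M) :=
  letI := basisBornology M
  isConvexBornology_of_coord (e := (Module.Basis.ofVectorSpace ℂ M).repr)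
    (isBounded_coordBornology _)

/-- Since all linear maps out of such a space are bounded, every short exact sequence of fine
modules is an extension in the bornological sense. -/
lemma isBoundedMap_basisBornology {V : Type*} [AddCommGroup V] [Module ℂ V] [Bornology V]
    [IsConvexBornology V] (f : M →ₗ[ℂ] V) : @IsBoundedMap M V _ _ (basisBornology M) _ _ _ f :=
  letI := basisBornology M
  isBoundedMap_of_coord (e := (Module.Basis.ofVectorSpace ℂ M).repr)
    (isBounded_coordBornology _) fun _ => isBoundedMap_complex _

variable [Module A M] [IsScalarTower ℂ A M]

/-- A module with the finest convex bornology. -/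
def BorMod.fine (A : Type u) [Ring A] [Algebra ℂ A] (M : Type u) [AddCommGroup M] [Module ℂ M]
    [Module A M] [IsScalarTower ℂ A M] : BorMod.{u, u} A :=
  letI := basisBornology M
  haveI := isConvexBornology_basisBornology M
  { carrier := M
    isBounded_smul := isBounded_fine_smul fun _ => isBoundedMap_basisBornology M _ }

lemma BorMod.isBoundedMap_fine {V : Type*} [AddCommGroup V] [Module ℂ V] [Bornology V]
    [IsConvexBornology V] (f : BorMod.fine A M →ₗ[ℂ] V) : IsBoundedMap f :=
  isBoundedMap_basisBornology M f

lemma BorMod.isComplete_fine : (BorMod.fine A M).IsComplete :=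
  letI := basisBornology M
  isCompleteBornology_of_coord (e := (Module.Basis.ofVectorSpace ℂ M).repr)
    (isBounded_coordBornology _) isCompleteBornology_complex

end Fine

section Kernel

variable {A : Type u} [Ring A] [Algebra ℂ A]

section

variable {M V V' : Type*} [AddCommGroup M] [Module ℂ M] [Bornology M] [AddCommGroup V] [Module ℂ V]
  [Bornology V] [AddCommGroup V'] [Module ℂ V'] [Bornology V'] {i : M →ₗ[ℂ] V}
  (hi : Function.Injective i) (hM : ∀ S : Set M, IsBounded S ↔ IsBounded (i '' S))

lemma real_smul_apply (a : ℝ) (x : M) : i (a • x) = a • i x := by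
  rw [← Complex.coe_smul, map_smul, Complex.coe_smul]

include hM

lemma isConvexBornology_of_image [IsConvexBornology V] : IsConvexBornology M where
  isBounded_add s t hs ht := by
    rw [hM] at hs ht ⊢
    refine (IsConvexBornology.isBounded_add _ _ hs ht).subset ?_
    rintro _ ⟨_, ⟨a, ha, c, hc, rfl⟩, rfl⟩
    exact ⟨_, ⟨a, ha, rfl⟩, _, ⟨c, hc, rfl⟩, map_add i a c⟩
  isBounded_smul c s hs := by
    rw [hM] at hs ⊢
    refine (IsConvexBornology.isBounded_smul c _ hs).subset ?_
    rintro _ ⟨_, ⟨a, ha, rfl⟩, rfl⟩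
    exact ⟨_, ⟨a, ha, rfl⟩, (map_smul i c a).symm⟩
  isBounded_hull s hs := by
    rw [hM] at hs
    obtain ⟨t, hst, ht, hbal, hconv⟩ := IsConvexBornology.isBounded_hull _ hs
    refine ⟨i ⁻¹' t, fun x hx => hst ⟨x, hx, rfl⟩, ?_, ?_, ?_⟩
    · rw [hM]
      exact ht.subset (Set.image_preimage_subset i t)
    · rintro c hc _ ⟨x, hx, rfl⟩
      change i (c • x) ∈ t
      rw [map_smul]
      exact hbal.smul_mem hc hx
    · intro x hx y hy a c ha hc hac
      change i (a • x + c • y) ∈ t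
      rw [map_add, real_smul_apply, real_smul_apply]
      exact hconv hx hy ha hc hac

include hi

/-- The limit, taken in `V`, stays in the kernel because bounded sets of `V'` lie in separated
discs. -/
lemma isCompleteBornology_of_ker {g : V →ₗ[ℂ] V'} (hg : IsBoundedMap g)
    (hig : ∀ y, g y = 0 ↔ ∃ x, i x = y) (hV : IsCompleteBornology V)
    (hV' : IsCompleteBornology V') : IsCompleteBornology M := by
  intro S hS
  rw [hM] at hS
  obtain ⟨D, hSD, hD, hbal, hconv, hsep, hcomp⟩ := hV _ hS
  obtain ⟨D', hDD', -, -, -, hsep', -⟩ := hV' _ (hg D hD)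
  refine ⟨i ⁻¹' D, fun x hx => hSD ⟨x, hx, rfl⟩, ?_, ?_, ?_, ?_, ?_⟩
  · rw [hM]
    exact hD.subset (Set.image_preimage_subset i D)
  · rintro c hc _ ⟨x, hx, rfl⟩
    change i (c • x) ∈ D
    rw [map_smul]
    exact hbal.smul_mem hc hx
  · intro x hx y hy a c ha hc hac
    change i (a • x + c • y) ∈ D
    rw [map_add, real_smul_apply, real_smul_apply]
    exact hconv hx hy ha hc hac
  · intro x hx
    refine hi (((hsep _ fun ε hε => ?_)).trans (map_zero i).symm)
    obtain ⟨y, hy, rfl⟩ := hx ε hε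
    exact ⟨_, hy, real_smul_apply _ _⟩
  · intro x hx
    obtain ⟨l, hl⟩ := hcomp (fun n => i (x n)) fun ε hε => by
      obtain ⟨N, hN⟩ := hx ε hε
      refine ⟨N, fun m hm n hn => ?_⟩
      obtain ⟨y, hy, hxy⟩ := hN m hm n hn
      exact ⟨_, hy, by rw [← map_sub, hxy, real_smul_apply]⟩
    obtain ⟨l, rfl⟩ := (hig l).1 (by
      rw [← neg_eq_zero]
      refine hsep' _ fun ε hε => ?_
      obtain ⟨N, hN⟩ := hl ε hε
      obtain ⟨y, hy, hxy⟩ := hN N le_rfl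
      refine ⟨g y, hDD' ⟨y, hy, rfl⟩, ?_⟩
      rw [← real_smul_apply, ← hxy, map_sub, (hig _).2 ⟨_, rfl⟩, zero_sub])
    refine ⟨l, fun ε hε => ?_⟩
    obtain ⟨N, hN⟩ := hl ε hε
    refine ⟨N, fun n hn => ?_⟩
    obtain ⟨y, hy, hxy⟩ := hN n hn
    refine ⟨ε⁻¹ • (x n - l), ?_, (smul_inv_smul₀ hε.ne' _).symm⟩
    change i _ ∈ D
    rw [real_smul_apply, map_sub, hxy, inv_smul_smul₀ hε.ne']
    exact hy

end

lemma isBounded_ker_iff {U : BorMod.{u, v} A} (N : Submodule A U) (S : Set N) :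
    IsBounded S ↔ IsBounded ((N.subtype.restrictScalars ℂ) '' S) :=
  (isBounded_image_subtype_val (s := S)).symm

/-- A submodule of a bornological module, with the subspace bornology. -/
def BorMod.sub {U : BorMod.{u, v} A} (N : Submodule A U) : BorMod.{u, v} A :=
  haveI : IsConvexBornology N := isConvexBornology_of_image (isBounded_ker_iff N)
  { carrier := N
    isBounded_smul := isBounded_fine_smul fun a s hs => by
      rw [isBounded_ker_iff] at hs ⊢
      refine (U.isBoundedMap_lsmul a _ hs).subset ?_
      rintro _ ⟨_, ⟨x, hx, rfl⟩, rfl⟩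
      exact ⟨_, ⟨x, hx, rfl⟩, rfl⟩ }

lemma BorMod.isBounded_sub_iff {U : BorMod.{u, v} A} (N : Submodule A U) (S : Set (BorMod.sub N)) :
    IsBounded S ↔ IsBounded ((N.subtype.restrictScalars ℂ) '' S) := isBounded_ker_iff N S

lemma BorMod.isComplete_ker {U V : BorMod.{u, v} A} (f : Hom U V) (hU : U.IsComplete)
    (hV : V.IsComplete) : (BorMod.sub (LinearMap.ker f.1)).IsComplete :=
  isCompleteBornology_of_ker (i := (LinearMap.ker f.1).subtype.restrictScalars ℂ)
    (g := f.1.restrictScalars ℂ) Subtype.val_injective (isBounded_sub_iff (LinearMap.ker f.1)) f.2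
    (fun y => ⟨fun h => ⟨⟨y, h⟩, rfl⟩, by rintro ⟨x, rfl⟩; exact x.2⟩) hU hV

end Kernel

end AffineHecke
end

noncomputable section
set_option linter.unusedSectionVars false
namespace AffineHecke

open Abelian Bornology

/-! ### Comparison of bornological with algebraic Ext classes. -/

section Shift

variable {A : Type u} [Ring A] [Algebra ℂ A] {C : BorMod.{u, v} A → Prop}

/-- The resolution of the kernel of the augmentation given by the other terms of a resolution. -/
def BorMod.ProjRes.shift {K : BorMod.{u, v} A} (Q : ProjRes C K) :
    ProjRes C (BorMod.sub (LinearMap.ker Q.ε.1)) where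
  obj n := Q.obj (n + 1)
  mem n := Q.mem (n + 1)
  projective n := Q.projective (n + 1)
  d n := Q.d (n + 1)
  ε := ⟨(Q.d 0).1.codRestrict (LinearMap.ker Q.ε.1) (fun y => LinearMap.mem_ker.2 (Q.ε_comp_d y)), fun s hs => by
    rw [isBounded_sub_iff]
    refine ((Q.d 0).2 s hs).subset ?_
    rintro _ ⟨_, ⟨y, hy, rfl⟩, rfl⟩
    exact ⟨y, hy, rfl⟩⟩
  d_comp_d n := Q.d_comp_d (n + 1)
  ε_comp_d x := Subtype.ext (Q.d_comp_d 0 x)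
  exact := by
    obtain ⟨η, γ, -, hγ, -, h0, h1⟩ := Q.exact
    refine ⟨γ 0 ∘ₗ (LinearMap.ker Q.ε.1).subtype.restrictScalars ℂ, fun n => γ (n + 1),
      fun s hs => ?_, fun n => hγ (n + 1), fun x => Subtype.ext ?_, fun x => h1 0 x,
      fun n x => h1 (n + 1) x⟩
    · rw [isBounded_sub_iff] at hs
      refine (hγ 0 _ hs).subset ?_
      rintro _ ⟨y, hy, rfl⟩
      exact ⟨_, ⟨y, hy, rfl⟩, rfl⟩
    · have h := h0 x.1
      rw [show Q.ε.1 x.1 = 0 from x.2, map_zero, zero_add] at h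
      exact h

end Shift

section Cocycle

variable {A : Type u} [Ring A] [Algebra ℂ A] {C : BorMod.{u, u} A → Prop}

/-- The short complex given by the augmentation of a resolution. -/
abbrev BorMod.ProjRes.shortComplex {K : BorMod.{u, u} A} (Q : BorMod.ProjRes C K) :
    ShortComplex (ModuleCat.{u} A) :=
  ShortComplex.mk (ModuleCat.ofHom (LinearMap.ker Q.ε.1).subtype) (ModuleCat.ofHom Q.ε.1)
    (ModuleCat.hom_ext (LinearMap.ext fun y => y.2))

lemma BorMod.ProjRes.shortExact {K : BorMod.{u, u} A} (Q : BorMod.ProjRes C K) :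
    Q.shortComplex.ShortExact :=
  shortExact_of Subtype.val_injective (LinearMap.exact_subtype_ker_map Q.ε.1) (by
    obtain ⟨η, -, -, -, hη, -⟩ := Q.exact
    exact fun y => ⟨η y, hη y⟩)

variable (C) in
/-- A sequence of extensions of bornological modules, linked by their outer terms. -/
structure BorMod.Tower (r : ℕ) where
  U : ℕ → BorMod.{u, u} A
  mem : ∀ m, C (U m)
  s : ∀ m, U m →ₗ[A] U m
  p : ∀ m, Hom (U m) (U (m + 1))
  exact : ∀ m, Function.Exact (s m) (p m).1
  injective : ∀ m < r, Function.Injective (s m)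
  surjective : ∀ m, Function.Surjective (p m).1
  exists_section : ∀ m, ∃ σ : U (m + 1) →ₗ[ℂ] U m, IsBoundedMap σ ∧ ∀ y, (p m).1 (σ y) = y
  exists_retraction : ∀ m < r, ∃ ρ : U m →ₗ[ℂ] U m, IsBoundedMap ρ ∧ ∀ y, ρ (s m y) = y

namespace BorMod.Tower

variable {r : ℕ} (D : BorMod.Tower C r)

/-- The short complexes of a tower. -/
abbrev shortComplex (m : ℕ) : ShortComplex (ModuleCat.{u} A) :=
  ShortComplex.mk (ModuleCat.ofHom (D.s m)) (ModuleCat.ofHom (D.p m).1)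
    (ModuleCat.hom_ext (LinearMap.ext (D.exact m).apply_apply_eq_zero))

lemma shortExact {m : ℕ} (hm : m < r) : (D.shortComplex m).ShortExact :=
  shortExact_of (D.injective m hm) (D.exact m) (D.surjective m)

/-- Projectivity of the first term lifts `κ ε` to `U m`. On `ker ε` the lift lands in the image of
`s m`, and the bounded retraction turns it into a bounded `κ'`. Naturality of extension classes
links the two sequences. -/
lemma exists_connecting {m : ℕ} (hm : m < r) {K : BorMod.{u, u} A}
    (κ : BorMod.Hom K (D.U (m + 1))) (Q : BorMod.ProjRes C K) :
    ∃ κ' : BorMod.Hom (BorMod.sub (LinearMap.ker Q.ε.1)) (D.U m),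
      Q.shortExact.extClass.comp (Ext.mk₀ (ModuleCat.ofHom κ'.1)) (add_zero 1) =
        (Ext.mk₀ (ModuleCat.ofHom κ.1)).comp (D.shortExact hm).extClass (zero_add 1) := by
  obtain ⟨ρ, hρb, hρ⟩ := D.exists_retraction m hm
  obtain ⟨g, hg⟩ := Q.projective 0 _ _ (D.mem m) (D.mem (m + 1)) (D.p m) (D.exists_section m)
    ⟨κ.1 ∘ₗ Q.ε.1, IsBoundedMap.comp κ.2 Q.ε.2⟩
  have hmul : ∀ y : LinearMap.ker Q.ε.1, D.s m (ρ (g.1 y)) = g.1 y := by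
    intro y
    obtain ⟨z, hz⟩ : ∃ z, D.s m z = g.1 y := (D.exact m (g.1 y)).1
      ((hg y).trans ((congrArg κ.1 y.2).trans (map_zero κ.1)))
    rw [← hz, hρ]
  let κ'' : LinearMap.ker Q.ε.1 →ₗ[A] D.U m :=
    { toFun := fun y => ρ (g.1 y)
      map_add' := fun y z => (congrArg ρ (map_add g.1 _ _)).trans (map_add ρ _ _)
      -- The retraction is only ℂ-linear; `A`-linearity is tested after applying the injective map
      -- `s m`.
      map_smul' := fun a y => by
        apply D.injective m hm
        rw [RingHom.id_apply, map_smul, hmul, hmul]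
        exact map_smul g.1 a _ }
  refine ⟨⟨κ'', fun s hs => ?_⟩, ?_⟩
  · rw [BorMod.isBounded_sub_iff] at hs
    refine (hρb _ (g.2 _ hs)).subset ?_
    rintro _ ⟨y, hy, rfl⟩
    exact ⟨_, ⟨_, ⟨y, hy, rfl⟩, rfl⟩, rfl⟩
  · let φ : Q.shortComplex ⟶ D.shortComplex m :=
      { τ₁ := ModuleCat.ofHom κ''
        τ₂ := ModuleCat.ofHom g.1
        τ₃ := ModuleCat.ofHom κ.1
        comm₁₂ := ModuleCat.hom_ext (LinearMap.ext hmul)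
        comm₂₃ := ModuleCat.hom_ext (LinearMap.ext hg) }
    exact ShortComplex.ShortExact.extClass_naturality Q.shortExact (D.shortExact hm) φ

variable {V : BorMod.{u, u} A} (e₀ : BorMod.Hom (D.U 0) V)
  (e : ∀ m, m ≤ r → Ext (ModuleCat.of A (D.U m)) (ModuleCat.of A V) m)
  (he₀ : e 0 (Nat.zero_le r) = Ext.mk₀ (ModuleCat.ofHom e₀.1))
  (he : ∀ m (hm : m + 1 ≤ r), e (m + 1) hm =
    (D.shortExact hm).extClass.comp (e m (Nat.le_of_succ_le hm)) (Nat.add_comm 1 m))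
  (hker : ∀ (U V : BorMod.{u, u} A) (f : BorMod.Hom U V), C U → C V →
    C (BorMod.sub (LinearMap.ker f.1)))

include he₀ he hker in
-- The pullback of `e (m + 1)` along `κ` equals the extension class of `Q` composed with the
-- pullback of `e m` along `κ'`, so a cocycle on `Q (m + 1)` represents it. If that is a coboundary,
-- even of an unbounded map, the class is zero. The induction passes to the shifted resolution of
-- `ker ε`, hence the generality in `K` and `Q`.
lemma exists_cocycle (m : ℕ) (hm : m + 1 ≤ r) {K : BorMod.{u, u} A} (hK : C K)
    (κ : BorMod.Hom K (D.U (m + 1))) (Q : BorMod.ProjRes C K) :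
    ∃ f : BorMod.Hom (Q.obj (m + 1)) V, (∀ y, f.1 ((Q.d (m + 1)).1 y) = 0) ∧
      ∀ g : Q.obj m →ₗ[A] V, (∀ y, f.1 y = g ((Q.d m).1 y)) →
        (Ext.mk₀ (ModuleCat.ofHom κ.1)).comp (e (m + 1) hm) (zero_add _) = 0 := by
  induction m generalizing K with
  | zero =>
    obtain ⟨κ', hκ'⟩ := D.exists_connecting hm κ Q
    refine ⟨⟨e₀.1 ∘ₗ κ'.1 ∘ₗ Q.shift.ε.1,
      IsBoundedMap.comp e₀.2 (IsBoundedMap.comp κ'.2 Q.shift.ε.2)⟩, fun y => ?_, fun g hg => ?_⟩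
    · exact (congrArg (fun z => e₀.1 (κ'.1 z)) (Q.shift.ε_comp_d y)).trans
        ((congrArg e₀.1 (map_zero κ'.1)).trans (map_zero e₀.1))
    · have h1 : ModuleCat.ofHom κ'.1 ≫ ModuleCat.ofHom e₀.1 =
          Q.shortComplex.f ≫ ModuleCat.ofHom g := by
        refine ModuleCat.hom_ext (LinearMap.ext fun y => ?_)
        obtain ⟨η, -, -, -, hη, -⟩ := Q.shift.exact
        have h2 := hg (η y)
        change e₀.1 (κ'.1 (Q.shift.ε.1 (η y))) = g (Q.shift.ε.1 (η y)).1 at h2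
        rw [hη] at h2
        exact h2
      rw [he, ← Ext.comp_assoc _ _ _ (zero_add 1) (add_zero 1) (by omega)]
      refine (congrArg (fun t => Ext.comp t _ (add_zero 1)) hκ'.symm).trans ?_
      rw [Ext.comp_assoc_of_second_deg_zero, he₀, Ext.mk₀_comp_mk₀]
      refine (congrArg (fun t => Ext.comp _ (Ext.mk₀ t) (add_zero 1)) h1).trans ?_
      have h2 : Q.shortExact.extClass.comp
          (Ext.mk₀ (Q.shortComplex.f ≫ ModuleCat.ofHom (Y := V) g)) (add_zero 1) = 0 := by
        rw [← Ext.mk₀_comp_mk₀, ← Ext.comp_assoc_of_second_deg_zero,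
          ShortComplex.ShortExact.extClass_comp, Ext.zero_comp]
      exact h2
  | succ m ih =>
    obtain ⟨κ', hκ'⟩ := D.exists_connecting hm κ Q
    obtain ⟨f, hf, h⟩ := ih (by omega) (hker _ _ Q.ε (Q.mem 0) hK) κ' Q.shift
    refine ⟨f, hf, fun g hg => ?_⟩
    have h1 := h g hg
    rw [he, ← Ext.comp_assoc _ _ _ (zero_add 1) (Nat.add_comm 1 (m + 1)) (by omega)]
    refine (congrArg (fun t => Ext.comp t (e (m + 1) _) (Nat.add_comm 1 (m + 1)))
      hκ'.symm).trans ?_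
    rw [Ext.comp_assoc_of_second_deg_zero]
    refine (congrArg (fun t => Ext.comp _ t (Nat.add_comm 1 (m + 1))) h1).trans ?_
    exact Ext.comp_zero _ _ _ _ _

include he₀ he hker in
-- `ExtVanishes` provides some unspecified resolution, so the comparison has to work for every one.
-- It is applied to the identity of `U r`.
lemma not_extVanishes (hne : e r le_rfl ≠ 0) :
    ¬ BorMod.ExtVanishes C (D.U r) V r := by
  rintro ⟨Q, hQ⟩
  have hcob : ∀ f : BorMod.Hom (Q.obj r) V, (∀ y, f.1 ((Q.d r).1 y) = 0) →
      f ∈ Q.coboundaries V r := by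
    intro f hf
    have h1 : f ∈ Q.cocycles V r :=
      AddMonoidHom.mem_ker.2 (Subtype.ext (LinearMap.ext hf))
    have h2 := (QuotientAddGroup.eq_zero_iff (N := (Q.coboundaries V r).addSubgroupOf
      (Q.cocycles V r)) ⟨f, h1⟩).1 (Subsingleton.elim _ _)
    exact AddSubgroup.mem_addSubgroupOf.1 h2
  refine hne ?_
  cases r with
  | zero =>
    have h0 := hcob ⟨e₀.1 ∘ₗ Q.ε.1, IsBoundedMap.comp e₀.2 Q.ε.2⟩ (fun y =>
      (congrArg e₀.1 (Q.ε_comp_d y)).trans (map_zero _))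
    have h1 := AddSubgroup.mem_bot.1 h0
    obtain ⟨η, -, -, -, hη, -⟩ := Q.exact
    rw [he₀]
    have h2 : e₀.1 = 0 := LinearMap.ext fun y => (congrArg e₀.1 (hη y)).symm.trans
      (congrArg (fun f : BorMod.Hom (Q.obj 0) V => f.1 (η y)) h1)
    rw [h2]
    exact Ext.mk₀_zero _ _
  | succ m =>
    obtain ⟨f, hf, h⟩ := D.exists_cocycle e₀ e he₀ he hker m le_rfl (D.mem (m + 1))
      ⟨LinearMap.id, IsBoundedMap.id⟩ Q
    obtain ⟨g, hg⟩ := hcob f hf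
    have h3 := h g.1 fun y => congrArg (fun f : BorMod.Hom (Q.obj (m + 1)) V => f.1 y) hg.symm
    exact (Ext.mk₀_id_comp _).symm.trans h3

end BorMod.Tower

variable (hfine : ∀ (M : Type u) [AddCommGroup M] [Module ℂ M] [Module A M] [IsScalarTower ℂ A M],
    C (BorMod.fine A M))
  (hker : ∀ (U V : BorMod.{u, u} A) (f : BorMod.Hom U V), C U → C V →
    C (BorMod.sub (LinearMap.ker f.1)))
  {x : ℕ → A} {r : ℕ} (hx : IsRegularSeq x r)

lemma BorMod.isBoundedMap_fine_fine {M N : Type u} [AddCommGroup M] [Module ℂ M] [Module A M]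
    [IsScalarTower ℂ A M] [AddCommGroup N] [Module ℂ N] [Module A N] [IsScalarTower ℂ A N]
    (f : BorMod.fine A M →ₗ[ℂ] BorMod.fine A N) : IsBoundedMap f :=
  BorMod.isBoundedMap_fine (A := A) M f

/-- A bounded homomorphism between modules with the finest convex bornology. -/
def BorMod.fineHom {M N : Type u} [AddCommGroup M] [Module ℂ M] [Module A M] [IsScalarTower ℂ A M]
    [AddCommGroup N] [Module ℂ N] [Module A N] [IsScalarTower ℂ A N] (f : M →ₗ[A] N) :
    BorMod.Hom (BorMod.fine A M) (BorMod.fine A N) :=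
  ⟨f, BorMod.isBoundedMap_fine_fine _⟩

/-- The tower given by a regular sequence. -/
def IsRegularSeq.tower : BorMod.Tower C r where
  U m := BorMod.fine A (SeqQuot x m)
  mem m := hfine _
  s m := seqMul hx.comm m m
  p m := BorMod.fineHom (seqProj x m)
  exact := seq_exact hx.comm
  injective m hm := hx.seqMul_injective hm
  surjective := seqProj_surjective x
  exists_section m := by
    obtain ⟨σ, hσ⟩ := ((seqProj x m).restrictScalars ℂ).exists_rightInverse_of_surjective
      (LinearMap.range_eq_top.2 (seqProj_surjective x m))
    exact ⟨σ, BorMod.isBoundedMap_fine_fine (M := SeqQuot x (m + 1)) (N := SeqQuot x m) σ,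
      fun y => LinearMap.congr_fun hσ y⟩
  exists_retraction m hm := by
    obtain ⟨ρ, hρ⟩ := ((seqMul hx.comm m m).restrictScalars ℂ).exists_leftInverse_of_injective
      (LinearMap.ker_eq_bot.2 (hx.seqMul_injective hm))
    exact ⟨ρ, BorMod.isBoundedMap_fine_fine (M := SeqQuot x m) (N := SeqQuot x m) ρ,
      fun y => LinearMap.congr_fun hρ y⟩

include hfine hker hx in
theorem IsRegularSeq.le_bor_cohomologicalDimension {V : Type u} [AddCommGroup V] [Module A V]
    [Module ℂ V] [IsScalarTower ℂ A V] (hV : ∀ j (w : V), x j • w = 0) {v : V}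
    (hv : v ≠ 0) : (r : ℕ∞) ≤ BorMod.cohomologicalDimension C := by
  refine le_sInf fun d hd => ?_
  by_contra hlt
  refine (hx.tower hfine).not_extVanishes (V := BorMod.fine A V)
    (BorMod.fineHom (orbitMap x v)) (hx.extElement v) rfl (fun _ _ => rfl) hker
    (hx.extElement_ne_zero hV hv le_rfl) ?_
  exact hd r (not_le.1 hlt) _ _ (hfine _) (hfine _)

end Cocycle

end AffineHecke
end

noncomputable section
set_option linter.unusedSectionVars false
namespace AffineHecke

/-! ### Bernstein elements and the Bernstein basis. -/

section Bernstein

variable {ι X Y : Type u} [AddCommGroup X] [AddCommGroup Y] {P : RootDatum ι X Y} {b : P.Base}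

/-- The element `x` of `X` such that `g = w t_x` with `w` in the finite Weyl group. -/
def rightPart (g : AffineWeylGroup P) : X := g.right⁻¹ • g.left.toAdd

lemma rightPart_mul_translation (g : AffineWeylGroup P) (y : X) :
    rightPart (g * translation P y) = rightPart g + y := by
  have h1 : (g * translation P y).left.toAdd = g.left.toAdd + g.right • y := rfl
  have h2 : (g * translation P y).right = g.right := by
    rw [SemidirectProduct.mul_right, translation_right, mul_one]
  rw [rightPart, h1, h2, smul_add, inv_smul_smul, rightPart]

lemma translation_zero : translation P 0 = 1 := rfl

lemma rightPart_translation (y : X) : rightPart (translation P y) = y := by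
  rw [rightPart, translation_right, inv_one, one_smul, translation_left]

variable (b) in
/-- Dominant elements of `X`. -/
def IsDominant (x : X) : Prop := ∀ i ∈ b.support, 0 ≤ P.coroot' i x

lemma IsDominant.nonneg {x : X} (hx : IsDominant b x) {i : ι} (hi : IsPosCoroot b i) :
    0 ≤ P.coroot' i x := posCone_nonneg hx hi

lemma IsDominant.nsmul {x : X} (hx : IsDominant b x) (n : ℕ) : IsDominant b (n • x) :=
  fun i hi => by
    rw [map_nsmul]
    exact nsmul_nonneg (hx i hi) n

variable [Finite ι]

/-- An inversion of `t_y` consists of a positive coroot `α^∨` and a level below `⟨y, α^∨⟩`. The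
dominant right part of `g` can only lower the resulting negative level, so it is an inversion of `g
t_y` as well. -/
lemma length_mul_translation {g : AffineWeylGroup P} {y : X} (hg : IsDominant b (rightPart g))
    (hy : IsDominant b y) :
    length b (g * translation P y) = length b g + length b (translation P y) := by
  refine length_mul_of_subset ?_
  rintro ⟨i, k⟩ ⟨h1, h2⟩
  refine ⟨h1, ?_⟩
  rw [actAffineRoot_mul]
  rw [act_translation] at h2 ⊢
  have hi : IsPosCoroot b i := by
    by_contra hi
    have h3 : IsPosCoroot b (P.reflectionPerm i i) := by
      have h4 := (isPos_neg_iff (b := b) ((i, 0) : AffineRoot P)).2 (by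
        simpa [IsPosAffineRoot] using hi)
      simpa [IsPosAffineRoot, affNeg] using h4
    have h5 := hy.nonneg h3
    have h6 : P.coroot' (P.reflectionPerm i i) y = - P.coroot' i y := by
      simp only [RootPairing.coroot']
      rw [neg_reflectionPerm_self, map_neg]
      rfl
    rcases h1 with h1 | h1
    · exact h2 (Or.inl (by simp only at h1 ⊢; omega))
    · exact hi h1.2
  have hk : k - P.coroot' i y < 0 := by
    by_contra hk
    rcases (not_lt.1 hk).lt_or_eq with h | h
    · exact h2 (Or.inl h)
    · exact h2 (Or.inr ⟨h.symm, hi⟩)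
  have hact : (actAffineRoot g ((i, k - P.coroot' i y) : AffineRoot P)).2 =
      k - P.coroot' i y - P.coroot' i (rightPart g) := by
    rw [actAffineRoot, coroot'_weyl]
    rfl
  have h0 := hg.nonneg hi
  rintro (h | h)
  · rw [hact] at h
    omega
  · rw [hact] at h
    omega

lemma exists_isDominant_add {ρ : X} (hρ : ∀ i ∈ b.support, 0 < P.coroot' i ρ) (x : X) :
    ∃ m : ℕ, ∀ n ≥ m, IsDominant b (x + n • ρ) := by
  refine ⟨∑ i ∈ b.support, (P.coroot' i x).natAbs, fun n hn i hi => ?_⟩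
  have h1 : (P.coroot' i x).natAbs ≤ n :=
    (Finset.single_le_sum (f := fun i => (P.coroot' i x).natAbs) (fun _ _ => Nat.zero_le _)
      hi).trans hn
  rw [map_add, map_nsmul, nsmul_eq_mul]
  have h2 : (n : ℤ) * 1 ≤ n * P.coroot' i ρ :=
    mul_le_mul_of_nonneg_left (hρ i hi) (Int.natCast_nonneg n)
  omega

variable (q : ParameterFunction b)

/-- The normalized basis elements of the Hecke algebra. -/
def Tnorm (g : AffineWeylGroup P) : Hecke q := (q g : ℂ)⁻¹ • T q g

lemma Tnorm_mul {g h : AffineWeylGroup P} (hgh : length b (g * h) = length b g + length b h) :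
    Tnorm q g * Tnorm q h = Tnorm q (g * h) := by
  rw [Tnorm, Tnorm, Tnorm, smul_mul_smul_comm, T_mul q hgh, q.mul_of_length_add g h hgh,
    Complex.ofReal_mul, mul_inv]

lemma Tnorm_mul_translation {g : AffineWeylGroup P} {y : X} (hg : IsDominant b (rightPart g))
    (hy : IsDominant b y) :
    Tnorm q g * Tnorm q (translation P y) = Tnorm q (g * translation P y) :=
  Tnorm_mul q (length_mul_translation hg hy)

lemma Tnorm_translation_add {x y : X} (hx : IsDominant b x) (hy : IsDominant b y) :
    Tnorm q (translation P x) * Tnorm q (translation P y) = Tnorm q (translation P (x + y)) := by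
  rw [Tnorm_mul_translation q (by rwa [rightPart_translation]) hy, translation_add]

lemma Tnorm_translation_comm {x y : X} (hx : IsDominant b x) (hy : IsDominant b y) :
    Tnorm q (translation P x) * Tnorm q (translation P y) =
      Tnorm q (translation P y) * Tnorm q (translation P x) := by
  rw [Tnorm_translation_add q hx hy, Tnorm_translation_add q hy hx, add_comm]

variable [P.IsReduced]

lemma isUnit_Tnorm (g : AffineWeylGroup P) : IsUnit (Tnorm q g) := by
  obtain ⟨t, ht⟩ := isUnit_T q g
  refine ⟨⟨Tnorm q g, (q g : ℂ) • ↑t⁻¹, ?_, ?_⟩, rfl⟩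
  · rw [Tnorm, ← ht, smul_mul_smul_comm, inv_mul_cancel₀ (q_ne_zero q g), Units.mul_inv, one_smul]
  · rw [Tnorm, ← ht, smul_mul_smul_comm, mul_inv_cancel₀ (q_ne_zero q g), Units.inv_mul, one_smul]

lemma linearIndependent_Tnorm : LinearIndependent ℂ (Tnorm q) :=
  (linearIndependent_T q).units_smul fun g => (Units.mk0 (q g : ℂ) (q_ne_zero q g))⁻¹

variable {ρ : X} (hρ : ∀ i ∈ b.support, 0 < P.coroot' i ρ)

include hρ in
lemma isDominant_nsmul (n : ℕ) : IsDominant b (n • ρ) :=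
  IsDominant.nsmul (fun i hi => (hρ i hi).le) n

include hρ in
-- In the dominant range lengths add, so the quotient of the normalized elements of `g t_{mρ}` and
-- `t_{mρ}` does not depend on large `m`. The factor `q(g)⁻¹`, instead of the usual `q(g)^{-1/2}`,
-- gives these elements the value 1 under the trivial character.
lemma exists_bernstein (g : AffineWeylGroup P) : ∃ (z : Hecke q) (m : ℕ), ∀ n ≥ m,
    z * Tnorm q (translation P (n • ρ)) = Tnorm q (g * translation P (n • ρ)) := by
  obtain ⟨m, hm⟩ := exists_isDominant_add hρ (rightPart g)
  refine ⟨Tnorm q (g * translation P (m • ρ)) * Ring.inverse (Tnorm q (translation P (m • ρ))), m,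
    fun n hn => ?_⟩
  obtain ⟨k, rfl⟩ := Nat.exists_eq_add_of_le hn
  rw [add_smul, ← Tnorm_translation_add q (isDominant_nsmul hρ m) (isDominant_nsmul hρ k),
    mul_assoc, ← mul_assoc (Ring.inverse _), Ring.inverse_mul_cancel _ (isUnit_Tnorm q _), one_mul,
    Tnorm_mul_translation q ?_ (isDominant_nsmul hρ k), mul_assoc, ← translation_add]
  rw [rightPart_mul_translation]
  exact hm m le_rfl

/-- The Bernstein basis elements: translation by a multiple of `ρ` to the dominant range. -/
def bernstein (g : AffineWeylGroup P) : Hecke q := (exists_bernstein q hρ g).choose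

lemma bernstein_spec (g : AffineWeylGroup P) : ∃ m : ℕ, ∀ n ≥ m,
    bernstein q hρ g * Tnorm q (translation P (n • ρ)) = Tnorm q (g * translation P (n • ρ)) :=
  (exists_bernstein q hρ g).choose_spec

lemma eq_of_mul_Tnorm {z z' : Hecke q} {g : AffineWeylGroup P}
    (h : z * Tnorm q g = z' * Tnorm q g) : z = z' :=
  (isUnit_Tnorm q g).mul_right_cancel h

lemma eq_bernstein {g : AffineWeylGroup P} {z : Hecke q} {m : ℕ} (h : ∀ n ≥ m,
    z * Tnorm q (translation P (n • ρ)) = Tnorm q (g * translation P (n • ρ))) :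
    z = bernstein q hρ g := by
  obtain ⟨m', h'⟩ := bernstein_spec q hρ g
  refine eq_of_mul_Tnorm q (g := translation P (max m m' • ρ)) ?_
  rw [h _ (le_max_left _ _), h' _ (le_max_right _ _)]

lemma bernstein_one : bernstein q hρ 1 = 1 :=
  (eq_bernstein q hρ (m := 0) fun n _ => by rw [one_mul, one_mul]).symm

lemma bernstein_mul_Tnorm (g : AffineWeylGroup P) {y : X} (hy : IsDominant b y) :
    bernstein q hρ g * Tnorm q (translation P y) = bernstein q hρ (g * translation P y) := by
  obtain ⟨m, h⟩ := bernstein_spec q hρ g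
  obtain ⟨m', h'⟩ := exists_isDominant_add hρ (rightPart g)
  refine eq_bernstein q hρ (m := max m m') fun n hn => ?_
  rw [mul_assoc, Tnorm_translation_comm q hy (isDominant_nsmul hρ n), ← mul_assoc,
    h n ((le_max_left _ _).trans hn), Tnorm_mul_translation q ?_ hy, mul_assoc, mul_assoc,
    ← translation_add, ← translation_add, add_comm y]
  rw [rightPart_mul_translation]
  exact h' n ((le_max_right _ _).trans hn)

lemma bernstein_mul_translation (g : AffineWeylGroup P) (x : X) :
    bernstein q hρ g * bernstein q hρ (translation P x) =
      bernstein q hρ (g * translation P x) := by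
  obtain ⟨m, h⟩ := bernstein_spec q hρ (translation P x)
  obtain ⟨m', h'⟩ := exists_isDominant_add hρ x
  have hn := h _ (le_max_left m m')
  have hd := h' _ (le_max_right m m')
  refine eq_of_mul_Tnorm q (g := translation P (max m m' • ρ)) ?_
  rw [mul_assoc, hn, ← translation_add, bernstein_mul_Tnorm q hρ g hd,
    bernstein_mul_Tnorm q hρ _ (isDominant_nsmul hρ _), translation_add, mul_assoc]

/-- Multiplication by a far dominant translation turns finitely many of these elements into distinct
members of the normalized standard basis. -/
lemma linearIndependent_bernstein : LinearIndependent ℂ (bernstein q hρ) := by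
  rw [linearIndependent_iff']
  intro s c hc
  choose m hm using bernstein_spec q hρ
  let N := s.sup m
  have h1 : ∑ g ∈ s, c g • Tnorm q (g * translation P (N • ρ)) = 0 := by
    rw [← zero_mul (Tnorm q (translation P (N • ρ))), ← hc, Finset.sum_mul]
    refine Finset.sum_congr rfl fun g hg => ?_
    rw [smul_mul_assoc, hm g N (Finset.le_sup hg)]
  have h2 := (linearIndependent_Tnorm q).comp (fun g => g * translation P (N • ρ))
    (mul_left_injective _)
  exact linearIndependent_iff'.1 h2 s c h1

/-- After multiplication by a far dominant translation `t` the rule for `T_s T_{g t}` applies;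
cancelling `t` leaves a combination of the elements for `g` and `s g`. -/
lemma T_simpleRefl_mul_mem (a : Node b) (g : AffineWeylGroup P) :
    T q (simpleRefl a) * bernstein q hρ g ∈
      Submodule.span ℂ (Set.range (bernstein q hρ)) := by
  obtain ⟨m, h⟩ := bernstein_spec q hρ g
  obtain ⟨m', h'⟩ := bernstein_spec q hρ (simpleRefl a * g)
  have hn := h _ (le_max_left m m')
  have hn' := h' _ (le_max_right m m')
  set t := translation P (max m m' • ρ)
  have hmem : ∀ g, bernstein q hρ g ∈ Submodule.span ℂ (Set.range (bernstein q hρ)) :=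
    fun g => Submodule.subset_span ⟨g, rfl⟩
  have key : ∃ x y : ℂ, T q (simpleRefl a) * T q (g * t) =
      x • T q (g * t) + y • T q (simpleRefl a * g * t) := by
    rw [T_simpleRefl_mul, mul_assoc]
    split_ifs
    · exact ⟨0, 1, by rw [zero_smul, one_smul, zero_add]⟩
    · exact ⟨_, _, rfl⟩
  obtain ⟨x, y, hxy⟩ := key
  have hT : ∀ g, T q g = (q g : ℂ) • Tnorm q g := fun g => by
    rw [Tnorm, smul_inv_smul₀ (q_ne_zero q g)]
  have h1 : T q (simpleRefl a) * bernstein q hρ g = x • bernstein q hρ g +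
      ((q (g * t) : ℂ)⁻¹ * y * q (simpleRefl a * g * t)) • bernstein q hρ (simpleRefl a * g) := by
    refine eq_of_mul_Tnorm q (g := t) ?_
    rw [mul_assoc, hn, add_mul, smul_mul_assoc, smul_mul_assoc, hn, hn']
    rw [Tnorm, mul_smul_comm, hxy, smul_add, smul_comm x, hT (simpleRefl a * g * t), smul_smul,
      smul_smul, smul_smul]
  rw [h1]
  exact add_mem (Submodule.smul_mem _ _ (hmem _)) (Submodule.smul_mem _ _ (hmem _))

lemma T_length_zero_mul_mem {ω : AffineWeylGroup P} (hω : length b ω = 0)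
    (g : AffineWeylGroup P) : T q ω * bernstein q hρ g ∈
      Submodule.span ℂ (Set.range (bernstein q hρ)) := by
  obtain ⟨m, h⟩ := bernstein_spec q hρ g
  have h1 : T q ω * bernstein q hρ g = bernstein q hρ (ω * g) := by
    refine eq_bernstein q hρ (m := m) fun n hn => ?_
    have h2 : length b (ω * (g * translation P (n • ρ))) =
        length b ω + length b (g * translation P (n • ρ)) := by
      rw [length_mul_left_of_eq_zero hω, hω, zero_add]
    have h3 : T q ω = Tnorm q ω := by
      rw [Tnorm, q.eq_one_of_length_eq_zero ω hω, Complex.ofReal_one, inv_one, one_smul]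
    rw [mul_assoc, h n hn, h3, Tnorm_mul q h2, mul_assoc]
  rw [h1]
  exact Submodule.subset_span ⟨_, rfl⟩

lemma span_bernstein : Submodule.span ℂ (Set.range (bernstein q hρ)) = ⊤ := by
  set M := Submodule.span ℂ (Set.range (bernstein q hρ)) with hM
  have hmul : ∀ z : Hecke q, (∀ g, z * bernstein q hρ g ∈ M) → ∀ x ∈ M, z * x ∈ M := by
    intro z hz x hx
    have : M ≤ M.comap (LinearMap.mulLeft ℂ z) := by
      rw [hM, Submodule.span_le]
      rintro _ ⟨g, rfl⟩
      exact hz g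
    exact this hx
  have h1 : ∀ g, ∀ x ∈ M, T q g * x ∈ M := by
    intro g
    refine length_induction_left (b := b) (p := fun g => ∀ x ∈ M, T q g * x ∈ M)
      (fun g hg => hmul _ (T_length_zero_mul_mem q hρ hg)) (fun a g hg ih x hx => ?_) g
    have h2 := T_simpleRefl_mul q a g
    rw [if_pos hg] at h2
    rw [← h2, mul_assoc]
    exact hmul _ (T_simpleRefl_mul_mem q hρ a) _ (ih x hx)
  rw [eq_top_iff, ← span_T q, Submodule.span_le]
  rintro _ ⟨g, rfl⟩
  have h3 := h1 g 1 (by rw [← bernstein_one q hρ]; exact Submodule.subset_span ⟨1, rfl⟩)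
  rwa [mul_one] at h3

/-- The Bernstein basis. -/
def bernsteinBasis : Module.Basis (AffineWeylGroup P) ℂ (Hecke q) :=
  Module.Basis.mk (linearIndependent_bernstein q hρ) (span_bernstein q hρ).ge

lemma bernsteinBasis_apply (g : AffineWeylGroup P) :
    bernsteinBasis q hρ g = bernstein q hρ g := by
  rw [bernsteinBasis, Module.Basis.mk_apply]

/-- The elements `θ_x` of the Hecke algebra. -/
def theta (x : X) : Hecke q := bernstein q hρ (translation P x)

lemma bernstein_mul_theta (g : AffineWeylGroup P) (x : X) :
    bernstein q hρ g * theta q hρ x = bernstein q hρ (g * translation P x) :=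
  bernstein_mul_translation q hρ g x

lemma theta_zero : theta q hρ 0 = 1 := bernstein_one q hρ

lemma theta_mul (x y : X) : theta q hρ x * theta q hρ y = theta q hρ (x + y) := by
  rw [theta, bernstein_mul_theta, theta, translation_add]

lemma theta_comm (x y : X) : Commute (theta q hρ x) (theta q hρ y) := by
  rw [commute_iff_eq, theta_mul, theta_mul, add_comm]

/-- The one-dimensional representation `T_g ↦ q(g)`. -/
def trivialChar : Hecke q →ₐ[ℂ] ℂ :=
  liftHecke q (fun g => (q g : ℂ)) (by
    intro x y hxy
    induction hxy with
    | one => rw [FreeAlgebra.lift_ι_apply, map_one, q_one, Complex.ofReal_one]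
    | mul g h hgh =>
      rw [map_mul, FreeAlgebra.lift_ι_apply, FreeAlgebra.lift_ι_apply, FreeAlgebra.lift_ι_apply,
        q.mul_of_length_add g h hgh, Complex.ofReal_mul]
    | quadratic s hs =>
      rw [map_mul, map_add, map_smul, map_smul, map_one, FreeAlgebra.lift_ι_apply, smul_eq_mul,
        smul_eq_mul]
      ring)

lemma trivialChar_Tnorm (g : AffineWeylGroup P) : trivialChar q (Tnorm q g) = 1 := by
  have h : trivialChar q (T q g) = (q g : ℂ) := by
    rw [trivialChar, T, liftHecke_mkHecke, FreeAlgebra.lift_ι_apply]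
  rw [Tnorm, map_smul, h, smul_eq_mul, inv_mul_cancel₀ (q_ne_zero q g)]

lemma trivialChar_theta (x : X) : trivialChar q (theta q hρ x) = 1 := by
  obtain ⟨m, h⟩ := bernstein_spec q hρ (translation P x)
  have h1 := congrArg (trivialChar q) (h m le_rfl)
  rw [map_mul, trivialChar_Tnorm, trivialChar_Tnorm, mul_one] at h1
  exact h1

end Bernstein

end AffineHecke
end

noncomputable section
set_option linter.unusedSectionVars false
namespace AffineHecke

/-! ### The regular sequence of elements θ_x - 1. -/

section BernsteinSequence

variable {ι X Y : Type u} [AddCommGroup X] [AddCommGroup Y] {P : RootDatum ι X Y} {b : P.Base}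
  [Finite ι] [P.IsReduced] (q : ParameterFunction b)
  {ρ : X} (hρ : ∀ i ∈ b.support, 0 < P.coroot' i ρ)

/-- Right multiplication by `θ_y` permutes the Bernstein basis, so regularity can be examined as in
a group algebra of `X`. -/
lemma bernsteinBasis_repr_mul_theta (y : X) (a : Hecke q) :
    (bernsteinBasis q hρ).repr (a * theta q hρ y) =
      Finsupp.mapDomain (· * translation P y) ((bernsteinBasis q hρ).repr a) := by
  have h : (bernsteinBasis q hρ).repr.toLinearMap ∘ₗ LinearMap.mulRight ℂ (theta q hρ y) =
      Finsupp.lmapDomain ℂ ℂ (· * translation P y) ∘ₗ (bernsteinBasis q hρ).repr.toLinearMap := by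
    refine (bernsteinBasis q hρ).ext fun g => ?_
    change (bernsteinBasis q hρ).repr (bernsteinBasis q hρ g * theta q hρ y) =
      Finsupp.mapDomain _ ((bernsteinBasis q hρ).repr (bernsteinBasis q hρ g))
    rw [Module.Basis.repr_self, Finsupp.mapDomain_single, bernsteinBasis_apply,
      bernstein_mul_theta, ← bernsteinBasis_apply, Module.Basis.repr_self]
  exact LinearMap.congr_fun h a

/-- Right translation removing the part of `rightPart g` seen by `p`. -/
def translationProj (p : X →+ X) (g : AffineWeylGroup P) : AffineWeylGroup P :=
  g * translation P (-p (rightPart g))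

lemma translationProj_mul_translation_of_fixed {p : X →+ X} {y : X} (hy : p y = y)
    (g : AffineWeylGroup P) : translationProj p (g * translation P y) = translationProj p g := by
  rw [translationProj, translationProj, rightPart_mul_translation, mul_assoc, ← translation_add,
    map_add, hy, neg_add_rev, add_neg_cancel_left]

lemma translationProj_mul_translation_of_zero {p : X →+ X} {y : X} (hy : p y = 0)
    (g : AffineWeylGroup P) :
    translationProj p (g * translation P y) = translationProj p g * translation P y := by
  rw [translationProj, translationProj, rightPart_mul_translation, mul_assoc, mul_assoc,
    ← translation_add, ← translation_add, map_add, hy, add_zero, add_comm]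

/-- The linear map of the Hecke algebra induced by `translationProj p`. -/
def heckeProj (p : X →+ X) : Hecke q →ₗ[ℂ] AffineWeylGroup P →₀ ℂ :=
  Finsupp.lmapDomain ℂ ℂ (translationProj p) ∘ₗ (bernsteinBasis q hρ).repr.toLinearMap

lemma heckeProj_apply (p : X →+ X) (a : Hecke q) : heckeProj q hρ p a =
    Finsupp.mapDomain (translationProj p) ((bernsteinBasis q hρ).repr a) := rfl

lemma heckeProj_mul_theta_of_fixed {p : X →+ X} {y : X} (hy : p y = y) (a : Hecke q) :
    heckeProj q hρ p (a * theta q hρ y) = heckeProj q hρ p a := by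
  rw [heckeProj_apply, heckeProj_apply, bernsteinBasis_repr_mul_theta, ← Finsupp.mapDomain_comp]
  congr 1
  exact funext (translationProj_mul_translation_of_fixed hy)

lemma heckeProj_mul_theta_of_zero {p : X →+ X} {y : X} (hy : p y = 0) (a : Hecke q) :
    heckeProj q hρ p (a * theta q hρ y) =
      Finsupp.mapDomain (· * translation P y) (heckeProj q hρ p a) := by
  rw [heckeProj_apply, heckeProj_apply, bernsteinBasis_repr_mul_theta, ← Finsupp.mapDomain_comp,
    ← Finsupp.mapDomain_comp]
  congr 1
  exact funext (translationProj_mul_translation_of_zero hy)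

/-- The sequence `θ_{ε j} - 1` in the Hecke algebra. -/
def thetaSeq (ε : ℕ → X) (j : ℕ) : Hecke q := theta q hρ (ε j) - 1

lemma heckeProj_eq_zero {ε : ℕ → X} {p : X →+ X} {m : ℕ} (hp : ∀ j < m, p (ε j) = ε j)
    {a : Hecke q} (ha : a ∈ seqIdeal (thetaSeq q hρ ε) m) : heckeProj q hρ p a = 0 := by
  refine Submodule.closure_induction (p := fun a _ => heckeProj q hρ p a = 0) (map_zero _)
    (fun x y _ _ hx hy => by rw [map_add, hx, hy, add_zero]) ?_ ha
  rintro r _ ⟨j, hj, rfl⟩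
  rw [smul_eq_mul, thetaSeq, mul_sub, mul_one, map_sub,
    heckeProj_mul_theta_of_fixed q hρ (hp j hj), sub_self]

lemma theta_sub_one_mem {ε : ℕ → X} {m : ℕ} {y : X}
    (hy : y ∈ AddSubgroup.closure (ε '' Set.Iio m)) :
    theta q hρ y - 1 ∈ seqIdeal (thetaSeq q hρ ε) m := by
  induction hy using AddSubgroup.closure_induction with
  | mem y hy =>
    obtain ⟨j, hj, rfl⟩ := hy
    exact mem_seqIdeal _ hj
  | zero => rw [theta_zero, sub_self]; exact zero_mem _
  | add y z _ _ hy hz =>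
    have h : theta q hρ (y + z) - 1 =
        theta q hρ y • (theta q hρ z - 1) + (theta q hρ y - 1) := by
      rw [smul_eq_mul, mul_sub, theta_mul, mul_one, sub_add_sub_cancel]
    rw [h]
    exact add_mem (Submodule.smul_mem _ _ hz) hy
  | neg y _ hy =>
    have h : theta q hρ (-y) - 1 = (-theta q hρ (-y)) • (theta q hρ y - 1) := by
      rw [smul_eq_mul, neg_mul, mul_sub, theta_mul, neg_add_cancel, theta_zero, mul_one, neg_sub]
    rw [h]
    exact Submodule.smul_mem _ _ hy

/-- Together with `heckeProj_eq_zero` this identifies the left ideal of the first `m` elements with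
the kernel of the projection, if `p` is a projection onto the span of the first `m` vectors. -/
lemma sub_linearCombination_heckeProj_mem {ε : ℕ → X} {p : X →+ X} {m : ℕ}
    (hp : ∀ y, p y ∈ AddSubgroup.closure (ε '' Set.Iio m)) (a : Hecke q) :
    a - (bernsteinBasis q hρ).repr.symm (heckeProj q hρ p a) ∈
      seqIdeal (thetaSeq q hρ ε) m := by
  let J := (seqIdeal (thetaSeq q hρ ε) m).restrictScalars ℂ
  let f : Hecke q →ₗ[ℂ] Hecke q :=
    LinearMap.id - (bernsteinBasis q hρ).repr.symm.toLinearMap ∘ₗ heckeProj q hρ p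
  have h : (⊤ : Submodule ℂ (Hecke q)) ≤ J.comap f := by
    rw [← (bernsteinBasis q hρ).span_eq, Submodule.span_le]
    rintro _ ⟨g, rfl⟩
    change bernsteinBasis q hρ g - (bernsteinBasis q hρ).repr.symm
      (heckeProj q hρ p (bernsteinBasis q hρ g)) ∈ seqIdeal (thetaSeq q hρ ε) m
    rw [heckeProj_apply, Module.Basis.repr_self, Finsupp.mapDomain_single,
      Module.Basis.repr_symm_single_one, bernsteinBasis_apply, bernsteinBasis_apply,
      translationProj, ← bernstein_mul_theta, ← mul_one_sub]
    refine Submodule.smul_mem _ (bernstein q hρ g) ?_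
    rw [← neg_sub]
    exact neg_mem (theta_sub_one_mem q hρ (neg_mem (hp _)))
  exact h (Submodule.mem_top (x := a))

lemma iterate_mul_translation (y : X) (n : ℕ) (g : AffineWeylGroup P) :
    (· * translation P y)^[n] g = g * translation P (n • y) := by
  induction n with
  | zero => rw [zero_smul, translation_zero, mul_one, Function.iterate_zero, id]
  | succ n ih => rw [Function.iterate_succ_apply', ih, succ_nsmul, translation_add, mul_assoc]

/-- Modulo the ideal, right multiplication by `θ - 1` is a translation minus the identity on
finitely supported functions, and translations have infinite orbits. -/
lemma thetaSeq_regular {ε : ℕ → X} {p : X →+ X} {m : ℕ} (hp : ∀ j < m, p (ε j) = ε j)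
    (hpm : p (ε m) = 0) (hpc : ∀ y, p y ∈ AddSubgroup.closure (ε '' Set.Iio m))
    (hε : ∀ k l : ℕ, k • ε m = l • ε m → k = l) {a : Hecke q}
    (ha : a * thetaSeq q hρ ε m ∈ seqIdeal (thetaSeq q hρ ε) m) :
    a ∈ seqIdeal (thetaSeq q hρ ε) m := by
  have h1 := heckeProj_eq_zero q hρ hp ha
  rw [thetaSeq, mul_sub, mul_one, map_sub, heckeProj_mul_theta_of_zero q hρ hpm, sub_eq_zero] at h1
  have h2 := eq_zero_of_mapDomain_eq (fun g k l h => by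
    rw [iterate_mul_translation, iterate_mul_translation] at h
    have h3 := congrArg rightPart (mul_left_cancel h)
    rw [rightPart_translation, rightPart_translation] at h3
    exact hε k l h3) h1
  have h3 := sub_linearCombination_heckeProj_mem q hρ hpc a
  rwa [h2, map_zero, sub_zero] at h3

lemma exists_isRegularSeq [Module.Finite ℤ X] : ∃ x : ℕ → Hecke q,
    IsRegularSeq x (Module.finrank ℤ X) ∧ ∀ j, trivialChar q (x j) = 0 := by
  obtain ⟨ρ, -, -, hρ, -⟩ := exists_alcove_point b
  have := torsionFree_weights P
  let e := Module.finBasis ℤ X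
  -- Beyond the rank the value 0 gives the element `θ_0 - 1 = 0`, for which commutation and
  -- vanishing hold trivially.
  let ε : ℕ → X := fun j => if h : j < Module.finrank ℤ X then e ⟨j, h⟩ else 0
  refine ⟨thetaSeq q hρ ε, ⟨fun i j => ?_, fun m hm a ha => ?_⟩, fun j => ?_⟩
  · exact ((theta_comm q hρ _ _).sub_left (Commute.one_left _)).sub_right (Commute.one_right _)
  · let p : X →ₗ[ℤ] X := e.constr ℤ fun i => if i.1 < m then e i else 0
    have hpe : ∀ i, p (e i) = if i.1 < m then e i else 0 := fun i => e.constr_basis ℤ _ i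
    have hεm : ε m = e ⟨m, hm⟩ := dif_pos hm
    refine thetaSeq_regular q hρ (p := p.toAddMonoidHom) (fun j hj => ?_) ?_ (fun y => ?_)
      (fun k l h => ?_) ha
    · have h : ε j = e ⟨j, hj.trans hm⟩ := dif_pos (hj.trans hm)
      rw [h]
      exact (hpe _).trans (if_pos hj)
    · rw [hεm]
      exact (hpe _).trans (if_neg (lt_irrefl m))
    · have h : (⊤ : Submodule ℤ X) ≤
          (AddSubgroup.closure (ε '' Set.Iio m)).toIntSubmodule.comap p := by
        rw [← e.span_eq, Submodule.span_le]
        rintro _ ⟨i, rfl⟩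
        change p (e i) ∈ AddSubgroup.closure (ε '' Set.Iio m)
        rw [hpe]
        split_ifs with hi
        · exact AddSubgroup.subset_closure ⟨i.1, hi, dif_pos i.2⟩
        · exact zero_mem _
      exact h (Submodule.mem_top (x := y))
    · have h1 := congrArg (fun z => e.repr z ⟨m, hm⟩) h
      simpa [hεm] using h1
  · rw [thetaSeq, map_sub, trivialChar_theta, map_one, sub_self]

end BernsteinSequence

/-! ### The trivial representation and the three dimension formulas. -/

section Dimension

variable {ι X Y : Type u} [AddCommGroup X] [AddCommGroup Y] {P : RootDatum ι X Y} {b : P.Base}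
  [Finite ι] [P.IsReduced] (q : ParameterFunction b)

/-- The space of the trivial representation of the Hecke algebra. -/
def TrivialRep (_q : ParameterFunction b) : Type u := ULift.{u} ℂ

instance : AddCommGroup (TrivialRep q) := inferInstanceAs (AddCommGroup (ULift.{u} ℂ))

instance : Module ℂ (TrivialRep q) := inferInstanceAs (Module ℂ (ULift.{u} ℂ))

instance : Nontrivial (TrivialRep q) := inferInstanceAs (Nontrivial (ULift.{u} ℂ))

instance : Module (Hecke q) (TrivialRep q) :=
  Module.compHom (TrivialRep q) (trivialChar q).toRingHom

lemma hecke_smul_trivialRep (a : Hecke q) (w : TrivialRep q) : a • w = trivialChar q a • w := rfl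

instance : IsScalarTower ℂ (Hecke q) (TrivialRep q) where
  smul_assoc c a w := by
    rw [hecke_smul_trivialRep, hecke_smul_trivialRep, map_smul, smul_assoc]

variable [Module.Finite ℤ X]

theorem cohomologicalDimension_hecke [Module.Finite ℤ Y] :
    cohomologicalDimension (ModuleCat.{u} (Hecke q)) = (Module.finrank ℤ X : ℕ∞) := by
  obtain ⟨x, hx, hx0⟩ := exists_isRegularSeq q
  obtain ⟨v, hv⟩ := exists_ne (0 : TrivialRep q)
  refine le_antisymm (cohomologicalDimension_moduleCat_le (pdLT_kerMul q))
    (hx.le_cohomologicalDimension (fun j w => ?_) hv)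
  rw [hecke_smul_trivialRep, hx0, zero_smul]

theorem bor_cohomologicalDimension_hecke [Module.Finite ℤ Y] {C : BorMod.{u, u} (Hecke q) → Prop}
    (htens : ∀ κ V, C V → C (BorMod.tens κ V))
    (hfine : ∀ (M : Type u) [AddCommGroup M] [Module ℂ M] [Module (Hecke q) M]
      [IsScalarTower ℂ (Hecke q) M], C (BorMod.fine (Hecke q) M))
    (hker : ∀ U V (f : BorMod.Hom U V), C U → C V → C (BorMod.sub (LinearMap.ker f.1))) :
    BorMod.cohomologicalDimension C = (Module.finrank ℤ X : ℕ∞) := by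
  obtain ⟨x, hx, hx0⟩ := exists_isRegularSeq q
  obtain ⟨v, hv⟩ := exists_ne (0 : TrivialRep q)
  refine le_antisymm (BorMod.cohomologicalDimension_le htens (pdLT_kerMul q))
    (hx.le_bor_cohomologicalDimension hfine hker (fun j w => ?_) hv)
  rw [hecke_smul_trivialRep, hx0, zero_smul]

theorem complete_cohomologicalDimension_hecke [Module.Finite ℤ Y] :
    BorMod.cohomologicalDimension (fun V : BorMod.{u, u} (Hecke q) => V.IsComplete) =
      (Module.finrank ℤ X : ℕ∞) :=
  bor_cohomologicalDimension_hecke q (fun κ _ hV => BorMod.isComplete_tens κ hV)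
    (fun M => BorMod.isComplete_fine M) (fun _ _ f hU hV => BorMod.isComplete_ker f hU hV)

end Dimension

end AffineHecke
end

theorem mainTheorem7 {ι X Y : Type u} [Finite ι] [AddCommGroup X] [AddCommGroup Y]
    [Module.Finite ℤ X] [Module.Finite ℤ Y] (P : RootDatum ι X Y) [P.IsReduced] (b : P.Base)
    (q : AffineHecke.ParameterFunction b) :
    AffineHecke.cohomologicalDimension (ModuleCat.{u} (AffineHecke.HeckeAlgebra b q)) =
        (Module.finrank ℤ X : ℕ∞) ∧
      AffineHecke.BorMod.cohomologicalDimension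
        (fun _ : AffineHecke.BorMod.{u, u} (AffineHecke.HeckeAlgebra b q) => True) =
        (Module.finrank ℤ X : ℕ∞) ∧
      AffineHecke.BorMod.cohomologicalDimension
        (fun V : AffineHecke.BorMod.{u, u} (AffineHecke.HeckeAlgebra b q) => V.IsComplete) =
        (Module.finrank ℤ X : ℕ∞) :=
  ⟨AffineHecke.cohomologicalDimension_hecke q,
    AffineHecke.bor_cohomologicalDimension_hecke q (fun _ _ _ => trivial) (fun _ => trivial)
      (fun _ _ _ _ _ => trivial),
    AffineHecke.complete_cohomologicalDimension_hecke q⟩
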